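/- Let $\mathbb K$ be a field of characteristic zero. A ribbon graph consists of a finite set $H$ of half-edges, a fixed point free involution $\sigma_1$ of $H$, whose orbits are the edges, and a permutation $\sigma_0$ of $H$, whose cycles are the vertices; the cycles of $\sigma_0^{-1}\sigma_1$ are its boundaries, and its genus is $g=1+\frac12(\#E-\#V-\#B)$. All graphs are connected, and their $m$ boundaries are labelled. For $d\in\mathbb Z$, $g\ge 0$ and $m\ge 1$ with $2g+m\ge 3$ let $\mathsf{RGC}_d^{(g,m)}$ be the cochain complex spanned over $\mathbb K$ by ribbon graphs $\Gamma$ of genus $g$ with $m$ labelled boundaries and with at least one vertex of valency $\ge 3$, where every edge has a direction, modulo isomorphisms with the following signs: edges have degree $1-d$, vertices have degree $d$ (so that permuting edges or vertices produces the sign of the permutation to the power $1-d$, respectively $d$), and reversing the direction of an edge multiplies the graph by $(-1)^d$. The degree of $\Gamma$ is $d\,\#V+(1-d)\,\#E-d$. The differential is one half of the signed sum over all ways to replace a vertex by two vertices joined by a new directed edge and to distribute the half-edges of the old vertex among the two new ones, at least one to each, compatibly with their cyclic order. Let $\mathsf{ORGC}_d^{(g,m)}$ be the analogous complex spanned by ribbon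 quivers, that is, by ribbon graphs with a fixed direction on every edge (isomorphisms have to preserve the directions) and without closed paths of directed edges, with the same degrees, the same signs of permutations, and with the differential given by the signed sum over the same splittings of the vertices (without the factor one half). Put $$\mathsf{RGC}_d=\prod_{g\ge 0,\ m\ge 1,\ 2g+m\ge 3}\mathsf{RGC}_d^{(g,m)},\qquad \mathsf{ORGC}_d=\prod_{g\ge 0,\ m\ge 1,\ 2g+m\ge 3}\mathsf{ORGC}_d^{(g,m)}.$$ Theorem. For every $d\in\mathbb Z$ there are isomorphisms $$H^\bullet(\mathsf{RGC}_d)\cong H^\bullet(\mathsf{ORGC}_{d+1}),$$ and they respect the decompositions into direct products: for all $g\ge 0$, $m\ge 1$ with $2g+m\ge 3$ there are isomorphisms $$H^\bullet(\mathsf{RGC}_d^{(g,m)})\cong H^\bullet(\mathsf{ORGC}_{d+1}^{(g,m)})$$ which are compatible with the former ones under the projections to the factors. -/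

import Mathlib

open CategoryTheory

/-- The set of half-edges of a graph with edges `0, …, e - 1`: the edge `i` consists of its tail
`(i, false)` and its head `(i, true)`. -/
abbrev HalfEdge (e : ℕ) : Type := Fin e × Bool

namespace HalfEdge

variable {e : ℕ}

/-- The fixed point free involution which exchanges the two half-edges of every edge. -/
def flipEdge (e : ℕ) : Equiv.Perm (HalfEdge e) :=
  Equiv.prodCongr (Equiv.refl (Fin e)) Equiv.boolNot

/-- The tail of a newly added edge. The new edge gets the number `0`. -/
def newTail : HalfEdge (e + 1) := (0, false)

/-- The head of a newly added edge. -/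
def newHead : HalfEdge (e + 1) := (0, true)

/-- An old half-edge after a new edge has been added. -/
def old (h : HalfEdge e) : HalfEdge (e + 1) := (h.1.succ, h.2)

theorem rec_on {P : HalfEdge (e + 1) → Prop} (ht : P newTail) (hh : P newHead)
    (ho : ∀ h, P (old h)) (h : HalfEdge (e + 1)) : P h := by
  obtain ⟨i, s⟩ := h
  refine Fin.cases ?_ (fun j => ho (j, s)) i
  cases s
  · exact ht
  · exact hh

@[simp] theorem old_inj {h h' : HalfEdge e} : old h = old h' ↔ h = h' := by
  constructor
  · intro hh
    have h1 := congrArg Prod.fst hh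
    have h2 := congrArg Prod.snd hh
    exact Prod.ext (Fin.succ_injective _ h1) h2
  · rintro rfl
    rfl

@[simp] theorem old_ne_tail (h : HalfEdge e) : old h ≠ newTail := by
  intro hh
  exact Fin.succ_ne_zero _ (congrArg Prod.fst hh)

@[simp] theorem old_ne_head (h : HalfEdge e) : old h ≠ newHead := by
  intro hh
  exact Fin.succ_ne_zero _ (congrArg Prod.fst hh)

@[simp] theorem tail_ne_old (h : HalfEdge e) : newTail ≠ old h := (old_ne_tail h).symm

@[simp] theorem head_ne_old (h : HalfEdge e) : newHead ≠ old h := (old_ne_head h).symm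

@[simp] theorem tail_ne_head : (newTail : HalfEdge (e + 1)) ≠ newHead := by
  intro hh
  have := congrArg Prod.snd hh
  simp [newTail, newHead] at this

@[simp] theorem head_ne_tail : (newHead : HalfEdge (e + 1)) ≠ newTail := tail_ne_head.symm

@[simp] theorem flipEdge_tail : flipEdge (e + 1) newTail = newHead := rfl

@[simp] theorem flipEdge_head : flipEdge (e + 1) newHead = newTail := rfl

@[simp] theorem flipEdge_old (h : HalfEdge e) :
    flipEdge (e + 1) (old h) = old (flipEdge e h) := rfl

@[simp] theorem flipEdge_flipEdge (h : HalfEdge e) : flipEdge e (flipEdge e h) = h := by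
  obtain ⟨i, s⟩ := h
  simp [flipEdge]

/-- Define a function on the half-edges of a graph with a new edge by its value at the new tail,
at the new head, and at the old half-edges. -/
def casesNew {α : Type*} (t d : α) (f : HalfEdge e → α) (h : HalfEdge (e + 1)) : α :=
  Fin.cases (if h.2 then d else t) (fun i => f (i, h.2)) h.1

@[simp] theorem casesNew_tail {α : Type*} (t d : α) (f : HalfEdge e → α) :
    casesNew t d f newTail = t := rfl

@[simp] theorem casesNew_head {α : Type*} (t d : α) (f : HalfEdge e → α) :
    casesNew t d f newHead = d := rfl

@[simp] theorem casesNew_old {α : Type*} (t d : α) (f : HalfEdge e → α) (h : HalfEdge e) :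
    casesNew t d f (old h) = f h := rfl

/-- The cyclic orders at the vertices after the vertex `v` which carries the two different
half-edges `x` and `y` has been split. If `v` is the cycle `(x, b₁, …, b_q = y, a₁, …, a_p)`, it is
replaced by the two cycles `(newTail, a₁, …, a_p, x)` and `(newHead, b₁, …, b_q)`. -/
def splitRot (σ : Equiv.Perm (HalfEdge e)) (x y : HalfEdge e) (hxy : x ≠ y) :
    Equiv.Perm (HalfEdge (e + 1)) where
  toFun := casesNew (old (σ y)) (old (σ x)) fun h =>
    if h = x then newTail else if h = y then newHead else old (σ h)
  invFun := casesNew (old x) (old y) fun h =>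
    if h = σ y then newTail else if h = σ x then newHead else old (σ⁻¹ h)
  left_inv := by
    refine rec_on ?_ ?_ fun h => ?_
    · simp
    · simp [hxy]
    · by_cases h1 : h = x
      · simp [h1]
      · by_cases h2 : h = y
        · simp [h2, hxy.symm]
        · simp [h1, h2]
  right_inv := by
    refine rec_on ?_ ?_ fun h => ?_
    · simp
    · simp [hxy.symm]
    · by_cases h1 : h = σ y
      · simp [h1]
      · by_cases h2 : h = σ x
        · simp [h2, hxy]
        · have h3 : σ⁻¹ h ≠ x := fun h => h2 (by simp [← h])
          have h4 : σ⁻¹ h ≠ y := fun h => h1 (by simp [← h])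
          simp only [casesNew_old, if_neg h1, if_neg h2, if_neg h3, if_neg h4]
          simp

section

variable (σ : Equiv.Perm (HalfEdge e)) (x y : HalfEdge e) (hxy : x ≠ y)

@[simp] theorem splitRot_tail : splitRot σ x y hxy newTail = old (σ y) := rfl

@[simp] theorem splitRot_head : splitRot σ x y hxy newHead = old (σ x) := rfl

theorem splitRot_old (h : HalfEdge e) : splitRot σ x y hxy (old h) =
    if h = x then newTail else if h = y then newHead else old (σ h) := rfl

@[simp] theorem splitRot_left : splitRot σ x y hxy (old x) = newTail := by simp [splitRot_old]

@[simp] theorem splitRot_right : splitRot σ x y hxy (old y) = newHead := by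
  simp [splitRot_old, hxy.symm]

theorem splitRot_other {h : HalfEdge e} (h1 : h ≠ x) (h2 : h ≠ y) :
    splitRot σ x y hxy (old h) = old (σ h) := by
  simp [splitRot_old, h1, h2]

end

/-- After the splitting of a vertex, the corner that follows `newTail` is a part of the former
corner that followed `y`, and the corner that follows `newHead` a part of the one that followed
`x`. -/
def corner (x y : HalfEdge e) : HalfEdge (e + 1) → HalfEdge e := casesNew y x id

@[simp] theorem corner_tail (x y : HalfEdge e) : corner x y newTail = y := rfl

@[simp] theorem corner_head (x y : HalfEdge e) : corner x y newHead = x := rfl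

@[simp] theorem corner_old (x y h : HalfEdge e) : corner x y (old h) = h := rfl

theorem sameCycle_of_closed {α : Type*} [Finite α] (σ : Equiv.Perm α) (P : α → Prop)
    (hP : ∀ h, P h → P (σ h)) {h h' : α} (hh : σ.SameCycle h h') (h0 : P h) : P h' := by
  obtain ⟨n, rfl⟩ := hh.exists_nat_pow_eq
  clear hh
  induction n with
  | zero => simpa using h0
  | succ n ih =>
    rw [pow_succ']
    exact hP _ ih

section

variable (σ : Equiv.Perm (HalfEdge e)) (x y : HalfEdge e) (hxy : x ≠ y)

/-- Half-edges in one cycle of the split permutation were in one cycle before. -/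
theorem corner_sameCycle (hs : σ.SameCycle x y) {h h' : HalfEdge (e + 1)}
    (hh : (splitRot σ x y hxy).SameCycle h h') : σ.SameCycle (corner x y h) (corner x y h') := by
  refine sameCycle_of_closed _ (fun k => σ.SameCycle (corner x y h) (corner x y k)) ?_ hh
    (Equiv.Perm.SameCycle.refl _ _)
  refine rec_on ?_ ?_ fun k => ?_
  · intro hk
    simpa [Equiv.Perm.sameCycle_apply_right] using hk
  · intro hk
    simpa [Equiv.Perm.sameCycle_apply_right] using hk
  · intro hk
    by_cases h1 : k = x
    · subst h1
      simpa using hk.trans hs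
    · by_cases h2 : k = y
      · subst h2
        simpa using hk.trans hs.symm
      · rw [splitRot_other _ _ _ _ h1 h2]
        simpa [Equiv.Perm.sameCycle_apply_right] using hk

/-- A cycle that is not split stays. -/
theorem sameCycle_old_of_not {h h' : HalfEdge e} (hh : σ.SameCycle h h') (hx : ¬ σ.SameCycle h x)
    (hy : ¬ σ.SameCycle h y) : (splitRot σ x y hxy).SameCycle (old h) (old h') := by
  refine (sameCycle_of_closed σ
    (fun k => σ.SameCycle h k ∧ (splitRot σ x y hxy).SameCycle (old h) (old k)) ?_ hh
    ⟨Equiv.Perm.SameCycle.refl _ _, Equiv.Perm.SameCycle.refl _ _⟩).2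
  rintro k ⟨h1, h2⟩
  refine ⟨Equiv.Perm.sameCycle_apply_right.2 h1, ?_⟩
  have h3 : k ≠ x := fun h => hx (h ▸ h1)
  have h4 : k ≠ y := fun h => hy (h ▸ h1)
  rw [← splitRot_other σ x y hxy h3 h4]
  exact Equiv.Perm.sameCycle_apply_right.2 h2

theorem sameCycle_tail_left : (splitRot σ x y hxy).SameCycle (old x) newTail := by
  rw [← splitRot_left σ x y hxy]
  exact Equiv.Perm.sameCycle_apply_right.2 (Equiv.Perm.SameCycle.refl _ _)

theorem sameCycle_head_right : (splitRot σ x y hxy).SameCycle (old y) newHead := by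
  rw [← splitRot_right σ x y hxy]
  exact Equiv.Perm.sameCycle_apply_right.2 (Equiv.Perm.SameCycle.refl _ _)

/-- Every half-edge at the split vertex lies at one of the two new vertices. -/
theorem sameCycle_tail_or_head {h : HalfEdge e} (hh : σ.SameCycle x h) :
    (splitRot σ x y hxy).SameCycle (old h) newTail ∨
      (splitRot σ x y hxy).SameCycle (old h) newHead := by
  refine sameCycle_of_closed σ (fun k => (splitRot σ x y hxy).SameCycle (old k) newTail ∨
      (splitRot σ x y hxy).SameCycle (old k) newHead) ?_ hh
      (Or.inl (sameCycle_tail_left σ x y hxy))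
  intro k hk
  by_cases h1 : k = x
  · subst h1
    right
    rw [← splitRot_head σ k y hxy]
    exact Equiv.Perm.sameCycle_apply_left.2 (Equiv.Perm.SameCycle.refl _ _)
  · by_cases h2 : k = y
    · subst h2
      left
      rw [← splitRot_tail σ x k hxy]
      exact Equiv.Perm.sameCycle_apply_left.2 (Equiv.Perm.SameCycle.refl _ _)
    · rw [← splitRot_other σ x y hxy h1 h2]
      simpa only [Equiv.Perm.sameCycle_apply_left] using hk

/-- The two new vertices are different. -/
theorem not_sameCycle_tail_head (hs : σ.SameCycle x y) :
    ¬ (splitRot σ x y hxy).SameCycle newTail newHead := by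
  classical
  obtain ⟨n0, hn0⟩ := hs.symm.exists_nat_pow_eq
  have hex : ∃ n, (σ ^ n) y = x := ⟨n0, hn0⟩
  set n := Nat.find hex with hn
  have hnx : (σ ^ n) y = x := Nat.find_spec hex
  have hmin : ∀ j < n, (σ ^ j) y ≠ x := fun j hj => Nat.find_min hex hj
  have hn1 : 1 ≤ n := by
    rcases Nat.eq_zero_or_pos n with h | h
    · rw [h] at hnx
      exact absurd hnx.symm (by simpa using hxy)
    · exact h
  have hy : ∀ j, 1 ≤ j → j ≤ n → (σ ^ j) y ≠ y := by
    intro j hj hjn hjy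
    have : (σ ^ (n - j)) y = x := by
      rw [← hnx]
      conv_rhs => rw [show n = (n - j) + j by omega, pow_add, Equiv.Perm.mul_apply, hjy]
    exact hmin (n - j) (by omega) this
  intro hcyc
  have key := sameCycle_of_closed (splitRot σ x y hxy)
    (fun k => k = newTail ∨ ∃ j, 1 ≤ j ∧ j ≤ n ∧ k = old ((σ ^ j) y)) ?_ hcyc (Or.inl rfl)
  · rcases key with h | ⟨j, -, -, h⟩
    · exact head_ne_tail h
    · exact head_ne_old _ h
  · rintro k (rfl | ⟨j, h1, h2, rfl⟩)
    · exact Or.inr ⟨1, le_rfl, hn1, by simp⟩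
    · by_cases hj : j = n
      · left
        rw [hj, hnx, splitRot_left]
      · right
        refine ⟨j + 1, by omega, by omega, ?_⟩
        rw [splitRot_other _ _ _ _ (hmin j (by omega)) (hy j h1 h2), pow_succ', Equiv.Perm.mul_apply]

end

end HalfEdge

open HalfEdge

/-- A ribbon graph with edges `0, …, e - 1`, each of them with a direction, with vertices
`0, …, v - 1` and with boundaries `0, …, m - 1`. The vertices are the cycles of a permutation `rot`
of the half-edges, which is the cyclic order of the half-edges at each vertex, and the boundaries
are the cycles of `rot⁻¹ ∘ flipEdge`. -/
structure RibbonGraph (e v m : ℕ) where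
  /-- the cyclic orders of the half-edges at the vertices -/
  rot : Equiv.Perm (HalfEdge e)
  /-- the vertex to which a half-edge is attached -/
  vert : HalfEdge e → Fin v
  /-- the boundary to which a half-edge belongs -/
  bdry : HalfEdge e → Fin m
  vert_surj : Function.Surjective vert
  vert_eq_iff : ∀ h h', vert h = vert h' ↔ rot.SameCycle h h'
  bdry_surj : Function.Surjective bdry
  bdry_eq_iff : ∀ h h', bdry h = bdry h' ↔ (rot⁻¹ * flipEdge e).SameCycle h h'

namespace RibbonGraph

variable {e v m : ℕ}

theorem ext_of {Γ Γ' : RibbonGraph e v m} (h1 : Γ.rot = Γ'.rot) (h2 : Γ.vert = Γ'.vert)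
    (h3 : Γ.bdry = Γ'.bdry) : Γ = Γ' := by
  cases Γ
  cases Γ'
  simp_all

/-- The number of half-edges at a vertex. -/
def valency (Γ : RibbonGraph e v m) (w : Fin v) : ℕ :=
  (Finset.univ.filter fun h => Γ.vert h = w).card

/-- Any two vertices are joined by a path of edges, whose directions are ignored. -/
def IsConnected (Γ : RibbonGraph e v m) : Prop :=
  ∀ w w' : Fin v, Relation.ReflTransGen
    (fun u u' => ∃ h, Γ.vert h = u ∧ Γ.vert (flipEdge e h) = u') w w'

/-- There is no closed path of directed edges. -/
def IsAcyclic (Γ : RibbonGraph e v m) : Prop :=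
  ∀ w : Fin v, ¬ Relation.TransGen
    (fun u u' => ∃ i : Fin e, Γ.vert (i, false) = u ∧ Γ.vert (i, true) = u') w w

/-- The ordered pairs of different corners at one vertex. Here a half-edge `h` stands for the corner
between `h` and its successor `rot h`. -/
abbrev CornerPair (Γ : RibbonGraph e v m) : Type :=
  {p : HalfEdge e × HalfEdge e // p.1 ≠ p.2 ∧ Γ.vert p.1 = Γ.vert p.2}

section split

variable (Γ : RibbonGraph e v m) (p : Γ.CornerPair)

theorem CornerPair.sameCycle {Γ : RibbonGraph e v m} (p : Γ.CornerPair) :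
    Γ.rot.SameCycle p.1.1 p.1.2 :=
  (Γ.vert_eq_iff _ _).1 p.2.2

/-- The cyclic orders at the vertices after a vertex has been cut into two along the corners `x` and
`y`, and the two pieces have been joined by a new edge. -/
abbrev rotSplit : Equiv.Perm (HalfEdge (e + 1)) := splitRot Γ.rot p.1.1 p.1.2 p.2.1

open Classical in
/-- The vertices after a splitting: the head of the new edge is the vertex `0`, the tail of the new
edge takes the place of the vertex that has been split. -/
noncomputable def vertSplit (h : HalfEdge (e + 1)) : Fin (v + 1) :=
  if (Γ.rotSplit p).SameCycle h newHead then 0 else (Γ.vert (corner p.1.1 p.1.2 h)).succ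

theorem vertSplit_head : Γ.vertSplit p newHead = 0 := by
  simp [vertSplit, Equiv.Perm.SameCycle.refl]

theorem vertSplit_of {h : HalfEdge (e + 1)} (hh : ¬ (Γ.rotSplit p).SameCycle h newHead) :
    Γ.vertSplit p h = (Γ.vert (corner p.1.1 p.1.2 h)).succ := by
  simp [vertSplit, hh]

theorem vertSplit_eq_zero {h : HalfEdge (e + 1)} :
    Γ.vertSplit p h = 0 ↔ (Γ.rotSplit p).SameCycle h newHead := by
  unfold vertSplit
  split_ifs with hh
  · simp [hh]
  · simp [hh, Fin.succ_ne_zero]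

theorem not_tail_head : ¬ (Γ.rotSplit p).SameCycle newTail newHead :=
  not_sameCycle_tail_head _ _ _ _ p.sameCycle

theorem vertSplit_tail : Γ.vertSplit p newTail = (Γ.vert p.1.1).succ := by
  rw [vertSplit_of _ _ (Γ.not_tail_head p), corner_tail, p.2.2]

theorem vert_corner_eq {h h' : HalfEdge (e + 1)} (hh : (Γ.rotSplit p).SameCycle h h') :
    Γ.vert (corner p.1.1 p.1.2 h) = Γ.vert (corner p.1.1 p.1.2 h') :=
  (Γ.vert_eq_iff _ _).2 (corner_sameCycle _ _ _ _ p.sameCycle hh)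

theorem exists_old (h : HalfEdge (e + 1)) :
    ∃ k : HalfEdge e, (Γ.rotSplit p).SameCycle h (old k) ∧ Γ.vert k = Γ.vert (corner p.1.1 p.1.2 h) := by
  revert h
  refine HalfEdge.rec_on ?_ ?_ fun k => ?_
  · exact ⟨p.1.1, (sameCycle_tail_left _ _ _ _).symm, p.2.2⟩
  · exact ⟨p.1.2, (sameCycle_head_right _ _ _ _).symm, p.2.2.symm⟩
  · exact ⟨k, Equiv.Perm.SameCycle.refl _ _, rfl⟩

theorem tail_or_head {h : HalfEdge (e + 1)}
    (hh : Γ.vert (corner p.1.1 p.1.2 h) = Γ.vert p.1.1) :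
    (Γ.rotSplit p).SameCycle h newTail ∨ (Γ.rotSplit p).SameCycle h newHead := by
  obtain ⟨k, h1, h2⟩ := Γ.exists_old p h
  have := sameCycle_tail_or_head Γ.rot p.1.1 p.1.2 p.2.1
    ((Γ.vert_eq_iff _ _).1 (h2.trans hh).symm)
  exact this.imp h1.trans h1.trans

theorem vertSplit_eq_iff (h h' : HalfEdge (e + 1)) :
    Γ.vertSplit p h = Γ.vertSplit p h' ↔ (Γ.rotSplit p).SameCycle h h' := by
  constructor
  · intro hh
    by_cases h0 : (Γ.rotSplit p).SameCycle h newHead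
    · have h1 := hh.symm.trans ((Γ.vertSplit_eq_zero p).2 h0)
      exact h0.trans ((Γ.vertSplit_eq_zero p).1 h1).symm
    · have h0' : ¬ (Γ.rotSplit p).SameCycle h' newHead := fun h1 =>
        h0 ((Γ.vertSplit_eq_zero p).1 (hh.trans ((Γ.vertSplit_eq_zero p).2 h1)))
      rw [vertSplit_of _ _ h0, vertSplit_of _ _ h0'] at hh
      have hh := Fin.succ_injective _ hh
      by_cases h2 : Γ.vert (corner p.1.1 p.1.2 h) = Γ.vert p.1.1
      · have h3 := (Γ.tail_or_head p h2).resolve_right h0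
        have h4 := (Γ.tail_or_head p (hh.symm.trans h2)).resolve_right h0'
        exact h3.trans h4.symm
      · obtain ⟨k, h3, h4⟩ := Γ.exists_old p h
        obtain ⟨k', h3', h4'⟩ := Γ.exists_old p h'
        refine h3.trans (Equiv.Perm.SameCycle.trans ?_ h3'.symm)
        refine sameCycle_old_of_not _ _ _ _ ((Γ.vert_eq_iff _ _).1 (h4.trans (hh.trans h4'.symm)))
          ?_ ?_
        · rw [← Γ.vert_eq_iff, h4]
          exact h2
        · rw [← Γ.vert_eq_iff, h4, ← p.2.2]
          exact h2
  · intro hh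
    by_cases h0 : (Γ.rotSplit p).SameCycle h newHead
    · rw [(Γ.vertSplit_eq_zero p).2 h0, (Γ.vertSplit_eq_zero p).2 (hh.symm.trans h0)]
    · have h0' : ¬ (Γ.rotSplit p).SameCycle h' newHead := fun h1 => h0 (hh.trans h1)
      rw [vertSplit_of _ _ h0, vertSplit_of _ _ h0', Γ.vert_corner_eq p hh]

theorem vertSplit_surj : Function.Surjective (Γ.vertSplit p) := by
  refine Fin.cases ⟨newHead, Γ.vertSplit_head p⟩ fun w => ?_
  by_cases hw : w = Γ.vert p.1.1
  · exact ⟨newTail, hw ▸ Γ.vertSplit_tail p⟩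
  · obtain ⟨h, rfl⟩ := Γ.vert_surj w
    refine ⟨old h, ?_⟩
    rw [vertSplit_of, corner_old]
    intro h1
    exact hw (by simpa using Γ.vert_corner_eq p h1)

/-- The boundaries after a splitting: they do not change, and both sides of the new edge belong to
the boundaries of the corners along which the vertex has been cut. -/
def bdrySplit (h : HalfEdge (e + 1)) : Fin m := Γ.bdry (corner p.1.1 p.1.2 h)

theorem inv_mul_eq_iff {α : Type*} (σ τ : Equiv.Perm α) (h k : α) :
    (σ⁻¹ * τ) h = k ↔ σ k = τ h := by
  rw [Equiv.Perm.mul_apply, Equiv.Perm.inv_eq_iff_eq]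
  exact eq_comm

theorem face_tail : ((Γ.rotSplit p)⁻¹ * flipEdge (e + 1)) newTail = old p.1.2 := by
  rw [inv_mul_eq_iff, splitRot_right, flipEdge_tail]

theorem face_head : ((Γ.rotSplit p)⁻¹ * flipEdge (e + 1)) newHead = old p.1.1 := by
  rw [inv_mul_eq_iff, splitRot_left, flipEdge_head]

theorem face_old (h : HalfEdge e) :
    corner p.1.1 p.1.2 (((Γ.rotSplit p)⁻¹ * flipEdge (e + 1)) (old h)) =
      (Γ.rot⁻¹ * flipEdge e) h ∧
    ((Γ.rotSplit p)⁻¹ * flipEdge (e + 1)).SameCycle (old h) (old ((Γ.rot⁻¹ * flipEdge e) h)) := by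
  have hk : Γ.rot ((Γ.rot⁻¹ * flipEdge e) h) = flipEdge e h := by simp
  set k := (Γ.rot⁻¹ * flipEdge e) h with hkd
  by_cases h2 : k = p.1.2
  · have : ((Γ.rotSplit p)⁻¹ * flipEdge (e + 1)) (old h) = newTail := by
      rw [inv_mul_eq_iff, splitRot_tail, flipEdge_old, ← hk, h2]
    refine ⟨by rw [this, corner_tail, h2], ?_⟩
    rw [h2, ← Γ.face_tail p, ← this]
    exact Equiv.Perm.sameCycle_apply_right.2 (Equiv.Perm.sameCycle_apply_right.2
      (Equiv.Perm.SameCycle.refl _ _))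
  · by_cases h1 : k = p.1.1
    · have : ((Γ.rotSplit p)⁻¹ * flipEdge (e + 1)) (old h) = newHead := by
        rw [inv_mul_eq_iff, splitRot_head, flipEdge_old, ← hk, h1]
      refine ⟨by rw [this, corner_head, h1], ?_⟩
      rw [h1, ← Γ.face_head p, ← this]
      exact Equiv.Perm.sameCycle_apply_right.2 (Equiv.Perm.sameCycle_apply_right.2
        (Equiv.Perm.SameCycle.refl _ _))
    · have : ((Γ.rotSplit p)⁻¹ * flipEdge (e + 1)) (old h) = old k := by
        rw [inv_mul_eq_iff, splitRot_other _ _ _ _ h1 h2, flipEdge_old, hk]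
      refine ⟨by rw [this, corner_old], ?_⟩
      rw [← this]
      exact Equiv.Perm.sameCycle_apply_right.2 (Equiv.Perm.SameCycle.refl _ _)

theorem bdrySplit_eq_iff (h h' : HalfEdge (e + 1)) :
    Γ.bdrySplit p h = Γ.bdrySplit p h' ↔
      ((Γ.rotSplit p)⁻¹ * flipEdge (e + 1)).SameCycle h h' := by
  have hstep : ∀ k, Γ.bdrySplit p (((Γ.rotSplit p)⁻¹ * flipEdge (e + 1)) k) = Γ.bdrySplit p k := by
    refine HalfEdge.rec_on ?_ ?_ fun k => ?_
    · rw [face_tail]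
      rfl
    · rw [face_head]
      rfl
    · unfold bdrySplit
      rw [(Γ.face_old p k).1, corner_old, Γ.bdry_eq_iff]
      exact Equiv.Perm.sameCycle_apply_left.2 (Equiv.Perm.SameCycle.refl _ _)
  have hold : ∀ k, ((Γ.rotSplit p)⁻¹ * flipEdge (e + 1)).SameCycle k
      (old (corner p.1.1 p.1.2 k)) := by
    refine HalfEdge.rec_on ?_ ?_ fun k => ?_
    · rw [corner_tail, ← face_tail]
      exact Equiv.Perm.sameCycle_apply_right.2 (Equiv.Perm.SameCycle.refl _ _)
    · rw [corner_head, ← face_head]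
      exact Equiv.Perm.sameCycle_apply_right.2 (Equiv.Perm.SameCycle.refl _ _)
    · exact Equiv.Perm.SameCycle.refl _ _
  constructor
  · intro hh
    have h1 := (Γ.bdry_eq_iff _ _).1 hh
    refine (hold h).trans (Equiv.Perm.SameCycle.trans ?_ (hold h').symm)
    exact sameCycle_of_closed (Γ.rot⁻¹ * flipEdge e) (fun k =>
      ((Γ.rotSplit p)⁻¹ * flipEdge (e + 1)).SameCycle (old (corner p.1.1 p.1.2 h)) (old k))
      (fun k hk => hk.trans (Γ.face_old p k).2) h1 (Equiv.Perm.SameCycle.refl _ _)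
  · intro hh
    exact sameCycle_of_closed _ (fun k => Γ.bdrySplit p h = Γ.bdrySplit p k)
      (fun k hk => hk.trans (hstep k).symm) hh rfl

/-- The splitting of a vertex: it is cut into two along two different corners `x` and `y`, which
leaves at least one of its half-edges at each of the two pieces, and the two pieces are joined by a
new edge. The new edge gets the number `0`, its head becomes the vertex `0`, and its tail takes the
place of the vertex that has been split. -/
noncomputable def split : RibbonGraph (e + 1) (v + 1) m where
  rot := Γ.rotSplit p
  vert := Γ.vertSplit p
  bdry := Γ.bdrySplit p
  vert_surj := Γ.vertSplit_surj p
  vert_eq_iff := Γ.vertSplit_eq_iff p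
  bdry_surj := fun b => (Γ.bdry_surj b).imp' old fun _ h => h
  bdry_eq_iff := Γ.bdrySplit_eq_iff p

/-- The vertex from which a vertex of the split graph arises. -/
def oldVertex : Fin (v + 1) → Fin v := Fin.cases (Γ.vert p.1.1) id

theorem oldVertex_vert (h : HalfEdge (e + 1)) :
    Γ.oldVertex p ((Γ.split p).vert h) = Γ.vert (corner p.1.1 p.1.2 h) := by
  change Γ.oldVertex p (Γ.vertSplit p h) = _
  by_cases h0 : (Γ.rotSplit p).SameCycle h newHead
  · rw [(Γ.vertSplit_eq_zero p).2 h0, Γ.vert_corner_eq p h0]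
    rfl
  · rw [vertSplit_of _ _ h0]
    rfl

theorem split_isConnected (hc : Γ.IsConnected) : (Γ.split p).IsConnected := by
  have hnew : ∀ u : Fin (v + 1), Relation.ReflTransGen
      (fun u u' => ∃ h, (Γ.split p).vert h = u ∧ (Γ.split p).vert (flipEdge (e + 1) h) = u')
      u (Γ.oldVertex p u).succ ∧ Relation.ReflTransGen
      (fun u u' => ∃ h, (Γ.split p).vert h = u ∧ (Γ.split p).vert (flipEdge (e + 1) h) = u')
      (Γ.oldVertex p u).succ u := by
    refine Fin.cases ⟨?_, ?_⟩ fun u => ⟨.refl, .refl⟩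
    · exact .single ⟨newHead, Γ.vertSplit_head p, Γ.vertSplit_tail p⟩
    · exact .single ⟨newTail, Γ.vertSplit_tail p, Γ.vertSplit_head p⟩
  intro w w'
  refine (hnew w).1.trans (Relation.ReflTransGen.trans ?_ (hnew w').2)
  have hpath := hc (Γ.oldVertex p w) (Γ.oldVertex p w')
  revert hpath
  generalize Γ.oldVertex p w' = u'
  intro hpath
  induction hpath with
  | refl => exact .refl
  | tail _ hb ih =>
    obtain ⟨h, rfl, rfl⟩ := hb
    refine ih.trans ?_
    have h1 := (hnew ((Γ.split p).vert (old h))).2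
    have h2 := (hnew ((Γ.split p).vert (flipEdge (e + 1) (old h)))).1
    rw [oldVertex_vert] at h1 h2
    exact h1.trans (.head ⟨old h, rfl, rfl⟩ h2)

theorem split_isAcyclic (ha : Γ.IsAcyclic) : (Γ.split p).IsAcyclic := by
  have key : ∀ w w' : Fin (v + 1), Relation.TransGen
      (fun u u' => ∃ i : Fin (e + 1), (Γ.split p).vert (i, false) = u ∧
        (Γ.split p).vert (i, true) = u') w w' →
      Relation.TransGen (fun u u' => ∃ i : Fin e, Γ.vert (i, false) = u ∧ Γ.vert (i, true) = u')
        (Γ.oldVertex p w) (Γ.oldVertex p w') ∨ (w = (Γ.vert p.1.1).succ ∧ w' = 0) := by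
    have hstep : ∀ w w' : Fin (v + 1), (∃ i : Fin (e + 1), (Γ.split p).vert (i, false) = w ∧
        (Γ.split p).vert (i, true) = w') →
        (∃ i : Fin e, Γ.vert (i, false) = Γ.oldVertex p w ∧
          Γ.vert (i, true) = Γ.oldVertex p w') ∨ (w = (Γ.vert p.1.1).succ ∧ w' = 0) := by
      rintro _ _ ⟨i, rfl, rfl⟩
      refine Fin.cases (Or.inr ⟨Γ.vertSplit_tail p, Γ.vertSplit_head p⟩) (fun i => Or.inl ?_) i
      exact ⟨i, (Γ.oldVertex_vert p (old (i, false))).symm,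
        (Γ.oldVertex_vert p (old (i, true))).symm⟩
    intro w w' hw
    induction hw with
    | single hb => exact (hstep _ _ hb).imp_left .single
    | tail _ hb ih =>
      rcases hstep _ _ hb with h1 | ⟨rfl, rfl⟩
      · left
        rcases ih with h2 | ⟨rfl, rfl⟩
        · exact h2.tail h1
        · exact .single h1
      · rcases ih with h2 | ⟨rfl, h2⟩
        · exact Or.inl h2
        · exact absurd h2 (Fin.succ_ne_zero _)
  intro w hw
  rcases key w w hw with h | ⟨h1, h2⟩
  · exact ha _ h
  · exact Fin.succ_ne_zero _ (h1.symm.trans h2)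

theorem split_trivalent (ht : ∃ w, 3 ≤ Γ.valency w) : ∃ w, 3 ≤ (Γ.split p).valency w := by
  obtain ⟨w, hw⟩ := ht
  have hval : ∀ {a b c : HalfEdge (e + 1)}, a ≠ b → a ≠ c → b ≠ c →
      (Γ.split p).vert a = (Γ.split p).vert b → (Γ.split p).vert a = (Γ.split p).vert c →
      ∃ w, 3 ≤ (Γ.split p).valency w := by
    intro a b c hab hac hbc h1 h2
    refine ⟨(Γ.split p).vert a, Finset.two_lt_card.2 ⟨a, ?_, b, ?_, c, ?_, hab, hac, hbc⟩⟩
    · simp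
    · simp [h1]
    · simp [h2]
  have hpair : ∀ {a b : HalfEdge e}, a ≠ b → Γ.vert a = Γ.vert b →
      (Γ.split p).vert (old a) = (Γ.split p).vert (old b) → Γ.vert a = Γ.vert p.1.1 →
      ∃ w, 3 ≤ (Γ.split p).valency w := by
    intro a b hab h1 h2 h3
    rcases Γ.tail_or_head p (h := old a) h3 with h4 | h4
    · exact hval (a := old a) (b := old b) (c := newTail) (by simpa using hab) (by simp) (by simp)
        h2 (((Γ.split p).vert_eq_iff _ _).2 h4)
    · exact hval (a := old a) (b := old b) (c := newHead) (by simpa using hab) (by simp) (by simp)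
        h2 (((Γ.split p).vert_eq_iff _ _).2 h4)
  obtain ⟨a, ha, b, hb, c, hc, hab, hac, hbc⟩ := Finset.two_lt_card.1 hw
  simp only [Finset.mem_filter, Finset.mem_univ, true_and] at ha hb hc
  by_cases h3 : w = Γ.vert p.1.1
  · have hor : ∀ {k}, Γ.vert k = w → (Γ.split p).vert (old k) = (Γ.split p).vert newTail ∨
        (Γ.split p).vert (old k) = (Γ.split p).vert newHead := fun {k} hk =>
      (Γ.tail_or_head p (h := old k) (hk.trans h3)).imp ((Γ.split p).vert_eq_iff _ _).2
        ((Γ.split p).vert_eq_iff _ _).2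
    rcases hor ha with h4 | h4 <;> rcases hor hb with h5 | h5 <;> rcases hor hc with h6 | h6
    · exact hpair hab (ha.trans hb.symm) (h4.trans h5.symm) (ha.trans h3)
    · exact hpair hab (ha.trans hb.symm) (h4.trans h5.symm) (ha.trans h3)
    · exact hpair hac (ha.trans hc.symm) (h4.trans h6.symm) (ha.trans h3)
    · exact hpair hbc (hb.trans hc.symm) (h5.trans h6.symm) (hb.trans h3)
    · exact hpair hbc (hb.trans hc.symm) (h5.trans h6.symm) (hb.trans h3)
    · exact hpair hac (ha.trans hc.symm) (h4.trans h6.symm) (ha.trans h3)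
    · exact hpair hab (ha.trans hb.symm) (h4.trans h5.symm) (ha.trans h3)
    · exact hpair hab (ha.trans hb.symm) (h4.trans h5.symm) (ha.trans h3)
  · have hv : ∀ {k}, Γ.vert k = w → (Γ.split p).vert (old k) = w.succ := by
      intro k hk
      change Γ.vertSplit p (old k) = _
      rw [vertSplit_of, corner_old, hk]
      intro h4
      exact h3 (hk.symm.trans (by simpa using Γ.vert_corner_eq p h4))
    exact hval (a := old a) (b := old b) (c := old c) (by simpa using hab) (by simpa using hac)
      (by simpa using hbc) ((hv ha).trans (hv hb).symm) ((hv ha).trans (hv hc).symm)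

end split

end RibbonGraph

namespace HalfEdge

variable {e : ℕ}

theorem eq_new_or_old (h : HalfEdge (e + 1)) : h = newTail ∨ h = newHead ∨ ∃ k, h = old k := by
  revert h
  exact rec_on (Or.inl rfl) (Or.inr (Or.inl rfl)) fun k => Or.inr (Or.inr ⟨k, rfl⟩)

/-- The exchange of the two edges that have been added last. -/
def swapNew (e : ℕ) : Equiv.Perm (HalfEdge (e + 2)) :=
  Equiv.prodCongr (Equiv.swap 0 1) (Equiv.refl Bool)

@[simp] theorem swapNew_tail : swapNew e newTail = old newTail := rfl

@[simp] theorem swapNew_head : swapNew e newHead = old newHead := rfl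

@[simp] theorem swapNew_old_tail : swapNew e (old newTail) = newTail := rfl

@[simp] theorem swapNew_old_head : swapNew e (old newHead) = newHead := rfl

@[simp] theorem swapNew_old_old (h : HalfEdge e) : swapNew e (old (old h)) = old (old h) := by
  refine Prod.ext (Equiv.swap_apply_of_ne_of_ne ?_ ?_) rfl
  · exact Fin.succ_ne_zero _
  · intro h1
    exact Fin.succ_ne_zero h.1 (Fin.succ_injective _ h1)

/-- The position of the corner after `x` when a vertex is first cut along `x'` and `y'`. -/
def lift (x' y' : HalfEdge (e + 1)) (x : HalfEdge e) : HalfEdge (e + 1) :=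
  if old x = x' then newHead else if old x = y' then newTail else old x

theorem lift_ne (x' y' : HalfEdge (e + 1)) {x y : HalfEdge e} (hxy : x ≠ y) :
    lift x' y' x ≠ lift x' y' y := by
  unfold lift
  have := @old_inj e x y
  grind [old_inj, old_ne_tail, old_ne_head, tail_ne_head]

theorem corner_lift {x y : HalfEdge e} {x' y' : HalfEdge (e + 1)} (t : HalfEdge e) :
    corner (corner x y x') (corner x y y') (lift x' y' t) = t := by
  unfold lift
  split_ifs with h1 h2
  · simp [← h1]
  · simp [← h2]
  · simp

theorem corner_corner_swap {x y : HalfEdge e} {x' y' : HalfEdge (e + 1)}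
    (h : HalfEdge (e + 2)) :
    corner (corner x y x') (corner x y y')
      (corner (lift x' y' x) (lift x' y' y) (swapNew e h)) = corner x y (corner x' y' h) := by
  revert h
  refine rec_on (by simp) (by simp) (rec_on ?_ ?_ fun t => ?_)
  · simpa using corner_lift y
  · simpa using corner_lift x
  · simp

theorem lift_corner {x y : HalfEdge e} (hxy : x ≠ y) {x' y' : HalfEdge (e + 1)}
    (h1 : corner x y x' ≠ corner x y y')
    (h2 : ¬ (x' = newTail ∧ y' = newHead))
    (h3 : ¬ (x' = newHead ∧ y' = newTail)) :
    lift (lift x' y' x) (lift x' y' y) (corner x y x') = x' ∧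
      lift (lift x' y' x) (lift x' y' y) (corner x y y') = y' := by
  rcases eq_new_or_old x' with rfl | rfl | ⟨s, rfl⟩ <;>
    rcases eq_new_or_old y' with rfl | rfl | ⟨t, rfl⟩ <;>
    simp only [lift, corner_tail, corner_head, corner_old] <;> grind [old_inj, old_ne_tail, old_ne_head, tail_ne_head, corner_tail, corner_head, corner_old]

theorem splitRot_splitRot_swap (σ : Equiv.Perm (HalfEdge e)) {x y : HalfEdge e} (hxy : x ≠ y)
    {x' y' : HalfEdge (e + 1)} (hxy' : x' ≠ y') (h1 : corner x y x' ≠ corner x y y')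
    (h2 : ¬ (x' = newTail ∧ y' = newHead)) (h3 : ¬ (x' = newHead ∧ y' = newTail))
    (h : HalfEdge (e + 2)) :
    splitRot (splitRot σ (corner x y x') (corner x y y') h1) (lift x' y' x) (lift x' y' y)
        (lift_ne x' y' hxy) (swapNew e h) =
      swapNew e (splitRot (splitRot σ x y hxy) x' y' hxy' h) := by
  revert h
  rcases eq_new_or_old x' with rfl | rfl | ⟨s, rfl⟩ <;>
    rcases eq_new_or_old y' with rfl | rfl | ⟨t, rfl⟩ <;>
    refine rec_on ?_ ?_ (rec_on ?_ ?_ fun u => ?_) <;>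
    simp only [lift, corner_tail, corner_head, corner_old, splitRot_tail, splitRot_head,
      splitRot_old, swapNew_tail, swapNew_head, swapNew_old_tail, swapNew_old_head,
      swapNew_old_old, old_inj, old_ne_tail, old_ne_head, tail_ne_old, head_ne_old, tail_ne_head, head_ne_tail, if_false, if_true] <;>
    grind [old_inj, old_ne_tail, old_ne_head, tail_ne_head, corner_tail, corner_head, corner_old, splitRot_old, splitRot_tail, splitRot_head,swapNew_tail, swapNew_head, swapNew_old_tail, swapNew_old_head,
      swapNew_old_old]

/-- Two different vertices which are cut and joined become one. -/
theorem sameCycle_tail_head_of_not (σ : Equiv.Perm (HalfEdge e)) (x y : HalfEdge e) (hxy : x ≠ y)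
    (hs : ¬ σ.SameCycle x y) : (splitRot σ x y hxy).SameCycle newTail newHead := by
  have key := sameCycle_of_closed σ (fun k => σ.SameCycle y k ∧
    ((splitRot σ x y hxy).SameCycle newTail newHead ∨
      (splitRot σ x y hxy).SameCycle newTail (old k))) ?_
    (h := σ y) (h' := y) (Equiv.Perm.sameCycle_apply_left.2 (Equiv.Perm.SameCycle.refl _ _))
    ⟨Equiv.Perm.sameCycle_apply_right.2 (Equiv.Perm.SameCycle.refl _ _), Or.inr ?_⟩
  · exact key.2.elim id fun h => h.trans (sameCycle_head_right _ _ _ _)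
  · rintro k ⟨h1, h2⟩
    refine ⟨Equiv.Perm.sameCycle_apply_right.2 h1, ?_⟩
    rcases h2 with h2 | h2
    · exact Or.inl h2
    · by_cases h3 : k = y
      · subst h3
        exact Or.inl (h2.trans (sameCycle_head_right _ _ _ _))
      · have h4 : k ≠ x := by
          rintro rfl
          exact hs h1.symm
        rw [← splitRot_other σ x y hxy h4 h3]
        exact Or.inr (Equiv.Perm.sameCycle_apply_right.2 h2)
  · rw [← splitRot_tail σ x y hxy]
    exact Equiv.Perm.sameCycle_apply_right.2 (Equiv.Perm.SameCycle.refl _ _)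

theorem sameCycle_iff_of_map {α β : Type*} (σ : Equiv.Perm α) (τ : Equiv.Perm β) (f : α ≃ β)
    (hf : ∀ h, τ (f h) = f (σ h)) (h k : α) : τ.SameCycle (f h) (f k) ↔ σ.SameCycle h k := by
  have hz : ∀ n : ℤ, (τ ^ n) (f h) = f ((σ ^ n) h) := by
    have hc : τ = (f.symm.trans σ).trans f := by
      ext b
      simpa using hf (f.symm b)
    have hn : ∀ n : ℕ, ∀ a, (τ ^ n) (f a) = f ((σ ^ n) a) := by
      intro n
      induction n with
      | zero => simp
      | succ n ih =>
        intro a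
        rw [pow_succ, pow_succ, Equiv.Perm.mul_apply, Equiv.Perm.mul_apply, hf, ih]
    intro n
    cases n with
    | ofNat n => simpa using hn n h
    | negSucc n =>
      rw [zpow_negSucc, zpow_negSucc, Equiv.Perm.inv_eq_iff_eq, hn]
      simp
  simp only [Equiv.Perm.SameCycle, hz, f.apply_eq_iff_eq]

end HalfEdge

/-- The two kinds of graphs: ribbon graphs, in which the direction of an edge is a mere choice, and
ribbon quivers, in which it is a part of the structure. -/
inductive Flavour
  | ribbon
  | quiver

namespace HalfEdge

variable {e : ℕ}

/-- The permutation of the half-edges that renumbers the edges by `s`, and which reverses those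
edges on which `r` is true. -/
def relabel (s : Equiv.Perm (Fin e)) (r : Fin e → Bool) : Equiv.Perm (HalfEdge e) where
  toFun h := (s h.1, xor (r h.1) h.2)
  invFun h := (s.symm h.1, xor (r (s.symm h.1)) h.2)
  left_inv h := by simp
  right_inv h := by simp

end HalfEdge

namespace RibbonGraph

variable {e v m : ℕ}

/-- An isomorphism between two graphs with marked boundaries. It consists of permutations of the
edges and of the vertices, and of a set of edges whose directions are reversed, which has to be empty
in the case of quivers. -/
structure Iso (F : Flavour) (Γ Γ' : RibbonGraph e v m) where
  /-- the map of the edges -/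
  edge : Equiv.Perm (Fin e)
  /-- whether an edge is reversed -/
  rev : Fin e → Bool
  /-- the map of the vertices -/
  vertex : Equiv.Perm (Fin v)
  rev_eq : F = Flavour.quiver → ∀ i, rev i = false
  map_rot : ∀ h, Γ'.rot (relabel edge rev h) = relabel edge rev (Γ.rot h)
  map_vert : ∀ h, Γ'.vert (relabel edge rev h) = vertex (Γ.vert h)
  map_bdry : ∀ h, Γ'.bdry (relabel edge rev h) = Γ.bdry h

/-- The sign of an isomorphism: the edges have degree `1 - d`, the vertices have degree `d`, and the
reversal of an edge contributes the factor `(-1) ^ d`. -/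
def Iso.sgn {F : Flavour} {Γ Γ' : RibbonGraph e v m} (φ : Iso F Γ Γ') (d : ℤ) : ℤˣ :=
  Equiv.Perm.sign φ.edge ^ (1 - d) * (∏ i, if φ.rev i then (-1) ^ d else 1) *
    Equiv.Perm.sign φ.vertex ^ d

section map

variable {F : Flavour} {Γ Γ' : RibbonGraph e v m} (φ : Iso F Γ Γ')

/-- The map of the pairs of corners that is induced by an isomorphism. -/
def Iso.mapPair : Γ.CornerPair ≃ Γ'.CornerPair :=
  Equiv.subtypeEquiv (Equiv.prodCongr (relabel φ.edge φ.rev) (relabel φ.edge φ.rev)) (by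
    rintro ⟨x, y⟩
    simp [φ.map_vert])

theorem Iso.exists_split (p : Γ.CornerPair) (d : ℤ) :
    ∃ ψ : Iso F (Γ.split p) (Γ'.split (φ.mapPair p)), ψ.sgn d = φ.sgn d := by
  set s := Equiv.Perm.decomposeFin.symm (0, φ.edge) with hs
  set t := Equiv.Perm.decomposeFin.symm (0, φ.vertex) with ht
  set r : Fin (e + 1) → Bool := Fin.cases false φ.rev with hr
  have h0 : relabel s r newTail = newTail := by
    simp [relabel, newTail, hs, hr]
  have h1 : relabel s r newHead = newHead := by
    simp [relabel, newHead, hs, hr]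
  have h2 : ∀ h, relabel s r (old h) = old (relabel φ.edge φ.rev h) := by
    intro h
    simp [relabel, old, hs, hr]
  have hp1 : (φ.mapPair p).1.1 = relabel φ.edge φ.rev p.1.1 := rfl
  have hp2 : (φ.mapPair p).1.2 = relabel φ.edge φ.rev p.1.2 := rfl
  have hrot : ∀ h, (Γ'.split (φ.mapPair p)).rot (relabel s r h) =
      relabel s r ((Γ.split p).rot h) := by
    refine HalfEdge.rec_on ?_ ?_ fun h => ?_
    · rw [h0]
      change old _ = relabel s r (old _)
      rw [h2, hp2, φ.map_rot]
    · rw [h1]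
      change old _ = relabel s r (old _)
      rw [h2, hp1, φ.map_rot]
    · rw [h2]
      change splitRot Γ'.rot (φ.mapPair p).1.1 (φ.mapPair p).1.2 (φ.mapPair p).2.1 _ =
        relabel s r (splitRot Γ.rot p.1.1 p.1.2 p.2.1 _)
      rw [splitRot_old, splitRot_old, hp1, hp2]
      simp only [EmbeddingLike.apply_eq_iff_eq]
      split_ifs
      · exact h0.symm
      · exact h1.symm
      · rw [h2, φ.map_rot]
  have hcor : ∀ h, corner (φ.mapPair p).1.1 (φ.mapPair p).1.2 (relabel s r h) =
      relabel φ.edge φ.rev (corner p.1.1 p.1.2 h) := by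
    refine HalfEdge.rec_on ?_ ?_ fun h => ?_
    · rw [h0]
      rfl
    · rw [h1]
      rfl
    · rw [h2]
      rfl
  refine ⟨⟨s, r, t, ?_, hrot, ?_, ?_⟩, ?_⟩
  · intro hF
    exact Fin.cases rfl (φ.rev_eq hF)
  · intro h
    have hsc := sameCycle_iff_of_map _ _ (relabel s r) hrot h newHead
    rw [h1] at hsc
    change Γ'.vertSplit _ _ = t (Γ.vertSplit _ _)
    by_cases hh : (Γ.split p).rot.SameCycle h newHead
    · rw [(Γ.vertSplit_eq_zero p).2 hh, (Γ'.vertSplit_eq_zero _).2 (hsc.2 hh)]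
      simp [ht]
    · rw [Γ.vertSplit_of p hh, Γ'.vertSplit_of _ (fun h3 => hh (hsc.1 h3)), hcor, φ.map_vert]
      simp [ht]
  · intro h
    change Γ'.bdry (corner _ _ _) = Γ.bdry (corner _ _ _)
    rw [hcor, φ.map_bdry]
  · simp only [Iso.sgn, Fin.prod_univ_succ, hs, ht, hr, Equiv.Perm.decomposeFin.symm_sign]
    simp
    rfl

end map

section double

variable (Γ : RibbonGraph e v m)

/-- Splitting two times. -/
noncomputable abbrev split₂ (p : Γ.CornerPair) (q : (Γ.split p).CornerPair) :
    RibbonGraph (e + 2) (v + 2) m :=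
  (Γ.split p).split q

variable (p : Γ.CornerPair) (q : (Γ.split p).CornerPair)

theorem split₂_cond1 : corner p.1.1 p.1.2 q.1.1 ≠ corner p.1.1 p.1.2 q.1.2 := by
  obtain ⟨⟨x', y'⟩, hne, hv⟩ := q
  have hsc : ∀ {h h'}, (Γ.split p).vert h = (Γ.split p).vert h' →
    (Γ.rotSplit p).SameCycle h h' := fun h => ((Γ.split p).vert_eq_iff _ _).1 h
  have hn := Γ.not_tail_head p
  have ht : (Γ.rotSplit p).SameCycle (old p.1.1) newTail := sameCycle_tail_left _ _ _ _
  have hh : (Γ.rotSplit p).SameCycle (old p.1.2) newHead := sameCycle_head_right _ _ _ _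
  have hv := hsc hv
  dsimp only at hne hv ⊢
  rcases eq_new_or_old x' with rfl | rfl | ⟨s, rfl⟩ <;>
    rcases eq_new_or_old y' with rfl | rfl | ⟨t, rfl⟩
  · exact absurd rfl hne
  · exact p.2.1.symm
  · intro heq
    change p.1.2 = t at heq
    rw [heq] at hh
    exact hn (hv.trans hh)
  · exact p.2.1
  · exact absurd rfl hne
  · intro heq
    change p.1.1 = t at heq
    rw [heq] at ht
    exact hn (ht.symm.trans hv.symm)
  · intro heq
    change s = p.1.2 at heq
    rw [← heq] at hh
    exact hn (hv.symm.trans hh)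
  · intro heq
    change s = p.1.1 at heq
    rw [← heq] at ht
    exact hn (ht.symm.trans hv)
  · simpa using hne

theorem split₂_cond2 : ¬ (q.1.1 = newTail ∧ q.1.2 = newHead) := by
  rintro ⟨h1, h2⟩
  have := q.sameCycle
  rw [h1, h2] at this
  exact Γ.not_tail_head p this

theorem split₂_cond3 : ¬ (q.1.1 = newHead ∧ q.1.2 = newTail) := by
  rintro ⟨h1, h2⟩
  have := q.sameCycle.symm
  rw [h1, h2] at this
  exact Γ.not_tail_head p this

/-- The first splitting when the two new edges are inserted in the opposite order. -/
def swapFst : Γ.CornerPair :=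
  ⟨(corner p.1.1 p.1.2 q.1.1, corner p.1.1 p.1.2 q.1.2), Γ.split₂_cond1 p q,
    Γ.vert_corner_eq p q.sameCycle⟩

theorem rot_swap (h : HalfEdge (e + 2)) :
    splitRot (Γ.rotSplit (Γ.swapFst p q)) (lift q.1.1 q.1.2 p.1.1) (lift q.1.1 q.1.2 p.1.2)
        (lift_ne q.1.1 q.1.2 p.2.1) (swapNew e h) = swapNew e ((Γ.split₂ p q).rot h) :=
  splitRot_splitRot_swap Γ.rot p.2.1 q.2.1 (Γ.split₂_cond1 p q) (Γ.split₂_cond2 p q)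
    (Γ.split₂_cond3 p q) h

/-- The second splitting when the two new edges are inserted in the opposite order. -/
noncomputable def swapSnd : (Γ.split (Γ.swapFst p q)).CornerPair :=
  ⟨(lift q.1.1 q.1.2 p.1.1, lift q.1.1 q.1.2 p.1.2), lift_ne q.1.1 q.1.2 p.2.1, by
    rw [vert_eq_iff]
    by_contra hcon
    have h1 := sameCycle_tail_head_of_not _ _ _ (lift_ne q.1.1 q.1.2 p.2.1) hcon
    have h2 := (sameCycle_iff_of_map _ _ (swapNew e) (Γ.rot_swap p q) (old newTail)
      (old newHead)).1 h1
    have h3 := corner_sameCycle _ _ _ q.2.1 q.sameCycle h2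
    exact Γ.not_tail_head p h3⟩

theorem split₂_vert_head : (Γ.split₂ p q).vert newHead = 0 := (Γ.split p).vertSplit_head q

theorem split₂_vert_of {h : HalfEdge (e + 2)} (hh : (Γ.split₂ p q).vert h ≠ 0) :
    (Γ.split₂ p q).vert h = ((Γ.split p).vert (corner q.1.1 q.1.2 h)).succ :=
  (Γ.split p).vertSplit_of q fun h1 => hh (((Γ.split p).vertSplit_eq_zero q).2 h1)

theorem split₂_vert_old_head (hh : (Γ.split₂ p q).vert (old newHead) ≠ 0) :
    (Γ.split₂ p q).vert (old newHead) = 1 := by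
  rw [Γ.split₂_vert_of p q hh, corner_old]
  exact congrArg Fin.succ (Γ.vertSplit_head p)

theorem split₂_vert_tail (hh : (Γ.split₂ p q).vert (old newHead) = 0) :
    (Γ.split₂ p q).vert newTail = 1 := by
  have h1 := (Γ.split p).vertSplit_tail q
  have h2 := (Γ.split p).vert_corner_eq q (((Γ.split p).vertSplit_eq_zero q).1 hh)
  rw [corner_old, corner_head] at h2
  refine h1.trans ?_
  rw [← h2]
  exact congrArg Fin.succ (Γ.vertSplit_head p)

theorem split₂_vert_old_tail : (Γ.split₂ p q).vert (old newTail) ≠ 0 →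
    (Γ.split₂ p q).vert (old newTail) ≠ 1 := by
  intro h0 h1
  rw [Γ.split₂_vert_of p q h0, corner_old] at h1
  have h2 : (Γ.split p).vert newTail = 0 := Fin.succ_injective _ h1
  exact Γ.not_tail_head p ((Γ.vertSplit_eq_zero p).1 h2)

theorem split₂_vert_old_tail_ne (hh : (Γ.split₂ p q).vert (old newHead) = 0) :
    (Γ.split₂ p q).vert (old newTail) ≠ 0 := by
  intro h1
  have h2 : (Γ.split₂ p q).rot.SameCycle (old newTail) (old newHead) :=
    ((Γ.split₂ p q).vert_eq_iff _ _).1 (h1.trans hh.symm)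
  have h3 := corner_sameCycle _ _ _ q.2.1 q.sameCycle h2
  exact Γ.not_tail_head p h3

/-- The vertex of the original graph from which a half-edge arises. -/
def base (h : HalfEdge (e + 2)) : Fin v := Γ.vert (corner p.1.1 p.1.2 (corner q.1.1 q.1.2 h))

theorem split₂_vert_other {h : HalfEdge (e + 2)} (h0 : (Γ.split₂ p q).vert h ≠ 0)
    (h1 : (Γ.split₂ p q).vert h ≠ 1) :
    (Γ.split₂ p q).vert h = (Γ.base p q h).succ.succ := by
  rw [Γ.split₂_vert_of p q h0] at h1 ⊢
  refine congrArg Fin.succ ?_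
  refine Γ.vertSplit_of p fun h2 => h1 ?_
  exact congrArg Fin.succ ((Γ.vertSplit_eq_zero p).2 h2)

theorem base_tail_eq (hh : (Γ.split₂ p q).vert (old newHead) = 0) :
    Γ.base p q newTail = Γ.base p q (old newTail) := by
  have h2 := (Γ.split p).vert_corner_eq q (((Γ.split p).vertSplit_eq_zero q).1 hh)
  rw [corner_old, corner_head, q.2.2] at h2
  have h3 := Γ.vert_corner_eq p (((Γ.split p).vert_eq_iff _ _).1 h2)
  simp only [base, corner_tail, corner_old]
  rw [← h3, corner_head, p.2.2]

theorem base_swap (h : HalfEdge (e + 2)) :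
    Γ.base (Γ.swapFst p q) (Γ.swapSnd p q) (swapNew e h) = Γ.base p q h :=
  congrArg Γ.vert (corner_corner_swap h)

theorem exists_iso_swap (F : Flavour) (d : ℤ) :
    ∃ ψ : Iso F (Γ.split₂ p q) (Γ.split₂ (Γ.swapFst p q) (Γ.swapSnd p q)), ψ.sgn d = -1 := by
  have hrot : ∀ h, (Γ.split₂ (Γ.swapFst p q) (Γ.swapSnd p q)).rot (swapNew e h) =
    swapNew e ((Γ.split₂ p q).rot h) := Γ.rot_swap p q
  set G := Γ.split₂ p q with hG
  set G' := Γ.split₂ (Γ.swapFst p q) (Γ.swapSnd p q) with hG'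
  have hsc : ∀ h k, G'.vert (swapNew e h) = G'.vert (swapNew e k) ↔ G.vert h = G.vert k := by
    intro h k
    rw [G.vert_eq_iff, G'.vert_eq_iff]
    exact sameCycle_iff_of_map _ _ _ hrot h k
  have hrel : relabel (Equiv.swap 0 1) (fun _ => false) = swapNew e := by
    ext h <;> simp [relabel, swapNew]
  have hG0 : G.vert newHead = 0 := Γ.split₂_vert_head p q
  have hG'0 : G'.vert (swapNew e (old newHead)) = 0 := Γ.split₂_vert_head _ _
  have hbase : ∀ h, G.vert h ≠ 0 → G.vert h ≠ 1 → G.vert h = (Γ.base p q h).succ.succ := fun h =>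
    Γ.split₂_vert_other p q
  have hbase' : ∀ h, G'.vert (swapNew e h) ≠ 0 → G'.vert (swapNew e h) ≠ 1 →
      G'.vert (swapNew e h) = (Γ.base p q h).succ.succ := fun h h0 h1 => by
    rw [← Γ.base_swap p q h]
    exact Γ.split₂_vert_other _ _ h0 h1
  suffices ∃ τ : Equiv.Perm (Fin (v + 2)), Equiv.Perm.sign τ = -1 ∧
      ∀ h, G'.vert (swapNew e h) = τ (G.vert h) by
    obtain ⟨τ, hτ, hv⟩ := this
    refine ⟨⟨Equiv.swap 0 1, fun _ => false, τ, fun _ _ => rfl, ?_, ?_, ?_⟩, ?_⟩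
    · rw [hrel]
      exact hrot
    · rw [hrel]
      exact hv
    · rw [hrel]
      exact fun h => congrArg Γ.bdry (corner_corner_swap h)
    · simp only [Iso.sgn, hτ]
      rw [Equiv.Perm.sign_swap (by simp)]
      simp [← zpow_add]
  by_cases hcase : G.vert (old newHead) = 0
  · -- the two new edges have the same head
    have hT : G.vert newTail = 1 := Γ.split₂_vert_tail p q hcase
    have hO0 : G.vert (old newTail) ≠ 0 := Γ.split₂_vert_old_tail_ne p q hcase
    have hO1 : G.vert (old newTail) ≠ 1 := Γ.split₂_vert_old_tail p q hO0
    have hcase' : G'.vert (old newHead) = 0 :=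
      ((hsc newHead (old newHead)).2 (hG0.trans hcase.symm)).trans hG'0
    have hT' : G'.vert (swapNew e (old newTail)) = 1 := Γ.split₂_vert_tail _ _ hcase'
    have hj : G'.vert (swapNew e newTail) = G.vert (old newTail) := by
      have h0 : G'.vert (swapNew e newTail) ≠ 0 := by
        rw [← hG'0, Ne, hsc, hT, hcase]
        simp
      have h1 : G'.vert (swapNew e newTail) ≠ 1 := by
        rw [← hT', Ne, hsc, hT]
        exact hO1.symm
      rw [hbase' _ h0 h1, hbase _ hO0 hO1, Γ.base_tail_eq p q hcase]
    refine ⟨Equiv.swap 1 (G.vert (old newTail)), Equiv.Perm.sign_swap hO1.symm, fun h => ?_⟩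
    by_cases h0 : G.vert h = 0
    · rw [h0, Equiv.swap_apply_of_ne_of_ne (by simp) hO0.symm, ← hG'0, hsc, h0, hcase]
    · by_cases h1 : G.vert h = 1
      · rw [h1, Equiv.swap_apply_left, ← hj, hsc, h1, hT]
      · by_cases h2 : G.vert h = G.vert (old newTail)
        · rw [h2, Equiv.swap_apply_right, ← hT', hsc, h2]
        · rw [Equiv.swap_apply_of_ne_of_ne h1 h2, hbase h h0 h1]
          refine hbase' h ?_ ?_
          · rw [← hG'0, Ne, hsc, hcase]
            exact h0
          · rw [← hT', Ne, hsc]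
            exact h2
  · have hH : G.vert (old newHead) = 1 := Γ.split₂_vert_old_head p q hcase
    have hH' : G'.vert (swapNew e newHead) = 1 := by
      refine Γ.split₂_vert_old_head _ _ ?_
      change G'.vert (swapNew e newHead) ≠ 0
      rw [← hG'0, Ne, hsc, hG0]
      exact fun h => hcase h.symm
    refine ⟨Equiv.swap 0 1, Equiv.Perm.sign_swap (by simp), fun h => ?_⟩
    by_cases h0 : G.vert h = 0
    · rw [h0, Equiv.swap_apply_left, ← hH', hsc, h0, hG0]
    · by_cases h1 : G.vert h = 1
      · rw [h1, Equiv.swap_apply_right, ← hG'0, hsc, h1, hH]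
      · rw [Equiv.swap_apply_of_ne_of_ne h0 h1, hbase h h0 h1]
        refine hbase' h ?_ ?_
        · rw [← hG'0, Ne, hsc, hH]
          exact h1
        · rw [← hH', Ne, hsc, hG0]
          exact h0

/-- The exchange of the order of two splittings, as a map. -/
noncomputable def swapPair (t : Σ p : Γ.CornerPair, (Γ.split p).CornerPair) :
    Σ p : Γ.CornerPair, (Γ.split p).CornerPair :=
  ⟨Γ.swapFst t.1 t.2, Γ.swapSnd t.1 t.2⟩

theorem sigma_ext {t t' : Σ p : Γ.CornerPair, (Γ.split p).CornerPair} (h1 : t.1.1 = t'.1.1)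
    (h2 : t.2.1 = t'.2.1) : t = t' := by
  obtain ⟨p, q⟩ := t
  obtain ⟨p', q'⟩ := t'
  obtain rfl : p = p' := Subtype.ext h1
  obtain rfl : q = q' := Subtype.ext h2
  rfl

theorem swapPair_swapPair (t : Σ p : Γ.CornerPair, (Γ.split p).CornerPair) :
    Γ.swapPair (Γ.swapPair t) = t := by
  obtain ⟨p, q⟩ := t
  have hl := lift_corner p.2.1 (Γ.split₂_cond1 p q) (Γ.split₂_cond2 p q) (Γ.split₂_cond3 p q)
  refine Γ.sigma_ext (Prod.ext ?_ ?_) (Prod.ext ?_ ?_)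
  · exact corner_lift _
  · exact corner_lift _
  · exact hl.1
  · exact hl.2

end double

end RibbonGraph

namespace RibbonGraph

universe u

/-- The conditions on the graphs that span the degree `k` part of the complex of genus `g` graphs with
`m` boundaries. The vertices have degree `d`, the edges have degree `1 - d`, and the total degree is
shifted by `d`. -/
structure IsGenerator (F : Flavour) (d : ℤ) (g m : ℕ) (k : ℤ) {e v : ℕ} (Γ : RibbonGraph e v m) :
    Prop where
  connected : Γ.IsConnected
  /-- `g = 1 + (e - v - m) / 2` -/
  genus : v + m + 2 * g = e + 2
  trivalent : ∃ w, 3 ≤ Γ.valency w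
  acyclic : F = Flavour.quiver → Γ.IsAcyclic
  degree : d * v + (1 - d) * e - d = k

/-- The graphs that span the degree `k` part of the complex of genus `g` graphs with `m`
boundaries. -/
abbrev Generator (F : Flavour) (d : ℤ) (g m : ℕ) (k : ℤ) : Type :=
  {X : Σ e v : ℕ, RibbonGraph e v m // IsGenerator F d g m k X.2.2}

section complex

variable (K : Type u) [Field K] (F : Flavour) (d : ℤ) (g m : ℕ) (k : ℤ)

/-- A graph as a vector. -/
noncomputable def vec {e v : ℕ} (Γ : RibbonGraph e v m) (h : IsGenerator F d g m k Γ) :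
    Generator F d g m k →₀ K :=
  Finsupp.single ⟨⟨e, v, Γ⟩, h⟩ 1

/-- Isomorphic graphs are identified up to the sign of the isomorphism. -/
noncomputable def relations : Submodule K (Generator F d g m k →₀ K) :=
  Submodule.span K {r | ∃ (e v : ℕ) (Γ Γ' : RibbonGraph e v m) (h : IsGenerator F d g m k Γ)
    (h' : IsGenerator F d g m k Γ') (φ : Iso F Γ Γ'),
    r = vec K F d g m k Γ' h' - (((φ.sgn d : ℤˣ) : ℤ) : K) • vec K F d g m k Γ h}

/-- The degree `k` part of the complex of genus `g` graphs with `m` boundaries. -/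
def Cochains : Type u := (Generator F d g m k →₀ K) ⧸ relations K F d g m k

noncomputable instance : AddCommGroup (Cochains K F d g m k) :=
  inferInstanceAs (AddCommGroup ((Generator F d g m k →₀ K) ⧸ relations K F d g m k))

noncomputable instance : Module K (Cochains K F d g m k) :=
  inferInstanceAs (Module K ((Generator F d g m k →₀ K) ⧸ relations K F d g m k))

/-- The class of a linear combination of graphs. -/
noncomputable def toCochains : (Generator F d g m k →₀ K) →ₗ[K] Cochains K F d g m k :=
  (relations K F d g m k).mkQ

theorem toCochains_eq_zero {x : Generator F d g m k →₀ K} :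
    toCochains K F d g m k x = 0 ↔ x ∈ relations K F d g m k :=
  Submodule.Quotient.mk_eq_zero _

/-- The coefficient of the splittings in the differential. In a ribbon graph, each splitting of a
vertex is counted twice, since the new edge may be given both directions. -/
noncomputable def splitCoeff (K : Type u) [Field K] : Flavour → K
  | Flavour.ribbon => 1 / 2
  | Flavour.quiver => 1

variable {F d g m k}

theorem IsGenerator.split {e v : ℕ} {Γ : RibbonGraph e v m} (h : IsGenerator F d g m k Γ)
    (p : Γ.CornerPair) : IsGenerator F d g m (k + 1) (Γ.split p) where
  connected := Γ.split_isConnected p h.connected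
  genus := by
    have := h.genus
    omega
  trivalent := Γ.split_trivalent p h.trivalent
  acyclic hF := Γ.split_isAcyclic p (h.acyclic hF)
  degree := by
    have := h.degree
    push_cast
    linarith

/-- The sum of all the splittings of the vertices of a graph. -/
noncomputable def splitSum (X : Generator F d g m k) : Generator F d g m (k + 1) →₀ K :=
  splitCoeff K F • ∑ p : X.1.2.2.CornerPair,
    vec K F d g m (k + 1) (X.1.2.2.split p) (X.2.split p)

/-- The class of a graph. -/
noncomputable def cls {e v : ℕ} (Γ : RibbonGraph e v m) (h : IsGenerator F d g m k Γ) :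
    Cochains K F d g m k :=
  toCochains K F d g m k (vec K F d g m k Γ h)

theorem cls_eq_of_iso {e v : ℕ} {Γ Γ' : RibbonGraph e v m} (h : IsGenerator F d g m k Γ)
    (h' : IsGenerator F d g m k Γ') (φ : Iso F Γ Γ') :
    cls K Γ' h' = (((φ.sgn d : ℤˣ) : ℤ) : K) • cls K Γ h := by
  rw [← sub_eq_zero]
  unfold cls
  rw [← map_smul, ← map_sub, toCochains_eq_zero]
  exact Submodule.subset_span ⟨e, v, Γ, Γ', h, h', φ, rfl⟩

theorem toCochains_splitSum {e v : ℕ} (Γ : RibbonGraph e v m) (h : IsGenerator F d g m k Γ) :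
    toCochains K F d g m (k + 1) (splitSum K ⟨⟨e, v, Γ⟩, h⟩) =
      splitCoeff K F • ∑ p : Γ.CornerPair, cls K (Γ.split p) (h.split p) := by
  simp only [splitSum, map_smul, map_sum]
  rfl

theorem relations_le : relations K F d g m k ≤ Submodule.comap
    (Finsupp.linearCombination K (splitSum K : Generator F d g m k → _))
    (relations K F d g m (k + 1)) := by
  refine Submodule.span_le.2 ?_
  rintro _ ⟨e, v, Γ, Γ', h, h', φ, rfl⟩
  simp only [SetLike.mem_coe, Submodule.mem_comap, map_sub, map_smul, vec,
    Finsupp.linearCombination_single, one_smul]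
  rw [← toCochains_eq_zero, map_sub, map_smul, toCochains_splitSum,
    toCochains_splitSum, sub_eq_zero, smul_comm, ← Equiv.sum_comp φ.mapPair]
  rw [Finset.smul_sum (r := (((φ.sgn d : ℤˣ) : ℤ) : K))]
  congr 1
  refine Finset.sum_congr rfl fun p _ => ?_
  obtain ⟨ψ, hψ⟩ := φ.exists_split p d
  rw [cls_eq_of_iso K (h.split p) (h'.split (φ.mapPair p)) ψ, hψ]

variable (F d g m k)

/-- The differential: the sum over all the splittings of the vertices. In the general formula for
the differential, a vertex is also split in such a way that one of the two pieces gets no half-edge,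
and a new univalent vertex is attached at each corner of each boundary. The terms of these two sorts
cancel each other, and only the splittings along two different corners remain. The sign of a graph
with a new edge and a new vertex is fixed by the convention that these are put in the first place. -/
noncomputable def differential : Cochains K F d g m k →ₗ[K] Cochains K F d g m (k + 1) :=
  (relations K F d g m k).mapQ (relations K F d g m (k + 1))
    (Finsupp.linearCombination K (splitSum K)) (relations_le K)

variable {F d g m k}

theorem differential_cls {e v : ℕ} (Γ : RibbonGraph e v m) (h : IsGenerator F d g m k Γ) :
    differential K F d g m k (cls K Γ h) =
      splitCoeff K F • ∑ p : Γ.CornerPair, cls K (Γ.split p) (h.split p) := by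
  rw [← toCochains_splitSum K Γ h]
  change toCochains K F d g m (k + 1)
    (Finsupp.linearCombination K (splitSum K) (vec K F d g m k Γ h)) = _
  rw [vec, Finsupp.linearCombination_single, one_smul]

theorem differential_comp [CharZero K] :
    differential K F d g m (k + 1) ∘ₗ differential K F d g m k = 0 := by
  refine Submodule.linearMap_qext (relations K F d g m k)
    (Finsupp.lhom_ext' fun X => LinearMap.ext_ring ?_)
  obtain ⟨⟨e, v, Γ⟩, h⟩ := X
  replace h : IsGenerator F d g m k Γ := h
  change differential K F d g m (k + 1) (differential K F d g m k (cls K Γ h)) = 0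
  rw [differential_cls, map_smul, map_sum]
  simp only [differential_cls]
  rw [← Finset.smul_sum]
  have hzero : ∑ p : Γ.CornerPair, ∑ q : (Γ.split p).CornerPair,
      cls K ((Γ.split p).split q) ((h.split p).split q) = 0 := by
    rw [Finset.sum_sigma', Finset.univ_sigma_univ]
    set S := ∑ t : Σ p : Γ.CornerPair, (Γ.split p).CornerPair,
      cls K ((Γ.split t.1).split t.2) ((h.split t.1).split t.2) with hS
    have hneg : S = -S := by
      calc S = _ := (Equiv.sum_comp (Function.Involutive.toPerm Γ.swapPair Γ.swapPair_swapPair)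
            fun t => cls K ((Γ.split t.1).split t.2) ((h.split t.1).split t.2)).symm
        _ = ∑ t : Σ p : Γ.CornerPair, (Γ.split p).CornerPair,
            -cls K ((Γ.split t.1).split t.2) ((h.split t.1).split t.2) := by
          refine Finset.sum_congr rfl fun t _ => ?_
          obtain ⟨ψ, hψ⟩ : ∃ ψ : Iso F ((Γ.split t.1).split t.2)
              ((Γ.split (Γ.swapPair t).1).split (Γ.swapPair t).2), ψ.sgn d = -1 :=
            Γ.exists_iso_swap t.1 t.2 F d
          have := cls_eq_of_iso K ((h.split t.1).split t.2)
            ((h.split (Γ.swapPair t).1).split (Γ.swapPair t).2) ψ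
          rw [hψ] at this
          rw [Units.val_neg, Units.val_one, Int.cast_neg, Int.cast_one, neg_one_smul] at this
          exact this
        _ = -S := Finset.sum_neg_distrib _
    have htwo : (2 : K) • S = 0 := by
      rw [two_smul]
      nth_rewrite 1 [hneg]
      exact neg_add_cancel S
    exact (smul_eq_zero.1 htwo).resolve_left two_ne_zero
  rw [hzero, smul_zero, smul_zero]

end complex

section

variable (K : Type u) [Field K] [CharZero K] (F : Flavour) (d : ℤ)

/-- The complex of genus `g` graphs with `m` marked boundaries. -/
noncomputable def graphComplex (g m : ℕ) : CochainComplex (ModuleCat.{u} K) ℤ :=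
  CochainComplex.of (fun k => ModuleCat.of K (Cochains K F d g m k))
    (fun k => ModuleCat.ofHom (differential K F d g m k))
    (fun k => by rw [← ModuleCat.ofHom_comp, differential_comp, ModuleCat.ofHom_zero])

/-- The pairs of a genus `g ≥ 0` and a number `m ≥ 1` of boundaries such that `2 g + m ≥ 3`. -/
structure StableType where
  /-- the genus -/
  g : ℕ
  /-- the number of boundaries -/
  m : ℕ
  one_le : 1 ≤ m
  three_le : 3 ≤ 2 * g + m

/-- The differential of the direct product of the complexes of graphs. -/
noncomputable def productDifferential (k : ℤ) :
    (∀ t : StableType, Cochains K F d t.g t.m k) →ₗ[K]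
      ∀ t : StableType, Cochains K F d t.g t.m (k + 1) :=
  LinearMap.pi fun t => differential K F d t.g t.m k ∘ₗ LinearMap.proj t

/-- The direct product of the complexes of graphs over all stable types `(g, m)`. -/
noncomputable def productComplex : CochainComplex (ModuleCat.{u} K) ℤ :=
  CochainComplex.of (fun k => ModuleCat.of K (∀ t : StableType, Cochains K F d t.g t.m k))
    (fun k => ModuleCat.ofHom (productDifferential K F d k))
    (fun k => by
      rw [← ModuleCat.ofHom_comp, ← ModuleCat.ofHom_zero]
      congr 1
      ext x t
      exact LinearMap.congr_fun (differential_comp K) (x t))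

/-- The projection of the direct product to one of its factors. -/
noncomputable def productProj (t : StableType) :
    productComplex K F d ⟶ graphComplex K F d t.g t.m :=
  CochainComplex.ofHom (fun _ => ModuleCat.ofHom (LinearMap.proj t)) fun k => by
    simp only [productComplex, graphComplex, CochainComplex.of_d]
    rfl

end

end RibbonGraph

open RibbonGraph

universe u

section

variable (K : Type u) [Field K] [CharZero K] (d : ℤ)

/-- The ribbon graph complex `RGC_d^{(g,m)}`. -/
noncomputable abbrev RGCPart (g m : ℕ) : CochainComplex (ModuleCat.{u} K) ℤ :=
  graphComplex K Flavour.ribbon d g m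

/-- The ribbon quiver complex `ORGC_d^{(g,m)}`. -/
noncomputable abbrev ORGCPart (g m : ℕ) : CochainComplex (ModuleCat.{u} K) ℤ :=
  graphComplex K Flavour.quiver d g m

/-- The ribbon graph complex `RGC_d`. -/
noncomputable abbrev RGC : CochainComplex (ModuleCat.{u} K) ℤ :=
  productComplex K Flavour.ribbon d

/-- The ribbon quiver complex `ORGC_d`. -/
noncomputable abbrev ORGC : CochainComplex (ModuleCat.{u} K) ℤ :=
  productComplex K Flavour.quiver d

/-- The projection `RGC_d ⟶ RGC_d^{(g,m)}`. -/
noncomputable abbrev RGC.proj (t : StableType) : RGC K d ⟶ RGCPart K d t.g t.m :=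
  productProj K Flavour.ribbon d t

/-- The projection `ORGC_d ⟶ ORGC_d^{(g,m)}`. -/
noncomputable abbrev ORGC.proj (t : StableType) : ORGC K d ⟶ ORGCPart K d t.g t.m :=
  productProj K Flavour.quiver d t

end

/-!
The complexes of ribbon graphs and of ribbon quivers are compared through a double complex, in which an
edge has one of three states: it is directed in one of the two ways, or it is dead. The directed edges
must not form a closed path. A dead edge carries an additional degree of one, and with it the reversal of
a dead edge changes the sign in the way in which the ribbon graph complex for `d` prescribes it, if the
other signs are those of the complex for `d + 1`. All the complexes are finite-dimensional in each degree,
so it is convenient to work with functions on graphs instead of linear combinations of graphs. On the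
functions `f Γ s` of a graph `Γ` and a state `s`, there are two anticommuting differentials: `splitDiff`
sums over the splittings of the vertices by a new directed edge, and `killDiff` sums over the directed
edges that are made dead.

*The rows.* The graphs without dead edges form the ribbon quiver complex (`restrict_splitDiff`,
`exists_restrict_eq`). If there are dead edges, `splitDiff` is exact (`exists_splitDiff_eq`): a bivalent
vertex with an incoming new edge can be inserted next to a dead half-edge, and the removal of such
vertices is a contracting homotopy. Its average over all the dead half-edges, except those at univalent
vertices, is invariant under isomorphisms, and there are such half-edges since some vertex is at least
trivalent. So the total complex computes the cohomology of the ribbon quiver complex.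

*The columns.* For a fixed connected graph, `killDiff` computes the cohomology of a complex on the acyclic
partial orientations. It is one-dimensional and lives in the degree where the number of dead edges is the
first Betti number `b = 2 g + m - 1`. This follows by induction on the number of edges, by the deletion of
loops and the contraction of the other edges: the linear form `evaluate`, which is defined by this
recursion, detects the cohomology (`exists_kill_eq`). A generator is the cocycle `volume`, whose value is
the determinant of the vector `(1, …, 1)` and of the targets of the directed edges; it is closed because
in an acyclic state with too many directed edges these targets are contained in a proper set of vertices,
and its evaluation is not zero (`IsConnected.evaluate_volume_ne_zero`), being the determinant of `(1, …, 1)`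
and of the differences of the ends of the edges of a spanning tree. Since `volume` is multiplied, under isomorphisms, by the sign of
the permutations of the edges and the vertices and of the reversals (`volume_stateMap`), the cohomology of
the columns is the space of functions that belongs to the ribbon graph complex for `d`, and
`volume_split` shows that `theta`, the evaluation relative to `volume` with a factor depending on the
number of vertices, intertwines `splitDiff` with the differential of the ribbon graph complex
(`theta_splitDiff`).

The double complex is bounded in each degree (`exists_bound`), so these two facts identify the
cohomologies (`finrank_cycles_mod_boundaries`), for each pair `(g, m)`. The cohomology of the direct
product is the direct product of the cohomologies (`homology_pi_bijective`), which gives the compatible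
isomorphisms for the products.
-/

/-! ### Isomorphisms of ribbon graphs -/

namespace HalfEdge

variable {e : ℕ}

theorem relabel_apply (s : Equiv.Perm (Fin e)) (r : Fin e → Bool) (h : HalfEdge e) :
    relabel s r h = (s h.1, xor (r h.1) h.2) := rfl

@[simp] theorem relabel_flipEdge (s : Equiv.Perm (Fin e)) (r : Fin e → Bool) (h : HalfEdge e) :
    relabel s r (flipEdge e h) = flipEdge e (relabel s r h) := by
  obtain ⟨i, b⟩ := h
  simp [flipEdge, relabel_apply]

@[simp] theorem flipEdge_fst (h : HalfEdge e) : (flipEdge e h).1 = h.1 := rfl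

theorem old_injective : Function.Injective (old : HalfEdge e → HalfEdge (e + 1)) :=
  fun _ _ h => old_inj.1 h

end HalfEdge

namespace RibbonGraph

variable {e v m : ℕ} {F : Flavour}

namespace Iso

variable {Γ Γ' Γ'' : RibbonGraph e v m}

/-- The map of the half-edges. -/
def half (φ : Iso F Γ Γ') : Equiv.Perm (HalfEdge e) := relabel φ.edge φ.rev

@[simp] theorem half_fst (φ : Iso F Γ Γ') (h : HalfEdge e) : (φ.half h).1 = φ.edge h.1 := rfl

@[simp] theorem half_snd (φ : Iso F Γ Γ') (h : HalfEdge e) :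
    (φ.half h).2 = xor (φ.rev h.1) h.2 := rfl

theorem half_flip (φ : Iso F Γ Γ') (h : HalfEdge e) :
    φ.half (flipEdge e h) = flipEdge e (φ.half h) := relabel_flipEdge _ _ _

theorem rot_half (φ : Iso F Γ Γ') (h : HalfEdge e) : Γ'.rot (φ.half h) = φ.half (Γ.rot h) :=
  φ.map_rot h

theorem vert_half (φ : Iso F Γ Γ') (h : HalfEdge e) : Γ'.vert (φ.half h) = φ.vertex (Γ.vert h) :=
  φ.map_vert h

/-- The composite of two isomorphisms. -/
def trans (φ : Iso F Γ Γ') (ψ : Iso F Γ' Γ'') : Iso F Γ Γ'' where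
  edge := φ.edge.trans ψ.edge
  rev i := xor (φ.rev i) (ψ.rev (φ.edge i))
  vertex := φ.vertex.trans ψ.vertex
  rev_eq hF i := by simp [φ.rev_eq hF, ψ.rev_eq hF]
  map_rot h := by
    have : ∀ k : HalfEdge e, relabel (φ.edge.trans ψ.edge)
        (fun i => xor (φ.rev i) (ψ.rev (φ.edge i))) k =
        relabel ψ.edge ψ.rev (relabel φ.edge φ.rev k) := fun k => by
      simp only [relabel_apply, Equiv.trans_apply]
      rw [Bool.xor_left_comm, Bool.xor_assoc]
    rw [this, this, ψ.map_rot, φ.map_rot]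
  map_vert h := by
    have : ∀ k : HalfEdge e, relabel (φ.edge.trans ψ.edge)
        (fun i => xor (φ.rev i) (ψ.rev (φ.edge i))) k =
        relabel ψ.edge ψ.rev (relabel φ.edge φ.rev k) := fun k => by
      simp only [relabel_apply, Equiv.trans_apply]
      rw [Bool.xor_left_comm, Bool.xor_assoc]
    rw [this, ψ.map_vert, φ.map_vert]
    rfl
  map_bdry h := by
    have : ∀ k : HalfEdge e, relabel (φ.edge.trans ψ.edge)
        (fun i => xor (φ.rev i) (ψ.rev (φ.edge i))) k =
        relabel ψ.edge ψ.rev (relabel φ.edge φ.rev k) := fun k => by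
      simp only [relabel_apply, Equiv.trans_apply]
      rw [Bool.xor_left_comm, Bool.xor_assoc]
    rw [this, ψ.map_bdry, φ.map_bdry]

theorem trans_half (φ : Iso F Γ Γ') (ψ : Iso F Γ' Γ'') (h : HalfEdge e) :
    (φ.trans ψ).half h = ψ.half (φ.half h) := by
  simp only [half, relabel_apply, trans, Equiv.trans_apply]
  rw [Bool.xor_left_comm, Bool.xor_assoc]

theorem relabel_symm_apply (s : Equiv.Perm (Fin e)) (r : Fin e → Bool) (h : HalfEdge e) :
    relabel s.symm (fun j => r (s.symm j)) h = (relabel s r).symm h := rfl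

/-- The inverse of an isomorphism. -/
def symm (φ : Iso F Γ Γ') : Iso F Γ' Γ where
  edge := φ.edge.symm
  rev j := φ.rev (φ.edge.symm j)
  vertex := φ.vertex.symm
  rev_eq hF _ := φ.rev_eq hF _
  map_rot h := by
    rw [relabel_symm_apply, relabel_symm_apply, Equiv.eq_symm_apply, ← φ.map_rot,
      Equiv.apply_symm_apply]
  map_vert h := by
    rw [relabel_symm_apply, Equiv.eq_symm_apply, ← φ.map_vert, Equiv.apply_symm_apply]
  map_bdry h := by
    rw [relabel_symm_apply, ← φ.map_bdry, Equiv.apply_symm_apply]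

@[simp] theorem symm_half (φ : Iso F Γ Γ') : φ.symm.half = φ.half.symm :=
  Equiv.ext fun _ => rfl

variable (F Γ) in
/-- The identity of a graph. -/
def refl : Iso F Γ Γ where
  edge := Equiv.refl _
  rev _ := false
  vertex := Equiv.refl _
  rev_eq _ _ := rfl
  map_rot h := by simp [relabel_apply]
  map_vert h := by
    simp [relabel_apply]
  map_bdry h := by
    simp [relabel_apply]

/-- Every isomorphism of quivers is one of ribbon graphs. -/
def toRibbon (φ : Iso F Γ Γ') : Iso Flavour.ribbon Γ Γ' where
  __ := φ
  rev_eq hF := by cases hF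

@[simp] theorem toRibbon_sgn (φ : Iso F Γ Γ') (d : ℤ) : φ.toRibbon.sgn d = φ.sgn d := rfl

theorem ext_of {φ ψ : Iso F Γ Γ'} (h1 : φ.edge = ψ.edge) (h2 : φ.rev = ψ.rev)
    (h3 : φ.vertex = ψ.vertex) : φ = ψ := by
  cases φ
  cases ψ
  simp_all

theorem trans_sgn (φ : Iso F Γ Γ') (ψ : Iso F Γ' Γ'') (d : ℤ) :
    (φ.trans ψ).sgn d = φ.sgn d * ψ.sgn d := by
  have hu : ((-1 : ℤˣ) ^ d) * (-1) ^ d = 1 := by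
    rw [← mul_zpow]
    simp
  have h1 : (∏ i, if (φ.trans ψ).rev i then (-1 : ℤˣ) ^ d else 1) =
      (∏ i, if φ.rev i then (-1) ^ d else 1) * ∏ i, if ψ.rev i then (-1) ^ d else 1 := by
    rw [← Equiv.prod_comp φ.edge (fun i => if ψ.rev i then (-1 : ℤˣ) ^ d else 1),
      ← Finset.prod_mul_distrib]
    refine Finset.prod_congr rfl fun i _ => ?_
    simp only [trans]
    rcases Bool.eq_false_or_eq_true (φ.rev i) with h | h <;>
      rcases Bool.eq_false_or_eq_true (ψ.rev (φ.edge i)) with h' | h' <;> simp [h, h', hu]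
  have h2 : Equiv.Perm.sign (φ.trans ψ).edge = Equiv.Perm.sign φ.edge * Equiv.Perm.sign ψ.edge := by
    rw [trans, Equiv.Perm.sign_trans, mul_comm]
  have h3 : Equiv.Perm.sign (φ.trans ψ).vertex =
      Equiv.Perm.sign φ.vertex * Equiv.Perm.sign ψ.vertex := by
    rw [trans, Equiv.Perm.sign_trans, mul_comm]
  rw [sgn, h1, h2, h3, sgn, sgn, mul_zpow, mul_zpow]
  ac_rfl

theorem refl_sgn (d : ℤ) : (refl F Γ).sgn d = 1 := by
  simp [sgn, refl]

theorem trans_symm (φ : Iso F Γ Γ') : φ.trans φ.symm = refl F Γ :=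
  ext_of (by ext; simp [trans, symm, refl]) (by ext; simp [trans, symm, refl])
    (by ext; simp [trans, symm, refl])

theorem symm_trans (φ : Iso F Γ Γ') : φ.symm.trans φ = refl F Γ' :=
  ext_of (by ext; simp [trans, symm, refl]) (by ext; simp [trans, symm, refl])
    (by ext; simp [trans, symm, refl])

theorem symm_sgn (φ : Iso F Γ Γ') (d : ℤ) : φ.symm.sgn d = φ.sgn d := by
  have h := trans_sgn φ φ.symm d
  rw [trans_symm, refl_sgn] at h
  rw [← mul_right_inj (φ.sgn d), ← h, Int.units_mul_self]

theorem exists_vertex (s : Equiv.Perm (Fin e)) (r : Fin e → Bool)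
    (hrot : ∀ h, Γ'.rot (relabel s r h) = relabel s r (Γ.rot h)) :
    ∃ τ : Equiv.Perm (Fin v), ∀ h, Γ'.vert (relabel s r h) = τ (Γ.vert h) := by
  have hsc := fun h k => sameCycle_iff_of_map _ _ (relabel s r) hrot h k
  have key : ∀ h k, Γ'.vert (relabel s r h) = Γ'.vert (relabel s r k) ↔ Γ.vert h = Γ.vert k :=
    fun h k => by rw [Γ'.vert_eq_iff, Γ.vert_eq_iff, hsc]
  choose c hc using Γ.vert_surj
  have hinj : Function.Injective fun w => Γ'.vert (relabel s r (c w)) := fun w w' hw => by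
    rw [← hc w, ← hc w']
    exact (key _ _).1 hw
  refine ⟨Equiv.ofBijective _ (Finite.injective_iff_bijective.1 hinj), fun h => ?_⟩
  rw [Equiv.ofBijective_apply, key, hc]

theorem vertex_unique {φ ψ : Iso F Γ Γ'} (h1 : φ.edge = ψ.edge) (h2 : φ.rev = ψ.rev) : φ = ψ := by
  refine ext_of h1 h2 (Equiv.ext fun w => ?_)
  obtain ⟨h, rfl⟩ := Γ.vert_surj w
  rw [← φ.map_vert, ← ψ.map_vert, h1, h2]

end Iso

section transport

variable (Γ : RibbonGraph e v m) (s : Equiv.Perm (Fin e)) (r : Fin e → Bool)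
  (t : Equiv.Perm (Fin v))

/-- The graph that arises by renumbering the edges and the vertices and by reversing edges. -/
def transport : RibbonGraph e v m where
  rot := (relabel s r) * Γ.rot * (relabel s r)⁻¹
  vert h := t (Γ.vert ((relabel s r).symm h))
  bdry h := Γ.bdry ((relabel s r).symm h)
  vert_surj := t.surjective.comp (Γ.vert_surj.comp (relabel s r).symm.surjective)
  vert_eq_iff h h' := by
    rw [t.apply_eq_iff_eq, Γ.vert_eq_iff]
    have := sameCycle_iff_of_map Γ.rot ((relabel s r) * Γ.rot * (relabel s r)⁻¹) (relabel s r)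
      (by simp) ((relabel s r).symm h) ((relabel s r).symm h')
    rwa [Equiv.apply_symm_apply, Equiv.apply_symm_apply, iff_comm] at this
  bdry_surj := Γ.bdry_surj.comp (relabel s r).symm.surjective
  bdry_eq_iff h h' := by
    rw [Γ.bdry_eq_iff]
    have := sameCycle_iff_of_map (Γ.rot⁻¹ * flipEdge e)
      (((relabel s r) * Γ.rot * (relabel s r)⁻¹)⁻¹ * flipEdge e) (relabel s r) (fun k => by
        simp only [mul_inv_rev, inv_inv, Equiv.Perm.mul_apply, ← relabel_flipEdge]
        change (relabel s r) (Γ.rot⁻¹ ((relabel s r).symm ((relabel s r) _))) = _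
        rw [Equiv.symm_apply_apply]) ((relabel s r).symm h) ((relabel s r).symm h')
    rwa [Equiv.apply_symm_apply, Equiv.apply_symm_apply, iff_comm] at this

/-- The isomorphism to the renumbered graph. -/
def transportIso : Iso Flavour.ribbon Γ (Γ.transport s r t) where
  edge := s
  rev := r
  vertex := t
  rev_eq hF := by cases hF
  map_rot h := by simp [transport]
  map_vert h := by
    simp only [transport, Equiv.symm_apply_apply]
  map_bdry h := by
    simp only [transport, Equiv.symm_apply_apply]

end transport

section finite

instance : Finite (RibbonGraph e v m) :=
  Finite.of_injective (fun Γ => (Γ.rot, Γ.vert, Γ.bdry)) fun Γ Γ' h => by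
    simp only [Prod.mk.injEq] at h
    exact ext_of h.1 h.2.1 h.2.2

instance (Γ Γ' : RibbonGraph e v m) : Finite (Iso F Γ Γ') :=
  Finite.of_injective (fun φ => (φ.edge, φ.rev, φ.vertex)) fun φ ψ h => by
    simp only [Prod.mk.injEq] at h
    exact Iso.ext_of h.1 h.2.1 h.2.2

end finite

section invariance

variable {Γ Γ' : RibbonGraph e v m}

theorem IsConnected.of_iso (φ : Iso F Γ Γ') (h : Γ.IsConnected) : Γ'.IsConnected := by
  intro w w'
  rw [← φ.vertex.apply_symm_apply w, ← φ.vertex.apply_symm_apply w']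
  refine Relation.ReflTransGen.lift φ.vertex ?_ _ _ (h (φ.vertex.symm w) (φ.vertex.symm w'))
  rintro _ _ ⟨k, rfl, rfl⟩
  exact ⟨φ.half k, φ.vert_half k, by rw [← φ.half_flip, φ.vert_half]⟩

theorem valency_of_iso (φ : Iso F Γ Γ') (w : Fin v) : Γ'.valency (φ.vertex w) = Γ.valency w := by
  refine (Finset.card_bij (fun h _ => φ.half h) ?_ (fun _ _ _ _ h => φ.half.injective h) ?_).symm
  · intro h hh
    simpa [φ.vert_half] using hh
  · intro h hh
    refine ⟨φ.half.symm h, ?_, φ.half.apply_symm_apply h⟩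
    simp only [Finset.mem_filter, Finset.mem_univ, true_and] at hh ⊢
    rw [← φ.vertex.apply_eq_iff_eq, ← φ.vert_half, Equiv.apply_symm_apply, hh]

theorem trivalent_of_iso (φ : Iso F Γ Γ') (h : ∃ w, 3 ≤ Γ.valency w) : ∃ w, 3 ≤ Γ'.valency w :=
  h.imp' φ.vertex fun w hw => by rwa [valency_of_iso]

theorem trivalent_iff : (∃ w, 3 ≤ Γ.valency w) ↔ ∃ a b c, a ≠ b ∧ a ≠ c ∧ b ≠ c ∧
    Γ.vert a = Γ.vert b ∧ Γ.vert a = Γ.vert c := by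
  constructor
  · rintro ⟨w, hw⟩
    obtain ⟨a, ha, b, hb, c, hc, h⟩ := Finset.two_lt_card.1 hw
    simp only [Finset.mem_filter, Finset.mem_univ, true_and] at ha hb hc
    exact ⟨a, b, c, h.1, h.2.1, h.2.2, by rw [ha, hb], by rw [ha, hc]⟩
  · rintro ⟨a, b, c, h1, h2, h3, h4, h5⟩
    exact ⟨Γ.vert a, Finset.two_lt_card.2 ⟨a, by simp, b, by simp [h4], c, by simp [h5], h1, h2, h3⟩⟩

end invariance

section lifting

variable {Γ Γ' : RibbonGraph e v m}

/-- The extension of a permutation of the edges by the new edge. -/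
abbrev extendPerm {n : ℕ} (s : Equiv.Perm (Fin n)) : Equiv.Perm (Fin (n + 1)) :=
  Equiv.Perm.decomposeFin.symm (0, s)

theorem relabel_extend_tail (s : Equiv.Perm (Fin e)) (r : Fin e → Bool) :
    relabel (extendPerm s) (Fin.cons false r : Fin (e + 1) → Bool) newTail = newTail := by
  simp [relabel, newTail]

theorem relabel_extend_head (s : Equiv.Perm (Fin e)) (r : Fin e → Bool) :
    relabel (extendPerm s) (Fin.cons false r : Fin (e + 1) → Bool) newHead = newHead := by
  simp [relabel, newHead]

theorem relabel_extend_old (s : Equiv.Perm (Fin e)) (r : Fin e → Bool) (h : HalfEdge e) :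
    relabel (extendPerm s) (Fin.cons false r : Fin (e + 1) → Bool) (old h) =
      old (relabel s r h) := by
  simp [relabel, old]

theorem sgn_extend {Γ₁ Γ₁' : RibbonGraph (e + 1) (v + 1) m} (ψ : Iso F Γ₁ Γ₁') (φ : Iso F Γ Γ')
    (h1 : ψ.edge = extendPerm φ.edge) (h2 : ψ.rev = (Fin.cons false φ.rev : Fin (e + 1) → Bool))
    (h3 : ψ.vertex = extendPerm φ.vertex) (d : ℤ) : ψ.sgn d = φ.sgn d := by
  simp only [Iso.sgn, Fin.prod_univ_succ, h1, h2, h3, Equiv.Perm.decomposeFin.symm_sign]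
  simp

/-- An isomorphism extends to the graphs that arise by corresponding splittings. -/
theorem Iso.exists_extend (φ : Iso F Γ Γ') (p : Γ.CornerPair) :
    ∃ ψ : Iso F (Γ.split p) (Γ'.split (φ.mapPair p)), ψ.edge = extendPerm φ.edge ∧
      ψ.rev = (Fin.cons false φ.rev : Fin (e + 1) → Bool) ∧ ψ.vertex = extendPerm φ.vertex := by
  set s := extendPerm φ.edge with hs
  set t := extendPerm φ.vertex with ht
  set r : Fin (e + 1) → Bool := Fin.cons false φ.rev with hr
  have h0 : relabel s r newTail = newTail := relabel_extend_tail _ _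
  have h1 : relabel s r newHead = newHead := relabel_extend_head _ _
  have h2 : ∀ h, relabel s r (old h) = old (relabel φ.edge φ.rev h) := relabel_extend_old _ _
  have hp1 : (φ.mapPair p).1.1 = relabel φ.edge φ.rev p.1.1 := rfl
  have hp2 : (φ.mapPair p).1.2 = relabel φ.edge φ.rev p.1.2 := rfl
  have hrot : ∀ h, (Γ'.split (φ.mapPair p)).rot (relabel s r h) =
      relabel s r ((Γ.split p).rot h) := by
    refine HalfEdge.rec_on ?_ ?_ fun h => ?_
    · rw [h0]
      change old _ = relabel s r (old _)
      rw [h2, hp2, φ.map_rot]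
    · rw [h1]
      change old _ = relabel s r (old _)
      rw [h2, hp1, φ.map_rot]
    · rw [h2]
      change splitRot Γ'.rot (φ.mapPair p).1.1 (φ.mapPair p).1.2 (φ.mapPair p).2.1 _ =
        relabel s r (splitRot Γ.rot p.1.1 p.1.2 p.2.1 _)
      rw [splitRot_old, splitRot_old, hp1, hp2]
      simp only [EmbeddingLike.apply_eq_iff_eq]
      split_ifs
      · exact h0.symm
      · exact h1.symm
      · rw [h2, φ.map_rot]
  have hcor : ∀ h, corner (φ.mapPair p).1.1 (φ.mapPair p).1.2 (relabel s r h) =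
      relabel φ.edge φ.rev (corner p.1.1 p.1.2 h) := by
    refine HalfEdge.rec_on ?_ ?_ fun h => ?_
    · rw [h0]
      rfl
    · rw [h1]
      rfl
    · rw [h2]
      rfl
  refine ⟨⟨s, r, t, ?_, hrot, ?_, ?_⟩, rfl, rfl, rfl⟩
  · intro hF
    exact Fin.cases rfl (φ.rev_eq hF)
  · intro h
    have hsc := sameCycle_iff_of_map _ _ (relabel s r) hrot h newHead
    rw [h1] at hsc
    change Γ'.vertSplit _ _ = t (Γ.vertSplit _ _)
    by_cases hh : (Γ.split p).rot.SameCycle h newHead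
    · rw [(Γ.vertSplit_eq_zero p).2 hh, (Γ'.vertSplit_eq_zero _).2 (hsc.2 hh)]
      simp [ht]
    · rw [Γ.vertSplit_of p hh, Γ'.vertSplit_of _ (fun h3 => hh (hsc.1 h3)), hcor, φ.map_vert]
      simp [ht]
  · intro h
    change Γ'.bdry (corner _ _ _) = Γ.bdry (corner _ _ _)
    rw [hcor, φ.map_bdry]

/-- The exchange of two successive splittings, with its effect on the edges. -/
theorem exists_swapIso (Γ : RibbonGraph e v m) (p : Γ.CornerPair) (q : (Γ.split p).CornerPair) :
    ∃ ψ : Iso F (Γ.split₂ p q) (Γ.split₂ (Γ.swapFst p q) (Γ.swapSnd p q)),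
      ψ.edge = Equiv.swap 0 1 ∧ (ψ.rev = fun _ => false) ∧ ∀ d, ψ.sgn d = -1 := by
  have hrot : ∀ h, (Γ.split₂ (Γ.swapFst p q) (Γ.swapSnd p q)).rot (swapNew e h) =
    swapNew e ((Γ.split₂ p q).rot h) := Γ.rot_swap p q
  set G := Γ.split₂ p q with hG
  set G' := Γ.split₂ (Γ.swapFst p q) (Γ.swapSnd p q) with hG'
  have hsc : ∀ h k, G'.vert (swapNew e h) = G'.vert (swapNew e k) ↔ G.vert h = G.vert k := by
    intro h k
    rw [G.vert_eq_iff, G'.vert_eq_iff]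
    exact sameCycle_iff_of_map _ _ _ hrot h k
  have hrel : relabel (Equiv.swap 0 1) (fun _ => false) = swapNew e := by
    ext h <;> simp [relabel, swapNew]
  have hG0 : G.vert newHead = 0 := Γ.split₂_vert_head p q
  have hG'0 : G'.vert (swapNew e (old newHead)) = 0 := Γ.split₂_vert_head _ _
  have hbase : ∀ h, G.vert h ≠ 0 → G.vert h ≠ 1 → G.vert h = (Γ.base p q h).succ.succ := fun h =>
    Γ.split₂_vert_other p q
  have hbase' : ∀ h, G'.vert (swapNew e h) ≠ 0 → G'.vert (swapNew e h) ≠ 1 →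
      G'.vert (swapNew e h) = (Γ.base p q h).succ.succ := fun h h0 h1 => by
    rw [← Γ.base_swap p q h]
    exact Γ.split₂_vert_other _ _ h0 h1
  suffices ∃ τ : Equiv.Perm (Fin (v + 2)), Equiv.Perm.sign τ = -1 ∧
      ∀ h, G'.vert (swapNew e h) = τ (G.vert h) by
    obtain ⟨τ, hτ, hv⟩ := this
    refine ⟨⟨Equiv.swap 0 1, fun _ => false, τ, fun _ _ => rfl, ?_, ?_, ?_⟩, rfl, rfl, fun d => ?_⟩
    · rw [hrel]
      exact hrot
    · rw [hrel]
      exact hv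
    · rw [hrel]
      exact fun h => congrArg Γ.bdry (corner_corner_swap h)
    · simp only [Iso.sgn, hτ]
      rw [Equiv.Perm.sign_swap (by simp)]
      simp [← zpow_add]
  by_cases hcase : G.vert (old newHead) = 0
  · -- the two new edges have the same head
    have hT : G.vert newTail = 1 := Γ.split₂_vert_tail p q hcase
    have hO0 : G.vert (old newTail) ≠ 0 := Γ.split₂_vert_old_tail_ne p q hcase
    have hO1 : G.vert (old newTail) ≠ 1 := Γ.split₂_vert_old_tail p q hO0
    have hcase' : G'.vert (old newHead) = 0 :=
      ((hsc newHead (old newHead)).2 (hG0.trans hcase.symm)).trans hG'0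
    have hT' : G'.vert (swapNew e (old newTail)) = 1 := Γ.split₂_vert_tail _ _ hcase'
    have hj : G'.vert (swapNew e newTail) = G.vert (old newTail) := by
      have h0 : G'.vert (swapNew e newTail) ≠ 0 := by
        rw [← hG'0, Ne, hsc, hT, hcase]
        simp
      have h1 : G'.vert (swapNew e newTail) ≠ 1 := by
        rw [← hT', Ne, hsc, hT]
        exact hO1.symm
      rw [hbase' _ h0 h1, hbase _ hO0 hO1, Γ.base_tail_eq p q hcase]
    refine ⟨Equiv.swap 1 (G.vert (old newTail)), Equiv.Perm.sign_swap hO1.symm, fun h => ?_⟩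
    by_cases h0 : G.vert h = 0
    · rw [h0, Equiv.swap_apply_of_ne_of_ne (by simp) hO0.symm, ← hG'0, hsc, h0, hcase]
    · by_cases h1 : G.vert h = 1
      · rw [h1, Equiv.swap_apply_left, ← hj, hsc, h1, hT]
      · by_cases h2 : G.vert h = G.vert (old newTail)
        · rw [h2, Equiv.swap_apply_right, ← hT', hsc, h2]
        · rw [Equiv.swap_apply_of_ne_of_ne h1 h2, hbase h h0 h1]
          refine hbase' h ?_ ?_
          · rw [← hG'0, Ne, hsc, hcase]
            exact h0
          · rw [← hT', Ne, hsc]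
            exact h2
  · have hH : G.vert (old newHead) = 1 := Γ.split₂_vert_old_head p q hcase
    have hH' : G'.vert (swapNew e newHead) = 1 := by
      refine Γ.split₂_vert_old_head _ _ ?_
      change G'.vert (swapNew e newHead) ≠ 0
      rw [← hG'0, Ne, hsc, hG0]
      exact fun h => hcase h.symm
    refine ⟨Equiv.swap 0 1, Equiv.Perm.sign_swap (by simp), fun h => ?_⟩
    by_cases h0 : G.vert h = 0
    · rw [h0, Equiv.swap_apply_left, ← hH', hsc, h0, hG0]
    · by_cases h1 : G.vert h = 1
      · rw [h1, Equiv.swap_apply_right, ← hG'0, hsc, h1, hH]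
      · rw [Equiv.swap_apply_of_ne_of_ne h0 h1, hbase h h0 h1]
        refine hbase' h ?_ ?_
        · rw [← hG'0, Ne, hsc, hH]
          exact h1
        · rw [← hH', Ne, hsc, hG0]
          exact h0

end lifting

end RibbonGraph

/-! ### States of the edges -/

namespace HalfEdge

variable {n : ℕ} {M N : Type*} [AddCommGroup M] [AddCommGroup N]

/-- The product over the pairs `i < j` does not depend on the order of the index set. -/
theorem prod_lt_perm (σ : Equiv.Perm (Fin n)) (H : Fin n → Fin n → ℤˣ)
    (hH : ∀ i j, H i j = H j i) :
    (∏ i, ∏ j, if i < j then H i j else 1) =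
      ∏ i, ∏ j, if i < j then H (σ i) (σ j) else 1 := by
  rw [← Equiv.prod_comp σ]
  have h1 : ∀ i, (∏ j, if σ i < j then H (σ i) j else 1) =
      ∏ j, if σ i < σ j then H (σ i) (σ j) else 1 := fun i => (Equiv.prod_comp σ _).symm
  simp only [h1]
  have h2 : ∀ i j : Fin n, (if σ i < σ j then H (σ i) (σ j) else 1) =
      (if i < j then (if σ i < σ j then H (σ i) (σ j) else 1) else 1) *
      (if j < i then (if σ i < σ j then H (σ i) (σ j) else 1) else 1) := by
    intro i j
    rcases lt_trichotomy i j with h | h | h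
    · simp [h, h.not_gt]
    · simp [h]
    · simp [h, h.not_gt]
  rw [Finset.prod_congr rfl fun i _ => Finset.prod_congr rfl fun j _ => h2 i j]
  simp only [Finset.prod_mul_distrib]
  rw [Finset.prod_comm (f := fun i j => if j < i then (if σ i < σ j then H (σ i) (σ j) else 1) else 1),
    ← Finset.prod_mul_distrib]
  refine Finset.prod_congr rfl fun i _ => ?_
  rw [← Finset.prod_mul_distrib]
  refine Finset.prod_congr rfl fun j _ => ?_
  by_cases h : i < j
  · rcases lt_or_gt_of_ne (σ.injective.ne h.ne) with h' | h'
    · simp [h, h', h'.not_gt]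
    · simp [h, h', h'.not_gt, hH (σ j)]
  · simp [h]

/-- The action of a renumbering and of reversals of the edges on the states. The state of an edge
is `some false` if the edge is directed as its label says, `some true` if it is directed the other
way, and `none` if it is dead. -/
def stateMap (σ : Equiv.Perm (Fin n)) (r : Fin n → Bool) (s : Fin n → Option Bool) :
    Fin n → Option Bool :=
  fun j => (s (σ.symm j)).map (xor (r (σ.symm j)))

@[simp] theorem stateMap_apply (σ : Equiv.Perm (Fin n)) (r : Fin n → Bool)
    (s : Fin n → Option Bool) (i : Fin n) :
    stateMap σ r s (σ i) = (s i).map (xor (r i)) := by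
  simp [stateMap]

theorem stateMap_eq_none (σ : Equiv.Perm (Fin n)) (r : Fin n → Bool)
    (s : Fin n → Option Bool) (i : Fin n) : stateMap σ r s (σ i) = none ↔ s i = none := by
  simp

theorem stateMap_eq_some (σ : Equiv.Perm (Fin n)) (r : Fin n → Bool)
    (s : Fin n → Option Bool) (h : HalfEdge n) :
    stateMap σ r s (relabel σ r h).1 = some (relabel σ r h).2 ↔ s h.1 = some h.2 := by
  rw [relabel_apply, stateMap_apply]
  rcases s h.1 with _ | b
  · simp
  · simp

theorem stateMap_trans (σ τ : Equiv.Perm (Fin n)) (r q : Fin n → Bool) (s : Fin n → Option Bool) :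
    stateMap (σ.trans τ) (fun i => xor (r i) (q (σ i))) s =
      stateMap τ q (stateMap σ r s) := by
  funext j
  obtain ⟨i, rfl⟩ := (σ.trans τ).surjective j
  rw [stateMap_apply, Equiv.trans_apply, stateMap_apply, stateMap_apply, Option.map_map]
  congr 1
  funext b
  simp only [Function.comp]
  rw [Bool.xor_left_comm, Bool.xor_assoc]

theorem stateMap_refl (s : Fin n → Option Bool) :
    stateMap (Equiv.refl _) (fun _ => false) s = s := by
  funext j
  cases h : s j <;> simp [stateMap, h]

theorem stateMap_update (σ : Equiv.Perm (Fin n)) (r : Fin n → Bool) (s : Fin n → Option Bool)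
    (i : Fin n) : stateMap σ r (Function.update s i none) =
      Function.update (stateMap σ r s) (σ i) none := by
  funext j
  obtain ⟨j, rfl⟩ := σ.surjective j
  by_cases h : j = i
  · subst h
    simp
  · rw [stateMap_apply, Function.update_of_ne h, Function.update_of_ne (σ.injective.ne h),
      stateMap_apply]

theorem stateMap_extend (σ : Equiv.Perm (Fin n)) (r : Fin n → Bool) (s : Fin n → Option Bool)
    (o : Option Bool) :
    stateMap (extendPerm σ) (Fin.cons false r : Fin (n + 1) → Bool) (Fin.cons o s) =
      Fin.cons o (stateMap σ r s) := by
  funext j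
  obtain ⟨j, rfl⟩ := (extendPerm σ).surjective j
  rw [stateMap_apply]
  refine Fin.cases ?_ (fun i => ?_) j
  · cases o <;> simp
  · simp

/-- The number of dead edges. -/
def deadCount (s : Fin n → Option Bool) : ℕ := (Finset.univ.filter fun i => s i = none).card

theorem deadCount_stateMap (σ : Equiv.Perm (Fin n)) (r : Fin n → Bool) (s : Fin n → Option Bool) :
    deadCount (stateMap σ r s) = deadCount s := by
  refine (Finset.card_bij (fun i _ => σ i) ?_ (fun _ _ _ _ h => σ.injective h) ?_).symm
  · intro i hi
    simpa using hi
  · intro j hj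
    obtain ⟨i, rfl⟩ := σ.surjective j
    exact ⟨i, by simpa using hj, rfl⟩

theorem deadCount_cons_some (b : Bool) (s : Fin n → Option Bool) :
    deadCount (Fin.cons (some b) s : Fin (n + 1) → Option Bool) = deadCount s := by
  rw [deadCount, deadCount, Finset.card_filter, Finset.card_filter, Fin.sum_univ_succ]
  simp only [Fin.cons_zero, Fin.cons_succ, reduceCtorEq, if_false, zero_add]

theorem deadCount_cons_none (s : Fin n → Option Bool) :
    deadCount (Fin.cons none s : Fin (n + 1) → Option Bool) = deadCount s + 1 := by
  rw [deadCount, deadCount, Finset.card_filter, Finset.card_filter, Fin.sum_univ_succ]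
  simp only [Fin.cons_zero, Fin.cons_succ, if_true, add_comm]

theorem deadCount_update {s : Fin n → Option Bool} {i : Fin n} (h : s i ≠ none) :
    deadCount (Function.update s i none) = deadCount s + 1 := by
  classical
  have : (Finset.univ.filter fun j => Function.update s i none j = none) =
      insert i (Finset.univ.filter fun j => s j = none) := by
    ext j
    by_cases hj : j = i
    · subst hj
      simp
    · simp [hj]
  rw [deadCount, this, Finset.card_insert_of_notMem (by simpa using h), deadCount]

theorem deadCount_le (s : Fin n → Option Bool) : deadCount s ≤ n := by
  simpa [deadCount] using Finset.card_filter_le (Finset.univ : Finset (Fin n)) fun i => s i = none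

/-- The sign by which a renumbering and reversals act on the ordered set of dead edges, each of
which carries a direction up to sign. -/
def deadSign (σ : Equiv.Perm (Fin n)) (r : Fin n → Bool) (s : Fin n → Option Bool) : ℤˣ :=
  (∏ i, ∏ j, if i < j then (if s i = none ∧ s j = none ∧ (i < j ↔ σ j < σ i) then -1 else 1)
    else 1) * ∏ i, if s i = none ∧ r i = true then -1 else 1

theorem deadSign_trans (σ τ : Equiv.Perm (Fin n)) (r q : Fin n → Bool)
    (s : Fin n → Option Bool) :
    deadSign (σ.trans τ) (fun i => xor (r i) (q (σ i))) s =
      deadSign σ r s * deadSign τ q (stateMap σ r s) := by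
  have h1 := prod_lt_perm σ (fun i j => if stateMap σ r s i = none ∧ stateMap σ r s j = none ∧
    (i < j ↔ τ j < τ i) then -1 else 1) (fun i j => by
      by_cases hij : i = j
      · rw [hij]
      · have h3 : (i < j ↔ τ j < τ i) ↔ (j < i ↔ τ i < τ j) := by
          have := τ.injective.ne hij
          rcases lt_or_gt_of_ne hij with h | h <;> rcases lt_or_gt_of_ne this with h' | h' <;>
            simp [h, h', h.not_gt, h'.not_gt]
        simp only [h3, and_left_comm])
  unfold deadSign
  rw [h1, ← Equiv.prod_comp σ (fun i => if stateMap σ r s i = none ∧ q i = true then (-1 : ℤˣ) else 1)]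
  rw [mul_mul_mul_comm]
  refine congrArg₂ (· * ·) ?_ ?_
  · rw [← Finset.prod_mul_distrib]
    refine Finset.prod_congr rfl fun i _ => ?_
    rw [← Finset.prod_mul_distrib]
    refine Finset.prod_congr rfl fun j _ => ?_
    by_cases hij : i < j
    · simp only [hij, if_true, stateMap_eq_none, true_iff, Equiv.trans_apply]
      by_cases hi : s i = none <;> by_cases hj : s j = none <;> simp only [hi, hj, true_and,
        false_and, if_false, mul_one]
      have h3 := σ.injective.ne hij.ne
      have h4 := τ.injective.ne h3
      rcases lt_or_gt_of_ne h3 with h | h <;> rcases lt_or_gt_of_ne h4 with h' | h' <;>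
        simp [h, h', h.not_gt, h'.not_gt]
    · simp [hij]
  · rw [← Finset.prod_mul_distrib]
    refine Finset.prod_congr rfl fun i _ => ?_
    simp only [stateMap_eq_none]
    rcases Bool.eq_false_or_eq_true (r i) with h | h <;>
      rcases Bool.eq_false_or_eq_true (q (σ i)) with h' | h' <;>
      by_cases hi : s i = none <;> simp [hi, h, h']

theorem deadSign_of_fixed {σ : Equiv.Perm (Fin n)} {r : Fin n → Bool} {s : Fin n → Option Bool}
    (hσ : ∀ i, s i = none → σ i = i) (hr : ∀ i, s i = none → r i = false) :
    deadSign σ r s = 1 := by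
  unfold deadSign
  rw [Finset.prod_eq_one, Finset.prod_eq_one, one_mul]
  · intro i _
    by_cases h : s i = none
    · simp [hr i h]
    · simp [h]
  · intro i _
    refine Finset.prod_eq_one fun j _ => ?_
    by_cases hij : i < j
    · by_cases hi : s i = none
      · by_cases hj : s j = none
        · simp [hσ i hi, hσ j hj, hij, hij.not_gt]
        · simp [hj]
      · simp [hi]
    · simp [hij]

theorem deadSign_extend (σ : Equiv.Perm (Fin n)) (r : Fin n → Bool) (s : Fin n → Option Bool)
    (o : Option Bool) :
    deadSign (extendPerm σ) (Fin.cons false r : Fin (n + 1) → Bool) (Fin.cons o s) =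
      deadSign σ r s := by
  simp [deadSign, Fin.prod_univ_succ]

/-- The sign of a direction. -/
def dirSign (b : Bool) : ℤˣ := if b then -1 else 1

/-- The sign of the number of dead edges before the edge `i`. -/
def posSign (s : Fin n → Option Bool) (i : Fin n) : ℤˣ :=
  ∏ j, if j < i ∧ s j = none then -1 else 1

theorem deadSign_update (σ : Equiv.Perm (Fin n)) (r : Fin n → Bool) (s : Fin n → Option Bool)
    {i : Fin n} (hi : s i ≠ none) :
    deadSign σ r (Function.update s i none) = deadSign σ r s *
      (posSign s i * posSign (stateMap σ r s) (σ i) * dirSign (r i)) := by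
  have hupd : ∀ j, Function.update s i none j = none ↔ j = i ∨ s j = none := by
    intro j
    by_cases hj : j = i
    · subst hj
      simp
    · simp [hj]
  have h1 : posSign (stateMap σ r s) (σ i) = ∏ j, if σ j < σ i ∧ s j = none then -1 else 1 := by
    rw [posSign, ← Equiv.prod_comp σ]
    simp only [stateMap_eq_none]
  have h2 : ∀ a c, (if a < c then (if (a = i ∨ s a = none) ∧ (c = i ∨ s c = none) ∧
      (a < c ↔ σ c < σ a) then (-1 : ℤˣ) else 1) else 1) =
      (if a < c then (if s a = none ∧ s c = none ∧ (a < c ↔ σ c < σ a) then (-1 : ℤˣ) else 1)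
        else 1) *
      ((if a = i then (if i < c ∧ s c = none ∧ σ c < σ i then -1 else 1) else 1) *
      (if c = i then (if a < i ∧ s a = none ∧ σ i < σ a then -1 else 1) else 1)) := by
    intro a c
    by_cases ha : a = i
    · subst ha
      by_cases hc : c = a
      · subst hc
        simp
      · by_cases h : a < c <;> simp [hc, h, hi]
    · by_cases hc : c = i
      · subst hc
        by_cases h : a < c <;> simp [ha, h, hi]
      · simp [ha, hc]
  have h3 : ∀ j, (if (j = i ∨ s j = none) ∧ r j = true then (-1 : ℤˣ) else 1) =
      (if s j = none ∧ r j = true then (-1 : ℤˣ) else 1) *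
        (if j = i then dirSign (r i) else 1) := by
    intro j
    by_cases hj : j = i
    · subst hj
      simp [hi, dirSign]
    · simp [hj]
  unfold deadSign
  simp only [hupd, h2, h3, Finset.prod_mul_distrib, Finset.prod_ite_eq', Finset.mem_univ, if_true]
  have h4 : (∏ x, ∏ x_1, if x = i then (if i < x_1 ∧ s x_1 = none ∧ σ x_1 < σ i then (-1 : ℤˣ) else 1)
      else 1) = ∏ c, if i < c ∧ s c = none ∧ σ c < σ i then (-1 : ℤˣ) else 1 := by
    rw [Finset.prod_eq_single i]
    · simp
    · intro b _ hb
      simp [hb]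
    · simp
  have h5 : (∏ c, if i < c ∧ s c = none ∧ σ c < σ i then (-1 : ℤˣ) else 1) *
      (∏ a, if a < i ∧ s a = none ∧ σ i < σ a then (-1 : ℤˣ) else 1) =
      posSign s i * posSign (stateMap σ r s) (σ i) := by
    rw [h1, posSign, ← Finset.prod_mul_distrib, ← Finset.prod_mul_distrib]
    refine Finset.prod_congr rfl fun j _ => ?_
    by_cases hj : s j = none
    · have hij : i ≠ j := fun h => hi (h ▸ hj)
      have h6 := σ.injective.ne hij
      rcases lt_or_gt_of_ne hij with h | h <;> rcases lt_or_gt_of_ne h6 with h' | h' <;>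
        simp [hj, h, h', h.not_gt, h'.not_gt]
    · simp [hj]
  rw [h4, ← h5]
  ac_rfl

/-- The signed sum over all ways to kill a directed edge. The sign is that of the position of the edge
among the dead ones, and of its direction. -/
def kill (f : (Fin n → Option Bool) → M) (s : Fin n → Option Bool) : M :=
  ∑ i, (s i).elim 0 fun b => (dirSign b * posSign s i) • f (Function.update s i none)

theorem kill_cons_some (f : (Fin (n + 1) → Option Bool) → M) (b : Bool) (s : Fin n → Option Bool) :
    kill f (Fin.cons (some b) s) =
      dirSign b • f (Fin.cons none s) + kill (fun t => f (Fin.cons (some b) t)) s := by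
  have h0 : posSign (Fin.cons (some b) s : Fin (n + 1) → Option Bool) 0 = 1 := by simp [posSign]
  have h1 : ∀ i, posSign (Fin.cons (some b) s : Fin (n + 1) → Option Bool) i.succ = posSign s i :=
    fun i => by simp [posSign, Fin.prod_univ_succ]
  rw [kill, Fin.sum_univ_succ, kill]
  simp only [Fin.cons_zero, Option.elim_some, h0, mul_one, Fin.cons_succ, h1, Fin.update_cons_zero,
    ← Fin.cons_update]

theorem kill_cons_none (f : (Fin (n + 1) → Option Bool) → M) (s : Fin n → Option Bool) :
    kill f (Fin.cons none s) = -kill (fun t => f (Fin.cons none t)) s := by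
  have h1 : ∀ i, posSign (Fin.cons none s : Fin (n + 1) → Option Bool) i.succ = -posSign s i :=
    fun i => by simp [posSign, Fin.prod_univ_succ]
  rw [kill, Fin.sum_univ_succ, kill, ← Finset.sum_neg_distrib]
  simp only [Fin.cons_zero, Option.elim_none, zero_add, Fin.cons_succ, h1, ← Fin.cons_update]
  refine Finset.sum_congr rfl fun i _ => ?_
  cases s i <;> simp [Units.smul_def]

theorem kill_add (f g : (Fin n → Option Bool) → M) (s : Fin n → Option Bool) :
    kill (fun t => f t + g t) s = kill f s + kill g s := by
  rw [kill, kill, kill, ← Finset.sum_add_distrib]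
  refine Finset.sum_congr rfl fun i _ => ?_
  cases s i <;> simp

theorem kill_map {G : Type*} [FunLike G M N] [AddMonoidHomClass G M N] (l : G)
    (f : (Fin n → Option Bool) → M) (s : Fin n → Option Bool) :
    kill (fun t => l (f t)) s = l (kill f s) := by
  rw [kill, kill, map_sum]
  refine Finset.sum_congr rfl fun i _ => ?_
  cases s i <;> simp [Units.smul_def]

theorem kill_neg (f : (Fin n → Option Bool) → M) (s : Fin n → Option Bool) :
    kill (fun t => -f t) s = -kill f s := kill_map (-AddMonoidHom.id M) f s

theorem kill_sub (f g : (Fin n → Option Bool) → M) (s : Fin n → Option Bool) :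
    kill (fun t => f t - g t) s = kill f s - kill g s := by
  simp only [sub_eq_add_neg]
  rw [kill_add f fun t => -g t, kill_neg]

theorem kill_units (c : ℤˣ) (f : (Fin n → Option Bool) → M) (s : Fin n → Option Bool) :
    kill (fun t => c • f t) s = c • kill f s :=
  kill_map (DistribSMul.toAddMonoidHom M c) f s

theorem kill_smul {R : Type*} [Semiring R] [Module R M] (c : R)
    (f : (Fin n → Option Bool) → M) (s : Fin n → Option Bool) :
    kill (fun t => c • f t) s = c • kill f s :=
  kill_map (DistribSMul.toAddMonoidHom M c) f s

theorem kill_sum {ι : Type*} (S : Finset ι) (f : ι → (Fin n → Option Bool) → M)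
    (s : Fin n → Option Bool) : kill (fun t => ∑ x ∈ S, f x t) s = ∑ x ∈ S, kill (f x) s := by
  simp only [kill]
  rw [Finset.sum_comm]
  refine Finset.sum_congr rfl fun i _ => ?_
  cases s i <;> simp [Finset.smul_sum]

theorem kill_congr {f g : (Fin n → Option Bool) → M} {s : Fin n → Option Bool}
    (h : ∀ i, s i ≠ none → f (Function.update s i none) = g (Function.update s i none)) :
    kill f s = kill g s := by
  refine Finset.sum_congr rfl fun i _ => ?_
  rcases hi : s i with _ | b
  · rfl
  · simp [h i (by simp [hi])]

theorem kill_zero (s : Fin n → Option Bool) : kill (fun _ => (0 : M)) s = 0 := by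
  refine Finset.sum_eq_zero fun i _ => ?_
  cases s i <;> simp

theorem kill_kill : ∀ {n : ℕ} (f : (Fin n → Option Bool) → M) (s : Fin n → Option Bool),
    kill (kill f) s = 0
  | 0, f, s => by simp [kill]
  | n + 1, f, s => by
    have ih := @kill_kill n
    obtain ⟨o, s, rfl⟩ : ∃ o t, s = Fin.cons o t := ⟨_, _, (Fin.cons_self_tail s).symm⟩
    rcases o with _ | b
    · rw [kill_cons_none]
      simp only [kill_cons_none]
      rw [kill_neg, ih, neg_zero, neg_zero]
    · rw [kill_cons_some, kill_cons_none]
      simp only [kill_cons_some]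
      rw [kill_add, kill_units, ih, add_zero, smul_neg, neg_add_cancel]

/-- The differential `kill` is compatible with renumberings and reversals of the edges. -/
theorem kill_stateMap (σ : Equiv.Perm (Fin n)) (r : Fin n → Bool)
    (f : (Fin n → Option Bool) → M) (s : Fin n → Option Bool) :
    kill (fun t => deadSign σ r t • f (stateMap σ r t)) s =
      deadSign σ r s • kill f (stateMap σ r s) := by
  rw [kill, kill, Finset.smul_sum, ← Equiv.sum_comp σ fun i => deadSign σ r s • _]
  refine Finset.sum_congr rfl fun i _ => ?_
  rw [stateMap_apply]
  rcases hi : s i with _ | b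
  · simp
  · simp only [Option.elim_some, Option.map_some]
    rw [deadSign_update σ r s (by simp [hi]), stateMap_update, smul_smul, smul_smul]
    congr 1
    have h1 : dirSign (xor (r i) b) = dirSign (r i) * dirSign b := by
      cases r i <;> cases b <;> rfl
    have h2 : posSign s i * posSign s i = 1 := Int.units_mul_self _
    rw [h1]
    calc _ = (posSign s i * posSign s i) * (deadSign σ r s * (dirSign (r i) * dirSign b *
          posSign (stateMap σ r s) (σ i))) := by ac_rfl
      _ = _ := by rw [h2, one_mul]

end HalfEdge

/-! ### Acyclic states and contraction of edges -/

namespace HalfEdge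

section relation

theorem not_transGen_add_iff {V : Type*} (R : V → V → Prop) (a b : V) :
    (∀ w, ¬ Relation.TransGen (fun u w => R u w ∨ (u = a ∧ w = b)) w w) ↔
      (∀ w, ¬ Relation.TransGen R w w) ∧ ¬ Relation.ReflTransGen R b a := by
  constructor
  · intro h
    have hm : R ≤ fun u w => R u w ∨ (u = a ∧ w = b) := fun _ _ => Or.inl
    refine ⟨fun w hw => h w (Relation.TransGen.mono hm _ _ hw), fun hba => h a ?_⟩
    exact Relation.TransGen.head' (Or.inr ⟨rfl, rfl⟩) (Relation.ReflTransGen.mono hm _ _ hba)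
  · rintro ⟨h1, h2⟩ w hw
    have key : ∀ u w, Relation.TransGen (fun u w => R u w ∨ (u = a ∧ w = b)) u w →
        Relation.TransGen R u w ∨ (Relation.ReflTransGen R u a ∧ Relation.ReflTransGen R b w) := by
      intro u w huw
      induction huw with
      | single hb =>
        rcases hb with hb | ⟨rfl, rfl⟩
        · exact Or.inl (.single hb)
        · exact Or.inr ⟨.refl, .refl⟩
      | tail _ hb ih =>
        rcases hb with hb | ⟨rfl, rfl⟩
        · exact ih.imp (fun h => h.tail hb) fun h => ⟨h.1, h.2.tail hb⟩
        · rcases ih with ih | ih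
          · exact Or.inr ⟨ih.to_reflTransGen, .refl⟩
          · exact Or.inr ⟨ih.1, .refl⟩
    rcases key w w hw with h | h
    · exact h1 w h
    · exact h2 (h.2.trans h.1)

variable {V : Type*} [DecidableEq V]

/-- The identification of the point `b` with the point `a`. -/
def merge (a b : V) : V → V := Function.update id b a

theorem merge_right (a b : V) : merge a b b = a := by simp [merge]

theorem merge_left (a b : V) : merge a b a = a := by
  by_cases h : a = b <;> simp [merge, Function.update_apply]

theorem merge_of_ne (a : V) {b c : V} (h : c ≠ b) : merge a b c = c := by simp [merge, h]

theorem merge_eq_iff {a b u w : V} : merge a b u = merge a b w ↔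
    u = w ∨ (u = a ∨ u = b) ∧ (w = a ∨ w = b) := by
  unfold merge
  simp only [Function.update_apply, id]
  grind

theorem merge_map {V' : Type*} [DecidableEq V'] {i : V → V'} (hi : Function.Injective i)
    (a b w : V) : merge (i a) (i b) (i w) = i (merge a b w) := by
  simp only [merge, Function.update_apply, id, hi.eq_iff]
  split_ifs <;> rfl

theorem not_transGen_merge_iff (R : V → V → Prop) {a b : V} (hab : a ≠ b) :
    (∀ w, ¬ Relation.TransGen (fun U W => ∃ u w, R u w ∧ merge a b u = U ∧ merge a b w = W) w w) ↔
      (∀ w, ¬ Relation.TransGen R w w) ∧ ¬ Relation.ReflTransGen R b a ∧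
        ¬ Relation.ReflTransGen R a b := by
  set Q := fun U W => ∃ u w, R u w ∧ merge a b u = U ∧ merge a b w = W with hQ
  constructor
  · intro h
    have hm : ∀ u w, Relation.TransGen R u w → Relation.TransGen Q (merge a b u) (merge a b w) :=
      fun u w => Relation.TransGen.lift (merge a b) (fun u w huw => ⟨u, w, huw, rfl, rfl⟩) u w
    refine ⟨fun w hw => h _ (hm w w hw), fun hba => ?_, fun hba => ?_⟩
    · rcases Relation.reflTransGen_iff_eq_or_transGen.1 hba with h1 | h1
      · exact hab h1
      · have := hm _ _ h1
        rw [merge_right, merge_left] at this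
        exact h _ this
    · rcases Relation.reflTransGen_iff_eq_or_transGen.1 hba with h1 | h1
      · exact hab h1.symm
      · have := hm _ _ h1
        rw [merge_right, merge_left] at this
        exact h _ this
  · rintro ⟨h1, h2, h3⟩ W hW
    have h4 : ∀ c c', (c = a ∨ c = b) → (c' = a ∨ c' = b) → ¬ Relation.TransGen R c c' := by
      rintro c c' (rfl | rfl) (rfl | rfl) h
      · exact h1 _ h
      · exact h3 h.to_reflTransGen
      · exact h2 h.to_reflTransGen
      · exact h1 _ h
    have key : ∀ U W, Relation.TransGen Q U W →
        (∃ u w, merge a b u = U ∧ merge a b w = W ∧ Relation.TransGen R u w) ∨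
        (∃ u c c' w, merge a b u = U ∧ merge a b w = W ∧ (c = a ∨ c = b) ∧ (c' = a ∨ c' = b) ∧
          Relation.TransGen R u c ∧ Relation.TransGen R c' w) := by
      intro U W hUW
      induction hUW with
      | single hb =>
        obtain ⟨u, w, h, rfl, rfl⟩ := hb
        exact Or.inl ⟨u, w, rfl, rfl, .single h⟩
      | tail _ hb ih =>
        obtain ⟨x, y, hxy, hx, rfl⟩ := hb
        rcases ih with ⟨u, w, hu, hw, huw⟩ | ⟨u, c, c', w, hu, hw, hc, hc', huc, hcw⟩
        · rcases merge_eq_iff.1 (hw.trans hx.symm) with rfl | h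
          · exact Or.inl ⟨u, y, hu, rfl, huw.tail hxy⟩
          · exact Or.inr ⟨u, w, x, y, hu, rfl, h.1, h.2, huw, .single hxy⟩
        · rcases merge_eq_iff.1 (hw.trans hx.symm) with rfl | h
          · exact Or.inr ⟨u, c, c', y, hu, rfl, hc, hc', huc, hcw.tail hxy⟩
          · exact absurd hcw (h4 _ _ hc' h.1)
    rcases key W W hW with ⟨u, w, hu, hw, huw⟩ | ⟨u, c, c', w, hu, hw, hc, hc', huc, hcw⟩
    · rcases merge_eq_iff.1 (hu.trans hw.symm) with rfl | h
      · exact h1 _ huw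
      · exact h4 _ _ h.1 h.2 huw
    · rcases merge_eq_iff.1 (hu.trans hw.symm) with rfl | h
      · exact h4 _ _ hc' hc (hcw.trans huc)
      · exact h4 _ _ hc' h.2 hcw

end relation

section state

variable {V : Type*} {n : ℕ}

/-- The relation that the directed edges of a state span on the vertices, if the half-edges are
attached to the vertices by `a`. -/
def Step (a : HalfEdge n → V) (s : Fin n → Option Bool) (u w : V) : Prop :=
  ∃ h : HalfEdge n, s h.1 = some h.2 ∧ a h = u ∧ a (flipEdge n h) = w

/-- The directed edges of a state do not form a closed path. -/
def Acyclic (a : HalfEdge n → V) (s : Fin n → Option Bool) : Prop :=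
  ∀ w, ¬ Relation.TransGen (Step a s) w w

variable {a : HalfEdge (n + 1) → V} {s : Fin n → Option Bool}

theorem step_cons_none (u w : V) :
    Step a (Fin.cons none s : Fin (n + 1) → Option Bool) u w ↔ Step (a ∘ old) s u w := by
  constructor
  · rintro ⟨h, h1, h2, h3⟩
    rcases eq_new_or_old h with rfl | rfl | ⟨k, rfl⟩
    · simp [newTail] at h1
    · simp [newHead] at h1
    · exact ⟨k, h1, h2, h3⟩
  · rintro ⟨k, h1, h2, h3⟩
    exact ⟨old k, h1, h2, h3⟩

theorem step_cons_false (u w : V) :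
    Step a (Fin.cons (some false) s : Fin (n + 1) → Option Bool) u w ↔
      Step (a ∘ old) s u w ∨ (u = a newTail ∧ w = a newHead) := by
  constructor
  · rintro ⟨h, h1, h2, h3⟩
    rcases eq_new_or_old h with rfl | rfl | ⟨k, rfl⟩
    · exact Or.inr ⟨h2.symm, h3.symm⟩
    · simp [newHead] at h1
    · exact Or.inl ⟨k, h1, h2, h3⟩
  · rintro (⟨k, h1, h2, h3⟩ | ⟨rfl, rfl⟩)
    · exact ⟨old k, h1, h2, h3⟩
    · exact ⟨newTail, rfl, rfl, rfl⟩

theorem step_cons_true (u w : V) :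
    Step a (Fin.cons (some true) s : Fin (n + 1) → Option Bool) u w ↔
      Step (a ∘ old) s u w ∨ (u = a newHead ∧ w = a newTail) := by
  constructor
  · rintro ⟨h, h1, h2, h3⟩
    rcases eq_new_or_old h with rfl | rfl | ⟨k, rfl⟩
    · simp [newTail] at h1
    · exact Or.inr ⟨h2.symm, h3.symm⟩
    · exact Or.inl ⟨k, h1, h2, h3⟩
  · rintro (⟨k, h1, h2, h3⟩ | ⟨rfl, rfl⟩)
    · exact ⟨old k, h1, h2, h3⟩
    · exact ⟨newHead, rfl, rfl, rfl⟩

theorem acyclic_cons_none :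
    Acyclic a (Fin.cons none s : Fin (n + 1) → Option Bool) ↔ Acyclic (a ∘ old) s := by
  rw [Acyclic, Acyclic, show Step a (Fin.cons none s : Fin (n + 1) → Option Bool) =
    Step (a ∘ old) s from funext₂ fun u w => propext (step_cons_none u w)]

theorem acyclic_cons_false :
    Acyclic a (Fin.cons (some false) s : Fin (n + 1) → Option Bool) ↔
      Acyclic (a ∘ old) s ∧ ¬ Relation.ReflTransGen (Step (a ∘ old) s) (a newHead) (a newTail) := by
  classical
  rw [Acyclic, Acyclic, ← not_transGen_add_iff,
    show Step a (Fin.cons (some false) s : Fin (n + 1) → Option Bool) = _ from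
      funext₂ fun u w => propext (step_cons_false u w)]

theorem acyclic_cons_true :
    Acyclic a (Fin.cons (some true) s : Fin (n + 1) → Option Bool) ↔
      Acyclic (a ∘ old) s ∧ ¬ Relation.ReflTransGen (Step (a ∘ old) s) (a newTail) (a newHead) := by
  classical
  rw [Acyclic, Acyclic, ← not_transGen_add_iff,
    show Step a (Fin.cons (some true) s : Fin (n + 1) → Option Bool) = _ from
      funext₂ fun u w => propext (step_cons_true u w)]

theorem not_acyclic_of_loop (h : a newTail = a newHead) (b : Bool) :
    ¬ Acyclic a (Fin.cons (some b) s : Fin (n + 1) → Option Bool) := by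
  cases b
  · rw [acyclic_cons_false, h]
    exact fun h => h.2 .refl
  · rw [acyclic_cons_true, h]
    exact fun h => h.2 .refl

/-- If both directions of an edge led to a closed path, the paths would close up without the edge. -/
theorem acyclic_false_or_true (h : a newTail ≠ a newHead) (ha : Acyclic (a ∘ old) s) :
    Acyclic a (Fin.cons (some false) s : Fin (n + 1) → Option Bool) ∨
      Acyclic a (Fin.cons (some true) s : Fin (n + 1) → Option Bool) := by
  rw [acyclic_cons_false, acyclic_cons_true]
  by_contra hcon
  push Not at hcon
  have h1 := hcon.1 ha
  have h2 := hcon.2 ha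
  rcases Relation.reflTransGen_iff_eq_or_transGen.1 h1 with h3 | h3
  · exact h h3
  · exact ha _ (h3.trans_left h2)

theorem acyclic_merge_iff [DecidableEq V] (h : a newTail ≠ a newHead) :
    Acyclic (merge (a newTail) (a newHead) ∘ a ∘ old) s ↔
      Acyclic a (Fin.cons (some false) s : Fin (n + 1) → Option Bool) ∧
      Acyclic a (Fin.cons (some true) s : Fin (n + 1) → Option Bool) := by
  have h1 : Step (merge (a newTail) (a newHead) ∘ a ∘ old) s = fun U W => ∃ u w,
      Step (a ∘ old) s u w ∧ merge (a newTail) (a newHead) u = U ∧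
        merge (a newTail) (a newHead) w = W := by
    funext U W
    apply propext
    constructor
    · rintro ⟨k, h1, h2, h3⟩
      exact ⟨_, _, ⟨k, h1, rfl, rfl⟩, h2, h3⟩
    · rintro ⟨_, _, ⟨k, h1, rfl, rfl⟩, h2, h3⟩
      exact ⟨k, h1, h2, h3⟩
  rw [Acyclic, h1, not_transGen_merge_iff _ h, acyclic_cons_false, acyclic_cons_true, Acyclic]
  tauto

theorem Acyclic.update {a : HalfEdge n → V} (h : Acyclic a s) (i : Fin n) :
    Acyclic a (Function.update s i none) := fun w hw => h w (Relation.TransGen.mono (by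
      rintro u w ⟨k, h1, h2, h3⟩
      refine ⟨k, ?_, h2, h3⟩
      by_cases hk : k.1 = i
      · simp [hk] at h1
      · rwa [Function.update_of_ne hk] at h1) w w hw)

theorem Acyclic.of_merge [DecidableEq V] (h : a newTail ≠ a newHead)
    (ha : Acyclic (merge (a newTail) (a newHead) ∘ a ∘ old) s) (b : Bool) :
    Acyclic a (Fin.cons (some b) s : Fin (n + 1) → Option Bool) := by
  rw [acyclic_merge_iff h] at ha
  cases b
  · exact ha.1
  · exact ha.2

theorem Acyclic.of_cons {o : Option Bool}
    (ha : Acyclic a (Fin.cons o s : Fin (n + 1) → Option Bool)) : Acyclic (a ∘ old) s := by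
  have := ha.update 0
  rwa [Fin.update_cons_zero, acyclic_cons_none] at this

theorem acyclic_comp {V' : Type*} {i : V → V'} (hi : Function.Injective i) (a : HalfEdge n → V) :
    Acyclic (i ∘ a) s ↔ Acyclic a s := by
  constructor
  · intro h w hw
    refine h (i w) (Relation.TransGen.lift i ?_ _ _ hw)
    rintro _ _ ⟨k, h1, rfl, rfl⟩
    exact ⟨k, h1, rfl, rfl⟩
  · intro h w hw
    have key : ∀ u w, Relation.TransGen (Step (i ∘ a) s) u w →
        ∃ u' w', i u' = u ∧ i w' = w ∧ Relation.TransGen (Step a s) u' w' := by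
      intro u w huw
      induction huw with
      | single hb =>
        obtain ⟨k, h1, rfl, rfl⟩ := hb
        exact ⟨_, _, rfl, rfl, .single ⟨k, h1, rfl, rfl⟩⟩
      | tail _ hb ih =>
        obtain ⟨k, h1, h2, rfl⟩ := hb
        obtain ⟨u', w', h3, rfl, h4⟩ := ih
        exact ⟨u', _, h3, rfl, h4.tail ⟨k, h1, hi h2, rfl⟩⟩
    obtain ⟨u', w', h1, h2, h3⟩ := key w w hw
    rw [hi (h1.trans h2.symm)] at h3
    exact h _ h3

theorem acyclic_stateMap {a a' : HalfEdge n → V} (σ : Equiv.Perm (Fin n)) (r : Fin n → Bool)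
    (ha : ∀ h, a' (relabel σ r h) = a h) :
    Acyclic a' (stateMap σ r s) ↔ Acyclic a s := by
  have : Step a' (stateMap σ r s) = Step a s := by
    funext u w
    apply propext
    constructor
    · rintro ⟨k, h1, h2, h3⟩
      obtain ⟨k, rfl⟩ := (relabel σ r).surjective k
      rw [stateMap_eq_some] at h1
      rw [← relabel_flipEdge, ha] at h3
      exact ⟨k, h1, by rwa [ha] at h2, h3⟩
    · rintro ⟨k, h1, h2, h3⟩
      exact ⟨relabel σ r k, (stateMap_eq_some _ _ _ _).2 h1, by rwa [ha], by
        rwa [← relabel_flipEdge, ha]⟩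
  rw [Acyclic, this, Acyclic]

end state

section contract

variable {V : Type*} [DecidableEq V] {M N : Type*} [AddCommGroup M] [AddCommGroup N]

/-- The evaluation of a function of the states: the edges are treated one after the other; a loop
has to be dead, and over the two directions of any other edge the sum is taken, whereupon this edge is
contracted. -/
def evaluate : ∀ {n : ℕ}, (HalfEdge n → V) → ((Fin n → Option Bool) → M) → M
  | 0, _, f => f Fin.elim0
  | _ + 1, a, f =>
    if a newTail = a newHead then evaluate (a ∘ old) fun s => f (Fin.cons none s)
    else evaluate (merge (a newTail) (a newHead) ∘ a ∘ old)
      fun s => f (Fin.cons (some false) s) + f (Fin.cons (some true) s)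

variable {n : ℕ}

theorem evaluate_map {G : Type*} [FunLike G M N] [AddMonoidHomClass G M N] (l : G) :
    ∀ {n : ℕ} (a : HalfEdge n → V) (f : (Fin n → Option Bool) → M),
    evaluate a (fun s => l (f s)) = l (evaluate a f)
  | 0, _, f => rfl
  | n + 1, a, f => by
    rw [evaluate, evaluate]
    simp only [← map_add, evaluate_map]
    split_ifs <;> rfl

theorem evaluate_add : ∀ {n : ℕ} (a : HalfEdge n → V) (f g : (Fin n → Option Bool) → M),
    evaluate a (fun s => f s + g s) = evaluate a f + evaluate a g
  | 0, _, f, g => rfl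
  | n + 1, a, f, g => by
    rw [evaluate, evaluate, evaluate]
    simp only [add_add_add_comm (f _) (g _), evaluate_add]
    split_ifs <;> rfl

theorem evaluate_neg (a : HalfEdge n → V) (f : (Fin n → Option Bool) → M) :
    evaluate a (fun s => -f s) = -evaluate a f := evaluate_map (-AddMonoidHom.id M) a f

theorem evaluate_sub (a : HalfEdge n → V) (f g : (Fin n → Option Bool) → M) :
    evaluate a (fun s => f s - g s) = evaluate a f - evaluate a g := by
  simp only [sub_eq_add_neg]
  rw [evaluate_add a f fun t => -g t, evaluate_neg]

theorem evaluate_units (c : ℤˣ) (a : HalfEdge n → V) (f : (Fin n → Option Bool) → M) :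
    evaluate a (fun s => c • f s) = c • evaluate a f :=
  evaluate_map (DistribSMul.toAddMonoidHom M c) a f

theorem evaluate_smul {R : Type*} [Semiring R] [Module R M] (c : R) (a : HalfEdge n → V)
    (f : (Fin n → Option Bool) → M) : evaluate a (fun s => c • f s) = c • evaluate a f :=
  evaluate_map (DistribSMul.toAddMonoidHom M c) a f

theorem evaluate_zero (a : HalfEdge n → V) : evaluate a (fun _ => (0 : M)) = 0 :=
  evaluate_map (0 : M →+ M) a fun _ => 0

theorem evaluate_sum {ι : Type*} (S : Finset ι) (a : HalfEdge n → V)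
    (f : ι → (Fin n → Option Bool) → M) :
    evaluate a (fun s => ∑ x ∈ S, f x s) = ∑ x ∈ S, evaluate a (f x) := by
  classical
  induction S using Finset.induction_on with
  | empty => simpa using evaluate_zero a
  | insert x S hx ih =>
    simp only [Finset.sum_insert hx]
    rw [evaluate_add a (f x), ih]

theorem evaluate_comp {V' : Type*} [DecidableEq V'] {i : V → V'} (hi : Function.Injective i) :
    ∀ {n : ℕ} (a : HalfEdge n → V) (f : (Fin n → Option Bool) → M),
    evaluate (i ∘ a) f = evaluate a f
  | 0, _, _ => rfl
  | n + 1, a, f => by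
    have h : merge ((i ∘ a) newTail) ((i ∘ a) newHead) ∘ (i ∘ a) ∘ old =
        i ∘ merge (a newTail) (a newHead) ∘ a ∘ old := funext fun k => merge_map hi _ _ _
    rw [evaluate, evaluate, h, evaluate_comp hi]
    simp only [Function.comp_apply, hi.eq_iff]
    have := evaluate_comp hi (a ∘ old) (fun s => f (Fin.cons none s))
    rw [Function.comp_assoc, this]

/-- Only the acyclic states matter in the evaluation. -/
theorem evaluate_eq_zero : ∀ {n : ℕ} (a : HalfEdge n → V) (f : (Fin n → Option Bool) → M),
    (∀ s, Acyclic a s → f s = 0) → evaluate a f = 0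
  | 0, a, f, h => h _ (fun w hw => by
      obtain ⟨u, ⟨k, -⟩, -⟩ := Relation.TransGen.head'_iff.1 hw
      exact k.1.elim0)
  | n + 1, a, f, h => by
    rw [evaluate]
    split_ifs with h0
    · exact evaluate_eq_zero _ _ fun s hs => h _ (acyclic_cons_none.2 hs)
    · refine evaluate_eq_zero _ _ fun s hs => ?_
      rw [h _ (hs.of_merge h0 false), h _ (hs.of_merge h0 true), add_zero]

theorem evaluate_congr {a : HalfEdge n → V} {f g : (Fin n → Option Bool) → M}
    (h : ∀ s, Acyclic a s → f s = g s) : evaluate a f = evaluate a g := by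
  rw [← sub_eq_zero, ← evaluate_sub]
  exact evaluate_eq_zero _ _ fun s hs => sub_eq_zero.2 (h s hs)

theorem evaluate_kill : ∀ {n : ℕ} (a : HalfEdge n → V) (f : (Fin n → Option Bool) → M),
    evaluate a (kill f) = 0
  | 0, a, f => by simp [evaluate, kill]
  | n + 1, a, f => by
    rw [evaluate]
    simp only [kill_cons_none, kill_cons_some]
    split_ifs with h0
    · rw [evaluate_neg, evaluate_kill, neg_zero]
    · have : ∀ s, dirSign false • f (Fin.cons none s) + kill (fun t => f (Fin.cons (some false) t)) s +
          (dirSign true • f (Fin.cons none s) + kill (fun t => f (Fin.cons (some true) t)) s) =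
          kill (fun t => f (Fin.cons (some false) t) + f (Fin.cons (some true) t)) s := by
        intro s
        rw [kill_add]
        simp only [dirSign, Units.smul_def, Bool.false_eq_true, if_false, if_true, Units.val_one,
          one_smul, Units.val_neg, neg_smul]
        abel
      simp only [this]
      exact evaluate_kill _ _

/-- A function that is closed on the acyclic states is exact there as soon as its evaluation is
zero. The proof is an induction on the number of edges. If the first edge is not a loop, the acyclic
states of the other edges remain acyclic with at least one of its two directions, and they do so with both
of them if and only if they are acyclic after its contraction. -/
theorem exists_kill_eq : ∀ {n : ℕ} (a : HalfEdge n → V) (f : (Fin n → Option Bool) → M),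
    (∀ s, Acyclic a s → kill f s = 0) → evaluate a f = 0 →
      ∃ g : (Fin n → Option Bool) → M, ∀ s, Acyclic a s → kill g s = f s
  | 0, a, f, _, h => ⟨0, fun s _ => by
      rw [Subsingleton.elim s Fin.elim0]
      simpa [kill, evaluate] using h.symm⟩
  | n + 1, a, f, hf, he => by
    rw [evaluate] at he
    split_ifs at he with h0
    · obtain ⟨g, hg⟩ := exists_kill_eq (a ∘ old) (fun s => f (Fin.cons none s)) (fun s hs => by
        have := hf _ (acyclic_cons_none.2 hs)
        rwa [kill_cons_none, neg_eq_zero] at this) he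
      refine ⟨fun s => -g (Fin.tail s), fun s hs => ?_⟩
      obtain ⟨o, s, rfl⟩ : ∃ o t, s = Fin.cons o t := ⟨_, _, (Fin.cons_self_tail s).symm⟩
      rcases o with _ | b
      · rw [kill_cons_none]
        simp only [Fin.tail_cons]
        rw [kill_neg, neg_neg, hg s (acyclic_cons_none.1 hs)]
      · exact absurd hs (not_acyclic_of_loop h0 b)
    · have hx : ∀ s, Acyclic a (Fin.cons (some false) s : Fin (n + 1) → Option Bool) →
          kill (fun t => f (Fin.cons (some false) t)) s = -f (Fin.cons none s) := fun s hs => by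
        have := hf _ hs
        rw [kill_cons_some] at this
        simpa [dirSign, eq_neg_iff_add_eq_zero, add_comm] using this
      have hy : ∀ s, Acyclic a (Fin.cons (some true) s : Fin (n + 1) → Option Bool) →
          kill (fun t => f (Fin.cons (some true) t)) s = f (Fin.cons none s) := fun s hs => by
        have := hf _ hs
        rw [kill_cons_some] at this
        simp only [dirSign, if_true, Units.smul_def, Units.val_neg, Units.val_one, neg_smul,
          one_smul] at this
        exact (neg_add_eq_zero.1 this).symm
      have hupd : ∀ (b : Bool) (s : Fin n → Option Bool) (i : Fin n),
          Acyclic a (Fin.cons (some b) s : Fin (n + 1) → Option Bool) →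
          Acyclic a (Fin.cons (some b) (Function.update s i none) : Fin (n + 1) → Option Bool) :=
        fun b s i hs => by
          rw [Fin.cons_update]
          exact hs.update _
      obtain ⟨u, hu⟩ := exists_kill_eq _ _ (fun s hs => by
        rw [kill_add, hx s (hs.of_merge h0 false), hy s (hs.of_merge h0 true), neg_add_cancel]) he
      -- where both directions are possible, the two formulas agree by the choice of `u`
      classical
      set gZ : (Fin n → Option Bool) → M := fun s =>
        if Acyclic a (Fin.cons (some false) s : Fin (n + 1) → Option Bool) then
          f (Fin.cons (some false) s) - kill u s else -f (Fin.cons (some true) s) with hgZ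
      have hgx : ∀ s, Acyclic a (Fin.cons (some false) s : Fin (n + 1) → Option Bool) →
          gZ s = f (Fin.cons (some false) s) - kill u s := fun s hs => if_pos hs
      have hgy : ∀ s, Acyclic a (Fin.cons (some true) s : Fin (n + 1) → Option Bool) →
          gZ s = -f (Fin.cons (some true) s) := fun s hs => by
        by_cases h1 : Acyclic a (Fin.cons (some false) s : Fin (n + 1) → Option Bool)
        · rw [hgx s h1, hu s ((acyclic_merge_iff h0).2 ⟨h1, hs⟩)]
          abel
        · exact if_neg h1
      refine ⟨fun s => (s 0).elim (gZ (Fin.tail s)) fun b => cond b 0 (u (Fin.tail s)),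
        fun s hs => ?_⟩
      obtain ⟨o, s, rfl⟩ : ∃ o t, s = Fin.cons o t := ⟨_, _, (Fin.cons_self_tail s).symm⟩
      rcases o with _ | _ | _
      · rw [kill_cons_none]
        simp only [Fin.cons_zero, Option.elim_none, Fin.tail_cons]
        rcases acyclic_false_or_true h0 (acyclic_cons_none.1 hs) with h1 | h1
        · rw [kill_congr (g := fun t => f (Fin.cons (some false) t) - kill u t)
            fun i _ => hgx _ (hupd _ _ i h1), kill_sub, kill_kill, sub_zero, hx s h1,
            neg_neg]
        · rw [kill_congr (g := fun t => -f (Fin.cons (some true) t))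
            fun i _ => hgy _ (hupd _ _ i h1), kill_neg, neg_neg, hy s h1]
      · rw [kill_cons_some]
        simp only [Fin.cons_zero, Option.elim_none, Option.elim_some, Fin.tail_cons, cond_false]
        rw [hgx s hs]
        simp [dirSign]
      · rw [kill_cons_some]
        simp only [Fin.cons_zero, Option.elim_none, Option.elim_some, Fin.tail_cons, cond_true]
        rw [hgy s hs, kill_zero]
        simp [dirSign, Units.smul_def]

/-- The number of loops that are met when the edges are contracted one after the other. -/
def loopCount : ∀ {n : ℕ}, (HalfEdge n → V) → ℕ
  | 0, _ => 0
  | _ + 1, a =>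
    if a newTail = a newHead then loopCount (a ∘ old) + 1
    else loopCount (merge (a newTail) (a newHead) ∘ a ∘ old)

theorem evaluate_eq_zero_of_count : ∀ {n : ℕ} (a : HalfEdge n → V)
    (f : (Fin n → Option Bool) → M), (∀ s, deadCount s = loopCount a → f s = 0) → evaluate a f = 0
  | 0, a, f, h => h _ (by simp [deadCount, loopCount])
  | n + 1, a, f, h => by
    rw [evaluate]
    rw [loopCount] at h
    split_ifs with h0
    · simp only [if_pos h0] at h
      exact evaluate_eq_zero_of_count _ _ fun s hs => h _ (by rw [deadCount_cons_none, hs])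
    · simp only [if_neg h0] at h
      refine evaluate_eq_zero_of_count _ _ fun s hs => ?_
      rw [h _ (by rw [deadCount_cons_some, hs]), h _ (by rw [deadCount_cons_some, hs]), add_zero]

/-- The contraction of a spanning forest: the number of the edges that are contracted is the number by
which the set of vertices shrinks. -/
theorem exists_collapse : ∀ {n : ℕ} (a : HalfEdge n → V) (S : Finset V), (∀ h, a h ∈ S) →
    ∃ q : V → V, (∀ h, q (a h) = q (a (flipEdge n h))) ∧
      (S.image q).card + n = S.card + loopCount a
  | 0, a, S, _ => ⟨id, fun h => h.1.elim0, by simp [loopCount]⟩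
  | n + 1, a, S, hS => by
    rw [loopCount]
    split_ifs with h0
    · obtain ⟨q, h1, h2⟩ := exists_collapse (a ∘ old) S fun h => hS _
      refine ⟨q, HalfEdge.rec_on (congrArg q h0) (congrArg q h0.symm) h1, by omega⟩
    · have hm : ∀ w ∈ S, merge (a newTail) (a newHead) w ∈ S.erase (a newHead) := by
        intro w hw
        by_cases h : w = a newHead
        · rw [h, merge_right]
          exact Finset.mem_erase.2 ⟨h0, hS _⟩
        · rw [merge_of_ne _ h]
          exact Finset.mem_erase.2 ⟨h, hw⟩
      obtain ⟨q, h1, h2⟩ := exists_collapse (merge (a newTail) (a newHead) ∘ a ∘ old)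
        (S.erase (a newHead)) fun h => hm _ (hS _)
      have h3 : q (merge (a newTail) (a newHead) (a newTail)) =
          q (merge (a newTail) (a newHead) (a newHead)) := by rw [merge_left, merge_right]
      refine ⟨q ∘ merge (a newTail) (a newHead), HalfEdge.rec_on h3 h3.symm h1, ?_⟩
      have h4 : S.image (q ∘ merge (a newTail) (a newHead)) = (S.erase (a newHead)).image q := by
        ext w
        simp only [Finset.mem_image, Function.comp_apply]
        constructor
        · rintro ⟨x, hx, rfl⟩
          exact ⟨_, hm x hx, rfl⟩
        · rintro ⟨x, hx, rfl⟩
          exact ⟨x, Finset.mem_of_mem_erase hx, by rw [merge_of_ne _ (Finset.ne_of_mem_erase hx)]⟩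
      have h5 := Finset.card_erase_add_one (hS newHead)
      rw [h4]
      omega

end contract

end HalfEdge

namespace RibbonGraph

variable {e v m : ℕ} {Γ : RibbonGraph e v m}

theorem IsConnected.loopCount (hc : Γ.IsConnected) (hv : 0 < v) :
    loopCount Γ.vert + v = e + 1 := by
  obtain ⟨q, h1, h2⟩ := exists_collapse Γ.vert Finset.univ fun _ => Finset.mem_univ _
  have h3 : ∀ w w', q w = q w' := fun w w' => by
    have := hc w w'
    induction this with
    | refl => rfl
    | tail _ hb ih =>
      obtain ⟨h, rfl, rfl⟩ := hb
      rw [ih, h1]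
  have h4 : Finset.univ.image q = {q ⟨0, hv⟩} := by
    ext w
    simp only [Finset.mem_image, Finset.mem_univ, true_and, Finset.mem_singleton]
    constructor
    · rintro ⟨x, rfl⟩
      exact h3 _ _
    · rintro rfl
      exact ⟨_, rfl⟩
  rw [h4, Finset.card_singleton, Finset.card_univ, Fintype.card_fin] at h2
  omega

end RibbonGraph

/-! ### The volume cocycle of a graph -/

namespace HalfEdge

open ExteriorAlgebra

section form

variable {K N : Type*} [Field K] [AddCommGroup N] [Module K N]

variable (K N) in
/-- The parity involution of the exterior algebra. -/
noncomputable abbrev parity : ExteriorAlgebra K N →ₐ[K] ExteriorAlgebra K N :=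
  CliffordAlgebra.involute

theorem parity_ι (x : N) : parity K N (ι K x) = -ι K x := CliffordAlgebra.involute_ι x

/-- The contraction of the exterior algebra with a linear form. -/
noncomputable abbrev contraction (φ : Module.Dual K N) :
    ExteriorAlgebra K N →ₗ[K] ExteriorAlgebra K N :=
  CliffordAlgebra.contractLeft φ

theorem contraction_ι_mul (φ : Module.Dual K N) (x : N) (y : ExteriorAlgebra K N) :
    contraction φ (ι K x * y) = φ x • y - ι K x * contraction φ y :=
  CliffordAlgebra.contractLeft_ι_mul φ x y

theorem contraction_parity (φ : Module.Dual K N) (y : ExteriorAlgebra K N) :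
    contraction φ (parity K N y) = -parity K N (contraction φ y) := by
  induction y using CliffordAlgebra.left_induction with
  | algebraMap r =>
    have h1 : parity K N (algebraMap K _ r) = algebraMap K _ r := AlgHom.commutes _ _
    have h2 : contraction φ (algebraMap K (ExteriorAlgebra K N) r) = 0 :=
      CliffordAlgebra.contractLeft_algebraMap _ φ r
    rw [h1, h2, map_zero, neg_zero]
  | add x y hx hy => rw [map_add, map_add, hx, hy, map_add, map_add, neg_add]
  | ι_mul y x hy =>
    change contraction φ (parity K N (ι K x * y)) = -parity K N (contraction φ (ι K x * y))
    rw [map_mul, parity_ι, neg_mul, map_neg, contraction_ι_mul, contraction_ι_mul, hy, map_sub,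
      map_smul, map_mul, parity_ι]
    simp

theorem units_smul_parity (c : ℤˣ) (y : ExteriorAlgebra K N) :
    parity K N (c • y) = c • parity K N y := by
  rw [Units.smul_def, map_zsmul, ← Units.smul_def]

theorem ι_mul_parity (x : N) (y : ExteriorAlgebra K N) :
    ι K x * parity K N y = -parity K N (ι K x * y) := by
  rw [map_mul, parity_ι, neg_mul, neg_neg]

theorem ι_mul_ι_mul (x y : N) (z : ExteriorAlgebra K N) :
    ι K x * (ι K y * z) = -(ι K y * (ι K x * z)) := by
  rw [eq_neg_iff_add_eq_zero, ← mul_assoc, ← mul_assoc, ← add_mul, ι_add_mul_swap, zero_mul]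

variable {n : ℕ}

/-- The product of the targets of the directed edges, in their order. An edge directed against its
label counts with a minus sign, and so does a dead edge which precedes a directed one. -/
noncomputable def edgeForm : ∀ {n : ℕ}, (HalfEdge n → N) → (Fin n → Option Bool) →
    ExteriorAlgebra K N
  | 0, _, _ => 1
  | _ + 1, a, s => (s 0).elim (parity K N (edgeForm (a ∘ old) (Fin.tail s))) fun b =>
      cond b (-(ι K (a newTail) * edgeForm (a ∘ old) (Fin.tail s)))
        (ι K (a newHead) * edgeForm (a ∘ old) (Fin.tail s))

theorem edgeForm_none (a : HalfEdge (n + 1) → N) (s : Fin n → Option Bool) :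
    edgeForm (K := K) a (Fin.cons none s) = parity K N (edgeForm (a ∘ old) s) := rfl

theorem edgeForm_false (a : HalfEdge (n + 1) → N) (s : Fin n → Option Bool) :
    edgeForm (K := K) a (Fin.cons (some false) s) = ι K (a newHead) * edgeForm (a ∘ old) s := rfl

theorem edgeForm_true (a : HalfEdge (n + 1) → N) (s : Fin n → Option Bool) :
    edgeForm (K := K) a (Fin.cons (some true) s) =
      -(ι K (a newTail) * edgeForm (a ∘ old) s) := rfl

theorem map_parity {N' : Type*} [AddCommGroup N'] [Module K N'] (g : N →ₗ[K] N')
    (y : ExteriorAlgebra K N) :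
    ExteriorAlgebra.map g (parity K N y) = parity K N' (ExteriorAlgebra.map g y) := by
  have : (ExteriorAlgebra.map g).comp (parity K N) =
      (parity K N').comp (ExteriorAlgebra.map g) := by
    refine ExteriorAlgebra.hom_ext (LinearMap.ext fun x => ?_)
    change ExteriorAlgebra.map g (parity K N (ι K x)) = parity K N' (ExteriorAlgebra.map g (ι K x))
    rw [parity_ι, map_neg, map_apply_ι, parity_ι]
  exact DFunLike.congr_fun this y

theorem map_edgeForm {N' : Type*} [AddCommGroup N'] [Module K N'] (g : N →ₗ[K] N') :
    ∀ {n : ℕ} (a : HalfEdge n → N) (s : Fin n → Option Bool),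
    edgeForm (K := K) (g ∘ a) s = ExteriorAlgebra.map g (edgeForm a s)
  | 0, a, s => (map_one _).symm
  | n + 1, a, s => by
    obtain ⟨o, s, rfl⟩ : ∃ o t, s = Fin.cons o t := ⟨_, _, (Fin.cons_self_tail s).symm⟩
    have ih := map_edgeForm g (a ∘ old) s
    rcases o with _ | _ | _
    · rw [edgeForm_none, edgeForm_none, Function.comp_assoc, ih, map_parity]
    · rw [edgeForm_false, edgeForm_false, Function.comp_assoc, ih, map_mul, map_apply_ι]
      rfl
    · rw [edgeForm_true, edgeForm_true, Function.comp_assoc, ih, map_neg, map_mul, map_apply_ι]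
      rfl

theorem kill_ι_mul {n : ℕ} (x : N) (f : (Fin n → Option Bool) → ExteriorAlgebra K N)
    (s : Fin n → Option Bool) : kill (fun t => ι K x * f t) s = ι K x * kill f s :=
  kill_map (LinearMap.mulLeft K (ι K x)) f s

theorem kill_edgeForm (φ : Module.Dual K N) : ∀ {n : ℕ} (a : HalfEdge n → N)
    (_ : ∀ h, φ (a h) = 1) (s : Fin n → Option Bool),
    kill (edgeForm a) s = parity K N (contraction φ (edgeForm a s))
  | 0, a, _, s => by
    have : contraction φ (1 : ExteriorAlgebra K N) = 0 := CliffordAlgebra.contractLeft_one _ φ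
    simp [kill, edgeForm, this]
  | n + 1, a, ha, s => by
    obtain ⟨o, s, rfl⟩ : ∃ o t, s = Fin.cons o t := ⟨_, _, (Fin.cons_self_tail s).symm⟩
    have ih := kill_edgeForm φ (a ∘ old) (fun h => ha _) s
    rcases o with _ | _ | _
    · rw [kill_cons_none, edgeForm_none]
      simp only [edgeForm_none]
      rw [kill_map, ih, contraction_parity, map_neg]
    · rw [kill_cons_some, edgeForm_false, edgeForm_none]
      simp only [edgeForm_false]
      rw [kill_ι_mul, ih,
        contraction_ι_mul, ha, map_sub, one_smul, map_mul (parity K N), parity_ι]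
      simp [dirSign]
    · rw [kill_cons_some, edgeForm_true, edgeForm_none]
      simp only [edgeForm_true]
      rw [kill_neg, kill_ι_mul, ih,
        map_neg, contraction_ι_mul, ha, map_neg, map_sub, one_smul, map_mul (parity K N), parity_ι]
      simp [dirSign, Units.smul_def]
      abel

end form

section equivariance

variable {K N : Type*} [Field K] [AddCommGroup N] [Module K N] {n : ℕ}

/-- The sign of the number of reversed edges. -/
def revSign (r : Fin n → Bool) : ℤˣ := ∏ i, if r i then -1 else 1

theorem revSign_xor (σ : Equiv.Perm (Fin n)) (r q : Fin n → Bool) :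
    revSign (fun i => xor (r i) (q (σ i))) = revSign r * revSign q := by
  rw [revSign, revSign, revSign, ← Equiv.prod_comp σ fun i => if q i then (-1 : ℤˣ) else 1,
    ← Finset.prod_mul_distrib]
  refine Finset.prod_congr rfl fun i _ => ?_
  rcases Bool.eq_false_or_eq_true (r i) with h | h <;>
    rcases Bool.eq_false_or_eq_true (q (σ i)) with h' | h' <;> simp [h, h']

variable (K N) in
/-- The transformation rule of `edgeForm` under the renumbering `σ` and the reversals `r`. -/
def FormCompatible (σ : Equiv.Perm (Fin n)) (r : Fin n → Bool) : Prop :=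
  ∀ (a : HalfEdge n → N) (s : Fin n → Option Bool),
    deadSign σ r s • edgeForm (K := K) a (stateMap σ r s) =
      (Equiv.Perm.sign σ * revSign r) • edgeForm (a ∘ relabel σ r) s

theorem FormCompatible.trans {σ τ : Equiv.Perm (Fin n)} {r q : Fin n → Bool}
    (h1 : FormCompatible K N σ r) (h2 : FormCompatible K N τ q) :
    FormCompatible K N (σ.trans τ) (fun i => xor (r i) (q (σ i))) := by
  intro a s
  have h3 : a ∘ relabel (σ.trans τ) (fun i => xor (r i) (q (σ i))) =
      (a ∘ relabel τ q) ∘ relabel σ r := by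
    funext h
    simp only [Function.comp_apply, relabel_apply, Equiv.trans_apply]
    rw [Bool.xor_left_comm, Bool.xor_assoc]
  rw [deadSign_trans, stateMap_trans, mul_smul, h2, smul_comm, h1, h3, revSign_xor, smul_smul,
    Equiv.Perm.sign_trans]
  congr 1
  ac_rfl

theorem deadSign_refl (r : Fin n → Bool) (s : Fin n → Option Bool) :
    deadSign (Equiv.refl _) r s = ∏ i, if s i = none ∧ r i = true then -1 else 1 := by
  rw [deadSign, Finset.prod_eq_one, one_mul]
  intro i _
  refine Finset.prod_eq_one fun j _ => ?_
  by_cases hij : i < j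
  · simp [hij, hij.not_gt]
  · simp [hij]

theorem formCompatible_refl : ∀ {n : ℕ} (r : Fin n → Bool),
    FormCompatible K N (Equiv.refl (Fin n)) r
  | 0, r => fun a s => by simp [deadSign, edgeForm, revSign]
  | n + 1, r => fun a s => by
    obtain ⟨o, s, rfl⟩ : ∃ o t, s = Fin.cons o t := ⟨_, _, (Fin.cons_self_tail s).symm⟩
    obtain ⟨b, r, rfl⟩ : ∃ b t, r = (Fin.cons b t : Fin (n + 1) → Bool) :=
      ⟨_, _, (Fin.cons_self_tail r).symm⟩
    have h1 : stateMap (Equiv.refl _) (Fin.cons b r : Fin (n + 1) → Bool) (Fin.cons o s) =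
        (Fin.cons (o.map (xor b)) (stateMap (Equiv.refl _) r s) : Fin (n + 1) → Option Bool) := by
      funext i
      refine Fin.cases ?_ (fun i => ?_) i <;> simp [stateMap]
    have h2 : (a ∘ relabel (Equiv.refl _) (Fin.cons b r : Fin (n + 1) → Bool)) ∘ old =
        (a ∘ old) ∘ relabel (Equiv.refl _) r := by
      funext h
      simp [relabel_apply, old]
    have h3 : deadSign (Equiv.refl _) (Fin.cons b r : Fin (n + 1) → Bool) (Fin.cons o s) =
        (if o = none ∧ b = true then -1 else 1) * deadSign (Equiv.refl _) r s := by
      rw [deadSign_refl, deadSign_refl, Fin.prod_univ_succ]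
      simp
    have h4 : revSign (Fin.cons b r : Fin (n + 1) → Bool) = (if b then -1 else 1) * revSign r := by
      simp [revSign, Fin.prod_univ_succ]
    have ih := formCompatible_refl r (a ∘ old) s
    rw [Equiv.Perm.sign_refl, one_mul] at ih ⊢
    have h5 : (a ∘ relabel (Equiv.refl _) (Fin.cons b r : Fin (n + 1) → Bool)) newHead =
        a (0, !b) := by
      simp [relabel_apply, newHead]
    have h6 : (a ∘ relabel (Equiv.refl _) (Fin.cons b r : Fin (n + 1) → Bool)) newTail =
        a (0, b) := by
      simp [relabel_apply, newTail]
    rw [h1, h3, h4, mul_smul, mul_smul]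
    rcases o with _ | _ | _
    · rw [Option.map_none, edgeForm_none, edgeForm_none, h2, ← units_smul_parity, ih,
        units_smul_parity]
      simp
    · rw [edgeForm_false, h2, h5, Option.map_some]
      cases b
      · rw [Bool.xor_false, edgeForm_false, ← mul_smul_comm, ← mul_smul_comm, ih]
        simp [newHead, mul_smul_comm]
      · rw [Bool.xor_false, edgeForm_true, ← mul_smul_comm, smul_neg, ← mul_smul_comm, ih]
        simp [newTail, Units.neg_smul, mul_smul_comm]
    · rw [edgeForm_true, h2, h6, Option.map_some]
      cases b
      · rw [Bool.xor_true, Bool.not_false, edgeForm_true, smul_neg, ← mul_smul_comm, smul_neg,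
          ← mul_smul_comm, ih]
        simp [newTail, mul_smul_comm]
      · rw [Bool.xor_true, Bool.not_true, edgeForm_false, ← mul_smul_comm, smul_neg,
          ← mul_smul_comm, ih]
        simp [newHead, Units.neg_smul, mul_smul_comm]

theorem sign_extendPerm (σ : Equiv.Perm (Fin n)) :
    Equiv.Perm.sign (extendPerm σ) = Equiv.Perm.sign σ := by
  simp [Equiv.Perm.decomposeFin.symm_sign]

theorem formCompatible_extend {σ : Equiv.Perm (Fin n)} {r : Fin n → Bool}
    (h : FormCompatible K N σ r) :
    FormCompatible K N (extendPerm σ) (Fin.cons false r : Fin (n + 1) → Bool) := by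
  intro a s
  obtain ⟨o, s, rfl⟩ : ∃ o t, s = Fin.cons o t := ⟨_, _, (Fin.cons_self_tail s).symm⟩
  have h1 : (a ∘ relabel (extendPerm σ) (Fin.cons false r : Fin (n + 1) → Bool)) ∘ old =
      (a ∘ old) ∘ relabel σ r := funext fun h => congrArg a (relabel_extend_old σ r h)
  have h2 : revSign (Fin.cons false r : Fin (n + 1) → Bool) = revSign r := by
    simp [revSign, Fin.prod_univ_succ]
  have ih := h (a ∘ old) s
  rw [deadSign_extend, stateMap_extend, sign_extendPerm, h2]
  rcases o with _ | _ | _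
  · rw [edgeForm_none, edgeForm_none, h1, ← units_smul_parity, ih, units_smul_parity]
  · rw [edgeForm_false, edgeForm_false, h1, ← mul_smul_comm, ih, mul_smul_comm,
      Function.comp_apply, relabel_extend_head]
  · rw [edgeForm_true, edgeForm_true, h1, smul_neg, ← mul_smul_comm, ih, mul_smul_comm, smul_neg,
      Function.comp_apply, relabel_extend_tail]

theorem deadSign_swap (o o' : Option Bool) (s : Fin n → Option Bool) :
    deadSign (Equiv.swap 0 1) (fun _ => false)
      (Fin.cons o (Fin.cons o' s : Fin (n + 1) → Option Bool) : Fin (n + 2) → Option Bool) =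
      if o = none ∧ o' = none then -1 else 1 := by
  have h1 : ∀ i : Fin n, Equiv.swap (0 : Fin (n + 2)) 1 i.succ.succ = i.succ.succ := fun i =>
    Equiv.swap_apply_of_ne_of_ne (Fin.succ_ne_zero _) fun h =>
      Fin.succ_ne_zero i (Fin.succ_injective _ h)
  have h3 : ∀ i : Fin n, ¬ i.succ.succ < (1 : Fin (n + 2)) := fun i => by
    rw [Fin.lt_def]
    simp
  have h5 : ∀ i j : Fin n, (if i < j then (if s i = none ∧ s j = none ∧ (i < j ↔ j < i)
      then (-1 : ℤˣ) else 1) else 1) = 1 := fun i j => by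
    by_cases h : i < j
    · simp [h, h.not_gt]
    · simp [h]
  simp [deadSign, Fin.prod_univ_succ, h1, h3, h5]

theorem stateMap_swap (o o' : Option Bool) (s : Fin n → Option Bool) :
    stateMap (Equiv.swap 0 1) (fun _ => false)
      (Fin.cons o (Fin.cons o' s : Fin (n + 1) → Option Bool) : Fin (n + 2) → Option Bool) =
      Fin.cons o' (Fin.cons o s : Fin (n + 1) → Option Bool) := by
  have h1 : ∀ i : Fin n, Equiv.swap (0 : Fin (n + 2)) 1 i.succ.succ = i.succ.succ := fun i =>
    Equiv.swap_apply_of_ne_of_ne (Fin.succ_ne_zero _) fun h =>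
      Fin.succ_ne_zero i (Fin.succ_injective _ h)
  have h2 : Equiv.swap (0 : Fin (n + 2)) 1 (Fin.succ 0) = 0 := Equiv.swap_apply_right 0 1
  have h0 : ∀ p : Option Bool, p.map (xor false) = p := fun p => by cases p <;> simp
  funext i
  refine Fin.cases ?_ (Fin.cases ?_ fun i => ?_) i
  · simp only [stateMap, Equiv.symm_swap, Equiv.swap_apply_left, h0]
    rfl
  · simp only [stateMap, Equiv.symm_swap, h2, h0]
    rfl
  · simp only [stateMap, Equiv.symm_swap, h1, h0]
    rfl

theorem formCompatible_swap :
    FormCompatible K N (Equiv.swap (0 : Fin (n + 2)) 1) (fun _ => false) := by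
  intro a s
  obtain ⟨o, s, rfl⟩ : ∃ o t, s = Fin.cons o t := ⟨_, _, (Fin.cons_self_tail s).symm⟩
  obtain ⟨o', s, rfl⟩ : ∃ o t, s = Fin.cons o t := ⟨_, _, (Fin.cons_self_tail s).symm⟩
  have hrel : relabel (Equiv.swap (0 : Fin (n + 2)) 1) (fun _ => false) = swapNew n := by
    ext h <;> simp [relabel, swapNew]
  have h1 : ((a ∘ swapNew n) ∘ old) ∘ old = (a ∘ old) ∘ old :=
    funext fun h => congrArg a (swapNew_old_old h)
  have h2 : revSign (fun _ : Fin (n + 2) => false) = 1 := by simp [revSign]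
  rw [stateMap_swap, deadSign_swap, hrel, Equiv.Perm.sign_swap (by simp), h2, mul_one]
  rcases o with _ | _ | _ <;> rcases o' with _ | _ | _ <;>
    simp [edgeForm_none, edgeForm_false, edgeForm_true, h1, Units.smul_def, ι_mul_ι_mul (a newHead), ι_mul_ι_mul (a newTail)]

theorem extendPerm_symm (τ : Equiv.Perm (Fin n)) : (extendPerm τ).symm = extendPerm τ.symm := by
  refine Equiv.ext fun i => (Equiv.symm_apply_eq _).2 ?_
  refine Fin.cases ?_ (fun i => ?_) i <;> simp

theorem decomposeFin_symm_eq (p : Fin (n + 1)) (τ : Equiv.Perm (Fin n)) :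
    Equiv.Perm.decomposeFin.symm (p, τ) = (extendPerm τ).trans (Equiv.swap 0 p) := by
  refine Equiv.ext fun i => ?_
  refine Fin.cases ?_ (fun i => ?_) i <;> simp

theorem swap_zero_succ (p : Fin (n + 1)) :
    Equiv.swap (0 : Fin (n + 2)) p.succ = ((extendPerm (Equiv.swap 0 p)).trans
      (Equiv.swap 0 1)).trans (extendPerm (Equiv.swap 0 p)) := by
  have h1 : (extendPerm (Equiv.swap 0 p)).symm = extendPerm (Equiv.swap 0 p) := by
    rw [extendPerm_symm, Equiv.symm_swap]
  have h2 := Equiv.symm_trans_swap_trans (0 : Fin (n + 2)) 1 (extendPerm (Equiv.swap 0 p))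
  have h3 : extendPerm (Equiv.swap 0 p) (1 : Fin (n + 2)) = p.succ := by
    rw [← Fin.succ_zero_eq_one]
    simp
  have h4 : extendPerm (Equiv.swap 0 p) (0 : Fin (n + 2)) = 0 := by simp
  rw [h1, h3, h4] at h2
  exact h2.symm

theorem FormCompatible.trans_false {α β : Equiv.Perm (Fin n)}
    (h1 : FormCompatible K N α fun _ => false) (h2 : FormCompatible K N β fun _ => false) :
    FormCompatible K N (α.trans β) fun _ => false := by
  have := h1.trans h2
  simpa only [Bool.xor_false] using this

theorem formCompatible_perm_succ
    (hn : ∀ σ : Equiv.Perm (Fin (n + 1)), FormCompatible K N σ (fun _ => false))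
    (σ : Equiv.Perm (Fin (n + 2))) : FormCompatible K N σ (fun _ => false) := by
  have hcons : (Fin.cons false fun _ => false : Fin (n + 2) → Bool) = fun _ => false := by
    funext i
    exact Fin.cases rfl (fun _ => rfl) i
  have hext : ∀ τ : Equiv.Perm (Fin (n + 1)),
      FormCompatible K N (extendPerm τ) (fun _ => false) := fun τ => by
    have h1 := formCompatible_extend (hn τ)
    rwa [hcons] at h1
  have hsw : ∀ p : Fin (n + 2), FormCompatible K N (Equiv.swap 0 p) (fun _ => false) := by
    intro p
    rcases Fin.eq_zero_or_eq_succ p with rfl | ⟨p, rfl⟩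
    · rw [Equiv.swap_self]
      exact formCompatible_refl _
    · rw [swap_zero_succ]
      exact ((hext _).trans_false formCompatible_swap).trans_false (hext _)
  have h1 := decomposeFin_symm_eq (Equiv.Perm.decomposeFin σ).1 (Equiv.Perm.decomposeFin σ).2
  rw [Prod.mk.eta, Equiv.symm_apply_apply] at h1
  rw [h1]
  exact (hext _).trans_false (hsw _)

theorem formCompatible_perm (σ : Equiv.Perm (Fin n)) : FormCompatible K N σ (fun _ => false) := by
  rcases n with _ | n
  · rw [Subsingleton.elim σ (Equiv.refl _)]
    exact formCompatible_refl _
  · induction n with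
    | zero =>
      rw [show σ = Equiv.refl _ from Equiv.ext fun i => by omega]
      exact formCompatible_refl _
    | succ n ih => exact formCompatible_perm_succ ih σ

theorem edgeForm_stateMap (σ : Equiv.Perm (Fin n)) (r : Fin n → Bool) (a : HalfEdge n → N)
    (s : Fin n → Option Bool) :
    deadSign σ r s • edgeForm (K := K) a (stateMap σ r s) =
      (Equiv.Perm.sign σ * revSign r) • edgeForm (a ∘ relabel σ r) s := by
  have := (formCompatible_refl (K := K) (N := N) r).trans (formCompatible_perm σ)
  simp only [Equiv.refl_trans, Bool.xor_false] at this
  exact this a s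

end equivariance

end HalfEdge

namespace HalfEdge

open ExteriorAlgebra

section top

variable {K : Type*} [Field K] {v : ℕ}

variable (K v) in
/-- The determinant as a linear form on the exterior algebra of `K ^ v`. -/
noncomputable def topForm : ExteriorAlgebra K (Fin v → K) →ₗ[K] K :=
  liftAlternating fun i =>
    if h : i = v then
      (Matrix.detRowAlternating (n := Fin v) (R := K)).domDomCongr (finCongr h.symm)
    else 0

theorem topForm_ιMulti (x : Fin v → Fin v → K) :
    topForm K v (ιMulti K v x) = Matrix.det (Matrix.of x) := by
  rw [topForm, liftAlternating_apply_ιMulti, dif_pos rfl]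
  rfl

/-- The permutation of the coordinates. -/
def permCoord (τ : Equiv.Perm (Fin v)) : (Fin v → K) →ₗ[K] (Fin v → K) :=
  LinearMap.funLeft K K τ.symm

theorem permCoord_single (τ : Equiv.Perm (Fin v)) (w : Fin v) :
    permCoord τ (Pi.single w (1 : K)) = Pi.single (τ w) 1 := by
  funext j
  simp only [permCoord, LinearMap.funLeft_apply, Pi.single_apply, Equiv.symm_apply_eq]

theorem topForm_map (τ : Equiv.Perm (Fin v)) (y : ExteriorAlgebra K (Fin v → K)) :
    topForm K v (ExteriorAlgebra.map (permCoord τ) y) = Equiv.Perm.sign τ • topForm K v y := by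
  have : (topForm K v) ∘ₗ (ExteriorAlgebra.map (permCoord τ)).toLinearMap =
      ((Equiv.Perm.sign τ : ℤ) : K) • topForm K v := by
    refine lhom_ext fun i => AlternatingMap.ext fun x => ?_
    change topForm K v (ExteriorAlgebra.map (permCoord τ) (ιMulti K i x)) =
      ((Equiv.Perm.sign τ : ℤ) : K) • topForm K v (ιMulti K i x)
    rw [map_apply_ιMulti]
    by_cases h : i = v
    · subst h
      rw [topForm_ιMulti, topForm_ιMulti, smul_eq_mul, ← Equiv.Perm.sign_symm τ]
      exact Matrix.det_permute' τ.symm (Matrix.of x)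
    · rw [topForm, liftAlternating_apply_ιMulti, liftAlternating_apply_ιMulti, dif_neg h]
      simp
  have h := LinearMap.congr_fun this y
  rw [Units.smul_def, zsmul_eq_mul]
  exact h

end top

section volume

variable {K : Type*} [Field K] {n v : ℕ}

variable (K) in
/-- The vectors of the standard basis at the half-edges. -/
def basisAt (a : HalfEdge n → Fin v) (h : HalfEdge n) : Fin v → K := Pi.single (a h) 1

variable (K) in
/-- The function on the states with `b` dead edges which is the determinant of the vector
`(1, …, 1)` and of the targets of the directed edges. -/
noncomputable def volume (a : HalfEdge n → Fin v) (b : ℕ) (s : Fin n → Option Bool) : K :=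
  if deadCount s = b then
    topForm K v (ι K (fun _ => 1) * edgeForm (basisAt K a) s) else 0

theorem parity_ιMulti {N : Type*} [AddCommGroup N] [Module K N] {k : ℕ} (x : Fin k → N) :
    parity K N (ιMulti K k x) = ((-1) ^ k : ℤˣ) • ιMulti K k x := by
  have := CliffordAlgebra.involute_prod_map_ι (Q := (0 : QuadraticForm K N)) (List.ofFn x)
  rw [List.map_ofFn, List.length_ofFn] at this
  rw [Units.smul_def, ← Int.cast_smul_eq_zsmul K]
  refine this.trans ?_
  simp
  rfl

theorem exists_edgeForm_eq {N : Type*} [AddCommGroup N] [Module K N] {V : Type*} (E : V → N) :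
    ∀ {n : ℕ} (a : HalfEdge n → V) (s : Fin n → Option Bool),
    ∃ (c : ℤˣ) (k : ℕ) (x : Fin k → V), edgeForm (K := K) (fun h => E (a h)) s =
      c • ιMulti K k (fun i => E (x i)) ∧ k + deadCount s = n ∧
      ∀ i, ∃ u, Step a s u (x i)
  | 0, a, s => ⟨1, 0, Fin.elim0, by simp [edgeForm], by simp [deadCount], fun i => i.elim0⟩
  | n + 1, a, s => by
    obtain ⟨o, s, rfl⟩ : ∃ o t, s = Fin.cons o t := ⟨_, _, (Fin.cons_self_tail s).symm⟩
    obtain ⟨c, k, x, h1, h2, h3⟩ := exists_edgeForm_eq E (a ∘ old) s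
    have h1' : edgeForm (K := K) ((fun h => E (a h)) ∘ old) s = c • ιMulti K k (fun i => E (x i)) := h1
    have h4 : ∀ w, ι K (E w) * (c • ιMulti K k (fun i => E (x i))) =
        c • ιMulti K (k + 1) (fun i => E ((Fin.cons w x : Fin (k + 1) → V) i)) := fun w => by
      rw [mul_smul_comm, ιMulti_succ_apply]
      rfl
    rcases o with _ | _ | _
    · refine ⟨c * (-1) ^ k, k, x, ?_, by rw [deadCount_cons_none]; omega, fun i =>
        (h3 i).imp fun u => (step_cons_none _ _).2⟩
      rw [edgeForm_none, h1', units_smul_parity, mul_smul, parity_ιMulti]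
    · refine ⟨c, k + 1, Fin.cons (a newHead) x, ?_, by rw [deadCount_cons_some]; omega, ?_⟩
      · rw [edgeForm_false, h1', h4]
      · refine Fin.cases ⟨a newTail, (step_cons_false _ _).2 (Or.inr ⟨rfl, rfl⟩)⟩ fun i => ?_
        exact (h3 i).imp fun u h => (step_cons_false _ _).2 (Or.inl h)
    · refine ⟨-c, k + 1, Fin.cons (a newTail) x, ?_, by rw [deadCount_cons_some]; omega, ?_⟩
      · rw [edgeForm_true, h1', h4, Units.neg_smul]
      · refine Fin.cases ⟨a newHead, (step_cons_true _ _).2 (Or.inr ⟨rfl, rfl⟩)⟩ fun i => ?_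
        exact (h3 i).imp fun u h => (step_cons_true _ _).2 (Or.inl h)

/-- In an acyclic state, some vertex is not the target of a directed edge. -/
theorem Acyclic.exists_source {a : HalfEdge n → Fin v} {s : Fin n → Option Bool}
    (h : Acyclic a s) (hv : 0 < v) : ∃ w, ∀ u, ¬ Step a s u w := by
  have hi : Std.Irrefl (Relation.TransGen (Step a s)) := ⟨h⟩
  have hw := Finite.wellFounded_of_trans_of_irrefl (Relation.TransGen (Step a s))
  obtain ⟨w, -, hw⟩ := hw.has_min Set.univ ⟨⟨0, hv⟩, trivial⟩
  exact ⟨w, fun u hu => hw u trivial (.single hu)⟩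

theorem edgeForm_eq_zero {a : HalfEdge n → Fin v} {s : Fin n → Option Bool} (ha : Acyclic a s)
    (hv : 0 < v) (hs : deadCount s + v = n) : edgeForm (K := K) (basisAt K a) s = 0 := by
  obtain ⟨c, k, x, h1, h2, h3⟩ := exists_edgeForm_eq (K := K)
    (fun w : Fin v => (Pi.single w 1 : Fin v → K)) a s
  obtain rfl : k = v := by omega
  obtain ⟨w, hw⟩ := ha.exists_source hv
  have h4 : ¬ Function.Injective x := fun hx => by
    obtain ⟨i, rfl⟩ := (Finite.injective_iff_surjective.1 hx) w
    obtain ⟨u, hu⟩ := h3 i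
    exact hw u hu
  have h5 : ιMulti K k (fun i => (Pi.single (x i) 1 : Fin k → K)) = 0 := by
    simp only [Function.Injective, not_forall] at h4
    obtain ⟨i, j, hij, hne⟩ := h4
    exact AlternatingMap.map_eq_zero_of_eq _ _ (by simp only [hij]) hne
  rw [h5, smul_zero] at h1
  exact h1

/-- The volume cocycle is closed on the acyclic states: with less than `b` dead edges, there are at least
`v` directed edges, whose targets are linearly dependent since some vertex is not a target. -/
theorem kill_volume {a : HalfEdge n → Fin v} {s : Fin n → Option Bool} {b : ℕ} (ha : Acyclic a s)
    (hv : 0 < v) (hb : b + v = n + 1) : kill (volume K a b) s = 0 := by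
  by_cases hs : deadCount s + 1 = b
  · rw [kill_congr (g := fun t => (topForm K v ∘ₗ LinearMap.mulLeft K (ι K fun _ => 1))
      (edgeForm (basisAt K a) t)) fun i hi => by
        rw [volume, if_pos (by rw [deadCount_update hi, hs])]
        rfl, kill_map,
      kill_edgeForm (∑ w : Fin v, LinearMap.proj w) _ fun h => by simp [basisAt]]
    rw [edgeForm_eq_zero ha hv (by omega), map_zero, map_zero, map_zero]
  · rw [kill_congr (g := fun _ => 0) fun i hi => by
      rw [volume, if_neg (by rw [deadCount_update hi]; exact hs)], kill_zero]

/-- After the multiplication with `y`, the targets matter only modulo `y`. -/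
theorem ι_mul_edgeForm_congr {N : Type*} [AddCommGroup N] [Module K N] (y : N) :
    ∀ {n : ℕ} (a b : HalfEdge n → N) (_ : ∀ h, ∃ r : K, b h = a h + r • y)
      (s : Fin n → Option Bool), ι K y * edgeForm a s = ι K y * edgeForm b s
  | 0, _, _, _, _ => rfl
  | n + 1, a, b, hab, s => by
    obtain ⟨o, s, rfl⟩ : ∃ o t, s = Fin.cons o t := ⟨_, _, (Fin.cons_self_tail s).symm⟩
    have ih := ι_mul_edgeForm_congr y (a ∘ old) (b ∘ old) (fun h => hab _) s
    have key : ∀ h, ι K y * (ι K (a h) * edgeForm (a ∘ old) s) =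
        ι K y * (ι K (b h) * edgeForm (b ∘ old) s) := fun h => by
      obtain ⟨r, hr⟩ := hab h
      rw [ι_mul_ι_mul, ih, ← ι_mul_ι_mul, hr, map_add, add_mul, mul_add, map_smul,
        smul_mul_assoc, mul_smul_comm, ← mul_assoc (ι K y) (ι K y), ι_sq_zero, zero_mul, smul_zero,
        add_zero]
    rcases o with _ | _ | _
    · rw [edgeForm_none, edgeForm_none, ι_mul_parity, ι_mul_parity, ih]
    · rw [edgeForm_false, edgeForm_false, key]
    · rw [edgeForm_true, edgeForm_true, mul_neg, mul_neg, key]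

/-- The evaluation of `edgeForm` is, up to sign, the product of the differences of the ends of the
edges of a spanning forest. -/
theorem evaluate_edgeForm {N : Type*} [AddCommGroup N] [Module K N] {V : Type*} [DecidableEq V]
    (E : V → N) : ∀ {n : ℕ} (a : HalfEdge n → V),
    ∃ (c : ℤˣ) (k : ℕ) (x : Fin k → N), evaluate a (edgeForm (K := K) (fun h => E (a h))) =
      c • ιMulti K k x ∧ k + loopCount a = n ∧
      ∀ h, E (a h) - E (a (flipEdge n h)) ∈ Submodule.span K (Set.range x)
  | 0, a => ⟨1, 0, Fin.elim0, by simp [edgeForm, evaluate], by simp [loopCount], fun i => i.1.elim0⟩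
  | n + 1, a => by
    by_cases h0 : a newTail = a newHead
    · obtain ⟨c, k, x, h1, h2, h3⟩ := evaluate_edgeForm E (a ∘ old)
      refine ⟨c * (-1) ^ k, k, x, ?_, by rw [loopCount, if_pos h0]; omega,
        HalfEdge.rec_on ?_ ?_ h3⟩
      · rw [evaluate, if_pos h0]
        simp only [edgeForm_none]
        rw [evaluate_map]
        refine (congrArg (parity K N) h1).trans ?_
        rw [units_smul_parity, mul_smul, parity_ιMulti]
      · rw [flipEdge_tail, h0, sub_self]
        exact zero_mem _
      · rw [flipEdge_head, h0, sub_self]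
        exact zero_mem _
    · obtain ⟨c, k, x, h1, h2, h3⟩ :=
        evaluate_edgeForm E (merge (a newTail) (a newHead) ∘ a ∘ old)
      set y := E (a newHead) - E (a newTail) with hy
      have hm : ∀ w, ∃ r : K, E (merge (a newTail) (a newHead) w) = E w + r • y := fun w => by
        by_cases hw : w = a newHead
        · refine ⟨-1, ?_⟩
          rw [hw, merge_right, hy]
          simp
        · exact ⟨0, by rw [merge_of_ne _ hw]; simp⟩
      have hys : y ∈ Submodule.span K (Set.range (Fin.cons y x : Fin (k + 1) → N)) :=
        Submodule.subset_span ⟨0, rfl⟩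
      refine ⟨c, k + 1, Fin.cons y x, ?_, by rw [loopCount, if_neg h0]; omega,
        HalfEdge.rec_on ?_ hys ?_⟩
      · rw [evaluate, if_neg h0]
        have h4 : ∀ s : Fin n → Option Bool, edgeForm (K := K) (fun h => E (a h)) (Fin.cons (some false) s) +
            edgeForm (fun h => E (a h)) (Fin.cons (some true) s) =
            LinearMap.mulLeft K (ι K y)
              (edgeForm (fun h => E ((merge (a newTail) (a newHead) ∘ a ∘ old) h)) s) := fun s => by
          rw [edgeForm_false, edgeForm_true, ← sub_eq_add_neg, ← sub_mul, ← map_sub,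
            LinearMap.mulLeft_apply]
          exact ι_mul_edgeForm_congr y _ _ (fun h => hm (a (old h))) s
        simp only [h4]
        rw [evaluate_map, h1, LinearMap.mulLeft_apply, mul_smul_comm, ιMulti_succ_apply]
        rfl
      · rw [flipEdge_tail, ← neg_sub]
        exact neg_mem hys
      · intro h
        have hle : Submodule.span K (Set.range x) ≤
            Submodule.span K (Set.range (Fin.cons y x : Fin (k + 1) → N)) :=
          Submodule.span_mono (by rintro _ ⟨i, rfl⟩; exact ⟨i.succ, rfl⟩)
        obtain ⟨r, hr⟩ := hm (a (old h))
        obtain ⟨r', hr'⟩ := hm (a (old (flipEdge n h)))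
        have h5 := hle (h3 h)
        simp only [Function.comp_apply] at h5
        rw [hr, hr'] at h5
        have h6 : E (a (old h)) - E (a (old (flipEdge n h))) =
            (E (a (old h)) + r • y - (E (a (old (flipEdge n h))) + r' • y)) - (r - r') • y := by
          rw [sub_smul]
          abel
        rw [flipEdge_old, h6]
        exact sub_mem h5 (Submodule.smul_mem _ _ hys)

end volume

end HalfEdge

namespace RibbonGraph

open ExteriorAlgebra

variable {K : Type*} [Field K] {e v m : ℕ} {Γ Γ' : RibbonGraph e v m}

theorem IsConnected.evaluate_volume_ne_zero [CharZero K] (hc : Γ.IsConnected) (hv : 0 < v) {b : ℕ}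
    (hb : b + v = e + 1) : evaluate Γ.vert (volume K Γ.vert b) ≠ 0 := by
  have hl := hc.loopCount hv
  obtain rfl : b = HalfEdge.loopCount Γ.vert := by omega
  have h1 : evaluate Γ.vert (volume K Γ.vert (HalfEdge.loopCount Γ.vert)) =
      evaluate Γ.vert (fun s => (topForm K v ∘ₗ LinearMap.mulLeft K (ι K fun _ => 1))
        (edgeForm (basisAt K Γ.vert) s)) := by
    rw [← sub_eq_zero, ← evaluate_sub]
    refine evaluate_eq_zero_of_count _ _ fun s hs => ?_
    rw [volume, if_pos hs]
    exact sub_self _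
  obtain ⟨c, k, x, h2, h3, h4⟩ := evaluate_edgeForm (K := K)
    (fun w : Fin v => (Pi.single w 1 : Fin v → K)) Γ.vert
  obtain rfl : v = k + 1 := by omega
  have h5 : evaluate Γ.vert (edgeForm (basisAt K Γ.vert)) = c • ιMulti K k x := h2
  rw [h1, evaluate_map, h5, LinearMap.comp_apply, LinearMap.mulLeft_apply, mul_smul_comm]
  have h6 : ι K (fun _ => (1 : K)) * ιMulti K k x =
      ιMulti K (k + 1) (Fin.cons (fun _ => 1) x : Fin (k + 1) → Fin (k + 1) → K) := by
    rw [ιMulti_succ_apply]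
    rfl
  rw [h6, Units.smul_def, map_zsmul, ← Units.smul_def, topForm_ιMulti]
  set X : Fin (k + 1) → Fin (k + 1) → K := Fin.cons (fun _ => 1) x with hX
  set S := Submodule.span K (Set.range X) with hS
  have h7 : ∀ w w' : Fin (k + 1), (Pi.single w 1 - Pi.single w' 1 : Fin (k + 1) → K) ∈ S := by
    intro w w'
    have hle : Submodule.span K (Set.range x) ≤ S :=
      Submodule.span_mono (by rintro _ ⟨i, rfl⟩; exact ⟨i.succ, rfl⟩)
    have := hc w w'
    induction this with
    | refl =>
      rw [sub_self]
      exact zero_mem _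
    | tail _ hb ih =>
      obtain ⟨h, rfl, rfl⟩ := hb
      have := add_mem ih (hle (h4 h))
      rwa [sub_add_sub_cancel] at this
  have h8 : ∀ w : Fin (k + 1), (Pi.single w 1 : Fin (k + 1) → K) ∈ S := by
    intro w
    have h9 : ((k + 1 : ℕ) : K) • (Pi.single w 1 : Fin (k + 1) → K) =
        (∑ w', (Pi.single w 1 - Pi.single w' 1 : Fin (k + 1) → K)) + X 0 := by
      rw [Finset.sum_sub_distrib, Finset.sum_const, Finset.card_univ, Fintype.card_fin,
        ← Nat.cast_smul_eq_nsmul K]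
      have : (∑ w' : Fin (k + 1), (Pi.single w' 1 : Fin (k + 1) → K)) = X 0 := by
        rw [hX]
        exact Finset.univ_sum_single (fun _ : Fin (k + 1) => (1 : K))
      rw [this, sub_add_cancel]
    have h10 : ((k + 1 : ℕ) : K) • (Pi.single w 1 : Fin (k + 1) → K) ∈ S := by
      rw [h9]
      exact add_mem (Submodule.sum_mem _ fun w' _ => h7 w w') (Submodule.subset_span ⟨0, rfl⟩)
    exact (Submodule.smul_mem_iff _ (by exact_mod_cast Nat.succ_ne_zero k)).1 h10
  have h11 : ⊤ ≤ S := by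
    intro y _
    rw [pi_eq_sum_univ' y]
    refine Submodule.sum_mem _ fun w _ => Submodule.smul_mem _ _ ?_
    convert h8 w using 1
  have h12 := linearIndependent_of_top_le_span_of_card_eq_finrank h11 (by simp)
  have h13 : IsUnit (Matrix.of X) := Matrix.linearIndependent_rows_iff_isUnit.1 h12
  have h14 := ((Matrix.isUnit_iff_isUnit_det _).1 h13).ne_zero
  exact (smul_ne_zero_iff_ne c).2 h14

/-- The volume cocycle transforms by the signs by which the ribbon graph complexes for `d` and `d + 1`
differ. -/
theorem volume_stateMap (φ : Iso Flavour.ribbon Γ Γ') (b : ℕ) (s : Fin e → Option Bool) :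
    deadSign φ.edge φ.rev s • volume K Γ'.vert b (stateMap φ.edge φ.rev s) =
      (Equiv.Perm.sign φ.edge * revSign φ.rev * Equiv.Perm.sign φ.vertex) •
        volume K Γ.vert b s := by
  unfold volume
  rw [deadCount_stateMap]
  split_ifs with hs
  · have h1 : basisAt K Γ'.vert ∘ relabel φ.edge φ.rev =
        permCoord φ.vertex ∘ basisAt K Γ.vert := by
      funext h
      simp only [Function.comp_apply, basisAt, permCoord_single, φ.map_vert]
    have h2 : ExteriorAlgebra.map (permCoord φ.vertex) (ι K fun _ => (1 : K)) =
        ι K fun _ => 1 := by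
      rw [map_apply_ι]
      rfl
    have h3 : ∀ (c : ℤˣ) (y : ExteriorAlgebra K (Fin v → K)),
        topForm K v (ι K (fun _ => 1) * (c • y)) = c • topForm K v (ι K (fun _ => 1) * y) := by
      intro c y
      rw [mul_smul_comm, Units.smul_def, map_zsmul, ← Units.smul_def]
    rw [← h3, edgeForm_stateMap, h3, h1, map_edgeForm]
    nth_rewrite 1 [← h2]
    rw [← map_mul, topForm_map, smul_smul]
  · simp

end RibbonGraph

/-! ### The double complex of functions on graphs with states -/

namespace RibbonGraph

variable {e v m : ℕ}

section flip

/-- The same cut, with the two pieces exchanged. -/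
def CornerPair.swap {Γ : RibbonGraph e v m} : Γ.CornerPair ≃ Γ.CornerPair where
  toFun p := ⟨(p.1.2, p.1.1), p.2.1.symm, p.2.2.symm⟩
  invFun p := ⟨(p.1.2, p.1.1), p.2.1.symm, p.2.2.symm⟩
  left_inv _ := rfl
  right_inv _ := rfl

theorem relabel_rev_tail :
    relabel (Equiv.refl (Fin (e + 1))) (Fin.cons true fun _ => false : Fin (e + 1) → Bool)
      newTail = newHead := by
  simp [relabel, newTail, newHead]

theorem relabel_rev_head :
    relabel (Equiv.refl (Fin (e + 1))) (Fin.cons true fun _ => false : Fin (e + 1) → Bool)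
      newHead = newTail := by
  simp [relabel, newTail, newHead]

theorem relabel_rev_old (h : HalfEdge e) :
    relabel (Equiv.refl (Fin (e + 1))) (Fin.cons true fun _ => false : Fin (e + 1) → Bool)
      (old h) = old h := by
  simp [relabel, old]

/-- The reversal of the new edge exchanges the two pieces of the vertex that has been cut. -/
theorem exists_flipIso (Γ : RibbonGraph e v m) (p : Γ.CornerPair) :
    ∃ ψ : Iso Flavour.ribbon (Γ.split p) (Γ.split (CornerPair.swap p)),
      ψ.edge = Equiv.refl _ ∧ ψ.rev = (Fin.cons true fun _ => false : Fin (e + 1) → Bool) ∧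
      ∀ d, ψ.sgn d = 1 := by
  set r : Fin (e + 1) → Bool := Fin.cons true fun _ => false with hr
  have h0 : relabel (Equiv.refl _) r newTail = newHead := relabel_rev_tail
  have h1 : relabel (Equiv.refl _) r newHead = newTail := relabel_rev_head
  have h2 : ∀ h, relabel (Equiv.refl _) r (old h) = old h := relabel_rev_old
  set G' := Γ.split (CornerPair.swap p) with hG'
  have hrot : ∀ h, G'.rot (relabel (Equiv.refl _) r h) =
      relabel (Equiv.refl _) r ((Γ.split p).rot h) := by
    refine HalfEdge.rec_on ?_ ?_ fun h => ?_
    · rw [h0]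
      exact (h2 _).symm
    · rw [h1]
      exact (h2 _).symm
    · rw [h2]
      change splitRot Γ.rot p.1.2 p.1.1 p.2.1.symm _ =
        relabel _ r (splitRot Γ.rot p.1.1 p.1.2 p.2.1 _)
      rw [splitRot_old, splitRot_old]
      by_cases hx : h = p.1.1
      · have : h ≠ p.1.2 := fun hy => p.2.1 (hx.symm.trans hy)
        rw [if_neg this, if_pos hx, if_pos hx, h0]
      · rw [if_neg hx, if_neg hx]
        split_ifs
        · exact h1.symm
        · exact (h2 _).symm
  have hcor : ∀ h, corner p.1.2 p.1.1 (relabel (Equiv.refl _) r h) = corner p.1.1 p.1.2 h := by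
    refine HalfEdge.rec_on ?_ ?_ fun h => ?_
    · rw [h0]
      rfl
    · rw [h1]
      rfl
    · rw [h2]
      rfl
  have hsc : ∀ h k, G'.vert (relabel (Equiv.refl _) r h) = G'.vert (relabel (Equiv.refl _) r k) ↔
      (Γ.split p).vert h = (Γ.split p).vert k := fun h k => by
    rw [RibbonGraph.vert_eq_iff, RibbonGraph.vert_eq_iff]
    exact sameCycle_iff_of_map _ _ _ hrot h k
  have hH : (Γ.split p).vert newHead = 0 := Γ.vertSplit_head p
  have hT : (Γ.split p).vert newTail = (Γ.vert p.1.1).succ := Γ.vertSplit_tail p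
  have hH' : G'.vert newHead = 0 := Γ.vertSplit_head _
  have hT' : G'.vert newTail = (Γ.vert p.1.1).succ :=
    (Γ.vertSplit_tail (CornerPair.swap p)).trans (congrArg Fin.succ p.2.2.symm)
  refine ⟨⟨Equiv.refl _, r, Equiv.swap 0 (Γ.vert p.1.1).succ, fun hF => (by cases hF), hrot,
    fun h => ?_, fun h => congrArg Γ.bdry (hcor h)⟩, rfl, rfl, fun d => ?_⟩
  · by_cases h3 : (Γ.split p).vert h = 0
    · rw [h3, Equiv.swap_apply_left, ← hT', ← h1, hsc, h3, hH]
    · by_cases h4 : (Γ.split p).vert h = (Γ.vert p.1.1).succ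
      · rw [h4, Equiv.swap_apply_right, ← hH', ← h0, hsc, h4, hT]
      · have h5 : G'.vert (relabel (Equiv.refl _) r h) ≠ 0 := by
          rw [← hH', ← h0, Ne, hsc, hT]
          exact h4
        rw [Equiv.swap_apply_of_ne_of_ne h3 h4]
        have h6 : (Γ.split p).vert h = (Γ.vert (corner p.1.1 p.1.2 h)).succ :=
          Γ.vertSplit_of p fun hh => h3 ((Γ.vertSplit_eq_zero p).2 hh)
        have h7 : G'.vert (relabel (Equiv.refl _) r h) =
            (Γ.vert (corner p.1.2 p.1.1 (relabel (Equiv.refl _) r h))).succ :=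
          Γ.vertSplit_of _ fun hh => h5 ((Γ.vertSplit_eq_zero _).2 hh)
        rw [h6, h7, hcor]
  · simp only [Iso.sgn, Fin.prod_univ_succ, hr]
    rw [Equiv.Perm.sign_swap (Fin.succ_ne_zero _).symm]
    simp [← mul_zpow]

end flip

/-- The conditions on a graph with states of its edges: the graph is one of those that span the
ribbon graph complex, and the directed edges do not form a closed path. -/
structure Admissible (g : ℕ) (Γ : RibbonGraph e v m) (s : Fin e → Option Bool) : Prop where
  connected : Γ.IsConnected
  genus : v + m + 2 * g = e + 2
  trivalent : ∃ w, 3 ≤ Γ.valency w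
  acyclic : Acyclic Γ.vert s

section admissible

variable {g : ℕ} {Γ Γ' : RibbonGraph e v m} {s : Fin e → Option Bool}

theorem Iso.acyclic_iff (φ : Iso Flavour.ribbon Γ Γ') :
    Acyclic Γ'.vert (stateMap φ.edge φ.rev s) ↔ Acyclic Γ.vert s := by
  rw [acyclic_stateMap (a := φ.vertex ∘ Γ.vert) φ.edge φ.rev fun h => φ.map_vert h,
    acyclic_comp φ.vertex.injective]

theorem Iso.stateMap_symm (φ : Iso Flavour.ribbon Γ Γ') :
    stateMap φ.symm.edge φ.symm.rev (stateMap φ.edge φ.rev s) = s := by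
  have h1 := stateMap_trans φ.edge φ.symm.edge φ.rev φ.symm.rev s
  have h2 := congrArg Iso.edge φ.trans_symm
  have h3 := congrArg Iso.rev φ.trans_symm
  change φ.edge.trans φ.symm.edge = _ at h2
  change (fun i => xor (φ.rev i) (φ.symm.rev (φ.edge i))) = _ at h3
  rw [← h1, h2, h3]
  exact stateMap_refl s

theorem Admissible.of_iso (φ : Iso Flavour.ribbon Γ Γ') (h : Admissible g Γ s) :
    Admissible g Γ' (stateMap φ.edge φ.rev s) :=
  ⟨h.connected.of_iso φ, h.genus, trivalent_of_iso φ h.trivalent, φ.acyclic_iff.2 h.acyclic⟩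

theorem admissible_iff_of_iso (φ : Iso Flavour.ribbon Γ Γ') :
    Admissible g Γ' (stateMap φ.edge φ.rev s) ↔ Admissible g Γ s :=
  ⟨fun h => by
    have := h.of_iso φ.symm
    rwa [φ.stateMap_symm] at this, Admissible.of_iso φ⟩

theorem Admissible.update (h : Admissible g Γ s) (i : Fin e) :
    Admissible g Γ (Function.update s i none) :=
  ⟨h.connected, h.genus, h.trivalent, h.acyclic.update i⟩

theorem Admissible.pos (h : Admissible g Γ s) : 0 < v := by
  obtain ⟨w, -⟩ := h.trivalent
  exact w.pos

/-- The contraction of the new edge of a split graph, on the vertices. -/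
theorem merge_split (Γ : RibbonGraph e v m) (p : Γ.CornerPair) :
    merge ((Γ.split p).vert newTail) ((Γ.split p).vert newHead) ∘ (Γ.split p).vert ∘ old =
      Fin.succ ∘ Γ.vert := by
  have hH : (Γ.split p).vert newHead = 0 := Γ.vertSplit_head p
  have hT : (Γ.split p).vert newTail = (Γ.vert p.1.1).succ := Γ.vertSplit_tail p
  funext h
  simp only [Function.comp_apply, hH, hT]
  have h1 := Γ.oldVertex_vert p (old h)
  rw [corner_old] at h1
  rw [← h1]
  generalize (Γ.split p).vert (old h) = w
  refine Fin.cases ?_ (fun w => ?_) w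
  · rw [merge_right]
    rfl
  · rw [merge_of_ne _ (Fin.succ_ne_zero _)]
    rfl

theorem split_tail_ne_head (Γ : RibbonGraph e v m) (p : Γ.CornerPair) :
    (Γ.split p).vert newTail ≠ (Γ.split p).vert newHead := by
  rw [show (Γ.split p).vert newHead = 0 from Γ.vertSplit_head p,
    show (Γ.split p).vert newTail = (Γ.vert p.1.1).succ from Γ.vertSplit_tail p]
  exact Fin.succ_ne_zero _

theorem acyclic_split (p : Γ.CornerPair) (h : Acyclic Γ.vert s) (b : Bool) :
    Acyclic (Γ.split p).vert (Fin.cons (some b) s : Fin (e + 1) → Option Bool) := by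
  refine Acyclic.of_merge (split_tail_ne_head Γ p) ?_ b
  rw [merge_split]
  exact (acyclic_comp (Fin.succ_injective v) Γ.vert).2 h

theorem Admissible.split (h : Admissible g Γ s) (p : Γ.CornerPair) (b : Bool) :
    Admissible g (Γ.split p) (Fin.cons (some b) s) :=
  ⟨Γ.split_isConnected p h.connected, by have := h.genus; omega, Γ.split_trivalent p h.trivalent,
    acyclic_split p h.acyclic b⟩

end admissible

section functions

/-- The functions on the graphs with `m` boundaries and with states of the edges. -/
abbrev StateFun (K : Type*) (m : ℕ) : Type _ :=
  ∀ e v : ℕ, RibbonGraph e v m → (Fin e → Option Bool) → K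

variable {K : Type*} [Field K] {m : ℕ}

/-- A function transforms under isomorphisms by the sign of the isomorphism and the sign with which it
acts on the dead edges. -/
def Equivariant (d : ℤ) (f : StateFun K m) : Prop :=
  ∀ ⦃e v : ℕ⦄ (Γ Γ' : RibbonGraph e v m) (φ : Iso Flavour.ribbon Γ Γ') (s : Fin e → Option Bool),
    f e v Γ' (stateMap φ.edge φ.rev s) = (φ.sgn d * deadSign φ.edge φ.rev s) • f e v Γ s

open Classical in
/-- The differential dual to the splitting of vertices, where the new edge is directed. -/
noncomputable def splitDiff (g : ℕ) : StateFun K m →ₗ[K] StateFun K m where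
  toFun f e v Γ s := if Admissible g Γ s then
    ∑ p : Γ.CornerPair, f (e + 1) (v + 1) (Γ.split p) (Fin.cons (some false) s) else 0
  map_add' f f' := by
    funext e v Γ s
    simp only [Pi.add_apply]
    split_ifs
    · exact Finset.sum_add_distrib
    · rw [add_zero]
  map_smul' c f := by
    funext e v Γ s
    simp only [Pi.smul_apply, RingHom.id_apply]
    split_ifs
    · exact Finset.smul_sum.symm
    · rw [smul_zero]

open Classical in
/-- The differential dual to the revival of dead edges. -/
noncomputable def killDiff (g : ℕ) : StateFun K m →ₗ[K] StateFun K m where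
  toFun f e v Γ s := if Admissible g Γ s then ((-1) ^ e : ℤˣ) • kill (f e v Γ) s else 0
  map_add' f f' := by
    funext e v Γ s
    simp only [Pi.add_apply]
    split_ifs
    · rw [← smul_add, ← kill_add]
      rfl
    · rw [add_zero]
  map_smul' c f := by
    funext e v Γ s
    simp only [Pi.smul_apply, RingHom.id_apply]
    split_ifs
    · rw [smul_comm, ← kill_smul]
      rfl
    · rw [smul_zero]

section

variable {g : ℕ} {Γ : RibbonGraph e v m} {s : Fin e → Option Bool}

theorem splitDiff_of (h : Admissible g Γ s) (f : StateFun K m) : splitDiff g f e v Γ s =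
    ∑ p : Γ.CornerPair, f (e + 1) (v + 1) (Γ.split p) (Fin.cons (some false) s) := if_pos h

theorem splitDiff_not (h : ¬ Admissible g Γ s) (f : StateFun K m) : splitDiff g f e v Γ s = 0 :=
  if_neg h

theorem killDiff_of (h : Admissible g Γ s) (f : StateFun K m) :
    killDiff g f e v Γ s = ((-1) ^ e : ℤˣ) • kill (f e v Γ) s := if_pos h

theorem killDiff_not (h : ¬ Admissible g Γ s) (f : StateFun K m) : killDiff g f e v Γ s = 0 :=
  if_neg h

end

variable {d : ℤ}

theorem Equivariant.splitDiff {f : StateFun K m} (hf : Equivariant d f) (g : ℕ) :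
    Equivariant d (splitDiff g f) := by
  intro e v Γ Γ' φ s
  by_cases h : Admissible g Γ s
  · rw [splitDiff_of h, splitDiff_of (h.of_iso φ), ← Equiv.sum_comp φ.mapPair, Finset.smul_sum]
    refine Finset.sum_congr rfl fun p _ => ?_
    obtain ⟨ψ, h1, h2, h3⟩ := φ.exists_extend p
    have := hf _ _ ψ (Fin.cons (some false) s)
    rwa [sgn_extend ψ φ h1 h2 h3, h1, h2, stateMap_extend, deadSign_extend] at this
  · rw [splitDiff_not h, splitDiff_not (mt (admissible_iff_of_iso φ).1 h), smul_zero]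

theorem Equivariant.killDiff {f : StateFun K m} (hf : Equivariant d f) (g : ℕ) :
    Equivariant d (killDiff g f) := by
  intro e v Γ Γ' φ s
  by_cases h : Admissible g Γ s
  · rw [killDiff_of h, killDiff_of (h.of_iso φ), smul_comm]
    congr 1
    have h1 := kill_stateMap φ.edge φ.rev (f e v Γ') s
    have h2 : ∀ t, deadSign φ.edge φ.rev t • f e v Γ' (stateMap φ.edge φ.rev t) =
        φ.sgn d • f e v Γ t := fun t => by
      rw [hf _ _ φ, smul_smul, mul_left_comm, Int.units_mul_self, mul_one]
    simp only [h2] at h1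
    rw [kill_units] at h1
    rw [mul_comm, mul_smul, h1, smul_smul, Int.units_mul_self, one_smul]
  · rw [killDiff_not h, killDiff_not (mt (admissible_iff_of_iso φ).1 h), smul_zero]

theorem stateMap_rev (o : Option Bool) (s : Fin e → Option Bool) :
    stateMap (Equiv.refl _) (Fin.cons true fun _ => false : Fin (e + 1) → Bool) (Fin.cons o s) =
      Fin.cons (o.map not) s := by
  funext i
  refine Fin.cases ?_ (fun i => ?_) i
  · rcases o with _ | b <;> simp [stateMap]
  · rcases h : s i with _ | b <;> simp [stateMap, h]

theorem deadSign_rev (o : Option Bool) (s : Fin e → Option Bool) :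
    deadSign (Equiv.refl _) (Fin.cons true fun _ => false : Fin (e + 1) → Bool) (Fin.cons o s) =
      if o = none then -1 else 1 := by
  rw [deadSign_refl, Fin.prod_univ_succ]
  simp

theorem Equivariant.split_swap {f : StateFun K m} (hf : Equivariant d f) (Γ : RibbonGraph e v m)
    (p : Γ.CornerPair) (o : Option Bool) (s : Fin e → Option Bool) :
    f _ _ (Γ.split (CornerPair.swap p)) (Fin.cons (o.map not) s) =
      (if o = none then -1 else 1 : ℤˣ) • f _ _ (Γ.split p) (Fin.cons o s) := by
  obtain ⟨ψ, h1, h2, h3⟩ := exists_flipIso Γ p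
  have := hf _ _ ψ (Fin.cons o s)
  rwa [h3, h1, h2, stateMap_rev, deadSign_rev, one_mul] at this

theorem Equivariant.sum_split_true {f : StateFun K m} (hf : Equivariant d f)
    (Γ : RibbonGraph e v m) (s : Fin e → Option Bool) :
    ∑ p : Γ.CornerPair, f _ _ (Γ.split p) (Fin.cons (some true) s) =
      ∑ p : Γ.CornerPair, f _ _ (Γ.split p) (Fin.cons (some false) s) := by
  rw [← Equiv.sum_comp CornerPair.swap]
  refine Finset.sum_congr rfl fun p _ => ?_
  have := hf.split_swap Γ p (some false) s
  simpa using this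

theorem Equivariant.sum_split_none [CharZero K] {f : StateFun K m} (hf : Equivariant d f)
    (Γ : RibbonGraph e v m) (s : Fin e → Option Bool) :
    ∑ p : Γ.CornerPair, f _ _ (Γ.split p) (Fin.cons none s) = 0 := by
  refine self_eq_neg.1 ?_
  rw [← Finset.sum_neg_distrib, ← Equiv.sum_comp CornerPair.swap]
  refine Finset.sum_congr rfl fun p _ => ?_
  have := hf.split_swap Γ p none s
  simpa [Units.smul_def] using this

theorem Equivariant.swap {f : StateFun K m} (hf : Equivariant d f)
    (Γ : RibbonGraph e v m) (p : Γ.CornerPair) (q : (Γ.split p).CornerPair)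
    (s : Fin e → Option Bool) (o : Bool) :
    f _ _ (Γ.split₂ (Γ.swapFst p q) (Γ.swapSnd p q)) (Fin.cons (some o) (Fin.cons (some o) s)) =
      -f _ _ (Γ.split₂ p q) (Fin.cons (some o) (Fin.cons (some o) s)) := by
  obtain ⟨ψ, h1, h2, h3⟩ := exists_swapIso (F := Flavour.ribbon) Γ p q
  have := hf _ _ ψ (Fin.cons (some o) (Fin.cons (some o) s))
  rw [h3, h1, h2, stateMap_swap, deadSign_swap] at this
  simpa [Units.smul_def] using this

theorem splitDiff_splitDiff [CharZero K] {f : StateFun K m} (hf : Equivariant d f) (g : ℕ) :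
    splitDiff g (splitDiff g f) = 0 := by
  funext e v Γ s
  by_cases h : Admissible g Γ s
  · rw [splitDiff_of h]
    simp only [fun p : Γ.CornerPair => splitDiff_of (h.split p false) f]
    refine self_eq_neg.1 ?_
    rw [Finset.sum_sigma', Finset.univ_sigma_univ, ← Finset.sum_neg_distrib,
      ← Equiv.sum_comp (Function.Involutive.toPerm Γ.swapPair Γ.swapPair_swapPair)]
    exact Finset.sum_congr rfl fun t _ => hf.swap Γ t.1 t.2 s false
  · rw [splitDiff_not h]
    rfl

theorem killDiff_killDiff (g : ℕ) (f : StateFun K m) : killDiff g (killDiff g f) = 0 := by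
  funext e v Γ s
  by_cases h : Admissible g Γ s
  · rw [killDiff_of h, kill_congr (g := fun t => ((-1) ^ e : ℤˣ) • kill (f e v Γ) t)
      fun i _ => killDiff_of (h.update i) f, kill_units, kill_kill, smul_zero, smul_zero]
    rfl
  · rw [killDiff_not h]
    rfl

theorem splitDiff_killDiff [CharZero K] {f : StateFun K m} (hf : Equivariant d f) (g : ℕ) :
    splitDiff g (killDiff g f) + killDiff g (splitDiff g f) = 0 := by
  funext e v Γ s
  simp only [Pi.add_apply, Pi.zero_apply]
  by_cases h : Admissible g Γ s
  · rw [splitDiff_of h, killDiff_of h, kill_congr (g := fun t => ∑ p : Γ.CornerPair,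
      f (e + 1) (v + 1) (Γ.split p) (Fin.cons (some false) t))
      fun i _ => splitDiff_of (h.update i) f,
      kill_sum Finset.univ fun (p : Γ.CornerPair) t =>
        f (e + 1) (v + 1) (Γ.split p) (Fin.cons (some false) t)]
    simp only [fun p : Γ.CornerPair => killDiff_of (h.split p false) f, kill_cons_some]
    rw [← Finset.smul_sum, Finset.sum_add_distrib, ← Finset.smul_sum, hf.sum_split_none, smul_zero,
      zero_add, pow_succ, mul_neg_one, Units.neg_smul, neg_add_cancel]
  · rw [splitDiff_not h, killDiff_not h, add_zero]

/-- The functions of degree `k` that are supported on the admissible states with `c` dead edges. -/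
def stateCochains (K : Type*) [Field K] (m : ℕ) (d : ℤ) (g c : ℕ) (k : ℤ) :
    Submodule K (StateFun K m) where
  carrier := {f | Equivariant d f ∧ ∀ ⦃e v : ℕ⦄ (Γ : RibbonGraph e v m) (s : Fin e → Option Bool),
    f e v Γ s ≠ 0 → Admissible g Γ s ∧ deadCount s = c ∧ d * v + (1 - d) * e - d + c = k}
  add_mem' := by
    rintro f f' ⟨h1, h2⟩ ⟨h1', h2'⟩
    refine ⟨fun e v Γ Γ' φ s => ?_, fun e v Γ s hs => ?_⟩
    · simp only [Pi.add_apply, h1 Γ Γ' φ, h1' Γ Γ' φ, smul_add]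
    · by_cases h : f e v Γ s = 0
      · refine h2' Γ s fun h' => hs ?_
        simp only [Pi.add_apply, h, h', add_zero]
      · exact h2 Γ s h
  zero_mem' := ⟨fun e v Γ Γ' φ s => by simp, fun e v Γ s hs => absurd rfl hs⟩
  smul_mem' := by
    rintro a f ⟨h1, h2⟩
    refine ⟨fun e v Γ Γ' φ s => ?_, fun e v Γ s hs => h2 Γ s fun h => hs ?_⟩
    · simp only [Pi.smul_apply, h1 Γ Γ' φ, smul_comm a]
    · simp only [Pi.smul_apply, h, smul_zero]

section

variable {g c : ℕ} {k : ℤ} {f : StateFun K m}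

theorem splitDiff_mem (hf : f ∈ stateCochains K m d g c (k + 1)) :
    splitDiff g f ∈ stateCochains K m d g c k := by
  refine ⟨hf.1.splitDiff g, fun e v Γ s hs => ?_⟩
  by_cases h : Admissible g Γ s
  · rw [splitDiff_of h] at hs
    obtain ⟨p, -, hp⟩ := Finset.exists_ne_zero_of_sum_ne_zero hs
    obtain ⟨-, h1, h2⟩ := hf.2 _ _ hp
    rw [deadCount_cons_some] at h1
    refine ⟨h, h1, ?_⟩
    push_cast at h2
    linarith
  · exact absurd (splitDiff_not h f) hs

theorem exists_of_kill_ne_zero {n : ℕ} {M : Type*} [AddCommGroup M]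
    {f : (Fin n → Option Bool) → M} {s : Fin n → Option Bool} (h : kill f s ≠ 0) :
    ∃ i, s i ≠ none ∧ f (Function.update s i none) ≠ 0 := by
  by_contra hcon
  push Not at hcon
  exact h ((kill_congr (g := fun _ => 0) hcon).trans (kill_zero s))

theorem killDiff_mem (hf : f ∈ stateCochains K m d g (c + 1) (k + 1)) :
    killDiff g f ∈ stateCochains K m d g c k := by
  refine ⟨hf.1.killDiff g, fun e v Γ s hs => ?_⟩
  by_cases h : Admissible g Γ s
  · rw [killDiff_of h] at hs
    obtain ⟨i, hi, hp⟩ := exists_of_kill_ne_zero (fun h0 => hs (by rw [h0, smul_zero]))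
    obtain ⟨-, h1, h2⟩ := hf.2 _ _ hp
    rw [deadCount_update hi] at h1
    refine ⟨h, by omega, ?_⟩
    push_cast at h2
    linarith
  · exact absurd (killDiff_not h f) hs

theorem killDiff_zero (hf : f ∈ stateCochains K m d g 0 k) : killDiff g f = 0 := by
  funext e v Γ s
  by_cases h : Admissible g Γ s
  · rw [killDiff_of h]
    by_contra hs
    obtain ⟨i, hi, hp⟩ := exists_of_kill_ne_zero (fun h0 => hs (by rw [h0, smul_zero]; rfl))
    have h1 := (hf.2 _ _ hp).2.1
    rw [deadCount_update hi] at h1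
    omega
  · exact killDiff_not h f

end

end functions

end RibbonGraph

/-! ### Bivalent vertices -/

namespace HalfEdge

variable {e : ℕ}

/-- The half-edges of a graph, as half-edges of the graph with a new bivalent vertex on the edge of `y`,
at which the new head and `y` meet: the new tail takes the place of `y`. -/
def graft (y h : HalfEdge e) : HalfEdge (e + 1) := if h = y then newTail else old h

theorem graft_self (y : HalfEdge e) : graft y y = newTail := if_pos rfl

theorem graft_of_ne {y h : HalfEdge e} (hh : h ≠ y) : graft y h = old h := if_neg hh

theorem graft_ne_head (y h : HalfEdge e) : graft y h ≠ newHead := by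
  unfold graft
  split_ifs
  · exact tail_ne_head
  · exact old_ne_head _

theorem graft_ne_old (y h : HalfEdge e) : graft y h ≠ old y := by
  unfold graft
  split_ifs with hh
  · exact tail_ne_old _
  · simpa using hh

theorem corner_graft (x y h : HalfEdge e) : corner x y (graft y h) = h := by
  unfold graft
  split_ifs with hh
  · exact hh.symm
  · rfl

theorem graft_injective (y : HalfEdge e) : Function.Injective (graft y) := fun h h' hh => by
  rw [← corner_graft y y h, hh, corner_graft]

theorem graft_corner (x : HalfEdge e) {y : HalfEdge e} {k : HalfEdge (e + 1)} (h1 : k ≠ newHead)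
    (h2 : k ≠ old y) : graft y (corner x y k) = k := by
  rcases eq_new_or_old k with rfl | rfl | ⟨k, rfl⟩
  · exact graft_self y
  · exact absurd rfl h1
  · exact graft_of_ne fun h => h2 (congrArg old h)

end HalfEdge

namespace RibbonGraph

variable {e v m : ℕ}

section remove

/-- Every permutation of the half-edges belongs to a ribbon graph. -/
theorem exists_rot_eq (σ : Equiv.Perm (HalfEdge e)) :
    ∃ (v m : ℕ) (Γ : RibbonGraph e v m), Γ.rot = σ := by
  have key : ∀ τ : Equiv.Perm (HalfEdge e), ∃ (n : ℕ) (c : HalfEdge e → Fin n),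
      Function.Surjective c ∧ ∀ h h', c h = c h' ↔ τ.SameCycle h h' := fun τ => by
    obtain ⟨n, ⟨q⟩⟩ := Finite.exists_equiv_fin (Quotient (Equiv.Perm.SameCycle.setoid τ))
    refine ⟨n, fun h => q (Quotient.mk _ h), q.surjective.comp Quotient.mk_surjective,
      fun h h' => ?_⟩
    rw [q.apply_eq_iff_eq]
    exact Quotient.eq
  obtain ⟨v, a, ha, ha'⟩ := key σ
  obtain ⟨m, b, hb, hb'⟩ := key (σ⁻¹ * flipEdge e)
  exact ⟨v, m, ⟨σ, a, b, ha, ha', hb, hb'⟩, rfl⟩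

theorem exists_rot_removed (R : Equiv.Perm (HalfEdge (e + 1))) (y : HalfEdge e)
    (h1 : R newHead = old y) (h2 : R (old y) = newHead) :
    ∃ σ : Equiv.Perm (HalfEdge e), ∀ h, R (graft y h) = graft y (σ h) := by
  have h1' : R⁻¹ (old y) = newHead := by rw [Equiv.Perm.inv_eq_iff_eq, h1]
  have h2' : R⁻¹ newHead = old y := by rw [Equiv.Perm.inv_eq_iff_eq, h2]
  have key : ∀ S : Equiv.Perm (HalfEdge (e + 1)), S⁻¹ newHead = old y → S⁻¹ (old y) = newHead →
      ∀ h, graft y (corner y y (S (graft y h))) = S (graft y h) := fun S hS hS' h =>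
    graft_corner y
      (fun h0 => graft_ne_old y h (by rw [← hS, ← h0]; exact (S.symm_apply_apply _).symm))
      (fun h0 => graft_ne_head y h (by rw [← hS', ← h0]; exact (S.symm_apply_apply _).symm))
  have hR := key R h2' h1'
  have hR' := key R⁻¹ (by rwa [inv_inv]) (by rwa [inv_inv])
  refine ⟨⟨fun h => corner y y (R (graft y h)), fun h => corner y y (R⁻¹ (graft y h)),
    fun h => ?_, fun h => ?_⟩, fun h => (hR h).symm⟩
  · change corner y y (R⁻¹ (graft y (corner y y (R (graft y h))))) = h
    rw [hR, show R⁻¹ (R (graft y h)) = graft y h from R.symm_apply_apply _, corner_graft]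
  · change corner y y (R (graft y (corner y y (R⁻¹ (graft y h))))) = h
    rw [hR', show R (R⁻¹ (graft y h)) = graft y h from R.apply_symm_apply _, corner_graft]

/-- A bivalent vertex, at which an edge ends, can be removed together with this edge, unless the other
end of the edge is a univalent vertex. -/
theorem exists_split_eq (Γ' : RibbonGraph (e + 1) (v + 1) m) (y : HalfEdge e)
    (h1 : Γ'.rot newHead = old y) (h2 : Γ'.rot (old y) = newHead) (h3 : Γ'.rot newTail ≠ newTail)
    (h4 : Γ'.vert newHead = 0) :
    ∃ (Γ : RibbonGraph e v m) (p : Γ.CornerPair), Γ.rot p.1.1 = p.1.2 ∧ p.1.2 = y ∧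
      Γ.split p = Γ' := by
  obtain ⟨σ, hσ⟩ := exists_rot_removed Γ'.rot y h1 h2
  set x := σ⁻¹ y with hx
  have hxy : σ x = y := σ.apply_symm_apply y
  have hne : x ≠ y := fun h => h3 (by rw [← graft_self y, hσ, ← h, hxy, h])
  have hrot : splitRot σ x y hne = Γ'.rot := by
    refine Equiv.ext (rec_on ?_ ?_ fun h => ?_)
    · rw [splitRot_tail, ← graft_self y, hσ, graft_of_ne]
      exact fun h => hne (σ.injective (hxy.trans h.symm))
    · rw [splitRot_head, hxy, h1]
    · rw [splitRot_old]
      split_ifs with ha hb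
      · rw [ha, ← graft_of_ne hne, hσ, hxy, graft_self]
      · rw [hb, h2]
      · rw [← graft_of_ne hb, hσ, graft_of_ne]
        exact fun h => ha (σ.injective (h.trans hxy.symm))
  have hcyc : σ.SameCycle x y := by
    rw [← hxy]
    exact Equiv.Perm.sameCycle_apply_right.2 (Equiv.Perm.SameCycle.refl _ _)
  have hvert : ∀ k, Γ'.vert k = 0 ↔ k = newHead ∨ k = old y := fun k => by
    rw [← h4, Γ'.vert_eq_iff, Equiv.Perm.sameCycle_comm]
    refine ⟨fun h => sameCycle_of_closed _ (fun k => k = newHead ∨ k = old y) ?_ h (Or.inl rfl), ?_⟩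
    · rintro k (rfl | rfl)
      · exact Or.inr h1
      · exact Or.inl h2
    · rintro (rfl | rfl)
      · exact Equiv.Perm.SameCycle.refl _ _
      · rw [← h1]
        exact Equiv.Perm.sameCycle_apply_right.2 (Equiv.Perm.SameCycle.refl _ _)
  have hgv : ∀ h, Γ'.vert (graft y h) ≠ 0 := fun h h0 =>
    ((hvert _).1 h0).elim (graft_ne_head y h) (graft_ne_old y h)
  have hpow : ∀ (n : ℕ) h, (Γ'.rot ^ n) (graft y h) = graft y ((σ ^ n) h) := fun n => by
    induction n with
    | zero => exact fun _ => rfl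
    | succ n ih =>
      intro h
      rw [pow_succ, pow_succ, Equiv.Perm.mul_apply, Equiv.Perm.mul_apply, hσ, ih]
  have hbt : Γ'.bdry newTail = Γ'.bdry (old y) := by
    rw [Γ'.bdry_eq_iff, ← (inv_mul_eq_iff Γ'.rot (flipEdge (e + 1)) newTail (old y)).2 h2]
    exact Equiv.Perm.sameCycle_apply_right.2 (Equiv.Perm.SameCycle.refl _ _)
  have hbh : Γ'.bdry newHead = Γ'.bdry (old x) := by
    rw [Γ'.bdry_eq_iff, ← (inv_mul_eq_iff Γ'.rot (flipEdge (e + 1)) newHead (old x)).2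
      (by rw [← hrot, splitRot_left]; rfl)]
    exact Equiv.Perm.sameCycle_apply_right.2 (Equiv.Perm.SameCycle.refl _ _)
  -- the condition on the boundaries does not depend on their labels
  obtain ⟨v₁, m₁, Δ, hΔ⟩ := exists_rot_eq σ
  have hbdry : ∀ h h', Γ'.bdry (old h) = Γ'.bdry (old h') ↔
      (σ⁻¹ * flipEdge e).SameCycle h h' := fun h h' => by
    subst hΔ
    have := Δ.bdrySplit_eq_iff ⟨(x, y), hne, (Δ.vert_eq_iff _ _).2 hcyc⟩ (old h) (old h')
    rw [Γ'.bdry_eq_iff, ← Δ.bdry_eq_iff, ← hrot]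
    exact this.symm
  let Γ : RibbonGraph e v m :=
    { rot := σ
      vert := fun h => (Γ'.vert (graft y h)).pred (hgv h)
      bdry := fun h => Γ'.bdry (old h)
      vert_surj := fun w => by
        obtain ⟨k, hk⟩ := Γ'.vert_surj w.succ
        have h0 : Γ'.vert k ≠ 0 := hk ▸ Fin.succ_ne_zero w
        rw [Ne, hvert, not_or] at h0
        refine ⟨corner y y k, ?_⟩
        simp only [graft_corner y h0.1 h0.2, hk, Fin.pred_succ]
      vert_eq_iff := fun h h' => by
        rw [Fin.pred_inj, Γ'.vert_eq_iff]
        constructor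
        · intro hh
          obtain ⟨n, hn⟩ := hh.exists_nat_pow_eq
          rw [hpow] at hn
          exact ⟨n, by exact_mod_cast graft_injective y hn⟩
        · intro hh
          obtain ⟨n, hn⟩ := hh.exists_nat_pow_eq
          exact ⟨n, by rw [← hn, ← hpow]; rfl⟩
      bdry_surj := fun b => by
        obtain ⟨k, rfl⟩ := Γ'.bdry_surj b
        rcases eq_new_or_old k with rfl | rfl | ⟨k, rfl⟩
        · exact ⟨y, hbt.symm⟩
        · exact ⟨x, hbh.symm⟩
        · exact ⟨k, rfl⟩
      bdry_eq_iff := hbdry }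
  have hΓv : ∀ h, (Γ.vert h).succ = Γ'.vert (graft y h) := fun h => Fin.succ_pred _ (hgv h)
  refine ⟨Γ, ⟨(x, y), hne, (Γ.vert_eq_iff _ _).2 hcyc⟩, hxy, rfl, ext_of hrot ?_ ?_⟩
  · funext k
    have hk : (splitRot σ x y hne).SameCycle k newHead ↔ Γ'.vert k = 0 := by
      rw [hrot, ← h4, Γ'.vert_eq_iff]
    change vertSplit _ _ k = _
    by_cases h0 : Γ'.vert k = 0
    · rw [h0, vertSplit_eq_zero]
      exact hk.2 h0
    · rw [vertSplit_of _ _ fun h => h0 (hk.1 h), hΓv]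
      rw [hvert, not_or] at h0
      exact congrArg _ (graft_corner x h0.1 h0.2)
  · funext k
    rcases eq_new_or_old k with rfl | rfl | ⟨k, rfl⟩
    · exact hbt.symm
    · exact hbh.symm
    · rfl

end remove

section descend

variable {Γ₀ Γ₁ : RibbonGraph e v m}

/-- An isomorphism that respects the removed vertices descends. -/
theorem exists_descend {p₀ : Γ₀.CornerPair} {p₁ : Γ₁.CornerPair} (h₀ : Γ₀.rot p₀.1.1 = p₀.1.2)
    (h₁ : Γ₁.rot p₁.1.1 = p₁.1.2) (χ : Iso Flavour.ribbon (Γ₀.split p₀) (Γ₁.split p₁))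
    (hχ : χ.half (old p₀.1.2) = old p₁.1.2) :
    ∃ ψ : Iso Flavour.ribbon Γ₀ Γ₁, χ.edge = extendPerm ψ.edge ∧
      χ.rev = (Fin.cons false ψ.rev : Fin (e + 1) → Bool) ∧ χ.vertex = extendPerm ψ.vertex := by
  have hr₀ : ∀ k, (Γ₀.split p₀).rot k = splitRot Γ₀.rot p₀.1.1 p₀.1.2 p₀.2.1 k := fun _ => rfl
  have hr₁ : ∀ k, (Γ₁.split p₁).rot k = splitRot Γ₁.rot p₁.1.1 p₁.1.2 p₁.2.1 k := fun _ => rfl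
  have hhead : χ.half newHead = newHead := by
    have := χ.rot_half (old p₀.1.2)
    rw [hχ, hr₀, hr₁, splitRot_right, splitRot_right] at this
    exact this.symm
  have htail : χ.half newTail = newTail := by
    rw [← flipEdge_head, χ.half_flip, hhead]
  have he0 : χ.edge 0 = 0 := congrArg Prod.fst hhead
  have hv0 : χ.rev 0 = false := by
    have := congrArg Prod.snd htail
    simpa [newTail] using this
  obtain ⟨ε, hε⟩ : ∃ ε, χ.edge = extendPerm ε := by
    refine ⟨(Equiv.Perm.decomposeFin χ.edge).2, ?_⟩
    rw [extendPerm, Equiv.eq_symm_apply]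
    refine Prod.ext ?_ rfl
    change _ = (0 : Fin (e + 1))
    have h := Equiv.Perm.decomposeFin_symm_apply_zero (Equiv.Perm.decomposeFin χ.edge).1
      (Equiv.Perm.decomposeFin χ.edge).2
    rw [Prod.mk.eta, Equiv.symm_apply_apply, he0] at h
    exact h.symm
  obtain ⟨r, hr⟩ : ∃ r, χ.rev = (Fin.cons false r : Fin (e + 1) → Bool) :=
    ⟨Fin.tail χ.rev, by rw [← hv0, Fin.cons_self_tail]⟩
  have hold : ∀ h, χ.half (old h) = old (relabel ε r h) := fun h => by
    rw [Iso.half, hε, hr, relabel_extend_old]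
  have hy : relabel ε r p₀.1.2 = p₁.1.2 := old_injective (by rw [← hold, hχ])
  have hx : relabel ε r p₀.1.1 = p₁.1.1 := by
    have := χ.rot_half (old p₀.1.1)
    rw [hr₀, splitRot_left, htail, hr₁, ← splitRot_left Γ₁.rot p₁.1.1 p₁.1.2 p₁.2.1,
      (splitRot Γ₁.rot p₁.1.1 p₁.1.2 p₁.2.1).apply_eq_iff_eq, hold] at this
    exact old_injective this
  have hrot : ∀ h, Γ₁.rot (relabel ε r h) = relabel ε r (Γ₀.rot h) := fun h => by
    by_cases h1 : h = p₀.1.1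
    · rw [h1, hx, h₀, h₁, hy]
    · by_cases h2 : h = p₀.1.2
      · rw [h2, hy]
        have := χ.rot_half newTail
        rw [htail, hr₀, hr₁, splitRot_tail, splitRot_tail, hold] at this
        exact old_injective this
      · have := χ.rot_half (old h)
        rw [hold, hr₀, hr₁, splitRot_other _ _ _ _ h1 h2, splitRot_other, hold] at this
        · exact old_injective this
        · rw [← hx]
          exact fun h3 => h1 ((relabel ε r).injective h3)
        · rw [← hy]
          exact fun h3 => h2 ((relabel ε r).injective h3)
  obtain ⟨τ, hτ⟩ := Iso.exists_vertex ε r hrot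
  obtain ⟨ψ, hψ1, hψ2⟩ : ∃ ψ : Iso Flavour.ribbon Γ₀ Γ₁, ψ.edge = ε ∧ ψ.rev = r :=
    ⟨⟨ε, r, τ, fun hF => (by cases hF), hrot, hτ, fun h => by
      have := χ.map_bdry (old h)
      rw [show relabel χ.edge χ.rev (old h) = old (relabel ε r h) from hold h] at this
      exact this⟩, rfl, rfl⟩
  refine ⟨ψ, by rw [hψ1, hε], by rw [hψ2, hr], ?_⟩
  have hp : ψ.mapPair p₀ = p₁ := by
    subst hψ1 hψ2
    exact Subtype.ext (Prod.ext hx hy)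
  obtain ⟨ξ, hξ1, hξ2, hξ3⟩ : ∃ ξ : Iso Flavour.ribbon (Γ₀.split p₀) (Γ₁.split p₁),
      ξ.edge = extendPerm ψ.edge ∧ ξ.rev = (Fin.cons false ψ.rev : Fin (e + 1) → Bool) ∧
      ξ.vertex = extendPerm ψ.vertex := by
    rw [← hp]
    exact ψ.exists_extend p₀
  rw [← hξ3, Iso.vertex_unique (φ := χ) (ψ := ξ) (by rw [hε, hξ1, hψ1]) (by rw [hr, hξ2, hψ2])]

end descend

end RibbonGraph

/-! ### Exactness of the splitting differential in the presence of dead edges -/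

namespace RibbonGraph

variable {e v m : ℕ}

section twist

variable {Γ Γ' Γ'' : RibbonGraph e v m} (φ : Iso Flavour.ribbon Γ Γ') (d : ℤ)
  (s : Fin e → Option Bool)

/-- The image of a state under an isomorphism. -/
def Iso.state : Fin e → Option Bool := stateMap φ.edge φ.rev s

/-- The sign with which an isomorphism acts on a graph with a state. -/
def Iso.twist : ℤˣ := φ.sgn d * deadSign φ.edge φ.rev s

theorem Iso.state_trans (ψ : Iso Flavour.ribbon Γ' Γ'') :
    (φ.trans ψ).state s = ψ.state (φ.state s) := stateMap_trans _ _ _ _ _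

theorem Iso.twist_trans (ψ : Iso Flavour.ribbon Γ' Γ'') :
    (φ.trans ψ).twist d s = φ.twist d s * ψ.twist d (φ.state s) := by
  rw [twist, trans_sgn, show deadSign (φ.trans ψ).edge (φ.trans ψ).rev s =
    deadSign φ.edge φ.rev s * deadSign ψ.edge ψ.rev (φ.state s) from deadSign_trans _ _ _ _ _,
    twist, twist, mul_mul_mul_comm]

theorem Iso.twist_refl : (Iso.refl Flavour.ribbon Γ).twist d s = 1 := by
  rw [twist, refl_sgn, one_mul, show deadSign (Iso.refl Flavour.ribbon Γ).edge _ s = _ from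
    deadSign_refl _ _]
  exact Finset.prod_eq_one fun i _ => if_neg fun h => Bool.false_ne_true h.2

@[simp] theorem Iso.state_symm : φ.symm.state (φ.state s) = s := φ.stateMap_symm

theorem Iso.twist_symm : φ.symm.twist d (φ.state s) = φ.twist d s := by
  have h := φ.twist_trans d s φ.symm
  rw [φ.trans_symm, twist_refl] at h
  rw [← mul_right_inj (φ.twist d s), ← h, Int.units_mul_self]

theorem Iso.state_half (h : HalfEdge e) (b : Bool) :
    φ.state s (φ.half h).1 = some (xor b (φ.half h).2) ↔ s h.1 = some (xor b h.2) := by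
  rw [Iso.state, half_fst, stateMap_apply, half_snd]
  rcases s h.1 with _ | c
  · simp
  · rw [Option.map_some, Option.some_inj, Option.some_inj, Bool.xor_left_comm, Bool.xor_right_inj]

theorem Iso.state_dead (h : HalfEdge e) : φ.state s (φ.half h).1 = none ↔ s h.1 = none :=
  stateMap_eq_none _ _ _ _

variable {φ d s} in
theorem Equivariant.map {K : Type*} [Field K] {f : StateFun K m} (hf : Equivariant d f) :
    f e v Γ' (φ.state s) = φ.twist d s • f e v Γ s := hf Γ Γ' φ s

variable {d s} in
theorem Iso.twist_extend {Γ₁ Γ₁' : RibbonGraph (e + 1) (v + 1) m}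
    (ψ : Iso Flavour.ribbon Γ₁ Γ₁') (h1 : ψ.edge = extendPerm φ.edge)
    (h2 : ψ.rev = (Fin.cons false φ.rev : Fin (e + 1) → Bool))
    (h3 : ψ.vertex = extendPerm φ.vertex) (o : Option Bool) :
    ψ.state (Fin.cons o s) = Fin.cons o (φ.state s) ∧
      ψ.twist d (Fin.cons o s) = φ.twist d s := by
  rw [state, twist, sgn_extend ψ φ h1 h2 h3, h1, h2, stateMap_extend, deadSign_extend]
  exact ⟨rfl, rfl⟩

end twist

section insertion

variable {K : Type*} [Field K] {d : ℤ} {f : StateFun K m}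

/-- A presentation of a graph with a dead half-edge `z` as the graph that arises from the insertion of a
bivalent vertex next to the half-edge `z`. -/
structure Insertion (Γ' : RibbonGraph (e + 1) (v + 1) m) (s' : Fin (e + 1) → Option Bool)
    (z : HalfEdge (e + 1)) where
  /-- the graph without the bivalent vertex -/
  base : RibbonGraph e v m
  /-- its state -/
  state : Fin e → Option Bool
  /-- the corners on both sides of the half-edge -/
  pair : base.CornerPair
  adj : base.rot pair.1.1 = pair.1.2
  dead : state pair.1.2.1 = none
  /-- the identification with the given graph -/
  iso : Iso Flavour.ribbon (base.split pair) Γ'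
  map_state : iso.state (Fin.cons (some false) state) = s'
  map_half : iso.half (old pair.1.2) = z

namespace Insertion

variable {Γ' Γ'' : RibbonGraph (e + 1) (v + 1) m} {s' : Fin (e + 1) → Option Bool}
  {z : HalfEdge (e + 1)}

/-- The value of a function on the graph without the bivalent vertex. -/
noncomputable def value (D : Insertion Γ' s' z) (d : ℤ) (f : StateFun K m) : K :=
  D.iso.twist d (Fin.cons (some false) D.state) • f e v D.base D.state

/-- The value does not depend on the presentation. -/
theorem value_eq (hf : Equivariant d f) (D D' : Insertion Γ' s' z) :
    D.value d f = D'.value d f := by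
  have hχ : (D.iso.trans D'.iso.symm).half (old D.pair.1.2) = old D'.pair.1.2 := by
    rw [Iso.trans_half, D.map_half, Iso.symm_half, Equiv.symm_apply_eq, D'.map_half]
  obtain ⟨ψ, h1, h2, h3⟩ := exists_descend D.adj D'.adj _ hχ
  obtain ⟨h4, h5⟩ := ψ.twist_extend (d := d) (s := D.state) _ h1 h2 h3 (some false)
  have h6 : D'.iso.symm.state s' = Fin.cons (some false) D'.state :=
    (congrArg D'.iso.symm.state D'.map_state.symm).trans (Iso.state_symm _ _)
  rw [Iso.state_trans, D.map_state, h6] at h4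
  have h7 : D'.state = ψ.state D.state := (Fin.cons_right_injective _ h4)
  rw [Iso.twist_trans, D.map_state] at h5
  have h8 := D'.iso.twist_symm d (Fin.cons (some false) D'.state)
  rw [D'.map_state] at h8
  rw [h8] at h5
  have h9 : f e v D'.base D'.state = ψ.twist d D.state • f e v D.base D.state := by
    rw [h7]
    exact hf.map
  rw [value, value, h9, ← h5, smul_smul, mul_left_comm, Int.units_mul_self, mul_one]

/-- The transport of a presentation along an isomorphism. -/
noncomputable def map (D : Insertion Γ' s' z) (φ : Iso Flavour.ribbon Γ' Γ'') :
    Insertion Γ'' (φ.state s') (φ.half z) where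
  __ := D
  iso := D.iso.trans φ
  map_state := by rw [Iso.state_trans, D.map_state]
  map_half := by rw [Iso.trans_half, D.map_half]

theorem value_map (D : Insertion Γ' s' z) (φ : Iso Flavour.ribbon Γ' Γ'') :
    (D.map φ).value d f = φ.twist d s' • D.value d f := by
  have h := D.iso.twist_trans d (Fin.cons (some false) D.state) φ
  rw [D.map_state] at h
  rw [value, value, smul_smul, mul_comm (φ.twist d s'), ← h]
  rfl

theorem local_structure (D : Insertion Γ' s' z) : Γ'.rot z ≠ z ∧ Γ'.rot (Γ'.rot z) = z ∧
    s' (Γ'.rot z).1 = some (!(Γ'.rot z).2) ∧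
    Γ'.rot (flipEdge _ (Γ'.rot z)) ≠ flipEdge _ (Γ'.rot z) ∧ s' z.1 = none := by
  obtain ⟨B, t, p, hadj, hd, φ, rfl, rfl⟩ := D
  have h0 : ∀ k, (B.split p).rot k = splitRot B.rot p.1.1 p.1.2 p.2.1 k := fun _ => rfl
  have h1 : Γ'.rot (φ.half (old p.1.2)) = φ.half newHead := by
    rw [φ.rot_half, h0, splitRot_right]
  have h2 : B.rot p.1.2 ≠ p.1.2 := fun h => p.2.1 (B.rot.injective (hadj.trans h.symm))
  rw [h1]
  refine ⟨?_, ?_, ?_, ?_, ?_⟩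
  · rw [Ne, φ.half.apply_eq_iff_eq]
    exact head_ne_old _
  · rw [φ.rot_half, h0, splitRot_head, hadj]
  · have := φ.state_half (Fin.cons (some false) t) newHead true
    simpa using this.2 rfl
  · rw [← φ.half_flip, flipEdge_head, φ.rot_half, Ne, φ.half.apply_eq_iff_eq, h0,
      splitRot_tail]
    exact old_ne_tail _
  · exact (φ.state_dead (Fin.cons (some false) t) (old p.1.2)).2 hd

/-- A bivalent vertex at which a directed edge ends next to a dead half-edge was inserted there. -/
theorem nonempty_of (h2 : Γ'.rot (Γ'.rot z) = z) (h3 : s' (Γ'.rot z).1 = some (!(Γ'.rot z).2))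
    (h4 : Γ'.rot (flipEdge _ (Γ'.rot z)) ≠ flipEdge _ (Γ'.rot z)) (h5 : s' z.1 = none) :
    Nonempty (Insertion Γ' s' z) := by
  obtain ⟨Γ'', ψ, hψ1, hψ2⟩ : ∃ (Γ'' : RibbonGraph (e + 1) (v + 1) m)
      (ψ : Iso Flavour.ribbon Γ' Γ''), ψ.half (Γ'.rot z) = newHead ∧ Γ''.vert newHead = 0 := by
    have h : (Γ'.transportIso (Equiv.swap (Γ'.rot z).1 0) (fun _ => !(Γ'.rot z).2)
        (Equiv.swap (Γ'.vert (Γ'.rot z)) 0)).half (Γ'.rot z) = newHead := by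
      refine Prod.ext ?_ ?_
      · rw [Iso.half_fst]
        exact Equiv.swap_apply_left _ _
      · rw [Iso.half_snd]
        exact Bool.not_bne_self _
    refine ⟨_, _, h, ?_⟩
    rw [← h, Iso.vert_half]
    exact Equiv.swap_apply_left _ _
  have hz : (ψ.half z).1 ≠ 0 := fun h => by
    have h6 : ψ.edge z.1 = ψ.edge (Γ'.rot z).1 := h.trans (congrArg Prod.fst hψ1).symm
    rw [← ψ.edge.injective h6, h5] at h3
    cases h3
  obtain ⟨y, hy⟩ : ∃ y, ψ.half z = old y := by
    rcases eq_new_or_old (ψ.half z) with h | h | h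
    · exact absurd (congrArg Prod.fst h) hz
    · exact absurd (congrArg Prod.fst h) hz
    · exact h
  have hhead : Γ''.rot newHead = old y := by rw [← hψ1, ψ.rot_half, h2, hy]
  have hold : Γ''.rot (old y) = newHead := by rw [← hy, ψ.rot_half, hψ1]
  have htail : Γ''.rot newTail ≠ newTail := by
    rw [← flipEdge_head, ← hψ1, ← ψ.half_flip, ψ.rot_half, Ne, ψ.half.apply_eq_iff_eq]
    exact h4
  obtain ⟨Γ₀, p, hp1, rfl, rfl⟩ := exists_split_eq Γ'' y hhead hold htail hψ2
  have hs : ψ.state s' = Fin.cons (some false) (Fin.tail (ψ.state s')) := by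
    have h := (ψ.state_half s' (Γ'.rot z) true).2 (by simpa using h3)
    rw [hψ1] at h
    rw [← show ψ.state s' 0 = some false from h, Fin.cons_self_tail]
  refine ⟨⟨Γ₀, Fin.tail (ψ.state s'), p, hp1, ?_, ψ.symm, ?_, ?_⟩⟩
  · have h := (ψ.state_dead s' z).2 h5
    rwa [hy] at h
  · rw [← hs, Iso.state_symm]
  · rw [Iso.symm_half, ← hy, Equiv.symm_apply_apply]

end Insertion

open Classical in
/-- The value of a function on the graph that arises by the removal of a bivalent vertex next to a dead
half-edge, or zero if there is no such vertex. -/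
noncomputable def removal (d : ℤ) (f : StateFun K m) : ∀ {e v : ℕ}, RibbonGraph e v m →
    (Fin e → Option Bool) → HalfEdge e → K
  | 0, _, _, _, _ => 0
  | _ + 1, 0, _, _, _ => 0
  | _ + 1, _ + 1, Γ, s, z => if h : Nonempty (Insertion Γ s z) then h.some.value d f else 0

section

variable {Γ' : RibbonGraph (e + 1) (v + 1) m} {s' : Fin (e + 1) → Option Bool}
  {z : HalfEdge (e + 1)}

theorem removal_of (hf : Equivariant d f) (D : Insertion Γ' s' z) :
    removal d f Γ' s' z = D.value d f := by
  rw [removal, dif_pos ⟨D⟩]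
  exact Insertion.value_eq hf _ _

theorem removal_not (h : ¬ Nonempty (Insertion Γ' s' z)) : removal d f Γ' s' z = 0 := dif_neg h

theorem removal_map (hf : Equivariant d f) : ∀ {e v : ℕ} {Γ Γ' : RibbonGraph e v m}
    (φ : Iso Flavour.ribbon Γ Γ') (s : Fin e → Option Bool) (z : HalfEdge e),
    removal d f Γ' (φ.state s) (φ.half z) = φ.twist d s • removal d f Γ s z
  | 0, _, _, _, _, _, z => z.1.elim0
  | _ + 1, 0, Γ, _, _, _, z => (Γ.vert z).elim0
  | _ + 1, _ + 1, Γ, Γ', φ, s, z => by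
    by_cases h : Nonempty (Insertion Γ s z)
    · obtain ⟨D⟩ := h
      rw [removal_of hf D, removal_of hf (D.map φ), D.value_map]
    · rw [removal_not h, removal_not, smul_zero]
      rintro ⟨D⟩
      refine h ⟨?_⟩
      have := D.map φ.symm
      rwa [φ.state_symm, Iso.symm_half, Equiv.symm_apply_apply] at this

end

/-- The cut by which a bivalent vertex is inserted next to the half-edge `z`. -/
def adjacentPair (Γ : RibbonGraph e v m) (z : HalfEdge e) (hz : Γ.rot z ≠ z) : Γ.CornerPair :=
  ⟨(Γ.rot.symm z, z), fun h => hz (by rw [← Γ.rot.symm_apply_eq.1 h]), by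
    rw [Γ.vert_eq_iff]
    have h := Equiv.Perm.SameCycle.refl Γ.rot (Γ.rot.symm z)
    rwa [← Equiv.Perm.sameCycle_apply_right, Equiv.apply_symm_apply] at h⟩

theorem removal_adjacent (hf : Equivariant d f) (Γ : RibbonGraph e v m) {s : Fin e → Option Bool}
    {p : Γ.CornerPair} (hp : Γ.rot p.1.1 = p.1.2) (hs : s p.1.2.1 = none) :
    removal d f (Γ.split p) (Fin.cons (some false) s) (old p.1.2) = f e v Γ s := by
  rw [removal_of hf ⟨Γ, s, p, hp, hs, Iso.refl _ _, stateMap_refl _, by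
    simp [Iso.half, relabel_apply, Iso.refl]⟩, Insertion.value, Iso.twist_refl, one_smul]

theorem Insertion.of_split {Γ : RibbonGraph e v m} {s : Fin e → Option Bool} {z : HalfEdge e}
    {q : Γ.CornerPair} (D : Insertion (Γ.split q) (Fin.cons (some false) s) (old z)) :
    z ≠ q.1.1 ∧ (z = q.1.2 → Γ.rot q.1.1 = z) ∧ (z ≠ q.1.2 → Γ.rot z ≠ z ∧ Γ.rot (Γ.rot z) = z ∧
      s (Γ.rot z).1 = some (!(Γ.rot z).2) ∧
      Γ.rot (flipEdge _ (Γ.rot z)) ≠ flipEdge _ (Γ.rot z) ∧ s z.1 = none) := by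
  obtain ⟨h1, h2, h3, h4, h5⟩ := D.local_structure
  have h0 : ∀ k, (Γ.split q).rot k = splitRot Γ.rot q.1.1 q.1.2 q.2.1 k := fun _ => rfl
  have hx : z ≠ q.1.1 := by
    rintro rfl
    rw [h0, splitRot_left] at h3
    cases h3
  refine ⟨hx, ?_, fun hy => ?_⟩
  · rintro rfl
    rw [h0 (old _), splitRot_right, h0, splitRot_head] at h2
    exact old_injective h2
  · rw [h0 (old z), splitRot_other _ _ _ _ hx hy] at h1 h2 h3 h4
    have hx' : Γ.rot z ≠ q.1.1 := fun h => by
      rw [h, h0, splitRot_left] at h2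
      exact tail_ne_old _ h2
    have hy' : Γ.rot z ≠ q.1.2 := fun h => by
      rw [h, h0, splitRot_right] at h2
      exact head_ne_old _ h2
    rw [h0, splitRot_other _ _ _ _ hx' hy'] at h2
    refine ⟨fun h => h1 (congrArg old h), old_injective h2, h3, fun h => h4 ?_, h5⟩
    have hfix : ∀ k, Γ.vert k = Γ.vert (flipEdge e (Γ.rot z)) → k = flipEdge e (Γ.rot z) :=
      fun k hk => sameCycle_of_closed Γ.rot (fun k => k = flipEdge e (Γ.rot z))
        (fun k hk => by rw [hk, h]) ((Γ.vert_eq_iff _ _).1 hk.symm) rfl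
    have hqx : flipEdge e (Γ.rot z) ≠ q.1.1 := fun hq =>
      q.2.1 (hq.symm.trans (hfix _ (by rw [← q.2.2, hq])).symm)
    have hqy : flipEdge e (Γ.rot z) ≠ q.1.2 := fun hq =>
      q.2.1 ((hfix _ (by rw [q.2.2, hq])).trans hq)
    rw [flipEdge_old, h0, splitRot_other _ _ _ _ hqx hqy, h]

end insertion

end RibbonGraph

namespace RibbonGraph

variable {e v m : ℕ}

section adjacent

variable {Γ : RibbonGraph e v m} {p : Γ.CornerPair} {s : Fin e → Option Bool} {g : ℕ}

theorem split_rot_apply (p : Γ.CornerPair) (k : HalfEdge (e + 1)) :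
    (Γ.split p).rot k = splitRot Γ.rot p.1.1 p.1.2 p.2.1 k := rfl

theorem vert_split_eq_zero (hp : Γ.rot p.1.1 = p.1.2) (k : HalfEdge (e + 1)) :
    (Γ.split p).vert k = 0 ↔ k = newHead ∨ k = old p.1.2 := by
  refine (Γ.vertSplit_eq_zero p).trans ⟨fun h => ?_, ?_⟩
  · refine sameCycle_of_closed _ (fun k => k = newHead ∨ k = old p.1.2) ?_ h.symm (Or.inl rfl)
    rintro k (rfl | rfl)
    · exact Or.inr (by rw [splitRot_head, hp])
    · exact Or.inl (splitRot_right _ _ _ _)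
  · rintro (rfl | rfl)
    · exact Equiv.Perm.SameCycle.refl _ _
    · exact sameCycle_head_right _ _ _ _

theorem vert_split_of_ne {k : HalfEdge (e + 1)} (hk : (Γ.split p).vert k ≠ 0) :
    (Γ.split p).vert k = (Γ.vert (corner p.1.1 p.1.2 k)).succ :=
  Γ.vertSplit_of p fun h => hk ((Γ.vertSplit_eq_zero p).2 h)

theorem vert_split_graft (hp : Γ.rot p.1.1 = p.1.2) (h : HalfEdge e) :
    (Γ.split p).vert (graft p.1.2 h) = (Γ.vert h).succ := by
  rw [vert_split_of_ne, corner_graft]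
  rw [Ne, vert_split_eq_zero hp, not_or]
  exact ⟨graft_ne_head _ _, graft_ne_old _ _⟩

theorem isConnected_of_split (h : (Γ.split p).IsConnected) : Γ.IsConnected := by
  intro w w'
  have key := h w.succ w'.succ
  suffices ∀ u u', Relation.ReflTransGen (fun u u' => ∃ h, (Γ.split p).vert h = u ∧
      (Γ.split p).vert (flipEdge (e + 1) h) = u') u u' → Relation.ReflTransGen
      (fun u u' => ∃ h, Γ.vert h = u ∧ Γ.vert (flipEdge e h) = u')
      (Γ.oldVertex p u) (Γ.oldVertex p u') from this _ _ key
  intro u u' huu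
  induction huu with
  | refl => exact .refl
  | tail _ hb ih =>
    obtain ⟨k, rfl, rfl⟩ := hb
    refine ih.trans ?_
    rw [oldVertex_vert, oldVertex_vert]
    rcases eq_new_or_old k with rfl | rfl | ⟨k, rfl⟩
    · rw [flipEdge_tail, corner_tail, corner_head, p.2.2]
    · rw [flipEdge_head, corner_tail, corner_head, p.2.2]
    · exact .single ⟨k, rfl, rfl⟩

theorem trivalent_of_split (hp : Γ.rot p.1.1 = p.1.2) (h : ∃ w, 3 ≤ (Γ.split p).valency w) :
    ∃ w, 3 ≤ Γ.valency w := by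
  obtain ⟨a, b, c, hab, hac, hbc, h1, h2⟩ := trivalent_iff.1 h
  by_cases h0 : (Γ.split p).vert a = 0
  · have ha := (vert_split_eq_zero hp a).1 h0
    have hb := (vert_split_eq_zero hp b).1 (h1 ▸ h0)
    have hc := (vert_split_eq_zero hp c).1 (h2 ▸ h0)
    rcases ha with ha | ha <;> rcases hb with hb | hb <;> rcases hc with hc | hc <;>
      simp_all
  · have hg : ∀ k, (Γ.split p).vert k ≠ 0 → graft p.1.2 (corner p.1.1 p.1.2 k) = k := fun k hk => by
      rw [Ne, vert_split_eq_zero hp, not_or] at hk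
      exact graft_corner _ hk.1 hk.2
    have hb := h1 ▸ h0
    have hc := h2 ▸ h0
    refine trivalent_iff.2 ⟨corner p.1.1 p.1.2 a, corner p.1.1 p.1.2 b, corner p.1.1 p.1.2 c,
      fun h => hab ?_, fun h => hac ?_, fun h => hbc ?_, ?_, ?_⟩
    · rw [← hg a h0, h, hg b hb]
    · rw [← hg a h0, h, hg c hc]
    · rw [← hg b hb, h, hg c hc]
    · rwa [vert_split_of_ne h0, vert_split_of_ne hb, Fin.succ_inj] at h1
    · rwa [vert_split_of_ne h0, vert_split_of_ne hc, Fin.succ_inj] at h2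

theorem acyclic_of_split (hp : Γ.rot p.1.1 = p.1.2) (hs : s p.1.2.1 = none) {o : Option Bool}
    (h : Acyclic (Γ.split p).vert (Fin.cons o s : Fin (e + 1) → Option Bool)) :
    Acyclic Γ.vert s := by
  have h1 := h.of_cons
  intro w hw
  refine h1 w.succ (Relation.TransGen.lift Fin.succ ?_ _ _ hw)
  rintro _ _ ⟨k, h2, rfl, rfl⟩
  have hne : ∀ k : HalfEdge e, s k.1 ≠ none → (Γ.split p).vert (old k) = (Γ.vert k).succ :=
    fun k hk => by
      rw [← vert_split_graft hp, graft_of_ne]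
      rintro rfl
      exact hk hs
  exact ⟨k, h2, hne k (by simp [h2]), hne _ (by simp [h2])⟩

theorem Admissible.of_split (hp : Γ.rot p.1.1 = p.1.2) (hs : s p.1.2.1 = none) {o : Option Bool}
    (h : Admissible g (Γ.split p) (Fin.cons o s)) : Admissible g Γ s :=
  ⟨isConnected_of_split h.connected, by have := h.genus; omega, trivalent_of_split hp h.trivalent,
    acyclic_of_split hp hs h.acyclic⟩

theorem rot_lift (hp : Γ.rot p.1.1 = p.1.2) {q : (Γ.split p).CornerPair}
    (h1 : q.1.1 ≠ old p.1.2) (h2 : q.1.2 ≠ old p.1.2) (h3 : q.1.1 ≠ newHead)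
    (h4 : q.1.2 ≠ newHead) :
    (Γ.split (Γ.swapFst p q)).rot (lift q.1.1 q.1.2 p.1.1) = old p.1.2 := by
  rw [split_rot_apply]
  have hne := p.2.1
  have hg : ∀ k, k ≠ newHead → k ≠ old p.1.2 → corner p.1.1 p.1.2 k = p.1.1 → k = old p.1.1 :=
    fun k h h' hk => by rw [← graft_corner p.1.1 h h', hk, graft_of_ne hne]
  unfold lift
  split_ifs with ha hb
  · rw [splitRot_head]
    change old (Γ.rot (corner p.1.1 p.1.2 q.1.1)) = _
    rw [← ha, corner_old, hp]
  · rw [splitRot_tail]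
    change old (Γ.rot (corner p.1.1 p.1.2 q.1.2)) = _
    rw [← hb, corner_old, hp]
  · rw [splitRot_other, hp]
    · exact fun h => ha (hg _ h3 h1 h.symm).symm
    · exact fun h => hb (hg _ h4 h2 h.symm).symm

end adjacent

section exactness

variable {K : Type*} [Field K] {d : ℤ} {f : StateFun K m} {g : ℕ}

theorem sum_removal_split {Γ : RibbonGraph e v m} {p : Γ.CornerPair} {s : Fin e → Option Bool}
    (hf : Equivariant d f) (h0 : splitDiff g f = 0) (hp : Γ.rot p.1.1 = p.1.2)
    (hs : s p.1.2.1 = none) (hA : Admissible g (Γ.split p) (Fin.cons (some false) s)) :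
    ∑ q : (Γ.split p).CornerPair, removal d f ((Γ.split p).split q)
      (Fin.cons (some false) (Fin.cons (some false) s : Fin (e + 1) → Option Bool))
      (old (old p.1.2)) = f _ _ (Γ.split p) (Fin.cons (some false) s) := by
  classical
  have hrn : (Γ.split p).rot newHead = old p.1.2 := by
    rw [split_rot_apply, splitRot_head, hp]
  rw [← Finset.sum_filter_add_sum_filter_not Finset.univ
    fun q : (Γ.split p).CornerPair => (Γ.split p).vert q.1.1 = 0]
  have h1 : ∀ q : (Γ.split p).CornerPair, (Γ.split p).vert q.1.1 ≠ 0 →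
      removal d f ((Γ.split p).split q)
        (Fin.cons (some false) (Fin.cons (some false) s : Fin (e + 1) → Option Bool))
        (old (old p.1.2)) = -f _ _ (Γ.split (Γ.swapFst p q)) (Fin.cons (some false) s) := by
    intro q hq
    have hq' : (Γ.split p).vert q.1.2 ≠ 0 := q.2.2 ▸ hq
    rw [Ne, vert_split_eq_zero hp, not_or] at hq hq'
    have hl : lift q.1.1 q.1.2 p.1.2 = old p.1.2 := by
      rw [lift, if_neg (Ne.symm hq.2), if_neg (Ne.symm hq'.2)]
    obtain ⟨ψ, hψ1, hψ2, hψ3⟩ := exists_swapIso (F := Flavour.ribbon) Γ p q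
    have hψs : ψ.state (Fin.cons (some false) (Fin.cons (some false) s : Fin (e + 1) → Option Bool)) =
        Fin.cons (some false) (Fin.cons (some false) s : Fin (e + 1) → Option Bool) := by
      rw [Iso.state, hψ1, hψ2, stateMap_swap]
    have hψt : ψ.twist d
        (Fin.cons (some false) (Fin.cons (some false) s : Fin (e + 1) → Option Bool)) = -1 := by
      rw [Iso.twist, hψ1, hψ2, hψ3, deadSign_swap]
      simp
    have hψh : ψ.half (old (old p.1.2)) = old (old p.1.2) := by
      rw [Iso.half, hψ1, hψ2]
      refine Prod.ext ?_ (by simp [relabel_apply])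
      change (swapNew e (old (old p.1.2))).1 = _
      rw [swapNew_old_old]
    have h2 := removal_map hf ψ
      (Fin.cons (some false) (Fin.cons (some false) s : Fin (e + 1) → Option Bool))
      (old (old p.1.2))
    have h3 := removal_adjacent hf (Γ.split (Γ.swapFst p q)) (s := Fin.cons (some false) s)
      (p := Γ.swapSnd p q) ((rot_lift hp hq.2 hq'.2 hq.1 hq'.1).trans hl.symm)
      (by
        change (Fin.cons (some false) s : Fin (e + 1) → Option Bool) (lift q.1.1 q.1.2 p.1.2).1 = none
        rw [hl]
        exact hs)
    rw [show (Γ.swapSnd p q).1.2 = old p.1.2 from hl] at h3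
    rw [hψs, hψt, hψh, h3] at h2
    rw [h2]
    simp [Units.smul_def]
  have h2 : ∑ q : (Γ.split p).CornerPair with ¬ (Γ.split p).vert q.1.1 = 0,
      removal d f ((Γ.split p).split q)
        (Fin.cons (some false) (Fin.cons (some false) s : Fin (e + 1) → Option Bool))
        (old (old p.1.2)) = 0 := by
    have h3 := splitDiff_of (hA.of_split hp hs) f
    rw [h0] at h3
    refine Eq.trans ?_ ((congrArg Neg.neg h3.symm).trans neg_zero)
    rw [← Finset.sum_neg_distrib]
    refine Finset.sum_bij' (fun q _ => Γ.swapFst p q)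
      (fun q _ => ⟨(graft p.1.2 q.1.1, graft p.1.2 q.1.2),
        fun h => q.2.1 (graft_injective _ h), by
          rw [vert_split_graft hp, vert_split_graft hp, q.2.2]⟩)
      (fun _ _ => Finset.mem_univ _) ?_ ?_ ?_ ?_
    · intro q _
      rw [Finset.mem_filter]
      refine ⟨Finset.mem_univ _, ?_⟩
      rw [vert_split_graft hp]
      exact Fin.succ_ne_zero _
    · intro q hq
      have hq := (Finset.mem_filter.1 hq).2
      have hq' : (Γ.split p).vert q.1.2 ≠ 0 := q.2.2 ▸ hq
      rw [vert_split_eq_zero hp, not_or] at hq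
      rw [Ne, vert_split_eq_zero hp, not_or] at hq'
      exact Subtype.ext (Prod.ext (graft_corner _ hq.1 hq.2) (graft_corner _ hq'.1 hq'.2))
    · intro q _
      exact Subtype.ext (Prod.ext (corner_graft _ _ _) (corner_graft _ _ _))
    · intro q hq
      exact h1 q (Finset.mem_filter.1 hq).2
  rw [h2, add_zero]
  have hz := vert_split_eq_zero hp
  have hv : (Γ.split p).vert newHead = (Γ.split p).vert (old p.1.2) := by
    rw [(hz _).2 (Or.inl rfl), (hz _).2 (Or.inr rfl)]
  rw [Finset.sum_eq_single_of_mem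
    (⟨(newHead, old p.1.2), head_ne_old _, hv⟩ : (Γ.split p).CornerPair)]
  · exact removal_adjacent hf (Γ.split p) (s := Fin.cons (some false) s)
      (p := ⟨(newHead, old p.1.2), head_ne_old _, hv⟩) hrn hs
  · rw [Finset.mem_filter]
    exact ⟨Finset.mem_univ _, (hz _).2 (Or.inl rfl)⟩
  · intro q hq hne
    have hq := (Finset.mem_filter.1 hq).2
    refine removal_not ?_
    rintro ⟨D⟩
    have h3 := D.of_split.1
    have h4 := ((hz _).1 hq).resolve_right h3.symm
    have h5 := ((hz _).1 (q.2.2.symm.trans hq)).resolve_left fun h => q.2.1 (h4.trans h.symm)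
    exact hne (Subtype.ext (Prod.ext h4 h5))

/-- The removal of bivalent vertices next to the dead half-edge `z` is a contracting homotopy for the
splitting differential. If there is already such a vertex in the graph, the splittings of the other
vertices commute with its removal, and their sum vanishes as the function is closed. -/
theorem sum_removal {Γ : RibbonGraph e v m} {s : Fin e → Option Bool} (hf : Equivariant d f)
    (h0 : splitDiff g f = 0) (hA : Admissible g Γ s) (z : HalfEdge e) (hz : s z.1 = none) :
    ∑ q : Γ.CornerPair, removal d f (Γ.split q) (Fin.cons (some false) s) (old z) =
      if Γ.rot z = z then 0 else f e v Γ s := by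
  obtain ⟨e, rfl⟩ : ∃ n, e = n + 1 := ⟨e - 1, by have := z.1.pos; omega⟩
  obtain ⟨v, rfl⟩ : ∃ n, v = n + 1 := ⟨v - 1, by have := (Γ.vert z).pos; omega⟩
  by_cases hI : Nonempty (Insertion Γ s z)
  · obtain ⟨D⟩ := hI
    rw [if_neg D.local_structure.1]
    obtain ⟨B, t, p, hp, hd, φ, rfl, rfl⟩ := D
    change Admissible g Γ (stateMap _ _ _) at hA
    rw [admissible_iff_of_iso] at hA
    rw [hf.map, ← sum_removal_split hf h0 hp hd hA, Finset.smul_sum, ← Equiv.sum_comp φ.mapPair]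
    refine Finset.sum_congr rfl fun q _ => ?_
    obtain ⟨ξ, h1, h2, h3⟩ := φ.exists_extend q
    obtain ⟨h4, h5⟩ := φ.twist_extend (d := d) (s := Fin.cons (some false) t) ξ h1 h2 h3 (some false)
    have h6 : ξ.half (old (old p.1.2)) = old (φ.half (old p.1.2)) := by
      rw [Iso.half, h1, h2, relabel_extend_old]
      rfl
    rw [← h5, ← removal_map hf, h4, h6]
  · have hq : ∀ q : Γ.CornerPair, removal d f (Γ.split q) (Fin.cons (some false) s) (old z) ≠ 0 →
        z = q.1.2 ∧ Γ.rot q.1.1 = z := fun q hq => by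
      by_contra hcon
      refine hq (removal_not ?_)
      rintro ⟨D⟩
      obtain ⟨-, h1, h2⟩ := D.of_split
      by_cases hy : z = q.1.2
      · exact hcon ⟨hy, h1 hy⟩
      · obtain ⟨-, h3, h4, h5, h6⟩ := h2 hy
        exact hI (Insertion.nonempty_of h3 h4 h5 h6)
    split_ifs with hr
    · refine Finset.sum_eq_zero fun q _ => ?_
      by_contra h
      obtain ⟨h1, h2⟩ := hq q h
      exact q.2.1 (Γ.rot.injective (by rw [h2, ← h1, hr]))
    · rw [Finset.sum_eq_single (adjacentPair Γ z hr)]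
      · exact removal_adjacent hf Γ (p := adjacentPair Γ z hr) (Γ.rot.apply_symm_apply z) hz
      · intro q _ hne
        by_contra h
        obtain ⟨h1, h2⟩ := hq q h
        exact hne (Subtype.ext (Prod.ext (Γ.rot.eq_symm_apply.2 h2) h1.symm))
      · exact fun h => absurd (Finset.mem_univ _) h

theorem sum_halfEdge {M : Type*} [AddCommMonoid M] (F : HalfEdge (e + 1) → M) :
    ∑ h, F h = F newTail + F newHead + ∑ h, F (old h) := by
  rw [Fintype.sum_prod_type, Fin.sum_univ_succ, Fintype.sum_prod_type, Fintype.sum_bool,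
    add_comm (F (0, true))]
  rfl

open Classical in
/-- The number of the dead half-edges at the vertices of valency at least two. -/
noncomputable def deadHalves (Γ : RibbonGraph e v m) (s : Fin e → Option Bool) : ℕ :=
  ∑ z : HalfEdge e, if s z.1 = none ∧ Γ.rot z ≠ z then 1 else 0

theorem deadHalves_map {Γ Γ' : RibbonGraph e v m} (φ : Iso Flavour.ribbon Γ Γ')
    (s : Fin e → Option Bool) : deadHalves Γ' (φ.state s) = deadHalves Γ s := by
  rw [deadHalves, deadHalves, ← Equiv.sum_comp φ.half]
  refine Finset.sum_congr rfl fun z _ => ?_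
  refine if_congr (and_congr (φ.state_dead s z) (not_congr ?_)) rfl rfl
  rw [φ.rot_half, φ.half.apply_eq_iff_eq]

theorem deadHalves_split (Γ : RibbonGraph e v m) (q : Γ.CornerPair) (s : Fin e → Option Bool) :
    deadHalves (Γ.split q) (Fin.cons (some false) s) = deadHalves Γ s := by
  have h0 : (Fin.cons (some false) s : Fin (e + 1) → Option Bool) 0 ≠ none := by simp
  rw [deadHalves, sum_halfEdge, if_neg fun h => h0 h.1, if_neg fun h => h0 h.1, zero_add, zero_add,
    deadHalves]
  refine Finset.sum_congr rfl fun z _ => ?_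
  have h1 : (Fin.cons (some false) s : Fin (e + 1) → Option Bool) (old z).1 = s z.1 := rfl
  have h2 : (Γ.split q).rot (old z) ≠ old z ↔ Γ.rot z ≠ z := by
    have hfix : Γ.rot z = z → ∀ k, Γ.vert k = Γ.vert z → k = z := fun h k hk =>
      sameCycle_of_closed Γ.rot (fun k => k = z) (fun k hk => by rw [hk, h])
        ((Γ.vert_eq_iff _ _).1 hk.symm) rfl
    rw [split_rot_apply, splitRot_old]
    split_ifs with ha hb
    · refine ⟨fun _ h => q.2.1 (ha.symm.trans (hfix h _ ?_).symm), fun _ => tail_ne_old z⟩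
      rw [ha, q.2.2]
    · refine ⟨fun _ h => q.2.1 ((hfix h _ ?_).trans hb), fun _ => head_ne_old z⟩
      rw [hb, q.2.2]
    · rw [Ne, old_inj]
  exact if_congr (and_congr (by rw [h1]) h2) rfl rfl

/-- A connected graph with a vertex of valency at least three is not a single edge, so that no edge has
two univalent ends. -/
theorem deadHalves_ne_zero {Γ : RibbonGraph e v m} {s : Fin e → Option Bool}
    (hA : Admissible g Γ s) (hs : deadCount s ≠ 0) : deadHalves Γ s ≠ 0 := by
  obtain ⟨i, hi⟩ := Finset.card_ne_zero.1 hs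
  have hi := (Finset.mem_filter.1 hi).2
  rw [deadHalves, ← Finset.card_filter]
  refine Finset.card_ne_zero.2 ?_
  by_contra hcon
  have hfix : ∀ b, Γ.rot (i, b) = (i, b) := fun b => by
    by_contra h
    exact hcon ⟨(i, b), Finset.mem_filter.2 ⟨Finset.mem_univ _, hi, h⟩⟩
  have hv : ∀ b k, Γ.vert k = Γ.vert (i, b) → k = (i, b) := fun b k hk =>
    sameCycle_of_closed Γ.rot (fun k => k = (i, b)) (fun k hk => by rw [hk, hfix])
      ((Γ.vert_eq_iff _ _).1 hk.symm) rfl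
  -- both ends of the edge are univalent, so that there are no other edges
  have hall : ∀ w, ∃ b, w = Γ.vert (i, b) := fun w => by
    have h := hA.connected (Γ.vert (i, false)) w
    induction h with
    | refl => exact ⟨false, rfl⟩
    | tail _ hb ih =>
      obtain ⟨k, rfl, rfl⟩ := hb
      obtain ⟨b, hb⟩ := ih
      rw [hv b k hb]
      exact ⟨!b, rfl⟩
  obtain ⟨a, b, c, hab, -, -, h1, -⟩ := trivalent_iff.1 hA.trivalent
  obtain ⟨β, hβ⟩ := hall (Γ.vert a)
  exact hab ((hv β a hβ).trans (hv β b (h1.symm.trans hβ)).symm)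

/-- The average of the removals of the bivalent vertices next to the dead half-edges. At a univalent vertex,
no bivalent vertex can be inserted, and the removal is zero. -/
noncomputable def averageRemoval (d : ℤ) (f : StateFun K m) : StateFun K m := fun _ _ Γ s =>
  (deadHalves Γ s : K)⁻¹ * ∑ z, removal d f Γ s z

theorem splitDiff_averageRemoval [CharZero K] (hf : Equivariant d f) (h0 : splitDiff g f = 0)
    {Γ : RibbonGraph e v m} {s : Fin e → Option Bool} (hA : Admissible g Γ s)
    (hs : deadCount s ≠ 0) : splitDiff g (averageRemoval d f) e v Γ s = f e v Γ s := by
  have hdead : ∀ {n w : ℕ} (Δ : RibbonGraph (n + 1) (w + 1) m) (t : Fin (n + 1) → Option Bool) z,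
      t z.1 ≠ none → removal d f Δ t z = 0 := fun Δ t z h => removal_not fun ⟨D⟩ =>
        h D.local_structure.2.2.2.2
  have hN : (deadHalves Γ s : K) ≠ 0 := Nat.cast_ne_zero.2 (deadHalves_ne_zero hA hs)
  rw [splitDiff_of hA]
  simp only [averageRemoval, deadHalves_split]
  rw [← Finset.mul_sum, inv_mul_eq_iff_eq_mul₀ hN]
  have h1 : ∀ q : Γ.CornerPair, ∑ z, removal d f (Γ.split q) (Fin.cons (some false) s) z =
      ∑ z : HalfEdge e, removal d f (Γ.split q) (Fin.cons (some false) s) (old z) := fun q => by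
    rw [sum_halfEdge, hdead _ _ newTail (by simp [newTail]), hdead _ _ newHead (by simp [newHead]),
      zero_add, zero_add]
  simp only [h1]
  rw [Finset.sum_comm, deadHalves, Nat.cast_sum, Finset.sum_mul]
  refine Finset.sum_congr rfl fun z _ => ?_
  by_cases hz : s z.1 = none
  · rw [sum_removal hf h0 hA z hz]
    by_cases hr : Γ.rot z = z
    · simp [hr]
    · simp [hr, hz]
  · rw [if_neg fun h => hz h.1, Nat.cast_zero, zero_mul]
    exact Finset.sum_eq_zero fun q _ => hdead _ _ _ hz

theorem averageRemoval_mem {c : ℕ} {k : ℤ} (hf : f ∈ stateCochains K m d g c k) :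
    averageRemoval d f ∈ stateCochains K m d g c (k + 1) := by
  refine ⟨fun e v Γ Γ' φ s => ?_, fun e v Γ s h => ?_⟩
  · change averageRemoval d f e v Γ' (φ.state s) = φ.twist d s • averageRemoval d f e v Γ s
    rw [averageRemoval, averageRemoval, deadHalves_map, ← Equiv.sum_comp φ.half]
    simp only [removal_map hf.1]
    rw [← Finset.smul_sum, mul_smul_comm]
  · obtain ⟨z, -, hz⟩ := Finset.exists_ne_zero_of_sum_ne_zero (right_ne_zero_of_mul h)
    obtain ⟨e, rfl⟩ : ∃ n, e = n + 1 := ⟨e - 1, by have := z.1.pos; omega⟩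
    obtain ⟨v, rfl⟩ : ∃ n, v = n + 1 := ⟨v - 1, by have := (Γ.vert z).pos; omega⟩
    by_cases hI : Nonempty (Insertion Γ s z)
    · obtain ⟨D⟩ := hI
      rw [removal_of hf.1 D, Insertion.value] at hz
      obtain ⟨B, t, p, hp, hd, φ, rfl, rfl⟩ := D
      obtain ⟨h1, h2, h3⟩ := hf.2 B t fun h0 => hz (by simp only [h0, smul_zero])
      refine ⟨(h1.split p false).of_iso φ, ?_, ?_⟩
      · rw [Iso.state, deadCount_stateMap, deadCount_cons_some, h2]
      · push_cast
        linarith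
    · exact absurd (removal_not hI) hz

/-- The splitting differential is exact on the functions on the graphs with dead edges. -/
theorem exists_splitDiff_eq [CharZero K] {c : ℕ} {k : ℤ} (hc : c ≠ 0)
    (hf : f ∈ stateCochains K m d g c k) (h0 : splitDiff g f = 0) :
    ∃ f' ∈ stateCochains K m d g c (k + 1), splitDiff g f' = f := by
  refine ⟨averageRemoval d f, averageRemoval_mem hf, ?_⟩
  funext e v Γ s
  by_cases hA : Admissible g Γ s ∧ deadCount s = c
  · exact splitDiff_averageRemoval hf.1 h0 hA.1 (by rw [hA.2]; exact hc)
  · have h1 : f e v Γ s = 0 := by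
      by_contra h
      exact hA ⟨(hf.2 Γ s h).1, (hf.2 Γ s h).2.1⟩
    rw [h1]
    by_contra h
    have h2 := (splitDiff_mem (averageRemoval_mem hf)).2 Γ s h
    exact hA ⟨h2.1, h2.2.1⟩

end exactness

end RibbonGraph

/-! ### Exactness of the revival of dead edges -/

namespace RibbonGraph

variable {e v m : ℕ}

section symmetrize

variable {K : Type*} [Field K] {d : ℤ}

noncomputable instance (Γ : RibbonGraph e v m) :
    Fintype (Σ Γ' : RibbonGraph e v m, Iso Flavour.ribbon Γ Γ') := Fintype.ofFinite _

instance (Γ : RibbonGraph e v m) : Nonempty (Σ Γ' : RibbonGraph e v m, Iso Flavour.ribbon Γ Γ') :=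
  ⟨⟨Γ, Iso.refl _ _⟩⟩

/-- The composition with an isomorphism. -/
def Iso.compEquiv {Γ Γ' : RibbonGraph e v m} (φ : Iso Flavour.ribbon Γ Γ') :
    (Σ Γ'' : RibbonGraph e v m, Iso Flavour.ribbon Γ' Γ'') ≃
      (Σ Γ'' : RibbonGraph e v m, Iso Flavour.ribbon Γ Γ'') where
  toFun ψ := ⟨ψ.1, φ.trans ψ.2⟩
  invFun ψ := ⟨ψ.1, φ.symm.trans ψ.2⟩
  left_inv ψ := Sigma.ext rfl (heq_of_eq (Iso.ext_of (by ext; simp [Iso.trans, Iso.symm])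
    (by ext; simp [Iso.trans, Iso.symm]) (by ext; simp [Iso.trans, Iso.symm])))
  right_inv ψ := Sigma.ext rfl (heq_of_eq (Iso.ext_of (by ext; simp [Iso.trans, Iso.symm])
    (by ext; simp [Iso.trans, Iso.symm]) (by ext; simp [Iso.trans, Iso.symm])))

/-- The average of a function over all the isomorphisms that start at a graph. -/
noncomputable def symmetrize (d : ℤ) (f : StateFun K m) : StateFun K m := fun e v Γ s =>
  (Fintype.card (Σ Γ' : RibbonGraph e v m, Iso Flavour.ribbon Γ Γ') : K)⁻¹ *
    ∑ ψ : (Σ Γ' : RibbonGraph e v m, Iso Flavour.ribbon Γ Γ'),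
      ψ.2.twist d s • f e v ψ.1 (ψ.2.state s)

theorem equivariant_symmetrize (f : StateFun K m) : Equivariant d (symmetrize d f) := by
  intro e v Γ Γ' φ s
  change symmetrize d f e v Γ' (φ.state s) = φ.twist d s • symmetrize d f e v Γ s
  rw [symmetrize, symmetrize, Fintype.card_congr φ.compEquiv, ← mul_smul_comm,
    ← Equiv.sum_comp φ.compEquiv]
  congr 1
  rw [Finset.smul_sum]
  refine Finset.sum_congr rfl fun ψ _ => ?_
  change _ = φ.twist d s • (φ.trans ψ.2).twist d s • f e v ψ.1 ((φ.trans ψ.2).state s)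
  rw [Iso.twist_trans, Iso.state_trans, smul_smul, ← mul_assoc, Int.units_mul_self, one_mul]

theorem kill_twist {Γ Γ' : RibbonGraph e v m} (φ : Iso Flavour.ribbon Γ Γ')
    (f : (Fin e → Option Bool) → K) (s : Fin e → Option Bool) :
    kill (fun t => φ.twist d t • f (φ.state t)) s = φ.twist d s • kill f (φ.state s) := by
  have h := kill_stateMap φ.edge φ.rev f s
  simp only [Iso.twist, mul_smul, kill_units]
  rw [← Iso.state] at h
  rw [← h]
  rfl

/-- The average of primitives that need not be equivariant is a primitive of an equivariant function. -/
theorem kill_symmetrize [CharZero K] {f h : StateFun K m} (hh : Equivariant d h)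
    {Γ : RibbonGraph e v m} {s : Fin e → Option Bool}
    (H : ∀ (Γ' : RibbonGraph e v m) (ψ : Iso Flavour.ribbon Γ Γ'),
      kill (f e v Γ') (ψ.state s) = h e v Γ' (ψ.state s)) :
    kill (symmetrize d f e v Γ) s = h e v Γ s := by
  have h1 : symmetrize d f e v Γ = fun s =>
      (Fintype.card (Σ Γ' : RibbonGraph e v m, Iso Flavour.ribbon Γ Γ') : K)⁻¹ •
      ∑ ψ : (Σ Γ' : RibbonGraph e v m, Iso Flavour.ribbon Γ Γ'),
        ψ.2.twist d s • f e v ψ.1 (ψ.2.state s) := rfl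
  rw [h1, kill_smul, kill_sum Finset.univ fun
    (ψ : Σ Γ' : RibbonGraph e v m, Iso Flavour.ribbon Γ Γ') t =>
      ψ.2.twist d t • f e v ψ.1 (ψ.2.state t)]
  simp only [kill_twist, H, hh.map]
  simp only [smul_smul, Int.units_mul_self, one_smul]
  rw [Finset.sum_const, Finset.card_univ, ← Nat.cast_smul_eq_nsmul K, smul_smul, inv_mul_cancel₀,
    one_smul]
  exact Nat.cast_ne_zero.2 Fintype.card_ne_zero

end symmetrize

section exactness

variable {K : Type*} [Field K] {d : ℤ} {f : StateFun K m} {g c : ℕ} {k : ℤ}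

theorem kill_eq_zero_of_killDiff (h0 : killDiff g f = 0) {Γ : RibbonGraph e v m}
    {s : Fin e → Option Bool} (hA : Admissible g Γ s) : kill (f e v Γ) s = 0 := by
  have h := killDiff_of hA f
  rw [h0] at h
  exact (smul_eq_zero_iff_eq _).1 h.symm

/-- The revival of dead edges is exact at the functions with vanishing evaluations. -/
theorem exists_killDiff_eq [CharZero K] (hf : f ∈ stateCochains K m d g c k)
    (h0 : killDiff g f = 0)
    (he : ∀ ⦃e v : ℕ⦄ (Γ : RibbonGraph e v m), Γ.IsConnected → evaluate Γ.vert (f e v Γ) = 0) :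
    ∃ f' ∈ stateCochains K m d g (c + 1) (k + 1), killDiff g f' = f := by
  classical
  have key : ∀ (e v : ℕ) (Γ : RibbonGraph e v m), ∃ q : (Fin e → Option Bool) → K,
      (∀ s, q s ≠ 0 → Admissible g Γ s ∧ deadCount s = c + 1 ∧
        d * v + (1 - d) * e - d + (c + 1 : ℕ) = k + 1) ∧
      ∀ s, Admissible g Γ s → kill q s = ((-1) ^ e : ℤˣ) • f e v Γ s := by
    intro e v Γ
    by_cases hΓ : ∃ s, Admissible g Γ s
    · obtain ⟨s₀, hs₀⟩ := hΓ
      obtain ⟨q, hq⟩ := exists_kill_eq Γ.vert (f e v Γ) (fun s hs => kill_eq_zero_of_killDiff h0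
        ⟨hs₀.connected, hs₀.genus, hs₀.trivalent, hs⟩) (he Γ hs₀.connected)
      refine ⟨fun s => if Admissible g Γ s ∧ deadCount s = c + 1 ∧
        d * v + (1 - d) * e - d + (c + 1 : ℕ) = k + 1 then ((-1) ^ e : ℤˣ) • q s else 0,
        fun s hs => by_contra fun hcon => hs (if_neg hcon), fun s hs => ?_⟩
      by_cases hc : deadCount s = c ∧ d * v + (1 - d) * e - d + (c + 1 : ℕ) = k + 1
      · rw [kill_congr (g := fun t => ((-1) ^ e : ℤˣ) • q t), kill_units, hq s hs.acyclic]
        intro i hi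
        rw [if_pos ⟨hs.update i, by rw [deadCount_update hi, hc.1], hc.2⟩]
      · rw [kill_congr (g := fun _ => 0), kill_zero]
        · by_contra h
          obtain ⟨-, h1, h2⟩ := hf.2 Γ s fun h0 => h (by rw [h0, smul_zero])
          exact hc ⟨h1, by push_cast; linarith⟩
        · intro i hi
          rw [if_neg]
          rintro ⟨-, h1, h2⟩
          rw [deadCount_update hi] at h1
          exact hc ⟨by omega, h2⟩
    · refine ⟨fun _ => 0, fun s hs => absurd rfl hs, fun s hs => absurd ⟨s, hs⟩ hΓ⟩
  choose q hq1 hq2 using key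
  have hh : Equivariant d fun e v Γ s => ((-1) ^ e : ℤˣ) • f e v Γ s := fun e v Γ Γ' φ s => by
    dsimp only
    rw [hf.1 Γ Γ' φ s, smul_comm]
  refine ⟨symmetrize d q, ⟨equivariant_symmetrize q, fun e v Γ s hs => ?_⟩, ?_⟩
  · obtain ⟨ψ, -, hψ⟩ := Finset.exists_ne_zero_of_sum_ne_zero (right_ne_zero_of_mul hs)
    obtain ⟨h1, h2, h3⟩ := hq1 e v ψ.1 _ fun h0 => hψ (by rw [h0, smul_zero])
    rw [Iso.state, deadCount_stateMap] at h2
    exact ⟨(admissible_iff_of_iso ψ.2).1 h1, h2, h3⟩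
  · funext e v Γ s
    by_cases hA : Admissible g Γ s
    · rw [killDiff_of hA, kill_symmetrize hh fun Γ' ψ => hq2 e v Γ' _ (hA.of_iso ψ), smul_smul,
        Int.units_mul_self, one_smul]
    · rw [killDiff_not hA]
      by_contra h
      exact hA (hf.2 Γ s (Ne.symm h)).1

/-- If the number of dead edges is not the first Betti number, the evaluation is zero. -/
theorem evaluate_eq_zero_of_ne (hf : f ∈ stateCochains K m d g c k) (hc : c + 1 ≠ 2 * g + m)
    (Γ : RibbonGraph e v m) (hΓ : Γ.IsConnected) : evaluate Γ.vert (f e v Γ) = 0 := by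
  refine evaluate_eq_zero_of_count _ _ fun s hs => ?_
  by_contra h
  obtain ⟨h1, h2, -⟩ := hf.2 Γ s h
  have h3 := hΓ.loopCount h1.pos
  have h4 := h1.genus
  omega

theorem exists_killDiff_eq_of_ne [CharZero K] (hf : f ∈ stateCochains K m d g c k)
    (h0 : killDiff g f = 0) (hc : c + 1 ≠ 2 * g + m) :
    ∃ f' ∈ stateCochains K m d g (c + 1) (k + 1), killDiff g f' = f :=
  exists_killDiff_eq hf h0 fun _ _ => evaluate_eq_zero_of_ne hf hc

end exactness

end RibbonGraph

/-! ### The comparison with the ribbon graph complex -/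

namespace HalfEdge

open ExteriorAlgebra

section volume

variable {K : Type*} [Field K] {n v : ℕ}

theorem evaluate_volume (a : HalfEdge n → Fin v) {b : ℕ} (hb : b = loopCount a) :
    evaluate a (volume K a b) =
      topForm K v (ι K (fun _ => 1) * evaluate a (edgeForm (basisAt K a))) := by
  have h1 : evaluate a (volume K a b) =
      evaluate a (fun s => (topForm K v ∘ₗ LinearMap.mulLeft K (ι K fun _ => 1))
        (edgeForm (basisAt K a) s)) := by
    rw [← sub_eq_zero, ← evaluate_sub]
    refine evaluate_eq_zero_of_count _ _ fun s hs => ?_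
    rw [volume, if_pos (hs.trans hb.symm)]
    exact sub_self _
  rw [h1, evaluate_map]
  rfl

theorem ι_mul_ιMulti_eq_zero {N : Type*} [AddCommGroup N] [Module K N] {k : ℕ} (x : Fin k → N)
    {z : N} (hz : z ∈ Submodule.span K (Set.range x)) : ι K z * ιMulti K k x = 0 := by
  induction hz using Submodule.span_induction with
  | mem z hz =>
    obtain ⟨i, rfl⟩ := hz
    have h : ι K (x i) * ιMulti K k x = ιMulti K (k + 1) (Fin.cons (x i) x : Fin (k + 1) → N) := by
      rw [ιMulti_succ_apply]
      rfl
    rw [h]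
    exact AlternatingMap.map_eq_zero_of_eq _ _ (i := 0) (j := i.succ) rfl (Fin.succ_ne_zero i).symm
  | zero => rw [map_zero, zero_mul]
  | add y z _ _ hy hz => rw [map_add, add_mul, hy, hz, add_zero]
  | smul c y _ hy => rw [map_smul, smul_mul_assoc, hy, smul_zero]

variable (K v) in
/-- The inclusion of the last coordinates. -/
def consZero : (Fin v → K) →ₗ[K] (Fin (v + 1) → K) where
  toFun x := Fin.cons 0 x
  map_add' x y := by
    funext i
    refine Fin.cases ?_ (fun i => ?_) i <;> simp
  map_smul' c x := by
    funext i
    refine Fin.cases ?_ (fun i => ?_) i <;> simp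

theorem topForm_map_consZero (z : ExteriorAlgebra K (Fin v → K)) :
    topForm K (v + 1) (ExteriorAlgebra.map (consZero K v) z) = 0 := by
  have : (topForm K (v + 1)) ∘ₗ (ExteriorAlgebra.map (consZero K v)).toLinearMap = 0 := by
    refine lhom_ext fun i => AlternatingMap.ext fun x => ?_
    change topForm K (v + 1) (ExteriorAlgebra.map (consZero K v) (ιMulti K i x)) = 0
    rw [map_apply_ιMulti]
    by_cases h : i = v + 1
    · subst h
      rw [topForm_ιMulti]
      exact Matrix.det_eq_zero_of_column_eq_zero 0 fun _ => rfl
    · rw [topForm, liftAlternating_apply_ιMulti, dif_neg h]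
      rfl
  exact LinearMap.congr_fun this z

theorem topForm_single_mul (z : ExteriorAlgebra K (Fin v → K)) :
    topForm K (v + 1) (ι K (Pi.single 0 1) * ExteriorAlgebra.map (consZero K v) z) =
      topForm K v z := by
  have : (topForm K (v + 1)) ∘ₗ (LinearMap.mulLeft K (ι K (Pi.single 0 1))) ∘ₗ
      (ExteriorAlgebra.map (consZero K v)).toLinearMap = topForm K v := by
    refine lhom_ext fun i => AlternatingMap.ext fun x => ?_
    rw [LinearMap.compAlternatingMap_apply, LinearMap.compAlternatingMap_apply,
      LinearMap.comp_apply, LinearMap.comp_apply, LinearMap.mulLeft_apply,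
      AlgHom.toLinearMap_apply]
    have h1 : ι K (Pi.single 0 1) * ιMulti K i (consZero K v ∘ x) = ιMulti K (i + 1)
        (Fin.cons (Pi.single 0 1) (consZero K v ∘ x) : Fin (i + 1) → Fin (v + 1) → K) := by
      rw [ιMulti_succ_apply]
      rfl
    rw [map_apply_ιMulti, h1]
    by_cases h : i = v
    · subst h
      rw [topForm_ιMulti, topForm_ιMulti, Matrix.det_succ_row_zero, Fin.sum_univ_succ,
        Finset.sum_eq_zero]
      · simp only [Fin.val_zero, pow_zero, one_mul, add_zero, Matrix.of_apply, Fin.cons_zero,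
          Pi.single_eq_same]
        rfl
      · intro j _
        simp
    · rw [topForm, topForm, liftAlternating_apply_ιMulti, liftAlternating_apply_ιMulti,
        dif_neg h, dif_neg (by omega)]
      rfl
  exact LinearMap.congr_fun this z

end volume

end HalfEdge

namespace RibbonGraph

open ExteriorAlgebra

variable {e v m : ℕ}

section volume

variable {K : Type*} [Field K] {Γ Γ' : RibbonGraph e v m}

/-- The new edge of a split graph is contracted at first. -/
theorem evaluate_split {M : Type*} [AddCommGroup M] (p : Γ.CornerPair)
    (f : (Fin (e + 1) → Option Bool) → M) : evaluate (Γ.split p).vert f =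
      evaluate Γ.vert fun s => f (Fin.cons (some false) s) + f (Fin.cons (some true) s) := by
  rw [evaluate, if_neg (split_tail_ne_head Γ p), merge_split, evaluate_comp (Fin.succ_injective v)]

/-- The evaluation of `edgeForm` gets multiplied by the difference of the ends of the new edge. The factors
come from the vector `(1, …, 1)`, which can be replaced by a multiple of a vector of the basis. -/
theorem volume_split [CharZero K] (hc : Γ.IsConnected) (hv : 0 < v) {b : ℕ} (hb : b + v = e + 1)
    (p : Γ.CornerPair) : (v : K) * evaluate (Γ.split p).vert (volume K (Γ.split p).vert b) =
      -((v + 1 : ℕ) * evaluate Γ.vert (volume K Γ.vert b)) := by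
  have hl := hc.loopCount hv
  have hl' := (Γ.split_isConnected p hc).loopCount (Nat.succ_pos v)
  have hH : (Γ.split p).vert newHead = 0 := Γ.vertSplit_head p
  have hT : (Γ.split p).vert newTail = (Γ.vert p.1.1).succ := Γ.vertSplit_tail p
  have hs : ∀ w : Fin v, (Pi.single w.succ 1 : Fin (v + 1) → K) =
      consZero K v (Pi.single w 1) := fun w => by
    funext i
    refine Fin.cases ?_ (fun i => ?_) i
    · simp [consZero]
    · simp [consZero, Pi.single_apply]
  rw [evaluate_volume _ (show b = loopCount (Γ.split p).vert by omega),
    evaluate_volume _ (show b = loopCount Γ.vert by omega)]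
  set ω := evaluate Γ.vert (edgeForm (K := K) (basisAt K Γ.vert)) with hω
  set t : Fin v → K := Pi.single (Γ.vert p.1.1) 1 with ht
  -- the vector `(1, …, 1)` differs from a multiple of a vector of the basis by differences of ends
  -- of edges
  have h1 : topForm K v (ι K (fun _ => 1) * ω) = (v : K) * topForm K v (ι K t * ω) := by
    obtain ⟨c, k, x, h2, h3, h4⟩ := evaluate_edgeForm (K := K)
      (fun w : Fin v => (Pi.single w 1 : Fin v → K)) Γ.vert
    have h5 : ω = c • ιMulti K k x := h2
    have h6 : ∀ w w' : Fin v, (Pi.single w 1 - Pi.single w' 1 : Fin v → K) ∈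
        Submodule.span K (Set.range x) := by
      intro w w'
      have := hc w w'
      induction this with
      | refl =>
        rw [sub_self]
        exact zero_mem _
      | tail _ hb ih =>
        obtain ⟨h, rfl, rfl⟩ := hb
        have := add_mem ih (h4 h)
        rwa [sub_add_sub_cancel] at this
    have h7 : ((fun _ => 1) - (v : K) • t : Fin v → K) ∈ Submodule.span K (Set.range x) := by
      have : ((fun _ => 1) - (v : K) • t : Fin v → K) =
          ∑ w : Fin v, (Pi.single w 1 - t : Fin v → K) := by
        rw [Finset.sum_sub_distrib, Finset.sum_const, Finset.card_univ, Fintype.card_fin,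
          ← Nat.cast_smul_eq_nsmul K]
        congr 1
        exact (Finset.univ_sum_single (fun _ : Fin v => (1 : K))).symm
      rw [this]
      exact Submodule.sum_mem _ fun w _ => h6 _ _
    have h8 : ι K ((fun _ => 1) - (v : K) • t : Fin v → K) * ω = 0 := by
      rw [h5, mul_smul_comm, ι_mul_ιMulti_eq_zero x h7, smul_zero]
    rw [map_sub, sub_mul, sub_eq_zero, map_smul, smul_mul_assoc] at h8
    rw [h8, map_smul, smul_eq_mul]
  have h2 : evaluate (Γ.split p).vert (edgeForm (K := K) (basisAt K (Γ.split p).vert)) =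
      ι K (Pi.single 0 1 - consZero K v t) * ExteriorAlgebra.map (consZero K v) ω := by
    have h3 : ∀ s : Fin e → Option Bool,
        edgeForm (K := K) (basisAt K (Γ.split p).vert) (Fin.cons (some false) s) +
        edgeForm (basisAt K (Γ.split p).vert) (Fin.cons (some true) s) =
        (LinearMap.mulLeft K (ι K (Pi.single 0 1 - consZero K v t)) ∘ₗ
          (ExteriorAlgebra.map (consZero K v)).toLinearMap) (edgeForm (basisAt K Γ.vert) s) := by
      intro s
      rw [edgeForm_false, edgeForm_true, ← sub_eq_add_neg, ← sub_mul, ← map_sub]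
      change _ = ι K _ * ExteriorAlgebra.map (consZero K v) (edgeForm (basisAt K Γ.vert) s)
      rw [← map_edgeForm]
      have h4 : basisAt K (Γ.split p).vert newHead - basisAt K (Γ.split p).vert newTail =
          Pi.single 0 1 - consZero K v t := by
        rw [basisAt, basisAt, hH, hT, hs]
      rw [h4]
      refine ι_mul_edgeForm_congr _ _ _ (fun h => ?_) s
      have h5 := congrFun (merge_split Γ p) h
      simp only [Function.comp_apply, hH, hT] at h5
      simp only [Function.comp_apply, basisAt]
      rw [← hs, ← h5]
      by_cases hw : (Γ.split p).vert (old h) = 0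
      · refine ⟨-1, ?_⟩
        rw [hw, merge_right, hs]
        simp [ht]
      · exact ⟨0, by rw [merge_of_ne _ hw]; simp⟩
    rw [evaluate_split]
    simp only [h3]
    rw [evaluate_map]
    rfl
  have h3 : (fun _ => 1 : Fin (v + 1) → K) = Pi.single 0 1 + consZero K v fun _ => 1 := by
    funext i
    refine Fin.cases ?_ (fun i => ?_) i <;> simp [consZero]
  have h4 : ∀ x y : Fin v → K, topForm K (v + 1) (ι K (consZero K v x) *
      (ι K (consZero K v y) * ExteriorAlgebra.map (consZero K v) ω)) = 0 := fun x y => by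
    rw [← map_apply_ι, ← map_apply_ι, ← map_mul, ← map_mul, topForm_map_consZero]
  have h5 : ∀ x : Fin v → K, topForm K (v + 1) (ι K (Pi.single 0 1) *
      (ι K (consZero K v x) * ExteriorAlgebra.map (consZero K v) ω)) =
        topForm K v (ι K x * ω) := fun x => by
    rw [← map_apply_ι, ← map_mul, topForm_single_mul]
  rw [h2, h3, map_add, map_sub, add_mul, sub_mul, mul_sub, mul_sub, ← mul_assoc (ι K (Pi.single 0 1))
    (ι K (Pi.single 0 1)), ι_sq_zero, zero_mul, zero_sub, ι_mul_ι_mul (consZero K v _) (Pi.single 0 1),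
    map_add, map_neg, map_sub, map_neg, h4, h5, h5, h1]
  push_cast
  ring

end volume

end RibbonGraph

namespace RibbonGraph

variable {e v m : ℕ}

section graphFun

/-- The functions on the graphs with `m` boundaries. -/
abbrev GraphFun (K : Type*) (m : ℕ) : Type _ := ∀ e v : ℕ, RibbonGraph e v m → K

variable {K : Type*} [Field K]

/-- The functions on the generators of degree `k` that transform under isomorphisms by their sign: the
dual of the space of cochains. -/
def graphCochains (K : Type*) [Field K] (m : ℕ) (F : Flavour) (d : ℤ) (g : ℕ) (k : ℤ) :
    Submodule K (GraphFun K m) where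
  carrier := {y | (∀ ⦃e v : ℕ⦄ (Γ Γ' : RibbonGraph e v m) (φ : Iso F Γ Γ'),
    y e v Γ' = φ.sgn d • y e v Γ) ∧ ∀ ⦃e v : ℕ⦄ (Γ : RibbonGraph e v m),
    y e v Γ ≠ 0 → IsGenerator F d g m k Γ}
  add_mem' := by
    rintro y y' ⟨h1, h2⟩ ⟨h1', h2'⟩
    refine ⟨fun e v Γ Γ' φ => ?_, fun e v Γ hs => ?_⟩
    · simp only [Pi.add_apply, h1 Γ Γ' φ, h1' Γ Γ' φ, smul_add]
    · by_cases h : y e v Γ = 0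
      · refine h2' Γ fun h' => hs ?_
        simp only [Pi.add_apply, h, h', add_zero]
      · exact h2 Γ h
  zero_mem' := ⟨fun e v Γ Γ' φ => by simp, fun e v Γ hs => absurd rfl hs⟩
  smul_mem' := by
    rintro a y ⟨h1, h2⟩
    refine ⟨fun e v Γ Γ' φ => ?_, fun e v Γ hs => h2 Γ fun h => hs ?_⟩
    · simp only [Pi.smul_apply, h1 Γ Γ' φ, smul_comm a]
    · simp only [Pi.smul_apply, h, smul_zero]

open Classical in
/-- The differential that is dual to the one of the graph complex. -/
noncomputable def graphDiff (K : Type u) [Field K] (m : ℕ) (F : Flavour) (d : ℤ) (g : ℕ) (k : ℤ) :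
    GraphFun K m →ₗ[K] GraphFun K m where
  toFun y e v Γ := if IsGenerator F d g m k Γ then
    splitCoeff K F * ∑ p : Γ.CornerPair, y (e + 1) (v + 1) (Γ.split p) else 0
  map_add' y y' := by
    funext e v Γ
    simp only [Pi.add_apply]
    split_ifs
    · rw [Finset.sum_add_distrib, mul_add]
    · rw [add_zero]
  map_smul' c y := by
    funext e v Γ
    simp only [Pi.smul_apply, RingHom.id_apply]
    split_ifs
    · rw [← Finset.smul_sum, mul_smul_comm]
    · rw [smul_zero]

end graphFun

section theta

variable {K : Type*} [Field K] {d : ℤ} {g b : ℕ} {k : ℤ} {f : StateFun K m}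
  {Γ Γ' : RibbonGraph e v m}

/-- The evaluation of a function on states, relative to the volume cocycle. The factor that depends on
the number `v` of vertices compensates the behaviour of the volume cocycle under splittings. -/
noncomputable def theta (K : Type*) [Field K] (m b : ℕ) : StateFun K m →ₗ[K] GraphFun K m where
  toFun f _ v Γ := (-1) ^ v * v * (evaluate Γ.vert (f _ v Γ) / evaluate Γ.vert (volume K Γ.vert b))
  map_add' f f' := by
    funext e v Γ
    simp only [Pi.add_apply]
    rw [← mul_add, ← add_div, ← evaluate_add]
    rfl
  map_smul' c f := by
    funext e v Γ
    simp only [Pi.smul_apply, RingHom.id_apply]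
    rw [← mul_smul_comm, ← smul_div_assoc, ← evaluate_smul]
    rfl

theorem theta_apply (f : StateFun K m) (Γ : RibbonGraph e v m) : theta K m b f e v Γ =
    (-1) ^ v * v * (evaluate Γ.vert (f e v Γ) / evaluate Γ.vert (volume K Γ.vert b)) := rfl

theorem Iso.state_state_symm (φ : Iso Flavour.ribbon Γ Γ') (t : Fin e → Option Bool) :
    φ.state (φ.symm.state t) = t := by
  rw [← Iso.state_trans, Iso.symm_trans]
  exact stateMap_refl _

theorem sgn_succ (φ : Iso Flavour.ribbon Γ Γ') (d : ℤ) : φ.sgn (d + 1) *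
    (Equiv.Perm.sign φ.edge * revSign φ.rev * Equiv.Perm.sign φ.vertex) = φ.sgn d := by
  have h1 : (∏ i, if φ.rev i then ((-1 : ℤˣ)) ^ (d + 1) else 1) * revSign φ.rev =
      ∏ i, if φ.rev i then (-1) ^ d else 1 := by
    rw [revSign, ← Finset.prod_mul_distrib]
    refine Finset.prod_congr rfl fun i _ => ?_
    split_ifs
    · rw [zpow_add_one, mul_assoc, Int.units_mul_self, mul_one]
    · rw [mul_one]
  have h2 : Equiv.Perm.sign φ.edge ^ (1 - (d + 1)) * Equiv.Perm.sign φ.edge =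
      Equiv.Perm.sign φ.edge ^ (1 - d) := by
    rw [← zpow_add_one]
    congr 1
    ring
  have h3 : Equiv.Perm.sign φ.vertex ^ (d + 1) * Equiv.Perm.sign φ.vertex =
      Equiv.Perm.sign φ.vertex ^ d := by
    rw [zpow_add_one, mul_assoc, Int.units_mul_self, mul_one]
  rw [Iso.sgn, Iso.sgn, ← h1, ← h2, ← h3]
  ac_rfl

/-- The evaluations of closed functions that correspond to each other under an isomorphism. -/
theorem evaluate_map_iso [CharZero K] (φ : Iso Flavour.ribbon Γ Γ') (hc : Γ.IsConnected)
    (hv : 0 < v) (hb : b + v = e + 1) {f f' : (Fin e → Option Bool) → K} (c : ℤˣ)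
    (hf : ∀ s, f' (stateMap φ.edge φ.rev s) = (c * deadSign φ.edge φ.rev s) • f s)
    (h0 : ∀ s, Acyclic Γ.vert s → kill f s = 0) :
    evaluate Γ'.vert f' / evaluate Γ'.vert (volume K Γ'.vert b) =
      (c * (Equiv.Perm.sign φ.edge * revSign φ.rev * Equiv.Perm.sign φ.vertex)) •
        (evaluate Γ.vert f / evaluate Γ.vert (volume K Γ.vert b)) := by
  have hV := hc.evaluate_volume_ne_zero (K := K) hv hb
  have hV' := (hc.of_iso φ).evaluate_volume_ne_zero (K := K) hv hb
  set ε := Equiv.Perm.sign φ.edge * revSign φ.rev * Equiv.Perm.sign φ.vertex with hε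
  set C := evaluate Γ.vert f / evaluate Γ.vert (volume K Γ.vert b) with hC
  -- a closed function is the sum of a multiple of the volume cocycle and of a coboundary
  obtain ⟨q, hq⟩ := exists_kill_eq Γ.vert (fun s => f s - C • volume K Γ.vert b s) (fun s hs => by
    rw [kill_sub, kill_smul, kill_volume hs hv hb, h0 s hs, smul_zero, sub_zero]) (by
    rw [evaluate_sub Γ.vert f fun s => C • volume K Γ.vert b s, evaluate_smul, smul_eq_mul, hC,
      div_mul_cancel₀ _ hV, sub_self])
  set q' : (Fin e → Option Bool) → K := fun t =>
    (c * deadSign φ.edge φ.rev (φ.symm.state t)) • q (φ.symm.state t) with hq'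
  have h1 : ∀ t, Acyclic Γ'.vert t → f' t =
      (c * ε) • C • volume K Γ'.vert b t + kill q' t := by
    intro t ht
    obtain ⟨s, rfl⟩ : ∃ s, t = stateMap φ.edge φ.rev s :=
      ⟨φ.symm.state t, (φ.state_state_symm t).symm⟩
    have hs := φ.acyclic_iff.1 ht
    have h2 := hq s hs
    have h3 := volume_stateMap (K := K) φ b s
    have h4 := kill_stateMap φ.edge φ.rev q' s
    have h5 : ∀ u, deadSign φ.edge φ.rev u • q' (stateMap φ.edge φ.rev u) = c • q u := fun u => by
      have h6 : φ.symm.state (stateMap φ.edge φ.rev u) = u := φ.state_symm u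
      rw [hq']
      dsimp only
      rw [h6, smul_smul, mul_left_comm, Int.units_mul_self, mul_one]
    simp only [h5] at h4
    rw [kill_units, h2] at h4
    have h7 : ∀ x y : K, x = deadSign φ.edge φ.rev s • y → y = deadSign φ.edge φ.rev s • x :=
      fun x y h => by rw [h, smul_smul, Int.units_mul_self, one_smul]
    rw [hf, h7 _ _ h3.symm, h7 _ _ h4]
    rw [← hε]
    generalize deadSign φ.edge φ.rev s = δ
    rcases Int.units_eq_one_or ε with h | h <;> rcases Int.units_eq_one_or δ with h' | h' <;>
      rcases Int.units_eq_one_or c with h'' | h'' <;>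
      simp only [h, h', h'', smul_eq_mul, mul_one, one_smul, mul_neg, Units.neg_smul, neg_neg] <;>
      ring
  rw [div_eq_iff hV', evaluate_congr h1, evaluate_add Γ'.vert
    (fun t => (c * ε) • C • volume K Γ'.vert b t) (kill q'), evaluate_units, evaluate_smul,
    evaluate_kill, add_zero, smul_eq_mul, smul_mul_assoc]

theorem evaluate_eq_zero_of_not {c : ℕ} (hf : f ∈ stateCochains K m d g c k)
    (h : ¬ ∃ s, Admissible g Γ s ∧ d * v + (1 - d) * e - d + c = k) :
    evaluate Γ.vert (f e v Γ) = 0 := by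
  refine evaluate_eq_zero _ _ fun s _ => ?_
  by_contra h0
  obtain ⟨h1, -, h2⟩ := hf.2 Γ s h0
  exact h ⟨s, h1, h2⟩

theorem Admissible.isGenerator {s : Fin e → Option Bool} (h : Admissible g Γ s)
    (hk : d * v + (1 - d) * e - d = k) : IsGenerator Flavour.ribbon d g m k Γ :=
  ⟨h.connected, h.genus, h.trivalent, fun hF => (by cases hF), hk⟩

theorem IsGenerator.admissible_dead (h : IsGenerator Flavour.ribbon d g m k Γ) :
    Admissible g Γ fun _ => none :=
  ⟨h.connected, h.genus, h.trivalent, fun w hw => by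
    obtain ⟨u, ⟨i, hi, -⟩, -⟩ := Relation.TransGen.head'_iff.1 hw
    cases hi⟩

/-- The sign of the evaluation of the volume cocycle turns the signs for `d + 1` into those for `d`. -/
theorem theta_mem [CharZero K] (hb : b + 1 = 2 * g + m)
    (hf : f ∈ stateCochains K m (d + 1) g b k) (h0 : killDiff g f = 0) :
    theta K m b f ∈ graphCochains K m Flavour.ribbon d g k := by
  have key : ∀ ⦃e v : ℕ⦄ (Γ : RibbonGraph e v m), evaluate Γ.vert (f e v Γ) ≠ 0 →
      ∃ s, Admissible g Γ s ∧ (d + 1) * v + (1 - (d + 1)) * e - (d + 1) + b = k := fun e v Γ h => by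
    by_contra hcon
    exact h (evaluate_eq_zero_of_not hf hcon)
  have hdiv : ∀ ⦃e v : ℕ⦄ (Γ Γ' : RibbonGraph e v m) (φ : Iso Flavour.ribbon Γ Γ'),
      evaluate Γ.vert (f e v Γ) ≠ 0 →
      theta K m b f e v Γ' = φ.sgn d • theta K m b f e v Γ := fun e v Γ Γ' φ h => by
    obtain ⟨s, hs, -⟩ := key Γ h
    have h1 := hs.genus
    rw [theta_apply, theta_apply, evaluate_map_iso φ hs.connected hs.pos (by omega) (φ.sgn (d + 1))
      (fun s => hf.1 Γ Γ' φ s) (fun s hs' => kill_eq_zero_of_killDiff h0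
        ⟨hs.connected, hs.genus, hs.trivalent, hs'⟩), sgn_succ, mul_smul_comm]
  refine ⟨fun e v Γ Γ' φ => ?_, fun e v Γ h => ?_⟩
  · by_cases h : evaluate Γ.vert (f e v Γ) = 0
    · by_cases h' : evaluate Γ'.vert (f e v Γ') = 0
      · rw [theta_apply, theta_apply, h, h', zero_div, zero_div, mul_zero, smul_zero]
      · rw [hdiv Γ' Γ φ.symm h', Iso.symm_sgn, smul_smul, Int.units_mul_self, one_smul]
    · exact hdiv Γ Γ' φ h
  · rw [theta_apply] at h
    obtain ⟨s, hs, hk⟩ := key Γ fun h' => h (by rw [h', zero_div, mul_zero])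
    have h1 : (v : ℤ) + m + 2 * g = e + 2 := by exact_mod_cast hs.genus
    have h2 : (b : ℤ) + 1 = 2 * g + m := by exact_mod_cast hb
    exact hs.isGenerator (by linarith)

theorem theta_killDiff (f : StateFun K m) :
    theta K m b (killDiff g f) = 0 := by
  funext e v Γ
  rw [theta_apply]
  suffices h : evaluate Γ.vert (killDiff g f e v Γ) = 0 by rw [h, zero_div, mul_zero]; rfl
  by_cases hΓ : ∃ s, Admissible g Γ s
  · obtain ⟨s₀, hs₀⟩ := hΓ
    rw [evaluate_congr (g := fun s => ((-1) ^ e : ℤˣ) • kill (f e v Γ) s) fun s hs =>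
      killDiff_of ⟨hs₀.connected, hs₀.genus, hs₀.trivalent, hs⟩ f, evaluate_units, evaluate_kill,
      smul_zero]
  · exact evaluate_eq_zero _ _ fun s _ => killDiff_not (fun h => hΓ ⟨s, h⟩) f

/-- The two directions of the new edge contribute equally to the sum over all the splittings, which
accounts for the factor one half in the differential of the ribbon graph complex. -/
theorem theta_splitDiff {K : Type u} [Field K] [CharZero K] {f : StateFun K m}
    (hb : b + 1 = 2 * g + m)
    (hf : f ∈ stateCochains K m (d + 1) g b (k + 1)) :
    theta K m b (splitDiff g f) = graphDiff K m Flavour.ribbon d g k (theta K m b f) := by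
  funext e v Γ
  have hb' : (b : ℤ) + 1 = 2 * g + m := by exact_mod_cast hb
  by_cases hΓ : IsGenerator Flavour.ribbon d g m k Γ
  · have h1 : graphDiff K m Flavour.ribbon d g k (theta K m b f) e v Γ =
        1 / 2 * ∑ p : Γ.CornerPair, theta K m b f _ _ (Γ.split p) := if_pos hΓ
    have hA := hΓ.admissible_dead
    have hv := hA.pos
    have hg := hΓ.genus
    have hv0 : (v : K) ≠ 0 := Nat.cast_ne_zero.2 hv.ne'
    have hv1 : ((v + 1 : ℕ) : K) ≠ 0 := Nat.cast_ne_zero.2 (Nat.succ_ne_zero v)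
    have hbe : b + v = e + 1 := by omega
    have hV := hΓ.connected.evaluate_volume_ne_zero (K := K) hv hbe
    have h2 : ∀ p : Γ.CornerPair, theta K m b f _ _ (Γ.split p) = (-1) ^ v * v *
        ((evaluate Γ.vert fun s => f _ _ (Γ.split p) (Fin.cons (some false) s) +
          f _ _ (Γ.split p) (Fin.cons (some true) s)) /
          evaluate Γ.vert (volume K Γ.vert b)) := fun p => by
      have h3 := volume_split (K := K) hΓ.connected hv hbe p
      have h4 : evaluate (Γ.split p).vert (volume K (Γ.split p).vert b) =
          -((v + 1 : ℕ) * evaluate Γ.vert (volume K Γ.vert b)) / v := by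
        rw [← h3, mul_div_cancel_left₀ _ hv0]
      rw [theta_apply, h4, evaluate_split, pow_succ]
      field_simp
    have h3 : evaluate Γ.vert (splitDiff g f e v Γ) = 1 / 2 * ∑ p : Γ.CornerPair,
        evaluate Γ.vert fun s => f _ _ (Γ.split p) (Fin.cons (some false) s) +
          f _ _ (Γ.split p) (Fin.cons (some true) s) := by
      rw [← smul_eq_mul, ← evaluate_sum, ← evaluate_smul]
      refine evaluate_congr fun s hs => ?_
      rw [splitDiff_of ⟨hΓ.connected, hΓ.genus, hΓ.trivalent, hs⟩, Finset.sum_add_distrib,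
        hf.1.sum_split_true, ← two_mul, smul_eq_mul, ← mul_assoc]
      norm_num
    rw [h1, theta_apply, h3]
    simp only [h2]
    rw [← Finset.mul_sum, ← Finset.sum_div]
    ring
  · have h1 : graphDiff K m Flavour.ribbon d g k (theta K m b f) e v Γ = 0 := if_neg hΓ
    rw [h1, theta_apply, evaluate_eq_zero_of_not (splitDiff_mem hf), zero_div, mul_zero]
    rintro ⟨s, hs, hk⟩
    have h2 : (v : ℤ) + m + 2 * g = e + 2 := by exact_mod_cast hs.genus
    exact hΓ (hs.isGenerator (by linarith))

/-- Every function on the graphs is the relative evaluation of a multiple of the volume cocycle. -/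
theorem exists_theta_eq [CharZero K] (hb : b + 1 = 2 * g + m) {y : GraphFun K m}
    (hy : y ∈ graphCochains K m Flavour.ribbon d g k) :
    ∃ f ∈ stateCochains K m (d + 1) g b k, killDiff g f = 0 ∧ theta K m b f = y := by
  classical
  set r : GraphFun K m := fun e v Γ => y e v Γ * ((-1 : K) ^ v * (v : K))⁻¹ with hr
  set f : StateFun K m := fun e v Γ s =>
    if Admissible g Γ s then r e v Γ * volume K Γ.vert b s else 0 with hf
  have hb' : (b : ℤ) + 1 = 2 * g + m := by exact_mod_cast hb
  have hfA : ∀ {e v : ℕ} {Γ : RibbonGraph e v m} {s : Fin e → Option Bool}, Admissible g Γ s →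
      f e v Γ s = r e v Γ * volume K Γ.vert b s := fun h => if_pos h
  have hfN : ∀ {e v : ℕ} {Γ : RibbonGraph e v m} {s : Fin e → Option Bool}, ¬ Admissible g Γ s →
      f e v Γ s = 0 := fun h => if_neg h
  have hmem : f ∈ stateCochains K m (d + 1) g b k := by
    refine ⟨fun e v Γ Γ' φ s => ?_, fun e v Γ s h => ?_⟩
    · by_cases hA : Admissible g Γ s
      · have h1 := volume_stateMap (K := K) φ b s
        have h2 : r e v Γ' = φ.sgn d • r e v Γ := by
          rw [hr]
          dsimp only
          rw [hy.1 Γ Γ' φ, smul_mul_assoc]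
        rw [hfA hA, hfA (hA.of_iso φ), h2, ← sgn_succ φ d]
        generalize Equiv.Perm.sign φ.edge * revSign φ.rev * Equiv.Perm.sign φ.vertex = ε at h1 ⊢
        generalize deadSign φ.edge φ.rev s = δ at h1 ⊢
        have h3 : volume K Γ'.vert b (stateMap φ.edge φ.rev s) =
            (δ * ε) • volume K Γ.vert b s := by
          rw [mul_smul, ← h1, smul_smul, Int.units_mul_self, one_smul]
        rw [h3]
        rcases Int.units_eq_one_or ε with h | h <;> rcases Int.units_eq_one_or δ with h' | h' <;>
          simp only [h, h', one_smul, Units.neg_smul, mul_one, mul_neg, smul_mul_assoc, neg_mul,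
            neg_neg]
      · rw [hfN hA, hfN (mt (admissible_iff_of_iso φ).1 hA), smul_zero]
    · by_cases hA : Admissible g Γ s
      · rw [hfA hA] at h
        have h1 := (hy.2 Γ fun h0 => h (by rw [hr]; simp [h0])).degree
        have h2 : deadCount s = b := by
          by_contra h0
          exact h (by rw [volume, if_neg h0, mul_zero])
        have h3 : (v : ℤ) + m + 2 * g = e + 2 := by exact_mod_cast hA.genus
        exact ⟨hA, h2, by linarith⟩
      · exact absurd (hfN hA) h
  refine ⟨f, hmem, ?_, ?_⟩
  · funext e v Γ s
    by_cases hA : Admissible g Γ s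
    · have h1 := hA.genus
      rw [killDiff_of hA, kill_congr (g := fun t => r e v Γ • volume K Γ.vert b t)
        fun i _ => hfA (hA.update i), kill_smul, kill_volume hA.acyclic hA.pos (by omega), smul_zero,
        smul_zero]
      rfl
    · exact killDiff_not hA f
  · funext e v Γ
    rw [theta_apply]
    by_cases hΓ : IsGenerator Flavour.ribbon d g m k Γ
    · have hv := hΓ.admissible_dead.pos
      have hg := hΓ.genus
      have hv0 : (v : K) ≠ 0 := Nat.cast_ne_zero.2 hv.ne'
      have hV := hΓ.connected.evaluate_volume_ne_zero (K := K) hv (b := b) (by omega)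
      rw [evaluate_congr (g := fun t => r e v Γ • volume K Γ.vert b t) fun s hs =>
        hfA ⟨hΓ.connected, hΓ.genus, hΓ.trivalent, hs⟩, evaluate_smul, smul_eq_mul,
        mul_div_cancel_right₀ _ hV, hr]
      dsimp only
      field_simp
    · have h1 : y e v Γ = 0 := by
        by_contra h
        exact hΓ (hy.2 Γ h)
      rw [h1, evaluate_eq_zero_of_not hmem, zero_div, mul_zero]
      rintro ⟨s, hs, hk⟩
      have h2 : (v : ℤ) + m + 2 * g = e + 2 := by exact_mod_cast hs.genus
      exact hΓ (hs.isGenerator (by linarith))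

theorem exists_killDiff_eq_of_theta [CharZero K] (hb : b + 1 = 2 * g + m)
    (hf : f ∈ stateCochains K m d g b k) (h0 : killDiff g f = 0) (h1 : theta K m b f = 0) :
    ∃ f' ∈ stateCochains K m d g (b + 1) (k + 1), killDiff g f' = f := by
  refine exists_killDiff_eq hf h0 fun e v Γ hc => ?_
  by_contra h
  obtain ⟨s, hs, -⟩ : ∃ s, Admissible g Γ s ∧ d * v + (1 - d) * e - d + b = k := by
    by_contra hcon
    exact h (evaluate_eq_zero_of_not hf hcon)
  have hv0 : (v : K) ≠ 0 := Nat.cast_ne_zero.2 hs.pos.ne'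
  have hg := hs.genus
  have hV := hc.evaluate_volume_ne_zero (K := K) hs.pos (b := b) (by omega)
  have h2 : theta K m b f e v Γ = 0 := by rw [h1]; rfl
  rw [theta_apply] at h2
  refine mul_ne_zero (mul_ne_zero (pow_ne_zero _ (by norm_num)) hv0) (div_ne_zero h hV) h2

end theta

end RibbonGraph

/-! ### Quivers as graphs without dead edges -/

namespace RibbonGraph

variable {e v m : ℕ}

section quiver

variable {K : Type*} [Field K] {d : ℤ} {g : ℕ} {k : ℤ} {f : StateFun K m}
  {Γ Γ' : RibbonGraph e v m} {s : Fin e → Option Bool}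

/-- The restriction of a function to the states where every edge is directed as its label says. -/
def restrict (K : Type*) [Field K] (m : ℕ) : StateFun K m →ₗ[K] GraphFun K m where
  toFun f e v Γ := f e v Γ fun _ => some false
  map_add' _ _ := rfl
  map_smul' _ _ := rfl

theorem restrict_apply (f : StateFun K m) (Γ : RibbonGraph e v m) :
    restrict K m f e v Γ = f e v Γ fun _ => some false := rfl

theorem ne_none_of_deadCount (hs : deadCount s = 0) (i : Fin e) : s i ≠ none := fun h => by
  have h1 := Finset.card_eq_zero.1 hs
  exact Finset.notMem_empty i (h1 ▸ Finset.mem_filter.2 ⟨Finset.mem_univ i, h⟩)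

theorem deadCount_const : deadCount (fun _ : Fin e => some false) = 0 := by
  simp [deadCount]

theorem deadSign_of_deadCount (hs : deadCount s = 0) (σ : Equiv.Perm (Fin e))
    (r : Fin e → Bool) : deadSign σ r s = 1 :=
  deadSign_of_fixed (fun i hi => absurd hi (ne_none_of_deadCount hs i))
    fun i hi => absurd hi (ne_none_of_deadCount hs i)

theorem isAcyclic_iff : Γ.IsAcyclic ↔ Acyclic Γ.vert fun _ => some false := by
  have h : Step Γ.vert (fun _ => some false) =
      fun u u' => ∃ i : Fin e, Γ.vert (i, false) = u ∧ Γ.vert (i, true) = u' := by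
    funext u u'
    refine propext ⟨?_, ?_⟩
    · rintro ⟨⟨i, b⟩, h1, h2, h3⟩
      obtain rfl : false = b := Option.some.inj h1
      exact ⟨i, h2, h3⟩
    · rintro ⟨i, h2, h3⟩
      exact ⟨(i, false), rfl, h2, h3⟩
  rw [Acyclic, h]
  rfl

theorem IsGenerator.admissible (h : IsGenerator Flavour.quiver d g m k Γ) :
    Admissible g Γ fun _ => some false :=
  ⟨h.connected, h.genus, h.trivalent, isAcyclic_iff.1 (h.acyclic rfl)⟩

theorem Admissible.isGenerator_quiver (h : Admissible g Γ fun _ => some false)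
    (hk : d * v + (1 - d) * e - d = k) : IsGenerator Flavour.quiver d g m k Γ :=
  ⟨h.connected, h.genus, h.trivalent, fun _ => isAcyclic_iff.2 h.acyclic, hk⟩

theorem Iso.stateMap_const (φ : Iso Flavour.quiver Γ Γ') :
    stateMap φ.edge φ.rev (fun _ => some false) = fun _ => some false := by
  funext j
  obtain ⟨i, rfl⟩ := φ.edge.surjective j
  rw [stateMap_apply, φ.rev_eq rfl]
  rfl

/-- An isomorphism that respects the directions is one of quivers. -/
theorem Iso.exists_quiver (φ : Iso Flavour.ribbon Γ Γ')
    (h : φ.state (fun _ => some false) = fun _ => some false) :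
    ∃ ψ : Iso Flavour.quiver Γ Γ', ∀ d, ψ.sgn d = φ.sgn d := by
  have h1 : ∀ i, φ.rev i = false := fun i => by
    have h2 := congrFun h (φ.edge i)
    rw [Iso.state, stateMap_apply] at h2
    simpa using h2
  exact ⟨⟨φ.edge, φ.rev, φ.vertex, fun _ => h1, φ.map_rot, φ.map_vert, φ.map_bdry⟩, fun _ => rfl⟩

theorem restrict_mem (hf : f ∈ stateCochains K m d g 0 k) :
    restrict K m f ∈ graphCochains K m Flavour.quiver d g k := by
  refine ⟨fun e v Γ Γ' φ => ?_, fun e v Γ h => ?_⟩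
  · have h := hf.1 Γ Γ' φ.toRibbon fun _ => some false
    rw [deadSign_of_deadCount deadCount_const, mul_one] at h
    rw [restrict_apply, restrict_apply, ← Iso.toRibbon_sgn, ← h]
    exact congrArg (f e v Γ') φ.stateMap_const.symm
  · obtain ⟨h1, -, h2⟩ := hf.2 Γ _ h
    exact h1.isGenerator_quiver (by simpa using h2)

theorem restrict_splitDiff {K : Type u} [Field K] {f : StateFun K m}
    (hf : f ∈ stateCochains K m d g 0 (k + 1)) :
    restrict K m (splitDiff g f) = graphDiff K m Flavour.quiver d g k (restrict K m f) := by
  funext e v Γ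
  by_cases hΓ : IsGenerator Flavour.quiver d g m k Γ
  · have h1 : graphDiff K m Flavour.quiver d g k (restrict K m f) e v Γ =
        1 * ∑ p : Γ.CornerPair, restrict K m f _ _ (Γ.split p) := if_pos hΓ
    have h2 : (Fin.cons (some false) fun _ => some false : Fin (e + 1) → Option Bool) =
        fun _ => some false := by
      funext i
      refine Fin.cases rfl (fun _ => rfl) i
    rw [h1, one_mul, restrict_apply, splitDiff_of hΓ.admissible, h2]
    rfl
  · have h1 : graphDiff K m Flavour.quiver d g k (restrict K m f) e v Γ = 0 := if_neg hΓ
    rw [h1, restrict_apply]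
    by_contra h
    exact hΓ ((restrict_mem (splitDiff_mem hf)).2 Γ h)

/-- The edges that are directed against their labels. -/
def against (s : Fin e → Option Bool) (i : Fin e) : Bool := s i == some true

/-- The isomorphism that makes all labels agree with the directions of a state. -/
def straighten (Γ : RibbonGraph e v m) (s : Fin e → Option Bool) : Iso Flavour.ribbon Γ
    (Γ.transport (Equiv.refl _) (against s) (Equiv.refl _)) :=
  Γ.transportIso (Equiv.refl _) (against s) (Equiv.refl _)

theorem straighten_state (hs : deadCount s = 0) :
    (Γ.straighten s).state s = fun _ => some false := by
  funext i
  change stateMap (Equiv.refl _) (against s) s (Equiv.refl _ i) = _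
  rw [stateMap_apply, against]
  rcases h : s i with _ | _ | _
  · exact absurd h (ne_none_of_deadCount hs i)
  · rfl
  · rfl

theorem eq_zero_of_restrict (hf : f ∈ stateCochains K m d g 0 k) (h0 : restrict K m f = 0) :
    f = 0 := by
  funext e v Γ s
  by_contra h
  have h1 := (hf.2 Γ s h).2.1
  have h2 := hf.1 _ _ (Γ.straighten s) s
  rw [← Iso.state, straighten_state h1] at h2
  have h3 := congrFun (congrFun (congrFun h0 e) v)
    (Γ.transport (Equiv.refl _) (against s) (Equiv.refl _))
  rw [restrict_apply, h2] at h3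
  exact h ((smul_eq_zero_iff_eq _).1 h3)

theorem exists_restrict_eq {y : GraphFun K m}
    (hy : y ∈ graphCochains K m Flavour.quiver d g k) :
    ∃ f ∈ stateCochains K m d g 0 k, restrict K m f = y := by
  classical
  -- the value is forced by the isomorphism that straightens the directions
  set f : StateFun K m := fun e v Γ s => if deadCount s = 0 then (Γ.straighten s).sgn d •
    y e v (Γ.transport (Equiv.refl _) (against s) (Equiv.refl _)) else 0
  refine ⟨f, ⟨fun e v Γ Γ' φ s => ?_, fun e v Γ s h => ?_⟩, ?_⟩
  · by_cases hs : deadCount s = 0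
    · have hs' : deadCount (stateMap φ.edge φ.rev s) = 0 := by rw [deadCount_stateMap, hs]
      have h1 : (((Γ.straighten s).symm.trans φ).trans
          (Γ'.straighten (stateMap φ.edge φ.rev s))).state (fun _ => some false) =
          fun _ => some false := by
        rw [Iso.state_trans, Iso.state_trans, ← straighten_state (Γ := Γ) hs, Iso.state_symm]
        exact (straighten_state hs').trans (straighten_state hs).symm
      obtain ⟨ψ, hψ⟩ := Iso.exists_quiver _ h1
      have h2 := hy.1 _ _ ψ
      rw [hψ, Iso.trans_sgn, Iso.trans_sgn, Iso.symm_sgn] at h2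
      have h3 : f e v Γ s = (Γ.straighten s).sgn d •
        y e v (Γ.transport (Equiv.refl _) (against s) (Equiv.refl _)) := if_pos hs
      have h4 : f e v Γ' (stateMap φ.edge φ.rev s) =
        (Γ'.straighten (stateMap φ.edge φ.rev s)).sgn d • y e v (Γ'.transport (Equiv.refl _)
          (against (stateMap φ.edge φ.rev s)) (Equiv.refl _)) := if_pos hs'
      rw [h3, h4, h2, deadSign_of_deadCount hs, smul_smul, smul_smul, mul_comm, mul_assoc,
        Int.units_mul_self, mul_one, mul_one, mul_comm]
    · have hs' : ¬ deadCount (stateMap φ.edge φ.rev s) = 0 := by rwa [deadCount_stateMap]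
      have h3 : f e v Γ s = 0 := if_neg hs
      have h4 : f e v Γ' (stateMap φ.edge φ.rev s) = 0 := if_neg hs'
      rw [h3, h4, smul_zero]
  · have hs : deadCount s = 0 := by
      by_contra hs
      exact h (if_neg hs)
    have h3 : f e v Γ s = (Γ.straighten s).sgn d •
      y e v (Γ.transport (Equiv.refl _) (against s) (Equiv.refl _)) := if_pos hs
    have h4 := hy.2 _ fun h0 => h (by rw [h3, h0, smul_zero])
    have h5 := h4.admissible
    rw [← straighten_state (Γ := Γ) hs] at h5
    exact ⟨(admissible_iff_of_iso (Γ.straighten s)).1 h5, hs, by simpa using h4.degree⟩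
  · funext e v Γ
    obtain ⟨ψ, hψ⟩ := Iso.exists_quiver _ (straighten_state (Γ := Γ) deadCount_const)
    have h3 : f e v Γ (fun _ => some false) = (Γ.straighten fun _ => some false).sgn d •
      y e v (Γ.transport (Equiv.refl _) (against fun _ => some false) (Equiv.refl _)) :=
      if_pos deadCount_const
    rw [restrict_apply, h3, hy.1 _ _ ψ, hψ, smul_smul, Int.units_mul_self, one_smul]

end quiver

end RibbonGraph

/-! ### Homology of complexes of vector spaces -/

section homology

variable {K : Type u} [Field K] (C : CochainComplex (ModuleCat.{u} K) ℤ)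

theorem iCycles_injective (k : ℤ) : Function.Injective (C.iCycles k).hom :=
  (ModuleCat.mono_iff_injective _).1 inferInstance

theorem exists_iCycles_eq {k : ℤ} {x : C.X k} (hx : (C.d k (k + 1)).hom x = 0) :
    ∃ z : C.cycles k, (C.iCycles k).hom z = x :=
  (ShortComplex.moduleCat_exact_iff _).1 (ShortComplex.exact_of_f_is_kernel
    (ShortComplex.mk (C.iCycles k) (C.d k (k + 1)) (by simp))
    (C.cyclesIsKernel k (k + 1) (by simp))) x hx

theorem d_iCycles {k : ℤ} (z : C.cycles k) : (C.d k (k + 1)).hom ((C.iCycles k).hom z) = 0 := by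
  rw [← LinearMap.comp_apply, ← ModuleCat.hom_comp, C.iCycles_d]
  rfl

theorem homologyπ_surjective (k : ℤ) : Function.Surjective (C.homologyπ k).hom :=
  (ModuleCat.epi_iff_surjective _).1 inferInstance

theorem exists_toCycles_eq {k : ℤ} {z : C.cycles (k + 1)} (hz : (C.homologyπ (k + 1)).hom z = 0) :
    ∃ x : C.X k, (C.toCycles k (k + 1)).hom x = z :=
  (ShortComplex.moduleCat_exact_iff _).1 (ShortComplex.exact_of_g_is_cokernel
    (ShortComplex.mk (C.toCycles k (k + 1)) (C.homologyπ (k + 1)) (by simp))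
    (C.homologyIsCokernel k (k + 1) (by simp))) z hz

theorem homologyπ_toCycles {k : ℤ} (x : C.X k) :
    (C.homologyπ (k + 1)).hom ((C.toCycles k (k + 1)).hom x) = 0 := by
  rw [← LinearMap.comp_apply, ← ModuleCat.hom_comp, C.toCycles_comp_homologyπ]
  rfl

theorem iCycles_toCycles {k : ℤ} (x : C.X k) :
    (C.iCycles (k + 1)).hom ((C.toCycles k (k + 1)).hom x) = (C.d k (k + 1)).hom x := by
  rw [← LinearMap.comp_apply, ← ModuleCat.hom_comp, C.toCycles_i]

theorem finite_homology (k : ℤ) [Module.Finite K (C.X k)] : Module.Finite K (C.homology k) :=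
  have : Module.Finite K (C.cycles k) := Module.Finite.of_injective _ (iCycles_injective C k)
  Module.Finite.of_surjective _ (homologyπ_surjective C k)

theorem finrank_homology (k : ℤ) [Module.Finite K (C.X (k + 1))] :
    Module.finrank K (C.homology (k + 1)) + Module.finrank K (LinearMap.range (C.d k (k + 1)).hom) =
      Module.finrank K (LinearMap.ker (C.d (k + 1) (k + 1 + 1)).hom) := by
  have : Module.Finite K (C.cycles (k + 1)) :=
    Module.Finite.of_injective _ (iCycles_injective C _)
  have h1 : LinearMap.range (C.iCycles (k + 1)).hom =
      LinearMap.ker (C.d (k + 1) (k + 1 + 1)).hom := by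
    ext x
    exact ⟨fun ⟨z, hz⟩ => hz ▸ d_iCycles C z, fun hx => exists_iCycles_eq C hx⟩
  have h2 : LinearMap.range (C.toCycles k (k + 1)).hom =
      LinearMap.ker (C.homologyπ (k + 1)).hom := by
    ext x
    exact ⟨fun ⟨z, hz⟩ => hz ▸ homologyπ_toCycles C z, fun hx => exists_toCycles_eq C hx⟩
  have h3 : LinearMap.range (C.d k (k + 1)).hom =
      (LinearMap.ker (C.homologyπ (k + 1)).hom).map (C.iCycles (k + 1)).hom := by
    rw [← h2, ← LinearMap.range_comp, ← ModuleCat.hom_comp, C.toCycles_i]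
  have h4 := LinearMap.finrank_range_add_finrank_ker (C.homologyπ (k + 1)).hom
  rw [LinearMap.range_eq_top.2 (homologyπ_surjective C _), finrank_top] at h4
  rw [← h1, h3, LinearMap.finrank_range_of_inj (iCycles_injective C _), ← h4,
    ((LinearMap.ker (C.homologyπ (k + 1)).hom).equivMapOfInjective _
      (iCycles_injective C _)).finrank_eq]

theorem nonempty_iso_of_finrank_eq {M N : ModuleCat.{u} K} [Module.Finite K M] [Module.Finite K N]
    (h : Module.finrank K M = Module.finrank K N) : Nonempty (M ≅ N) :=
  ⟨(LinearEquiv.ofFinrankEq M N h).toModuleIso⟩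

variable {C} {ι : Type} {D : ι → CochainComplex (ModuleCat.{u} K) ℤ} {p : ∀ t, C ⟶ D t}

/-- The homology of a product is the product of the homologies. -/
theorem homology_pi_bijective
    (hp : ∀ k, Function.Bijective fun (x : C.X k) t => ((p t).f k).hom x) (k : ℤ) :
    Function.Bijective fun (x : C.homology k) t =>
      (HomologicalComplex.homologyMap (p t) k).hom x := by
  obtain ⟨k, rfl⟩ : ∃ j, k = j + 1 := ⟨k - 1, by ring⟩
  have hπ : ∀ t (z : C.cycles (k + 1)), (HomologicalComplex.homologyMap (p t) (k + 1)).hom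
      ((C.homologyπ (k + 1)).hom z) = ((D t).homologyπ (k + 1)).hom
        ((HomologicalComplex.cyclesMap (p t) (k + 1)).hom z) := fun t z => by
    simp only [← LinearMap.comp_apply, ← ModuleCat.hom_comp, HomologicalComplex.homologyπ_naturality]
  have hi : ∀ t (z : C.cycles (k + 1)), ((D t).iCycles (k + 1)).hom
      ((HomologicalComplex.cyclesMap (p t) (k + 1)).hom z) =
        ((p t).f (k + 1)).hom ((C.iCycles (k + 1)).hom z) := fun t z => by
    simp only [← LinearMap.comp_apply, ← ModuleCat.hom_comp, HomologicalComplex.cyclesMap_i]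
  have hd : ∀ t j (x : C.X j), ((D t).d j (j + 1)).hom (((p t).f j).hom x) =
      ((p t).f (j + 1)).hom ((C.d j (j + 1)).hom x) := fun t j x => by
    simp only [← LinearMap.comp_apply, ← ModuleCat.hom_comp, (p t).comm]
  constructor
  · rw [show (fun (x : C.homology (k + 1)) t =>
      (HomologicalComplex.homologyMap (p t) (k + 1)).hom x) = LinearMap.pi fun t =>
      (HomologicalComplex.homologyMap (p t) (k + 1)).hom from rfl, injective_iff_map_eq_zero]
    intro x hx
    obtain ⟨z, rfl⟩ := homologyπ_surjective C _ x
    have h1 : ∀ t, ∃ w, ((D t).toCycles k (k + 1)).hom w =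
        (HomologicalComplex.cyclesMap (p t) (k + 1)).hom z := fun t =>
      exists_toCycles_eq (D t) (by rw [← hπ]; exact congrFun hx t)
    choose w hw using h1
    obtain ⟨y, hy⟩ := (hp k).2 w
    rw [show z = (C.toCycles k (k + 1)).hom y from ?_]
    · exact homologyπ_toCycles C y
    · refine iCycles_injective C _ ((hp (k + 1)).1 (funext fun t => ?_))
      dsimp only
      rw [iCycles_toCycles, ← hd, ← hi, ← hw, iCycles_toCycles, ← congrFun hy t]
  · intro x
    choose z hz using fun t => homologyπ_surjective (D t) _ (x t)
    obtain ⟨y, hy⟩ := (hp (k + 1)).2 fun t => ((D t).iCycles (k + 1)).hom (z t)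
    have h1 : (C.d (k + 1) (k + 1 + 1)).hom y = 0 := by
      refine (hp _).1 (funext fun t => ?_)
      dsimp only
      rw [← hd, map_zero, show ((p t).f (k + 1)).hom y = _ from congrFun hy t, d_iCycles]
    obtain ⟨z', rfl⟩ := exists_iCycles_eq C h1
    refine ⟨(C.homologyπ (k + 1)).hom z', funext fun t => ?_⟩
    dsimp only
    rw [hπ, ← hz]
    congr 1
    refine iCycles_injective (D t) _ ?_
    rw [hi]
    exact congrFun hy t

/-- Isomorphisms between the homologies of the factors give one between the homologies of the
products. -/
theorem exists_iso_homology_pi {C' : CochainComplex (ModuleCat.{u} K) ℤ}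
    {D' : ι → CochainComplex (ModuleCat.{u} K) ℤ} {p' : ∀ t, C' ⟶ D' t}
    (hp : ∀ k, Function.Bijective fun (x : C.X k) t => ((p t).f k).hom x)
    (hp' : ∀ k, Function.Bijective fun (x : C'.X k) t => ((p' t).f k).hom x) (k : ℤ)
    (φ : ∀ t, (D t).homology k ≅ (D' t).homology k) :
    ∃ Φ : C.homology k ≅ C'.homology k, ∀ t,
      Φ.hom ≫ HomologicalComplex.homologyMap (p' t) k =
        HomologicalComplex.homologyMap (p t) k ≫ (φ t).hom := by
  set a : C.homology k ≃ₗ[K] ∀ t, (D t).homology k := LinearEquiv.ofBijective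
    (LinearMap.pi fun t => (HomologicalComplex.homologyMap (p t) k).hom)
    (homology_pi_bijective hp k)
  set a' : C'.homology k ≃ₗ[K] ∀ t, (D' t).homology k := LinearEquiv.ofBijective
    (LinearMap.pi fun t => (HomologicalComplex.homologyMap (p' t) k).hom)
    (homology_pi_bijective hp' k)
  set f := LinearEquiv.piCongrRight fun t => (φ t).toLinearEquiv
  refine ⟨((a.trans f).trans a'.symm).toModuleIso, fun t => ModuleCat.hom_ext
    (LinearMap.ext fun x => ?_)⟩
  have h : a' (a'.symm (f (a x))) = f (a x) := a'.apply_symm_apply _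
  exact congrFun h t

end homology

/-! ### The total complex -/

namespace RibbonGraph

section total

variable {K : Type*} [Field K] {m : ℕ} {d : ℤ} {g b : ℕ} {k : ℤ}

/-- The total complex of the double complex of the two differentials: sequences of functions, indexed
by the number of dead edges. -/
def totalCochains (K : Type*) [Field K] (m : ℕ) (d : ℤ) (g : ℕ) (k : ℤ) :
    Submodule K (ℕ → StateFun K m) :=
  Submodule.pi Set.univ fun c => stateCochains K m d g c k

theorem mem_totalCochains {F : ℕ → StateFun K m} :
    F ∈ totalCochains K m d g k ↔ ∀ c, F c ∈ stateCochains K m d g c k := by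
  simp [totalCochains]

/-- The differential of the total complex. -/
noncomputable def totalDiff (K : Type*) [Field K] (m g : ℕ) :
    (ℕ → StateFun K m) →ₗ[K] ℕ → StateFun K m :=
  LinearMap.pi fun c => splitDiff g ∘ₗ LinearMap.proj c + killDiff g ∘ₗ LinearMap.proj (c + 1)

theorem totalDiff_apply (F : ℕ → StateFun K m) (c : ℕ) :
    totalDiff K m g F c = splitDiff g (F c) + killDiff g (F (c + 1)) := rfl

theorem totalDiff_mem {F : ℕ → StateFun K m} (hF : F ∈ totalCochains K m d g (k + 1)) :
    totalDiff K m g F ∈ totalCochains K m d g k :=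
  mem_totalCochains.2 fun c => add_mem (splitDiff_mem (mem_totalCochains.1 hF c))
    (killDiff_mem (mem_totalCochains.1 hF (c + 1)))

theorem killDiff_splitDiff [CharZero K] {f : StateFun K m} {c : ℕ}
    (hf : f ∈ stateCochains K m d g c k) :
    killDiff g (splitDiff g f) = -splitDiff g (killDiff g f) :=
  eq_neg_of_add_eq_zero_right (splitDiff_killDiff hf.1 g)

theorem totalDiff_totalDiff [CharZero K] {F : ℕ → StateFun K m}
    (hF : F ∈ totalCochains K m d g k) : totalDiff K m g (totalDiff K m g F) = 0 := by
  funext c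
  rw [mem_totalCochains] at hF
  rw [totalDiff_apply, totalDiff_apply, totalDiff_apply, map_add, map_add,
    splitDiff_splitDiff (hF c).1, killDiff_killDiff, killDiff_splitDiff (hF (c + 1))]
  simp

theorem totalDiff_update (F : ℕ → StateFun K m) {n c : ℕ} (f : StateFun K m) (h : c ≠ n)
    (h' : c + 1 ≠ n) : totalDiff K m g (Function.update F n f) c = totalDiff K m g F c := by
  rw [totalDiff_apply, totalDiff_apply, Function.update_of_ne h, Function.update_of_ne h']

theorem update_mem {F : ℕ → StateFun K m} (hF : F ∈ totalCochains K m d g k) {n : ℕ}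
    {f : StateFun K m} (hf : f ∈ stateCochains K m d g n k) :
    Function.update F n f ∈ totalCochains K m d g k := by
  rw [mem_totalCochains] at hF ⊢
  intro c
  by_cases h : c = n
  · subst h
    rwa [Function.update_self]
  · rw [Function.update_of_ne h]
    exact hF c

/-- In a given degree, the number of dead edges is bounded. -/
theorem exists_bound (m : ℕ) (d : ℤ) (g : ℕ) (k : ℤ) :
    ∃ N : ℕ, ∀ c, N ≤ c → ∀ f ∈ stateCochains K m d g c k, f = 0 := by
  refine ⟨(k - d * (2 - m - 2 * g - 1)).toNat + 1, fun c hc f hf => ?_⟩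
  funext e v Γ s
  by_contra h
  obtain ⟨h1, h2, h3⟩ := hf.2 Γ s h
  have h4 := deadCount_le s
  have h5 : (v : ℤ) = e + 2 - m - 2 * g := by
    have := h1.genus
    omega
  rw [h5] at h3
  have h6 : k - d * (2 - m - 2 * g - 1) = e + c := by
    rw [← h3]
    ring
  omega

/-- A cocycle of the total complex is cohomologous to a function on the states without dead edges,
since the differential of the splittings is exact in all the other columns. -/
theorem exists_totalDiff_eq_of_pos [CharZero K] {F : ℕ → StateFun K m}
    (hF : F ∈ totalCochains K m d g k) (h0 : ∀ c, 0 < c → totalDiff K m g F c = 0) :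
    ∃ G ∈ totalCochains K m d g (k + 1), ∀ c, 0 < c → totalDiff K m g G c = F c := by
  obtain ⟨N, hN⟩ := exists_bound (K := K) m d g k
  suffices h : ∀ n, n ≤ N → ∃ G ∈ totalCochains K m d g (k + 1),
      ∀ c, 0 < c → N - n ≤ c → totalDiff K m g G c = F c by
    obtain ⟨G, hG, h1⟩ := h N le_rfl
    exact ⟨G, hG, fun c hc => h1 c hc (by omega)⟩
  intro n
  induction n with
  | zero =>
    exact fun _ => ⟨0, zero_mem _, fun c _ hc => by
      rw [map_zero, hN c hc _ (mem_totalCochains.1 hF c)]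
      rfl⟩
  | succ n ih =>
    intro hn
    obtain ⟨G, hG, h1⟩ := ih (by omega)
    obtain ⟨c, hc⟩ : ∃ c, N - (n + 1) = c := ⟨_, rfl⟩
    rw [hc]
    rcases Nat.eq_zero_or_pos c with rfl | hpos
    · exact ⟨G, hG, fun c' h2 h3 => h1 c' h2 (by omega)⟩
    have hF' := mem_totalCochains.1 hF
    have hG' := mem_totalCochains.1 hG
    have h2 := h1 (c + 1) (by omega) (by omega)
    have h3 := h0 c hpos
    rw [totalDiff_apply] at h2 h3
    obtain ⟨u, hu, hu'⟩ := exists_splitDiff_eq (f := F c - killDiff g (G (c + 1))) hpos.ne'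
      (sub_mem (hF' c) (killDiff_mem (hG' (c + 1)))) (by
        have h4 := killDiff_splitDiff (hG' (c + 1))
        rw [← h2, map_add, killDiff_killDiff, add_zero, h4] at h3
        rw [map_sub, sub_eq_add_neg]
        exact h3)
    refine ⟨Function.update G c u, update_mem hG hu, fun c' h4 h5 => ?_⟩
    by_cases h6 : c' = c
    · subst h6
      rw [totalDiff_apply, Function.update_self, Function.update_of_ne (by omega), hu']
      abel
    · rw [totalDiff_update _ _ h6 (by omega)]
      exact h1 c' h4 (by omega)

/-- The primitives with respect to the revival of dead edges are found one after the other. -/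
theorem exists_totalDiff_eq_of_le [CharZero K] {F : ℕ → StateFun K m}
    (hF : F ∈ totalCochains K m d g k) {p : ℕ} {f : StateFun K m}
    (hf : f ∈ stateCochains K m d g p (k + 1)) (h0 : killDiff g (F p - splitDiff g f) = 0) (n : ℕ)
    (hn : ∀ c, p ≤ c → c < p + n → c + 1 ≠ 2 * g + m ∧ (c + 1 < p + n → totalDiff K m g F c = 0)) :
    ∃ G ∈ totalCochains K m d g (k + 1), (∀ c, c < p → G c = 0) ∧ G p = f ∧
      ∀ c, p ≤ c → c < p + n → totalDiff K m g G c = F c := by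
  induction n with
  | zero =>
    exact ⟨Function.update 0 p f, update_mem (zero_mem _) hf,
      fun c hc => Function.update_of_ne hc.ne _ _, Function.update_self _ _ _,
      fun c h1 h2 => absurd h2 (by omega)⟩
  | succ n ih =>
    obtain ⟨G, hG, h1, h2, h3⟩ := ih fun c h1 h2 =>
      ⟨(hn c h1 (by omega)).1, fun h => (hn c h1 (by omega)).2 (by omega)⟩
    have hF' := mem_totalCochains.1 hF
    have hG' := mem_totalCochains.1 hG
    obtain ⟨u, hu, hu'⟩ := exists_killDiff_eq_of_ne (f := F (p + n) - splitDiff g (G (p + n)))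
      (sub_mem (hF' _) (splitDiff_mem (hG' _))) (by
        cases n with
        | zero => rw [add_zero, h2, h0]
        | succ n =>
          have h4 := h3 (p + n) (by omega) (by omega)
          have h5 := (hn (p + n) (by omega) (by omega)).2 (by omega)
          rw [totalDiff_apply] at h4 h5
          rw [← h4, map_add, splitDiff_splitDiff (hG' _).1, zero_add] at h5
          rw [map_sub, ← add_assoc, killDiff_splitDiff (hG' _), sub_neg_eq_add, add_comm]
          exact h5)
      (hn (p + n) (by omega) (by omega)).1
    refine ⟨Function.update G (p + n + 1) u, update_mem hG hu, fun c hc => ?_, ?_,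
      fun c h4 h5 => ?_⟩
    · rw [Function.update_of_ne (by omega)]
      exact h1 c hc
    · rw [Function.update_of_ne (by omega)]
      exact h2
    · by_cases h6 : c = p + n
      · subst h6
        rw [totalDiff_apply, Function.update_self, Function.update_of_ne (by omega), hu']
        abel
      · rw [totalDiff_update _ _ (by omega) (by omega)]
        exact h3 c h4 (by omega)

/-- A cocycle of the total complex is cohomologous to one that vanishes on the states with fewer dead
edges than the first Betti number `b`. -/
theorem exists_totalDiff_eq_of_lt [CharZero K] (hb : b + 1 = 2 * g + m) {F : ℕ → StateFun K m}
    (hF : F ∈ totalCochains K m d g k) (h0 : ∀ c, c + 1 < b → totalDiff K m g F c = 0) :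
    ∃ G ∈ totalCochains K m d g (k + 1), ∀ c, c < b → totalDiff K m g G c = F c := by
  obtain ⟨G, hG, -, -, h⟩ := exists_totalDiff_eq_of_le hF (zero_mem (stateCochains K m d g 0 (k + 1)))
    (by rw [map_zero, sub_zero, killDiff_zero (mem_totalCochains.1 hF 0)]) b
    fun c _ h2 => ⟨by omega, fun h3 => h0 c (by omega)⟩
  exact ⟨G, hG, fun c hc => h c (Nat.zero_le c) (by omega)⟩

/-- A cocycle that vanishes below the first Betti number, and whose leading term is trivial, is a
coboundary. -/
theorem exists_totalDiff_eq_of_theta [CharZero K] (hb : b + 1 = 2 * g + m) {F : ℕ → StateFun K m}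
    (hF : F ∈ totalCochains K m d g k) (h0 : totalDiff K m g F = 0) (h1 : ∀ c, c < b → F c = 0)
    (h2 : killDiff g (F b) = 0) (h3 : theta K m b (F b) = 0) :
    ∃ G ∈ totalCochains K m d g (k + 1), (∀ c, c ≤ b → G c = 0) ∧ totalDiff K m g G = F := by
  have hF' := mem_totalCochains.1 hF
  obtain ⟨u, hu, hu'⟩ := exists_killDiff_eq_of_theta hb (hF' b) h2 h3
  obtain ⟨N, hN⟩ := exists_bound (K := K) m d g k
  obtain ⟨G, hG, h4, h5, h6⟩ := exists_totalDiff_eq_of_le hF hu (by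
    have h := congrFun h0 b
    rw [totalDiff_apply] at h
    rw [map_sub, killDiff_splitDiff hu, hu', sub_neg_eq_add, add_comm]
    exact h) N fun c h7 h8 => ⟨by omega, fun _ => congrFun h0 c⟩
  refine ⟨G, hG, fun c hc => h4 c (by omega), funext fun c => ?_⟩
  rcases lt_trichotomy c b with h | rfl | h
  · rw [totalDiff_apply, h4 c (by omega), h4 (c + 1) (by omega), h1 c h]
    simp
  · rw [totalDiff_apply, h4 c (by omega), h5, hu', map_zero, zero_add]
  · by_cases h' : c < b + 1 + N
    · exact h6 c h h'
    · rw [hN c (by omega) _ (hF' c), hN c (by omega) _ (mem_totalCochains.1 (totalDiff_mem hG) c)]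

end total

end RibbonGraph

/-! ### The comparison of the cohomologies -/

theorem finrank_map_mkQ {K V : Type*} [Field K] [AddCommGroup V] [Module K V]
    {Z B : Submodule K V} [Module.Finite K Z] (h : B ≤ Z) :
    Module.finrank K (Z.map B.mkQ) + Module.finrank K B = Module.finrank K Z := by
  have h1 := LinearMap.finrank_range_add_finrank_ker (B.mkQ ∘ₗ Z.subtype)
  rw [LinearMap.range_comp, Submodule.range_subtype, LinearMap.ker_comp, Submodule.ker_mkQ] at h1
  rw [← h1, (Submodule.comapSubtypeEquivOfLe h).finrank_eq]

/-- Two quotients agree if they are quotients of one space by the same subspace. -/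
theorem finrank_map_mkQ_eq {K U V V' : Type*} [Field K] [AddCommGroup U] [Module K U]
    [AddCommGroup V] [Module K V] [AddCommGroup V'] [Module K V'] {W : Submodule K U}
    {α : U →ₗ[K] V} {β : U →ₗ[K] V'} {B : Submodule K V} {B' : Submodule K V'}
    (h : ∀ x ∈ W, α x ∈ B ↔ β x ∈ B') :
    Module.finrank K ((W.map α).map B.mkQ) = Module.finrank K ((W.map β).map B'.mkQ) := by
  set a := B.mkQ ∘ₗ α ∘ₗ W.subtype with ha
  set b := B'.mkQ ∘ₗ β ∘ₗ W.subtype with hb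
  have h1 : LinearMap.ker a = LinearMap.ker b := by
    ext x
    simpa [ha, hb, Submodule.Quotient.mk_eq_zero] using h x x.2
  have h2 : (W.map α).map B.mkQ = LinearMap.range a := by
    rw [ha, LinearMap.range_comp, LinearMap.range_comp, Submodule.range_subtype]
  have h3 : (W.map β).map B'.mkQ = LinearMap.range b := by
    rw [hb, LinearMap.range_comp, LinearMap.range_comp, Submodule.range_subtype]
  rw [h2, h3, ← a.quotKerEquivRange.finrank_eq, ← b.quotKerEquivRange.finrank_eq, h1]

namespace RibbonGraph

section comparison

variable {K : Type u} [Field K] {m : ℕ} {d : ℤ} {g b : ℕ} {k : ℤ}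

/-- The cocycles of the dual of the graph complex. -/
noncomputable def graphCycles (K : Type u) [Field K] (m : ℕ) (F : Flavour) (d : ℤ) (g : ℕ) (k : ℤ) :
    Submodule K (GraphFun K m) :=
  graphCochains K m F d g (k + 1) ⊓ LinearMap.ker (graphDiff K m F d g k)

/-- The coboundaries of the dual of the graph complex. -/
noncomputable def graphBoundaries (K : Type u) [Field K] (m : ℕ) (F : Flavour) (d : ℤ) (g : ℕ)
    (k : ℤ) : Submodule K (GraphFun K m) :=
  (graphCochains K m F d g (k + 1 + 1)).map (graphDiff K m F d g (k + 1))

/-- The sequence that is concentrated in the functions on the states with `c` dead edges. -/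
def column (K : Type u) [Field K] (m c : ℕ) : StateFun K m →ₗ[K] ℕ → StateFun K m :=
  LinearMap.single K (fun _ => StateFun K m) c

theorem column_self (c : ℕ) (f : StateFun K m) : column K m c f c = f := Pi.single_eq_same _ _

theorem column_of_ne {c c' : ℕ} (h : c' ≠ c) (f : StateFun K m) : column K m c f c' = 0 :=
  Pi.single_eq_of_ne h _

theorem column_mem {c : ℕ} {f : StateFun K m} (hf : f ∈ stateCochains K m d g c k) :
    column K m c f ∈ totalCochains K m d g k :=
  update_mem (zero_mem _) hf

theorem totalDiff_column_zero (f : StateFun K m) :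
    totalDiff K m g (column K m 0 f) = column K m 0 (splitDiff g f) := by
  funext c
  rw [totalDiff_apply, column_of_ne (Nat.succ_ne_zero c), map_zero, add_zero]
  rcases Nat.eq_zero_or_pos c with rfl | h
  · rw [column_self, column_self]
  · rw [column_of_ne h.ne', column_of_ne h.ne', map_zero]

theorem totalDiff_column_of_lt {f : StateFun K m} (h0 : killDiff g f = 0) {c : ℕ} (hc : c < b) :
    totalDiff K m g (column K m b f) c = 0 := by
  rw [totalDiff_apply, column_of_ne hc.ne, map_zero, zero_add]
  by_cases h : c + 1 = b
  · subst h
    rw [column_self, h0]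
  · rw [column_of_ne h, map_zero]

theorem totalDiff_column_self (f : StateFun K m) :
    totalDiff K m g (column K m b f) b = splitDiff g f := by
  rw [totalDiff_apply, column_self, column_of_ne (Nat.succ_ne_self b),
    map_zero, add_zero]

/-- The total cochain that differs by a coboundary from a function on the states without dead
edges. -/
noncomputable def shifted (K : Type u) [Field K] (m g : ℕ) :
    StateFun K m × (ℕ → StateFun K m) →ₗ[K] ℕ → StateFun K m :=
  column K m 0 ∘ₗ LinearMap.fst K _ _ -
    totalDiff K m g ∘ₗ LinearMap.snd K _ _

theorem shifted_apply (x : StateFun K m × (ℕ → StateFun K m)) :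
    shifted K m g x = column K m 0 x.1 - totalDiff K m g x.2 := rfl

/-- The cocycles without dead edges, together with a cochain whose coboundary shifts them to a cocycle
that vanishes on the states with less than `b` dead edges. -/
noncomputable def comparison (K : Type u) [Field K] (m : ℕ) (d : ℤ) (g b : ℕ) (k : ℤ) :
    Submodule K (StateFun K m × (ℕ → StateFun K m)) :=
  (stateCochains K m d g 0 k ⊓ LinearMap.ker (splitDiff g)).prod (totalCochains K m d g (k + 1)) ⊓
    (Submodule.pi (Set.Iio b) fun _ => ⊥).comap (shifted K m g)

theorem mem_comparison {x : StateFun K m × (ℕ → StateFun K m)} : x ∈ comparison K m d g b k ↔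
    ((x.1 ∈ stateCochains K m d g 0 k ∧ splitDiff g x.1 = 0) ∧
      x.2 ∈ totalCochains K m d g (k + 1)) ∧ ∀ c, c < b → shifted K m g x c = 0 :=
  ⟨fun h => ⟨h.1, fun c hc => h.2 c hc⟩, fun h => ⟨h.1, fun c hc => h.2 c hc⟩⟩

theorem killDiff_of_totalDiff {F : ℕ → StateFun K m} (hF : F ∈ totalCochains K m d g k)
    (h0 : ∀ c, c < b → F c = 0) (h1 : ∀ c, c < b → totalDiff K m g F c = 0) :
    killDiff g (F b) = 0 := by
  cases b with
  | zero => exact killDiff_zero (mem_totalCochains.1 hF 0)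
  | succ b =>
    have h := h1 b (Nat.lt_succ_self b)
    rwa [totalDiff_apply, h0 b (Nat.lt_succ_self b), map_zero, zero_add] at h

variable [CharZero K]

theorem shifted_mem {x : StateFun K m × (ℕ → StateFun K m)} (hx : x ∈ comparison K m d g b k) :
    shifted K m g x ∈ totalCochains K m d g k ∧ totalDiff K m g (shifted K m g x) = 0 ∧
      killDiff g (shifted K m g x b) = 0 := by
  obtain ⟨⟨⟨h1, h2⟩, h3⟩, h4⟩ := mem_comparison.1 hx
  have h5 : shifted K m g x ∈ totalCochains K m d g k :=
    sub_mem (column_mem h1) (totalDiff_mem h3)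
  have h6 : totalDiff K m g (shifted K m g x) = 0 := by
    rw [shifted_apply, map_sub, totalDiff_totalDiff h3, totalDiff_column_zero, h2, map_zero,
      sub_zero]
  exact ⟨h5, h6, killDiff_of_totalDiff h5 h4 fun c _ => congrFun h6 c⟩

theorem map_restrict_comparison (hb : b + 1 = 2 * g + m) :
    (comparison K m d g b (k + 1)).map (restrict K m ∘ₗ LinearMap.fst K _ _) =
      graphCycles K m Flavour.quiver d g k := by
  ext y
  constructor
  · rintro ⟨x, hx, rfl⟩
    obtain ⟨⟨⟨h1, h2⟩, -⟩, -⟩ := mem_comparison.1 hx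
    refine ⟨restrict_mem h1, ?_⟩
    change graphDiff K m Flavour.quiver d g k (restrict K m x.1) = 0
    rw [← restrict_splitDiff h1, h2, map_zero]
  · rintro ⟨h1, h2⟩
    obtain ⟨f, hf, rfl⟩ := exists_restrict_eq h1
    have h3 : splitDiff g f = 0 := eq_zero_of_restrict (splitDiff_mem hf) (by
      rw [restrict_splitDiff hf]
      exact h2)
    obtain ⟨G, hG, h4⟩ := exists_totalDiff_eq_of_lt hb (column_mem hf) fun c _ => by
      rw [totalDiff_column_zero, h3, map_zero]
      rfl
    refine ⟨(f, G), mem_comparison.2 ⟨⟨⟨hf, h3⟩, hG⟩, fun c hc => ?_⟩, rfl⟩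
    rw [shifted_apply, Pi.sub_apply, h4 c hc, sub_self]

theorem map_theta_comparison (hb : b + 1 = 2 * g + m) :
    (comparison K m (d + 1) g b (k + 1)).map
        (theta K m b ∘ₗ LinearMap.proj b ∘ₗ shifted K m g) =
      graphCycles K m Flavour.ribbon d g k := by
  ext y
  constructor
  · rintro ⟨x, hx, rfl⟩
    obtain ⟨h1, h2, h3⟩ := shifted_mem hx
    have h4 := mem_totalCochains.1 h1
    refine ⟨theta_mem hb (h4 b) h3, ?_⟩
    change graphDiff K m Flavour.ribbon d g k (theta K m b (shifted K m g x b)) = 0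
    have h5 := congrFun h2 b
    rw [totalDiff_apply] at h5
    rw [← theta_splitDiff hb (h4 b), eq_neg_of_add_eq_zero_left h5, map_neg, theta_killDiff, neg_zero]
  · rintro ⟨h1, h2⟩
    obtain ⟨f, hf, h3, rfl⟩ := exists_theta_eq hb h1
    have h4 := column_mem hf
    -- the function extends to a cocycle of the total complex
    obtain ⟨T, hT, h5, h6⟩ := exists_totalDiff_eq_of_theta hb (totalDiff_mem h4)
      (totalDiff_totalDiff h4) (fun c hc => totalDiff_column_of_lt h3 hc)
      (by rw [totalDiff_column_self, killDiff_splitDiff hf, h3, map_zero, neg_zero])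
      (by
        rw [totalDiff_column_self, theta_splitDiff hb hf]
        exact h2)
    have h7 : totalDiff K m g (column K m b f - T) = 0 := by rw [map_sub, h6, sub_self]
    have h8 : column K m b f - T ∈ totalCochains K m (d + 1) g (k + 1) := sub_mem h4 hT
    obtain ⟨G, hG, h9⟩ := exists_totalDiff_eq_of_pos h8 fun c _ => congrFun h7 c
    have h10 : (column K m b f - T) 0 - totalDiff K m g G 0 ∈ stateCochains K m (d + 1) g 0 (k + 1) :=
      sub_mem (mem_totalCochains.1 h8 0) (mem_totalCochains.1 (totalDiff_mem hG) 0)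
    have h11 : column K m b f - T - totalDiff K m g G =
        column K m 0 ((column K m b f - T) 0 - totalDiff K m g G 0) := by
      funext c
      rcases Nat.eq_zero_or_pos c with rfl | hc
      · rw [column_self]
        rfl
      · rw [column_of_ne hc.ne', Pi.sub_apply, h9 c hc, sub_self]
    have h12 : shifted K m g ((column K m b f - T) 0 - totalDiff K m g G 0, -G) =
        column K m b f - T := by
      rw [shifted_apply, ← h11, map_neg]
      abel
    refine ⟨((column K m b f - T) 0 - totalDiff K m g G 0, -G),
      mem_comparison.2 ⟨⟨⟨h10, ?_⟩, neg_mem hG⟩, fun c hc => ?_⟩, ?_⟩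
    · have h13 := congrFun (congrArg (totalDiff K m g) h11) 0
      rw [map_sub, h7, totalDiff_totalDiff hG, totalDiff_column_zero, column_self] at h13
      rw [← h13]
      simp
    · rw [h12, Pi.sub_apply, h5 c hc.le, column_of_ne hc.ne, sub_zero]
    · change theta K m b (shifted K m g _ b) = _
      rw [h12, Pi.sub_apply, h5 b le_rfl, column_self, sub_zero]

theorem theta_mem_boundaries (hb : b + 1 = 2 * g + m) {x : StateFun K m × (ℕ → StateFun K m)}
    (hx : x ∈ comparison K m (d + 1) g b (k + 1))
    (h : restrict K m x.1 ∈ graphBoundaries K m Flavour.quiver (d + 1) g k) :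
    theta K m b (shifted K m g x b) ∈ graphBoundaries K m Flavour.ribbon d g k := by
  obtain ⟨⟨⟨h1, h2⟩, h3⟩, h4⟩ := mem_comparison.1 hx
  obtain ⟨y, hy, h5⟩ := h
  obtain ⟨f, hf, rfl⟩ := exists_restrict_eq hy
  rw [← restrict_splitDiff hf] at h5
  have h6 : x.1 = splitDiff g f := sub_eq_zero.1 (eq_zero_of_restrict
    (sub_mem h1 (splitDiff_mem hf)) (by rw [map_sub, h5, sub_self]))
  have h7 : totalDiff K m g (column K m 0 f - x.2) = shifted K m g x := by
    rw [map_sub, totalDiff_column_zero, shifted_apply, h6]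
  have h8 : column K m 0 f - x.2 ∈ totalCochains K m (d + 1) g (k + 1 + 1) :=
    sub_mem (column_mem hf) h3
  obtain ⟨G, hG, h9⟩ := exists_totalDiff_eq_of_lt hb h8 fun c hc => by
    rw [h7]
    exact h4 c (by omega)
  set H := column K m 0 f - x.2 - totalDiff K m g G with hH
  have hH' : H ∈ totalCochains K m (d + 1) g (k + 1 + 1) := sub_mem h8 (totalDiff_mem hG)
  have h10 : totalDiff K m g H = shifted K m g x := by
    rw [hH, map_sub, totalDiff_totalDiff hG, sub_zero, h7]
  have h11 : ∀ c, c < b → H c = 0 := fun c hc => by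
    rw [hH, Pi.sub_apply, h9 c hc, sub_self]
  have h12 := mem_totalCochains.1 hH' b
  refine ⟨theta K m b (H b), theta_mem hb h12 (killDiff_of_totalDiff hH' h11 fun c hc => by
    rw [h10, h4 c hc]), ?_⟩
  rw [← h10, totalDiff_apply, map_add, theta_killDiff, add_zero, theta_splitDiff hb h12]

theorem restrict_mem_boundaries (hb : b + 1 = 2 * g + m) {x : StateFun K m × (ℕ → StateFun K m)}
    (hx : x ∈ comparison K m (d + 1) g b (k + 1))
    (h : theta K m b (shifted K m g x b) ∈ graphBoundaries K m Flavour.ribbon d g k) :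
    restrict K m x.1 ∈ graphBoundaries K m Flavour.quiver (d + 1) g k := by
  obtain ⟨⟨⟨h1, h2⟩, h3⟩, h4⟩ := mem_comparison.1 hx
  obtain ⟨h5, h6, h7⟩ := shifted_mem hx
  obtain ⟨y, hy, h8⟩ := h
  obtain ⟨f, hf, h9, rfl⟩ := exists_theta_eq hb hy
  have hf' := column_mem hf
  rw [← theta_splitDiff hb hf] at h8
  obtain ⟨U, hU, -, h10⟩ := exists_totalDiff_eq_of_theta (F := shifted K m g x -
      totalDiff K m g (column K m b f)) hb (sub_mem h5 (totalDiff_mem hf'))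
    (by rw [map_sub, h6, totalDiff_totalDiff hf', sub_zero])
    (fun c hc => by rw [Pi.sub_apply, h4 c hc, totalDiff_column_of_lt h9 hc, sub_zero])
    (by rw [Pi.sub_apply, totalDiff_column_self, map_sub, h7, killDiff_splitDiff hf, h9, map_zero,
      neg_zero, sub_zero])
    (by rw [Pi.sub_apply, totalDiff_column_self, map_sub, h8, sub_self])
  have h11 : totalDiff K m g (U + column K m b f + x.2) = column K m 0 x.1 := by
    rw [map_add, map_add, h10, shifted_apply]
    abel
  have h12 : U + column K m b f + x.2 ∈ totalCochains K m (d + 1) g (k + 1 + 1) :=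
    add_mem (add_mem hU hf') h3
  obtain ⟨G, hG, h13⟩ := exists_totalDiff_eq_of_pos h12 fun c hc => by
    rw [h11, column_of_ne hc.ne']
  set H := U + column K m b f + x.2 - totalDiff K m g G with hH
  have hH' : H ∈ totalCochains K m (d + 1) g (k + 1 + 1) := sub_mem h12 (totalDiff_mem hG)
  have h14 : totalDiff K m g H = column K m 0 x.1 := by
    rw [hH, map_sub, totalDiff_totalDiff hG, sub_zero, h11]
  have h15 := congrFun h14 0
  have h16 : H 1 = 0 := by rw [hH, Pi.sub_apply, h13 1 one_pos, sub_self]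
  rw [totalDiff_apply, zero_add, h16, map_zero, add_zero, column_self] at h15
  have h17 := mem_totalCochains.1 hH' 0
  exact ⟨restrict K m (H 0), restrict_mem h17, by rw [← restrict_splitDiff h17, h15]⟩

/-- The dual complexes of ribbon graphs and of ribbon quivers have cohomologies of the same
dimension. -/
theorem finrank_cycles_mod_boundaries (hb : b + 1 = 2 * g + m) :
    Module.finrank K ((graphCycles K m Flavour.quiver (d + 1) g k).map
      (graphBoundaries K m Flavour.quiver (d + 1) g k).mkQ) =
    Module.finrank K ((graphCycles K m Flavour.ribbon d g k).map
      (graphBoundaries K m Flavour.ribbon d g k).mkQ) := by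
  rw [← map_restrict_comparison hb, ← map_theta_comparison hb]
  exact finrank_map_mkQ_eq fun x hx =>
    ⟨theta_mem_boundaries hb hx, restrict_mem_boundaries hb hx⟩

end comparison

end RibbonGraph

/-! ### Duality -/

namespace RibbonGraph

section duality

variable {K : Type u} [Field K] {F : Flavour} {d : ℤ} {g m : ℕ} {k : ℤ}

theorem IsGenerator.size_eq {e v e' v' : ℕ} {Γ : RibbonGraph e v m} {Γ' : RibbonGraph e' v' m}
    (h : IsGenerator F d g m k Γ) (h' : IsGenerator F d g m k Γ') : e = e' ∧ v = v' := by
  have h1 : (v : ℤ) + m + 2 * g = e + 2 := by exact_mod_cast h.genus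
  have h2 : (v' : ℤ) + m + 2 * g = e' + 2 := by exact_mod_cast h'.genus
  have h3 := h.degree
  have h4 := h'.degree
  have h5 : (e : ℤ) = e' := by linear_combination h3 - h4 - d * (h1 - h2)
  omega

instance : Finite (Generator F d g m k) := by
  rcases isEmpty_or_nonempty (Generator F d g m k) with h | ⟨⟨⟨e, v, Γ⟩, h⟩⟩
  · infer_instance
  · refine Finite.of_surjective (fun Γ' : {Γ' : RibbonGraph e v m // IsGenerator F d g m k Γ'} =>
      (⟨⟨e, v, Γ'.1⟩, Γ'.2⟩ : Generator F d g m k)) ?_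
    rintro ⟨⟨e', v', Γ'⟩, h'⟩
    obtain ⟨rfl, rfl⟩ := IsGenerator.size_eq h h'
    exact ⟨⟨Γ', h'⟩, rfl⟩

instance : Module.Finite K (Cochains K F d g m k) :=
  inferInstanceAs (Module.Finite K ((Generator F d g m k →₀ K) ⧸ relations K F d g m k))

open Classical in
/-- The values of a functional on the graphs. -/
noncomputable def dualFun (K : Type u) [Field K] (F : Flavour) (d : ℤ) (g m : ℕ) (k : ℤ) :
    Module.Dual K (Cochains K F d g m k) →ₗ[K] GraphFun K m where
  toFun y _ _ Γ := if h : IsGenerator F d g m k Γ then y (cls K Γ h) else 0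
  map_add' y y' := by
    funext e v Γ
    simp only [Pi.add_apply]
    split_ifs
    · rfl
    · rw [add_zero]
  map_smul' c y := by
    funext e v Γ
    simp only [Pi.smul_apply, RingHom.id_apply]
    split_ifs
    · rfl
    · rw [smul_zero]

variable {e v : ℕ} {Γ : RibbonGraph e v m}

theorem dualFun_of (h : IsGenerator F d g m k Γ) (y : Module.Dual K (Cochains K F d g m k)) :
    dualFun K F d g m k y e v Γ = y (cls K Γ h) := dif_pos h

theorem dualFun_not (h : ¬ IsGenerator F d g m k Γ) (y : Module.Dual K (Cochains K F d g m k)) :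
    dualFun K F d g m k y e v Γ = 0 := dif_neg h

theorem dual_ext {y y' : Module.Dual K (Cochains K F d g m k)}
    (h : ∀ ⦃e v : ℕ⦄ (Γ : RibbonGraph e v m) (hΓ : IsGenerator F d g m k Γ),
      y (cls K Γ hΓ) = y' (cls K Γ hΓ)) : y = y' := by
  refine Submodule.linearMap_qext (relations K F d g m k)
    (Finsupp.lhom_ext' fun X => LinearMap.ext_ring ?_)
  obtain ⟨⟨e, v, Γ⟩, hΓ⟩ := X
  exact h Γ hΓ

theorem dualFun_injective : Function.Injective (dualFun K F d g m k) := fun y y' h =>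
  dual_ext fun e v Γ hΓ => by rw [← dualFun_of hΓ, ← dualFun_of hΓ, h]

theorem IsGenerator.of_iso {Γ' : RibbonGraph e v m} (h : IsGenerator F d g m k Γ)
    (φ : Iso F Γ Γ') : IsGenerator F d g m k Γ' := by
  refine ⟨h.connected.of_iso φ.toRibbon, h.genus, trivalent_of_iso φ h.trivalent,
    fun hF => ?_, h.degree⟩
  subst hF
  have h1 := φ.toRibbon.acyclic_iff.2 (isAcyclic_iff.1 (h.acyclic rfl))
  rw [show stateMap φ.toRibbon.edge φ.toRibbon.rev _ = _ from φ.stateMap_const] at h1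
  exact isAcyclic_iff.2 h1

theorem range_dualFun : LinearMap.range (dualFun K F d g m k) = graphCochains K m F d g k := by
  ext y
  constructor
  · rintro ⟨y, rfl⟩
    refine ⟨fun e v Γ Γ' φ => ?_, fun e v Γ h => ?_⟩
    · by_cases h : IsGenerator F d g m k Γ
      · rw [dualFun_of h, dualFun_of (h.of_iso φ), cls_eq_of_iso K h (h.of_iso φ) φ, map_smul,
          Units.smul_def, ← Int.cast_smul_eq_zsmul K]
      · rw [dualFun_not h, dualFun_not fun h' => h (h'.of_iso φ.symm), smul_zero]
    · by_contra h'
      exact h (dualFun_not h' y)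
  · rintro ⟨h1, h2⟩
    obtain ⟨z, hz⟩ : ∃ z : Module.Dual K (Cochains K F d g m k), ∀ ⦃e v : ℕ⦄
        (Γ : RibbonGraph e v m) (h : IsGenerator F d g m k Γ), z (cls K Γ h) = y e v Γ := by
      refine ⟨(relations K F d g m k).liftQ
        (Finsupp.linearCombination K fun X : Generator F d g m k => y _ _ X.1.2.2) ?_,
        fun e v Γ h => ?_⟩
      · refine Submodule.span_le.2 ?_
        rintro _ ⟨e, v, Γ, Γ', h, h', φ, rfl⟩
        rw [SetLike.mem_coe, LinearMap.mem_ker, map_sub, map_smul, vec, vec,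
          Finsupp.linearCombination_single, Finsupp.linearCombination_single, one_smul, one_smul,
          sub_eq_zero]
        change y e v Γ' = _
        rw [h1 Γ Γ' φ, Units.smul_def, ← Int.cast_smul_eq_zsmul K]
      · change Finsupp.linearCombination K _ (vec K F d g m k Γ h) = _
        rw [vec, Finsupp.linearCombination_single, one_smul]
    refine ⟨z, ?_⟩
    funext e v Γ
    by_cases h : IsGenerator F d g m k Γ
    · rw [dualFun_of h, hz]
    · rw [dualFun_not h]
      by_contra h'
      exact h (h2 Γ (Ne.symm h'))

theorem graphDiff_dualFun (y : Module.Dual K (Cochains K F d g m (k + 1))) :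
    graphDiff K m F d g k (dualFun K F d g m (k + 1) y) =
      dualFun K F d g m k ((differential K F d g m k).dualMap y) := by
  funext e v Γ
  by_cases h : IsGenerator F d g m k Γ
  · have h1 : graphDiff K m F d g k (dualFun K F d g m (k + 1) y) e v Γ = splitCoeff K F *
        ∑ p : Γ.CornerPair, dualFun K F d g m (k + 1) y _ _ (Γ.split p) := if_pos h
    rw [h1, dualFun_of h, LinearMap.dualMap_apply, differential_cls, map_smul, map_sum, smul_eq_mul]
    congr 1
    exact Finset.sum_congr rfl fun p _ => dualFun_of (h.split p) y
  · rw [dualFun_not h]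
    exact if_neg h

theorem graphCycles_eq : graphCycles K m F d g k =
    (LinearMap.ker (differential K F d g m k).dualMap).map (dualFun K F d g m (k + 1)) := by
  ext y
  rw [graphCycles, ← range_dualFun]
  constructor
  · rintro ⟨⟨y, rfl⟩, h⟩
    refine ⟨y, dualFun_injective ?_, rfl⟩
    rw [← graphDiff_dualFun, map_zero]
    exact h
  · rintro ⟨y, h, rfl⟩
    refine ⟨⟨y, rfl⟩, ?_⟩
    change graphDiff K m F d g k _ = 0
    rw [graphDiff_dualFun, show (differential K F d g m k).dualMap y = 0 from h, map_zero]

theorem graphBoundaries_eq : graphBoundaries K m F d g k =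
    (LinearMap.range (differential K F d g m (k + 1)).dualMap).map (dualFun K F d g m (k + 1)) := by
  rw [graphBoundaries, ← range_dualFun, ← LinearMap.range_comp, ← LinearMap.range_comp]
  congr 1
  exact LinearMap.ext fun y => graphDiff_dualFun y

variable [CharZero K]

instance (k : ℤ) : Module.Finite K ((graphComplex K F d g m).X k) :=
  inferInstanceAs (Module.Finite K (Cochains K F d g m k))

theorem graphComplex_d (k : ℤ) : ((graphComplex K F d g m).d k (k + 1)).hom =
    differential K F d g m k :=
  congrArg ModuleCat.Hom.hom (CochainComplex.of_d (fun k => ModuleCat.of K (Cochains K F d g m k))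
    (fun k => ModuleCat.ofHom (differential K F d g m k)) k)

/-- The cohomology of a graph complex and of its dual have the same dimension. -/
theorem finrank_homology_graphComplex (k : ℤ) :
    Module.finrank K ((graphComplex K F d g m).homology (k + 1)) =
      Module.finrank K ((graphCycles K m F d g k).map (graphBoundaries K m F d g k).mkQ) := by
  have h1 : Module.finrank K ((graphComplex K F d g m).homology (k + 1)) +
      Module.finrank K (LinearMap.range (differential K F d g m k)) =
      Module.finrank K (LinearMap.ker (differential K F d g m (k + 1))) := by
    have h := finrank_homology (graphComplex K F d g m) k
    rwa [graphComplex_d, graphComplex_d] at h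
  have hZ : Module.Finite K (graphCycles K m F d g k) := by
    rw [graphCycles_eq]
    infer_instance
  have hB : graphBoundaries K m F d g k ≤ graphCycles K m F d g k := by
    rw [graphBoundaries_eq, graphCycles_eq]
    refine Submodule.map_mono ?_
    rintro _ ⟨y, rfl⟩
    rw [LinearMap.mem_ker, ← LinearMap.comp_apply, LinearMap.dualMap_comp_dualMap,
      differential_comp]
    exact LinearMap.ext fun x => map_zero y
  have h2 := finrank_map_mkQ hB
  have h3 : Module.finrank K (graphCycles K m F d g k) =
      Module.finrank K (LinearMap.ker (differential K F d g m k).dualMap) := by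
    rw [graphCycles_eq]
    exact (Submodule.equivMapOfInjective _ dualFun_injective _).finrank_eq.symm
  have h4 : Module.finrank K (graphBoundaries K m F d g k) =
      Module.finrank K (LinearMap.range (differential K F d g m (k + 1))) := by
    rw [graphBoundaries_eq, ← LinearMap.finrank_range_dualMap_eq_finrank_range]
    exact (Submodule.equivMapOfInjective _ dualFun_injective _).finrank_eq.symm
  have h5 := LinearMap.finrank_range_add_finrank_ker (differential K F d g m k).dualMap
  have h6 := LinearMap.finrank_range_add_finrank_ker (differential K F d g m (k + 1))
  rw [LinearMap.finrank_range_dualMap_eq_finrank_range, Subspace.dual_finrank_eq] at h5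
  omega

theorem nonempty_homology_iso (t : StableType) (k : ℤ) :
    Nonempty ((RGCPart K d t.g t.m).homology k ≅ (ORGCPart K (d + 1) t.g t.m).homology k) := by
  obtain ⟨k, rfl⟩ : ∃ j, k = j + 1 := ⟨k - 1, by ring⟩
  have h1 : 2 * t.g + t.m - 1 + 1 = 2 * t.g + t.m := by
    have := t.three_le
    omega
  have := finite_homology (RGCPart K d t.g t.m) (k + 1)
  have := finite_homology (ORGCPart K (d + 1) t.g t.m) (k + 1)
  refine nonempty_iso_of_finrank_eq ?_
  rw [finrank_homology_graphComplex, finrank_homology_graphComplex,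
    finrank_cycles_mod_boundaries h1]

theorem productProj_bijective (k : ℤ) : Function.Bijective
    fun (x : (productComplex K F d).X k) t => ((productProj K F d t).f k).hom x :=
  Function.bijective_id

end duality

end RibbonGraph

theorem theorem1p1p1 (K : Type u) [Field K] [CharZero K] (d : ℤ) :
    ∃ (φ : ∀ (t : StableType) (k : ℤ),
        (RGCPart K d t.g t.m).homology k ≅ (ORGCPart K (d + 1) t.g t.m).homology k)
      (Φ : ∀ k : ℤ, (RGC K d).homology k ≅ (ORGC K (d + 1)).homology k),
      ∀ (t : StableType) (k : ℤ),
        (Φ k).hom ≫ HomologicalComplex.homologyMap (ORGC.proj K (d + 1) t) k =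
          HomologicalComplex.homologyMap (RGC.proj K d t) k ≫ (φ t k).hom := by
  choose Φ hΦ using fun k => exists_iso_homology_pi
    (productProj_bijective (K := K) (F := Flavour.ribbon) (d := d))
    (productProj_bijective (K := K) (F := Flavour.quiver) (d := d + 1)) k
    fun t => (nonempty_homology_iso (K := K) (d := d) t k).some
  exact ⟨fun t k => (nonempty_homology_iso t k).some, Φ, fun t k => hΦ k t⟩
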